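/- **The source calculus.** Dependently typed Cocon without recursors has two levels, and is presented with type annotations on abstractions, applications and unboxings. *Domain level.* Types $A,B ::= \mathsf{ty} \mid \mathsf{trm}[M] \mid \Pi x{:}A.B$; terms $M,N ::= x \mid \lambda x.M \mid M\,N \mid \lfloor t\rfloor_\sigma \mid \mathsf{o} \mid \mathsf{arr}\,a\,b \mid \mathsf{lam}\,a\,b\,f \mid \mathsf{app}\,a\,b\,m\,n$ (constants fully applied, $\mathsf{o}:\mathsf{ty}$, $\mathsf{arr}\,a\,b:\mathsf{ty}$, $\mathsf{lam}\,a\,b\,f:\mathsf{trm}[\mathsf{arr}\,a\,b]$ for $f:\mathsf{trm}[a]\to\mathsf{trm}[b]$, $\mathsf{app}\,a\,b\,m\,n:\mathsf{trm}[b]$ for $m:\mathsf{trm}[\mathsf{arr}\,a\,b]$, $n:\mathsf{trm}[a]$); contexts $\Psi,\Phi ::= \cdot \mid \psi \mid \Psi,x{:}A$; substitutions $\sigma ::= \cdot \mid \sigma,M \mid \mathsf{wk}$ ($\mathsf{wk}$ goes from an extension of $\Phi$ to $\Phi$). *Computation level.* Contextual types $T ::= (\Psi\vdash A)\mid(\Psi\vdash_v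 A)$ (the second contains only variables of $\Psi$ and weakenings $\lfloor x\rfloor_{\mathsf{wk}}$ of computation variables $x:\lceil\Phi\vdash_v A\rceil$); contextual objects $C=(\hat\Psi\vdash M)$; computation types $\tau ::= \lceil T\rceil\mid(y{:}\check\tau_1)\Rightarrow\tau_2$ and $\check\tau ::= \tau\mid\mathsf{ctx}$; computation terms $t ::= y\mid\lceil C\rceil\mid \mathsf{fn}\,y\Rightarrow t\mid t_1\,t_2$, where a domain context $\Psi$ may be used as a term of type $\mathsf{ctx}$; contexts $\Gamma$ are lists of declarations $y:\check\tau$. If $t:\lceil\Phi\vdash A\rceil$ or $t:\lceil\Phi\vdash_v A\rceil$, and $\Gamma;\Psi\vdash\sigma:\Phi$, then $\Gamma;\Psi\vdash\lfloor t\rfloor_\sigma:[\sigma]A$. Both levels have a conversion rule. Definitional equality is the congruence generated by $\beta$ and $\eta$ for both function types, $\lfloor\lceil\hat\Phi\vdash M\rceil\rfloor_\sigma\equiv[\sigma]M$, $t\equiv\lceil\hat\Psi\vdash\lfloor t\rfloor_{\mathrm{id}}\rceil$ for $t:\lceil\Psi\vdash A\rceil$, the evident expansions of weakening substitutions and of substitutions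 into the empty context, and the identification of the context variable $y$ with the one-variable domain context $y$ as terms of type $\mathsf{ctx}$. **The target calculus.** Fitch-style dependent intuitionistic K has $\Pi$-types and a modality $\square$, both with $\beta\eta$; contexts contain declarations and locks (written $\mathsf{lock}$); $\Gamma\vdash\mathsf{box}\,t:\square A$ if $\Gamma,\mathsf{lock}\vdash t:A$, and $\Gamma,\mathsf{lock},\Gamma'\vdash\mathsf{unbox}\,t:A$ if $\Gamma\vdash t:\square A$ and $\Gamma'$ has no lock; a variable can be used only if no lock stands to its right. It is extended by a universe $\mathsf{Type}$, closed under $\Pi$ and containing types $\mathsf{ty}$ and $\mathsf{trm}\,m$ ($m:\mathsf{ty}$) with the four constants above, and by a universe $\mathsf{Ctx}$ with $\top:\mathsf{Ctx}$ whose only instance (up to $\equiv$) is $()$, and with $\varphi.a:\mathsf{Ctx}$ for $\varphi:\mathsf{Ctx}$, $a:\Pi u{:}\varphi.\,\mathsf{Type}$, whose instances are the pairs $(u,x)$, $u:\varphi$, $x:a\,u$ (with projections $\pi_1,\pi_2$ and $\beta\eta$). **The translation.** $[\![\cdot]\!]=\top$, $[\![\psi]\!]=\mathsf{unbox}\,\psi$,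 $[\![\Psi,x{:}A]\!]=[\![\Psi]\!].[\![A]\!]$. Domain types, terms and substitutions over $\Psi$ become functions of $u:[\![\Psi]\!]$: $[\![\mathsf{ty}]\!]=\lambda u.\mathsf{ty}$, $[\![\mathsf{trm}[M]]\!]=\lambda u.\mathsf{trm}([\![M]\!]\,u)$, $[\![\Pi x{:}A.B]\!]=\lambda u.\Pi x{:}[\![A]\!]u.\,[\![B]\!](u,x)$; $[\![x]\!]=\lambda u.\pi_2(\pi_1^k u)$ if $x$ is followed by $k$ declarations, $[\![\lambda x.M]\!]=\lambda u\,x.[\![M]\!](u,x)$, $[\![M\,N]\!]=\lambda u.([\![M]\!]u)([\![N]\!]u)$, $[\![\lfloor t\rfloor_\sigma]\!]=\lambda u.(\mathsf{unbox}\,[\![t]\!])([\![\sigma]\!]u)$, and $\lambda u.\,c\,([\![M_1]\!]u)\cdots([\![M_n]\!]u)$ for a constant $c$ applied to $M_1,\dots,M_n$; $[\![\cdot]\!]=\lambda u.()$, $[\![\sigma,M]\!]=\lambda u.([\![\sigma]\!]u,[\![M]\!]u)$, $[\![\mathsf{wk}]\!]=\lambda u.\pi_1^k u$ if the context is weakened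 by $k$ declarations. Moreover $[\![\hat\Psi\vdash M]\!]=[\![M]\!]$, $[\![\Psi\vdash A]\!]=[\![\Psi\vdash_v A]\!]=\Pi u{:}[\![\Psi]\!].[\![A]\!]u$, $[\![\lceil T\rceil]\!]=\square[\![T]\!]$, $[\![(y{:}\check\tau_1)\Rightarrow\tau_2]\!]=\Pi y{:}[\![\check\tau_1]\!].[\![\tau_2]\!]$, $[\![\mathsf{ctx}]\!]=\square\mathsf{Ctx}$; $[\![y]\!]=y$, $[\![\lceil C\rceil]\!]=\mathsf{box}\,[\![C]\!]$, $[\![\mathsf{fn}\,y\Rightarrow t]\!]=\lambda y.[\![t]\!]$, $[\![t_1\,t_2]\!]=[\![t_1]\!]\,[\![t_2]\!]$, and a domain context $\Psi$ used as a term becomes $\mathsf{box}\,[\![\Psi]\!]$. Computation contexts are translated pointwise. **Theorem (Soundness).** If $\vdash\Gamma$ then $[\![\Gamma]\!]$ is a well-formed context of K. Moreover, for every $\Gamma$: 1. if $\Gamma\vdash\Phi:\mathsf{ctx}$, then $[\![\Gamma]\!],\mathsf{lock}\vdash[\![\Phi]\!]:\mathsf{Ctx}$; 2. if $\Gamma;\Psi\vdash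 A$, then $[\![\Gamma]\!],\mathsf{lock}\vdash[\![A]\!]:\Pi u{:}[\![\Psi]\!].\,\mathsf{Type}$; 3. if $\Gamma;\Psi\vdash M:A$, then $[\![\Gamma]\!],\mathsf{lock}\vdash[\![M]\!]:\Pi u{:}[\![\Psi]\!].\,[\![A]\!]\,u$; 4. if $\Gamma;\Psi\vdash\sigma:\Phi$, then $[\![\Gamma]\!],\mathsf{lock}\vdash[\![\sigma]\!]:\Pi u{:}[\![\Psi]\!].\,[\![\Phi]\!]$; 5. if $\Gamma\vdash C:T$, then $[\![\Gamma]\!],\mathsf{lock}\vdash[\![C]\!]:[\![T]\!]$; 6. if $\Gamma\vdash\check\tau$, then $[\![\check\tau]\!]$ is a type in the context $[\![\Gamma]\!]$; 7. if $\Gamma\vdash t:\check\tau$, then $[\![\Gamma]\!]\vdash[\![t]\!]:[\![\check\tau]\!]$. Consequently Cocon without recursors is interpreted in every category with families with a dependent right adjoint that supports the type formers of K. A category with families has a dependent right adjoint if it has an endofunctor $L$ and types $R_\Gamma(A)\in Ty(\Gamma)$ for $A\in Ty(L\Gamma)$, stable under substitution, with bijections $Tm(L\Gamma,A)\simeq Tm(\Gamma,R_\Gamma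 A)$ natural in $\Gamma$; the further structure is that of $\Pi$-types and of the universes $\mathsf{Type}$ and $\mathsf{Ctx}$ above, with their equations and stable under substitution. Locks are interpreted by $L$ and $\square$ by $R$. In every such category, for $\vdash\Gamma$, the context $[\![\Gamma]\!]$ has exactly one denotation; the translations of all domain contexts, domain types, domain terms, substitutions, contextual objects, computation types and computation terms that are well formed over $\Gamma$ have exactly one denotation, over the denotation of the context and of the type given in 1–7; and definitionally equal domain types, domain terms, substitutions, computation types and computation terms have equal denotations. -/

import Mathlib

open CategoryTheory

/-! # Dependently typed Cocon without recursors

Raw expressions are well scoped by de Bruijn indices.  There are two independent kinds of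
variables: domain-level variables (declared in a domain-level context `Ψ`) and computation-level
variables (declared in a computation-level context `Γ`; these include the context variables `ψ`).
As usual for interpretations into categories with families, abstractions, applications and
unboxings record the types taken from their typing derivation; erasing these records gives the
plain terms. -/

namespace Cocon

mutual
/-- Domain-level types `ty`, `trm[M]`, `Π x : A. B`. -/
inductive DTy : Type
  | ty : DTy
  | trm (M : DTm) : DTy
  | pi (A B : DTy) : DTy

/-- Domain-level terms.  `lam A B M` is `λ x. M : Π x : A. B`, `app A B M N` is `M N` with
`M : Π x : A. B`, `unbox Φ A t σ` is `⌊t⌋_σ` with `t : ⌈Φ ⊢ A⌉` or `t : ⌈Φ ⊢ᵥ A⌉`.  The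
constants of the object language are fully applied. -/
inductive DTm : Type
  | var (n : ℕ) : DTm
  | lam (A B : DTy) (M : DTm) : DTm
  | app (A B : DTy) (M N : DTm) : DTm
  | unbox (Φ : DCtx) (A : DTy) (t : CTm) (σ : DSub) : DTm
  | o : DTm
  | arr (a b : DTm) : DTm
  | lamc (a b f : DTm) : DTm
  | appc (a b m n : DTm) : DTm

/-- Domain-level substitutions: empty, weakening by `k` variables (`wk_Ψ̂` in a context that
extends `Ψ` by `k` declarations), extension. -/
inductive DSub : Type
  | nil : DSub
  | wk (k : ℕ) : DSub
  | cons (σ : DSub) (M : DTm) : DSub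

/-- Domain-level contexts: empty, a context variable, extension. -/
inductive DCtx : Type
  | nil : DCtx
  | var (y : ℕ) : DCtx
  | snoc (Ψ : DCtx) (A : DTy) : DCtx

/-- Contextual types `Ψ ⊢ A` and `Ψ ⊢ᵥ A`. -/
inductive CxTy : Type
  | tm (Ψ : DCtx) (A : DTy) : CxTy
  | vr (Ψ : DCtx) (A : DTy) : CxTy

/-- Contextual objects `Ψ̂ ⊢ M`. -/
inductive CxObj : Type
  | mk (Ψ : DCtx) (M : DTm) : CxObj

/-- Domains of discourse: computation types `⌈T⌉`, `(y : τ₁) ⇒ τ₂`, and `ctx`.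
That `τ₂` is not `ctx` is part of the formation rule. -/
inductive CTy : Type
  | box (T : CxTy) : CTy
  | pi (τ₁ τ₂ : CTy) : CTy
  | ctx : CTy

/-- Computation terms.  `fn τ t` is `fn y ⇒ t` with `y : τ`; `app τ₁ τ₂ t s` is `t s` with
`t : (y : τ₁) ⇒ τ₂`; `ctx Ψ` is the domain-level context `Ψ`, used as a function argument. -/
inductive CTm : Type
  | var (y : ℕ) : CTm
  | box (C : CxObj) : CTm
  | fn (τ : CTy) (t : CTm) : CTm
  | app (τ₁ τ₂ : CTy) (t s : CTm) : CTm
  | ctx (Ψ : DCtx) : CTm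
end

/-! ### Domain-level weakening and substitution

Both leave the computations inside `unbox` alone: these contain no free domain-level variable. -/

/-- `(wk (j + c + 1), x_{j+c-1}, …, x_j)`. -/
def DSub.chain : ℕ → ℕ → DSub
  | j, 0 => .wk (j + 1)
  | j, c + 1 => .cons (DSub.chain (j + 1) c) (.var j)

mutual
/-- Weakening by one variable, inserted below the innermost `c` variables. -/
def DTy.shift : ℕ → DTy → DTy
  | _, .ty => .ty
  | c, .trm M => .trm (DTm.shift c M)
  | c, .pi A B => .pi (DTy.shift c A) (DTy.shift (c + 1) B)

def DTm.shift : ℕ → DTm → DTm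
  | c, .var n => .var (if n < c then n else n + 1)
  | c, .lam A B M => .lam (DTy.shift c A) (DTy.shift (c + 1) B) (DTm.shift (c + 1) M)
  | c, .app A B M N =>
      .app (DTy.shift c A) (DTy.shift (c + 1) B) (DTm.shift c M) (DTm.shift c N)
  | c, .unbox Φ A t σ => .unbox Φ A t (DSub.shift c σ)
  | _, .o => .o
  | c, .arr a b => .arr (DTm.shift c a) (DTm.shift c b)
  | c, .lamc a b f => .lamc (DTm.shift c a) (DTm.shift c b) (DTm.shift c f)
  | c, .appc a b m n =>
      .appc (DTm.shift c a) (DTm.shift c b) (DTm.shift c m) (DTm.shift c n)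

/-- On substitutions the operation is composition; `wk k` becomes
`(wk (c + 1), x_{c-1}, …, x_k)` when `k ≤ c`, and `wk (k + 1)` otherwise. -/
def DSub.shift : ℕ → DSub → DSub
  | _, .nil => .nil
  | c, .wk k => DSub.chain k (c - k)
  | c, .cons σ M => .cons (DSub.shift c σ) (DTm.shift c M)
end

/-- The term that a substitution provides for variable `n`. -/
def DSub.lookup : DSub → ℕ → DTm
  | .nil, n => .var n
  | .wk k, n => .var (n + k)
  | .cons _ M, 0 => M
  | .cons σ _, n + 1 => σ.lookup n

/-- The restriction of a substitution that forgets the innermost `k` variables. -/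
def DSub.drop : ℕ → DSub → DSub
  | 0, σ => σ
  | _ + 1, .nil => .nil
  | k + 1, .wk j => .wk (j + (k + 1))
  | k + 1, .cons σ _ => σ.drop k

/-- A substitution carried under a binder. -/
def DSub.lift (σ : DSub) : DSub := .cons (σ.shift 0) (.var 0)

mutual
/-- `[σ]A`. -/
def DTy.sub : DSub → DTy → DTy
  | _, .ty => .ty
  | σ, .trm M => .trm (DTm.sub σ M)
  | σ, .pi A B => .pi (DTy.sub σ A) (DTy.sub σ.lift B)

/-- `[σ]M`. -/
def DTm.sub : DSub → DTm → DTm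
  | σ, .var n => σ.lookup n
  | σ, .lam A B M => .lam (DTy.sub σ A) (DTy.sub σ.lift B) (DTm.sub σ.lift M)
  | σ, .app A B M N => .app (DTy.sub σ A) (DTy.sub σ.lift B) (DTm.sub σ M) (DTm.sub σ N)
  | σ, .unbox Φ A t τ => .unbox Φ A t (DSub.sub σ τ)
  | _, .o => .o
  | σ, .arr a b => .arr (DTm.sub σ a) (DTm.sub σ b)
  | σ, .lamc a b f => .lamc (DTm.sub σ a) (DTm.sub σ b) (DTm.sub σ f)
  | σ, .appc a b m n => .appc (DTm.sub σ a) (DTm.sub σ b) (DTm.sub σ m) (DTm.sub σ n)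

/-- Composition `[σ]τ`. -/
def DSub.sub : DSub → DSub → DSub
  | _, .nil => .nil
  | σ, .wk k => σ.drop k
  | σ, .cons τ M => .cons (DSub.sub σ τ) (DTm.sub σ M)
end

/-- `[N/x]B`. -/
def DTy.inst (B : DTy) (N : DTm) : DTy := B.sub (.cons (.wk 0) N)

/-- `[N/x]M`. -/
def DTm.inst (M N : DTm) : DTm := M.sub (.cons (.wk 0) N)

/-! ### Computation-level renaming and substitution -/

/-- A renaming carried under a binder. -/
def liftRen (ρ : ℕ → ℕ) : ℕ → ℕ
  | 0 => 0
  | n + 1 => ρ n + 1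

mutual
def DTy.cren : (ℕ → ℕ) → DTy → DTy
  | _, .ty => .ty
  | ρ, .trm M => .trm (DTm.cren ρ M)
  | ρ, .pi A B => .pi (DTy.cren ρ A) (DTy.cren ρ B)

def DTm.cren : (ℕ → ℕ) → DTm → DTm
  | _, .var n => .var n
  | ρ, .lam A B M => .lam (DTy.cren ρ A) (DTy.cren ρ B) (DTm.cren ρ M)
  | ρ, .app A B M N => .app (DTy.cren ρ A) (DTy.cren ρ B) (DTm.cren ρ M) (DTm.cren ρ N)
  | ρ, .unbox Φ A t σ =>
      .unbox (DCtx.cren ρ Φ) (DTy.cren ρ A) (CTm.cren ρ t) (DSub.cren ρ σ)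
  | _, .o => .o
  | ρ, .arr a b => .arr (DTm.cren ρ a) (DTm.cren ρ b)
  | ρ, .lamc a b f => .lamc (DTm.cren ρ a) (DTm.cren ρ b) (DTm.cren ρ f)
  | ρ, .appc a b m n =>
      .appc (DTm.cren ρ a) (DTm.cren ρ b) (DTm.cren ρ m) (DTm.cren ρ n)

def DSub.cren : (ℕ → ℕ) → DSub → DSub
  | _, .nil => .nil
  | _, .wk k => .wk k
  | ρ, .cons σ M => .cons (DSub.cren ρ σ) (DTm.cren ρ M)

def DCtx.cren : (ℕ → ℕ) → DCtx → DCtx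
  | _, .nil => .nil
  | ρ, .var y => .var (ρ y)
  | ρ, .snoc Ψ A => .snoc (DCtx.cren ρ Ψ) (DTy.cren ρ A)

def CxTy.cren : (ℕ → ℕ) → CxTy → CxTy
  | ρ, .tm Ψ A => .tm (DCtx.cren ρ Ψ) (DTy.cren ρ A)
  | ρ, .vr Ψ A => .vr (DCtx.cren ρ Ψ) (DTy.cren ρ A)

def CxObj.cren : (ℕ → ℕ) → CxObj → CxObj
  | ρ, .mk Ψ M => .mk (DCtx.cren ρ Ψ) (DTm.cren ρ M)

def CTy.cren : (ℕ → ℕ) → CTy → CTy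
  | ρ, .box T => .box (CxTy.cren ρ T)
  | ρ, .pi τ₁ τ₂ => .pi (CTy.cren ρ τ₁) (CTy.cren (liftRen ρ) τ₂)
  | _, .ctx => .ctx

def CTm.cren : (ℕ → ℕ) → CTm → CTm
  | ρ, .var y => .var (ρ y)
  | ρ, .box C => .box (CxObj.cren ρ C)
  | ρ, .fn τ t => .fn (CTy.cren ρ τ) (CTm.cren (liftRen ρ) t)
  | ρ, .app τ₁ τ₂ t s =>
      .app (CTy.cren ρ τ₁) (CTy.cren (liftRen ρ) τ₂) (CTm.cren ρ t) (CTm.cren ρ s)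
  | ρ, .ctx Ψ => .ctx (DCtx.cren ρ Ψ)
end

/-- The domain-level context that a term of type `ctx` stands for.  (A term of type `ctx` is a
variable or a context, since functions do not return contexts; the last value is never used.) -/
def CTm.toDCtx : CTm → DCtx
  | .var y => .var y
  | .ctx Ψ => Ψ
  | _ => .nil

/-- A computation-level substitution carried under a binder. -/
def liftSub (θ : ℕ → CTm) : ℕ → CTm
  | 0 => .var 0
  | n + 1 => (θ n).cren Nat.succ

mutual
def DTy.csub : (ℕ → CTm) → DTy → DTy
  | _, .ty => .ty
  | θ, .trm M => .trm (DTm.csub θ M)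
  | θ, .pi A B => .pi (DTy.csub θ A) (DTy.csub θ B)

def DTm.csub : (ℕ → CTm) → DTm → DTm
  | _, .var n => .var n
  | θ, .lam A B M => .lam (DTy.csub θ A) (DTy.csub θ B) (DTm.csub θ M)
  | θ, .app A B M N => .app (DTy.csub θ A) (DTy.csub θ B) (DTm.csub θ M) (DTm.csub θ N)
  | θ, .unbox Φ A t σ =>
      .unbox (DCtx.csub θ Φ) (DTy.csub θ A) (CTm.csub θ t) (DSub.csub θ σ)
  | _, .o => .o
  | θ, .arr a b => .arr (DTm.csub θ a) (DTm.csub θ b)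
  | θ, .lamc a b f => .lamc (DTm.csub θ a) (DTm.csub θ b) (DTm.csub θ f)
  | θ, .appc a b m n =>
      .appc (DTm.csub θ a) (DTm.csub θ b) (DTm.csub θ m) (DTm.csub θ n)

def DSub.csub : (ℕ → CTm) → DSub → DSub
  | _, .nil => .nil
  | _, .wk k => .wk k
  | θ, .cons σ M => .cons (DSub.csub θ σ) (DTm.csub θ M)

def DCtx.csub : (ℕ → CTm) → DCtx → DCtx
  | _, .nil => .nil
  | θ, .var y => (θ y).toDCtx
  | θ, .snoc Ψ A => .snoc (DCtx.csub θ Ψ) (DTy.csub θ A)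

def CxTy.csub : (ℕ → CTm) → CxTy → CxTy
  | θ, .tm Ψ A => .tm (DCtx.csub θ Ψ) (DTy.csub θ A)
  | θ, .vr Ψ A => .vr (DCtx.csub θ Ψ) (DTy.csub θ A)

def CxObj.csub : (ℕ → CTm) → CxObj → CxObj
  | θ, .mk Ψ M => .mk (DCtx.csub θ Ψ) (DTm.csub θ M)

def CTy.csub : (ℕ → CTm) → CTy → CTy
  | θ, .box T => .box (CxTy.csub θ T)
  | θ, .pi τ₁ τ₂ => .pi (CTy.csub θ τ₁) (CTy.csub (liftSub θ) τ₂)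
  | _, .ctx => .ctx

def CTm.csub : (ℕ → CTm) → CTm → CTm
  | θ, .var y => θ y
  | θ, .box C => .box (CxObj.csub θ C)
  | θ, .fn τ t => .fn (CTy.csub θ τ) (CTm.csub (liftSub θ) t)
  | θ, .app τ₁ τ₂ t s =>
      .app (CTy.csub θ τ₁) (CTy.csub (liftSub θ) τ₂) (CTm.csub θ t) (CTm.csub θ s)
  | θ, .ctx Ψ => .ctx (DCtx.csub θ Ψ)
end

/-- The substitution `s/y` for the innermost variable. -/
def single (s : CTm) : ℕ → CTm
  | 0 => s
  | n + 1 => .var n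

/-- `[s/y]τ`. -/
def CTy.inst (τ : CTy) (s : CTm) : CTy := τ.csub (single s)

/-- `[s/y]t`. -/
def CTm.inst (t s : CTm) : CTm := t.csub (single s)

/-! ### Judgments -/

/-- Computation-level contexts, innermost declaration first. -/
abbrev Ctx : Type := List CTy

/-- `y : τ ∈ Γ`. -/
inductive CLook : Ctx → ℕ → CTy → Prop
  | here {Γ : Ctx} {τ : CTy} : CLook (τ :: Γ) 0 (τ.cren Nat.succ)
  | there {Γ : Ctx} {τ τ' : CTy} {y : ℕ} :
      CLook Γ y τ → CLook (τ' :: Γ) (y + 1) (τ.cren Nat.succ)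

/-- `x : A ∈ Ψ`. -/
inductive DLook : DCtx → ℕ → DTy → Prop
  | here {Ψ : DCtx} {A : DTy} : DLook (.snoc Ψ A) 0 (A.shift 0)
  | there {Ψ : DCtx} {A B : DTy} {n : ℕ} :
      DLook Ψ n A → DLook (.snoc Ψ B) (n + 1) (A.shift 0)

/-- `Drop Ψ k Φ`: the context `Ψ` is `Φ` extended by `k` declarations. -/
inductive Drop : DCtx → ℕ → DCtx → Prop
  | zero {Ψ : DCtx} : Drop Ψ 0 Ψ
  | succ {Ψ Φ : DCtx} {A : DTy} {k : ℕ} : Drop Ψ k Φ → Drop (.snoc Ψ A) (k + 1) Φ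

mutual
/-- `⊢ Γ`. -/
inductive WfCtx : Ctx → Prop
  | nil : WfCtx []
  | cons {Γ : Ctx} {τ : CTy} : WfCtx Γ → CTyWf Γ τ → WfCtx (τ :: Γ)

/-- `Γ ⊢ Ψ : ctx`. -/
inductive DCtxWf : Ctx → DCtx → Prop
  | nil {Γ : Ctx} : WfCtx Γ → DCtxWf Γ .nil
  | var {Γ : Ctx} {y : ℕ} : WfCtx Γ → CLook Γ y .ctx → DCtxWf Γ (.var y)
  | snoc {Γ : Ctx} {Ψ : DCtx} {A : DTy} :
      DCtxWf Γ Ψ → DTyWf Γ Ψ A → DCtxWf Γ (.snoc Ψ A)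

/-- `Γ ⊢ Ψ ≡ Ψ' : ctx`. -/
inductive DCtxEq : Ctx → DCtx → DCtx → Prop
  | refl {Γ : Ctx} {Ψ : DCtx} : DCtxWf Γ Ψ → DCtxEq Γ Ψ Ψ
  | symm {Γ : Ctx} {Ψ Ψ' : DCtx} : DCtxEq Γ Ψ Ψ' → DCtxEq Γ Ψ' Ψ
  | trans {Γ : Ctx} {Ψ Ψ' Ψ'' : DCtx} :
      DCtxEq Γ Ψ Ψ' → DCtxEq Γ Ψ' Ψ'' → DCtxEq Γ Ψ Ψ''
  | snoc {Γ : Ctx} {Ψ Ψ' : DCtx} {A A' : DTy} :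
      DCtxEq Γ Ψ Ψ' → DTyWf Γ Ψ A → DTyWf Γ Ψ A' → DTyWf Γ Ψ' A' → DTyEq Γ Ψ A A' →
      DCtxEq Γ (.snoc Ψ A) (.snoc Ψ' A')

/-- `Γ; Ψ ⊢ A`. -/
inductive DTyWf : Ctx → DCtx → DTy → Prop
  | ty {Γ : Ctx} {Ψ : DCtx} : DCtxWf Γ Ψ → DTyWf Γ Ψ .ty
  | trm {Γ : Ctx} {Ψ : DCtx} {M : DTm} :
      DCtxWf Γ Ψ → HasDTm Γ Ψ M .ty → DTyWf Γ Ψ (.trm M)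
  | pi {Γ : Ctx} {Ψ : DCtx} {A B : DTy} :
      DCtxWf Γ Ψ → DTyWf Γ Ψ A → DTyWf Γ (.snoc Ψ A) B → DTyWf Γ Ψ (.pi A B)

/-- `Γ; Ψ ⊢ A ≡ A'`. -/
inductive DTyEq : Ctx → DCtx → DTy → DTy → Prop
  | refl {Γ : Ctx} {Ψ : DCtx} {A : DTy} : DTyWf Γ Ψ A → DTyEq Γ Ψ A A
  | symm {Γ : Ctx} {Ψ : DCtx} {A A' : DTy} : DTyEq Γ Ψ A A' → DTyEq Γ Ψ A' A
  | trans {Γ : Ctx} {Ψ : DCtx} {A A' A'' : DTy} :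
      DTyEq Γ Ψ A A' → DTyEq Γ Ψ A' A'' → DTyEq Γ Ψ A A''
  | trm {Γ : Ctx} {Ψ : DCtx} {M M' : DTm} :
      DCtxWf Γ Ψ → DTmEq Γ Ψ M M' .ty → DTyEq Γ Ψ (.trm M) (.trm M')
  | pi {Γ : Ctx} {Ψ : DCtx} {A A' B B' : DTy} :
      DCtxWf Γ Ψ → DTyWf Γ Ψ A → DTyWf Γ Ψ A' → DTyEq Γ Ψ A A' →
      DTyWf Γ (.snoc Ψ A) B → DTyWf Γ (.snoc Ψ A) B' → DTyEq Γ (.snoc Ψ A) B B' →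
      DTyEq Γ Ψ (.pi A B) (.pi A' B')

/-- `Γ; Ψ ⊢ M : A`. -/
inductive HasDTm : Ctx → DCtx → DTm → DTy → Prop
  | var {Γ : Ctx} {Ψ : DCtx} {n : ℕ} {A : DTy} :
      DCtxWf Γ Ψ → DLook Ψ n A → HasDTm Γ Ψ (.var n) A
  | lam {Γ : Ctx} {Ψ : DCtx} {A B : DTy} {M : DTm} :
      DCtxWf Γ Ψ → DTyWf Γ Ψ A → DTyWf Γ (.snoc Ψ A) B → HasDTm Γ (.snoc Ψ A) M B →
      HasDTm Γ Ψ (.lam A B M) (.pi A B)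
  | app {Γ : Ctx} {Ψ : DCtx} {A B : DTy} {M N : DTm} :
      DCtxWf Γ Ψ → DTyWf Γ Ψ A → DTyWf Γ (.snoc Ψ A) B →
      HasDTm Γ Ψ M (.pi A B) → HasDTm Γ Ψ N A → HasDTm Γ Ψ (.app A B M N) (B.inst N)
  | unbox {Γ : Ctx} {Ψ Φ : DCtx} {A : DTy} {t : CTm} {σ : DSub} :
      DCtxWf Γ Ψ → DCtxWf Γ Φ → DTyWf Γ Φ A →
      HasCTm Γ t (.box (.tm Φ A)) → HasDSub Γ Ψ σ Φ →
      HasDTm Γ Ψ (.unbox Φ A t σ) (A.sub σ)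
  | unboxv {Γ : Ctx} {Ψ Φ : DCtx} {A : DTy} {t : CTm} {σ : DSub} :
      DCtxWf Γ Ψ → DCtxWf Γ Φ → DTyWf Γ Φ A →
      HasCTm Γ t (.box (.vr Φ A)) → HasDSub Γ Ψ σ Φ →
      HasDTm Γ Ψ (.unbox Φ A t σ) (A.sub σ)
  | conv {Γ : Ctx} {Ψ : DCtx} {A B : DTy} {M : DTm} :
      HasDTm Γ Ψ M A → DTyEq Γ Ψ A B → HasDTm Γ Ψ M B
  | o {Γ : Ctx} {Ψ : DCtx} : DCtxWf Γ Ψ → HasDTm Γ Ψ .o .ty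
  | arr {Γ : Ctx} {Ψ : DCtx} {a b : DTm} :
      DCtxWf Γ Ψ → HasDTm Γ Ψ a .ty → HasDTm Γ Ψ b .ty → HasDTm Γ Ψ (.arr a b) .ty
  | lamc {Γ : Ctx} {Ψ : DCtx} {a b f : DTm} :
      DCtxWf Γ Ψ → HasDTm Γ Ψ a .ty → HasDTm Γ Ψ b .ty →
      HasDTm Γ Ψ f (.pi (.trm a) (.trm (b.shift 0))) →
      HasDTm Γ Ψ (.lamc a b f) (.trm (.arr a b))
  | appc {Γ : Ctx} {Ψ : DCtx} {a b m n : DTm} :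
      DCtxWf Γ Ψ → HasDTm Γ Ψ a .ty → HasDTm Γ Ψ b .ty →
      HasDTm Γ Ψ m (.trm (.arr a b)) → HasDTm Γ Ψ n (.trm a) →
      HasDTm Γ Ψ (.appc a b m n) (.trm b)

/-- `Γ; Ψ ⊢ M ≡ M' : A`: the congruence generated by `βη` and by `⌊⌈Φ̂ ⊢ M⌉⌋_σ ≡ [σ]M`. -/
inductive DTmEq : Ctx → DCtx → DTm → DTm → DTy → Prop
  | refl {Γ : Ctx} {Ψ : DCtx} {M : DTm} {A : DTy} : HasDTm Γ Ψ M A → DTmEq Γ Ψ M M A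
  | symm {Γ : Ctx} {Ψ : DCtx} {M M' : DTm} {A : DTy} :
      DTmEq Γ Ψ M M' A → DTmEq Γ Ψ M' M A
  | trans {Γ : Ctx} {Ψ : DCtx} {M M' M'' : DTm} {A : DTy} :
      DTmEq Γ Ψ M M' A → DTmEq Γ Ψ M' M'' A → DTmEq Γ Ψ M M'' A
  | conv {Γ : Ctx} {Ψ : DCtx} {A B : DTy} {M M' : DTm} :
      DTmEq Γ Ψ M M' A → DTyEq Γ Ψ A B → DTmEq Γ Ψ M M' B
  | lam {Γ : Ctx} {Ψ : DCtx} {A A' B B' : DTy} {M M' : DTm} :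
      DCtxWf Γ Ψ → DTyWf Γ Ψ A → DTyWf Γ Ψ A' → DTyEq Γ Ψ A A' →
      DTyWf Γ (.snoc Ψ A) B → DTyWf Γ (.snoc Ψ A) B' → DTyEq Γ (.snoc Ψ A) B B' →
      HasDTm Γ (.snoc Ψ A) M' B → DTmEq Γ (.snoc Ψ A) M M' B →
      DTmEq Γ Ψ (.lam A B M) (.lam A' B' M') (.pi A B)
  | app {Γ : Ctx} {Ψ : DCtx} {A A' B B' : DTy} {M M' N N' : DTm} :
      DCtxWf Γ Ψ → DTyWf Γ Ψ A → DTyWf Γ Ψ A' → DTyEq Γ Ψ A A' →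
      DTyWf Γ (.snoc Ψ A) B → DTyWf Γ (.snoc Ψ A) B' → DTyEq Γ (.snoc Ψ A) B B' →
      DTmEq Γ Ψ M M' (.pi A B) → HasDTm Γ Ψ N A → DTmEq Γ Ψ N N' A →
      DTmEq Γ Ψ (.app A B M N) (.app A' B' M' N') (B.inst N)
  | unbox {Γ : Ctx} {Ψ Φ Φ' : DCtx} {A A' : DTy} {t t' : CTm} {σ σ' : DSub} :
      DCtxWf Γ Ψ → DCtxWf Γ Φ → DCtxWf Γ Φ' → DCtxEq Γ Φ Φ' →
      DTyWf Γ Φ A → DTyWf Γ Φ A' → DTyEq Γ Φ A A' → CTmEq Γ t t' (.box (.tm Φ A)) →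
      HasDSub Γ Ψ σ Φ → HasDSub Γ Ψ σ' Φ → DSubEq Γ Ψ σ σ' Φ →
      DTmEq Γ Ψ (.unbox Φ A t σ) (.unbox Φ' A' t' σ') (A.sub σ)
  | unboxv {Γ : Ctx} {Ψ Φ Φ' : DCtx} {A A' : DTy} {t t' : CTm} {σ σ' : DSub} :
      DCtxWf Γ Ψ → DCtxWf Γ Φ → DCtxWf Γ Φ' → DCtxEq Γ Φ Φ' →
      DTyWf Γ Φ A → DTyWf Γ Φ A' → DTyEq Γ Φ A A' → CTmEq Γ t t' (.box (.vr Φ A)) →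
      HasDSub Γ Ψ σ Φ → HasDSub Γ Ψ σ' Φ → DSubEq Γ Ψ σ σ' Φ →
      DTmEq Γ Ψ (.unbox Φ A t σ) (.unbox Φ' A' t' σ') (A.sub σ)
  | arr {Γ : Ctx} {Ψ : DCtx} {a a' b b' : DTm} :
      DCtxWf Γ Ψ → DTmEq Γ Ψ a a' .ty → DTmEq Γ Ψ b b' .ty →
      DTmEq Γ Ψ (.arr a b) (.arr a' b') .ty
  | lamc {Γ : Ctx} {Ψ : DCtx} {a a' b b' f f' : DTm} :
      DCtxWf Γ Ψ → HasDTm Γ Ψ a .ty → HasDTm Γ Ψ b .ty →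
      DTmEq Γ Ψ a a' .ty → DTmEq Γ Ψ b b' .ty →
      DTmEq Γ Ψ f f' (.pi (.trm a) (.trm (b.shift 0))) →
      DTmEq Γ Ψ (.lamc a b f) (.lamc a' b' f') (.trm (.arr a b))
  | appc {Γ : Ctx} {Ψ : DCtx} {a a' b b' m m' n n' : DTm} :
      DCtxWf Γ Ψ → HasDTm Γ Ψ a .ty → HasDTm Γ Ψ b .ty →
      DTmEq Γ Ψ a a' .ty → DTmEq Γ Ψ b b' .ty →
      DTmEq Γ Ψ m m' (.trm (.arr a b)) → DTmEq Γ Ψ n n' (.trm a) →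
      DTmEq Γ Ψ (.appc a b m n) (.appc a' b' m' n') (.trm b)
  | beta {Γ : Ctx} {Ψ : DCtx} {A B : DTy} {M N : DTm} :
      DCtxWf Γ Ψ → DTyWf Γ Ψ A → DTyWf Γ (.snoc Ψ A) B →
      HasDTm Γ (.snoc Ψ A) M B → HasDTm Γ Ψ N A →
      DTmEq Γ Ψ (.app A B (.lam A B M) N) (M.inst N) (B.inst N)
  | eta {Γ : Ctx} {Ψ : DCtx} {A B : DTy} {M : DTm} :
      DCtxWf Γ Ψ → DTyWf Γ Ψ A → DTyWf Γ (.snoc Ψ A) B → HasDTm Γ Ψ M (.pi A B) →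
      DTmEq Γ Ψ M (.lam A B (.app (A.shift 0) (B.shift 1) (M.shift 0) (.var 0))) (.pi A B)
  | unboxBeta {Γ : Ctx} {Ψ Φ : DCtx} {A : DTy} {M : DTm} {σ : DSub} :
      DCtxWf Γ Ψ → DCtxWf Γ Φ → DTyWf Γ Φ A → HasDTm Γ Φ M A → HasDSub Γ Ψ σ Φ →
      DTmEq Γ Ψ (.unbox Φ A (.box (.mk Φ M)) σ) (M.sub σ) (A.sub σ)

/-- `Γ; Ψ ⊢ σ : Φ`. -/
inductive HasDSub : Ctx → DCtx → DSub → DCtx → Prop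
  | nil {Γ : Ctx} {Ψ : DCtx} : DCtxWf Γ Ψ → HasDSub Γ Ψ .nil .nil
  | cons {Γ : Ctx} {Ψ Φ : DCtx} {σ : DSub} {A : DTy} {M : DTm} :
      DCtxWf Γ Ψ → DCtxWf Γ Φ → DTyWf Γ Φ A → HasDSub Γ Ψ σ Φ → HasDTm Γ Ψ M (A.sub σ) →
      HasDSub Γ Ψ (.cons σ M) (.snoc Φ A)
  | wk {Γ : Ctx} {Ψ Φ : DCtx} {k : ℕ} :
      DCtxWf Γ Ψ → DCtxWf Γ Φ → Drop Ψ k Φ → HasDSub Γ Ψ (.wk k) Φ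

/-- `Γ; Ψ ⊢ σ ≡ σ' : Φ`. -/
inductive DSubEq : Ctx → DCtx → DSub → DSub → DCtx → Prop
  | refl {Γ : Ctx} {Ψ Φ : DCtx} {σ : DSub} : HasDSub Γ Ψ σ Φ → DSubEq Γ Ψ σ σ Φ
  | symm {Γ : Ctx} {Ψ Φ : DCtx} {σ σ' : DSub} : DSubEq Γ Ψ σ σ' Φ → DSubEq Γ Ψ σ' σ Φ
  | trans {Γ : Ctx} {Ψ Φ : DCtx} {σ σ' σ'' : DSub} :
      DSubEq Γ Ψ σ σ' Φ → DSubEq Γ Ψ σ' σ'' Φ → DSubEq Γ Ψ σ σ'' Φ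
  | cons {Γ : Ctx} {Ψ Φ : DCtx} {σ σ' : DSub} {A : DTy} {M M' : DTm} :
      DCtxWf Γ Ψ → DCtxWf Γ Φ → DTyWf Γ Φ A → HasDSub Γ Ψ σ Φ → DSubEq Γ Ψ σ σ' Φ →
      DTmEq Γ Ψ M M' (A.sub σ) →
      DSubEq Γ Ψ (.cons σ M) (.cons σ' M') (.snoc Φ A)
  | nilEta {Γ : Ctx} {Ψ : DCtx} {σ : DSub} :
      HasDSub Γ Ψ σ .nil → DSubEq Γ Ψ σ .nil .nil
  | wkEta {Γ : Ctx} {Ψ Φ : DCtx} {A : DTy} {k : ℕ} :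
      HasDSub Γ Ψ (.wk k) (.snoc Φ A) →
      DSubEq Γ Ψ (.wk k) (.cons (.wk (k + 1)) (.var k)) (.snoc Φ A)

/-- `Γ ⊢ C : T`. -/
inductive HasObj : Ctx → CxObj → CxTy → Prop
  | tm {Γ : Ctx} {Ψ : DCtx} {M : DTm} {A : DTy} :
      DCtxWf Γ Ψ → DTyWf Γ Ψ A → HasDTm Γ Ψ M A → HasObj Γ (.mk Ψ M) (.tm Ψ A)
  | var {Γ : Ctx} {Ψ : DCtx} {n : ℕ} {A : DTy} :
      DCtxWf Γ Ψ → DLook Ψ n A → HasObj Γ (.mk Ψ (.var n)) (.vr Ψ A)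
  | unboxv {Γ : Ctx} {Ψ Φ : DCtx} {A : DTy} {x k : ℕ} :
      DCtxWf Γ Ψ → DCtxWf Γ Φ → DTyWf Γ Φ A →
      CLook Γ x (.box (.vr Φ A)) → HasDSub Γ Ψ (.wk k) Φ →
      HasObj Γ (.mk Ψ (.unbox Φ A (.var x) (.wk k))) (.vr Ψ (A.sub (.wk k)))

/-- `Γ ⊢ C ≡ C' : T`. -/
inductive ObjEq : Ctx → CxObj → CxObj → CxTy → Prop
  | tm {Γ : Ctx} {Ψ Ψ' : DCtx} {M M' : DTm} {A : DTy} :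
      DCtxWf Γ Ψ → DCtxWf Γ Ψ' → DCtxEq Γ Ψ Ψ' → DTyWf Γ Ψ A →
      HasDTm Γ Ψ M' A → DTmEq Γ Ψ M M' A →
      ObjEq Γ (.mk Ψ M) (.mk Ψ' M') (.tm Ψ A)
  | vr {Γ : Ctx} {Ψ Ψ' : DCtx} {M M' : DTm} {A A' : DTy} :
      DCtxWf Γ Ψ → DCtxWf Γ Ψ' → DCtxEq Γ Ψ Ψ' → DTyWf Γ Ψ A →
      HasObj Γ (.mk Ψ M) (.vr Ψ A) → HasObj Γ (.mk Ψ' M') (.vr Ψ' A') →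
      HasDTm Γ Ψ M' A → DTmEq Γ Ψ M M' A →
      ObjEq Γ (.mk Ψ M) (.mk Ψ' M') (.vr Ψ A)

/-- `Γ ⊢ τ`. -/
inductive CTyWf : Ctx → CTy → Prop
  | ctx {Γ : Ctx} : WfCtx Γ → CTyWf Γ .ctx
  | pi {Γ : Ctx} {τ₁ τ₂ : CTy} :
      WfCtx Γ → CTyWf Γ τ₁ → CTyWf (τ₁ :: Γ) τ₂ → τ₂ ≠ .ctx → CTyWf Γ (.pi τ₁ τ₂)
  | tm {Γ : Ctx} {Ψ : DCtx} {A : DTy} :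
      WfCtx Γ → DCtxWf Γ Ψ → DTyWf Γ Ψ A → CTyWf Γ (.box (.tm Ψ A))
  | vr {Γ : Ctx} {Ψ : DCtx} {A : DTy} :
      WfCtx Γ → DCtxWf Γ Ψ → DTyWf Γ Ψ A → CTyWf Γ (.box (.vr Ψ A))

/-- `Γ ⊢ τ ≡ τ'`. -/
inductive CTyEq : Ctx → CTy → CTy → Prop
  | refl {Γ : Ctx} {τ : CTy} : CTyWf Γ τ → CTyEq Γ τ τ
  | symm {Γ : Ctx} {τ τ' : CTy} : CTyEq Γ τ τ' → CTyEq Γ τ' τ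
  | trans {Γ : Ctx} {τ τ' τ'' : CTy} : CTyEq Γ τ τ' → CTyEq Γ τ' τ'' → CTyEq Γ τ τ''
  | pi {Γ : Ctx} {τ₁ τ₁' τ₂ τ₂' : CTy} :
      WfCtx Γ → CTyWf Γ τ₁ → CTyEq Γ τ₁ τ₁' → CTyWf (τ₁ :: Γ) τ₂ →
      CTyEq (τ₁ :: Γ) τ₂ τ₂' → τ₂ ≠ .ctx → CTyEq Γ (.pi τ₁ τ₂) (.pi τ₁' τ₂')
  | tm {Γ : Ctx} {Ψ Ψ' : DCtx} {A A' : DTy} :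
      WfCtx Γ → DCtxWf Γ Ψ → DCtxWf Γ Ψ' → DCtxEq Γ Ψ Ψ' →
      DTyWf Γ Ψ A → DTyWf Γ Ψ A' → DTyWf Γ Ψ' A' → DTyEq Γ Ψ A A' →
      CTyEq Γ (.box (.tm Ψ A)) (.box (.tm Ψ' A'))
  | vr {Γ : Ctx} {Ψ Ψ' : DCtx} {A A' : DTy} :
      WfCtx Γ → DCtxWf Γ Ψ → DCtxWf Γ Ψ' → DCtxEq Γ Ψ Ψ' →
      DTyWf Γ Ψ A → DTyWf Γ Ψ A' → DTyWf Γ Ψ' A' → DTyEq Γ Ψ A A' →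
      CTyEq Γ (.box (.vr Ψ A)) (.box (.vr Ψ' A'))

/-- `Γ ⊢ t : τ`. -/
inductive HasCTm : Ctx → CTm → CTy → Prop
  | var {Γ : Ctx} {y : ℕ} {τ : CTy} : WfCtx Γ → CLook Γ y τ → HasCTm Γ (.var y) τ
  | ctx {Γ : Ctx} {Ψ : DCtx} : WfCtx Γ → DCtxWf Γ Ψ → HasCTm Γ (.ctx Ψ) .ctx
  | box {Γ : Ctx} {C : CxObj} {T : CxTy} : WfCtx Γ → HasObj Γ C T → HasCTm Γ (.box C) (.box T)
  | fn {Γ : Ctx} {τ₁ τ₂ : CTy} {t : CTm} :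
      WfCtx Γ → CTyWf Γ τ₁ → CTyWf (τ₁ :: Γ) τ₂ → τ₂ ≠ .ctx → HasCTm (τ₁ :: Γ) t τ₂ →
      HasCTm Γ (.fn τ₁ t) (.pi τ₁ τ₂)
  | app {Γ : Ctx} {τ₁ τ₂ : CTy} {t s : CTm} :
      WfCtx Γ → CTyWf Γ τ₁ → CTyWf (τ₁ :: Γ) τ₂ → τ₂ ≠ .ctx →
      HasCTm Γ t (.pi τ₁ τ₂) → HasCTm Γ s τ₁ → HasCTm Γ (.app τ₁ τ₂ t s) (τ₂.inst s)
  | conv {Γ : Ctx} {τ τ' : CTy} {t : CTm} : HasCTm Γ t τ → CTyEq Γ τ τ' → HasCTm Γ t τ'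

/-- `Γ ⊢ t ≡ t' : τ`: the congruence generated by `βη` for functions, by
`t ≡ ⌈Ψ̂ ⊢ ⌊t⌋_id⌉`, and by identifying a context variable with the one-variable context. -/
inductive CTmEq : Ctx → CTm → CTm → CTy → Prop
  | refl {Γ : Ctx} {t : CTm} {τ : CTy} : HasCTm Γ t τ → CTmEq Γ t t τ
  | symm {Γ : Ctx} {t t' : CTm} {τ : CTy} : CTmEq Γ t t' τ → CTmEq Γ t' t τ
  | trans {Γ : Ctx} {t t' t'' : CTm} {τ : CTy} :
      CTmEq Γ t t' τ → CTmEq Γ t' t'' τ → CTmEq Γ t t'' τ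
  | conv {Γ : Ctx} {τ τ' : CTy} {t t' : CTm} :
      CTmEq Γ t t' τ → CTyEq Γ τ τ' → CTmEq Γ t t' τ'
  | ctx {Γ : Ctx} {Ψ Ψ' : DCtx} :
      WfCtx Γ → DCtxEq Γ Ψ Ψ' → CTmEq Γ (.ctx Ψ) (.ctx Ψ') .ctx
  | ctxVar {Γ : Ctx} {y : ℕ} :
      WfCtx Γ → CLook Γ y .ctx → CTmEq Γ (.ctx (.var y)) (.var y) .ctx
  | box {Γ : Ctx} {C C' : CxObj} {T : CxTy} :
      WfCtx Γ → ObjEq Γ C C' T → CTmEq Γ (.box C) (.box C') (.box T)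
  | fn {Γ : Ctx} {τ₁ τ₁' τ₂ : CTy} {t t' : CTm} :
      WfCtx Γ → CTyWf Γ τ₁ → CTyEq Γ τ₁ τ₁' → CTyWf (τ₁ :: Γ) τ₂ → τ₂ ≠ .ctx →
      CTmEq (τ₁ :: Γ) t t' τ₂ → CTmEq Γ (.fn τ₁ t) (.fn τ₁' t') (.pi τ₁ τ₂)
  | app {Γ : Ctx} {τ₁ τ₁' τ₂ τ₂' : CTy} {t t' s s' : CTm} :
      WfCtx Γ → CTyWf Γ τ₁ → CTyEq Γ τ₁ τ₁' →
      CTyWf (τ₁ :: Γ) τ₂ → CTyEq (τ₁ :: Γ) τ₂ τ₂' → τ₂ ≠ .ctx →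
      CTmEq Γ t t' (.pi τ₁ τ₂) → HasCTm Γ s τ₁ → CTmEq Γ s s' τ₁ →
      CTmEq Γ (.app τ₁ τ₂ t s) (.app τ₁' τ₂' t' s') (τ₂.inst s)
  | beta {Γ : Ctx} {τ₁ τ₂ : CTy} {t s : CTm} :
      WfCtx Γ → CTyWf Γ τ₁ → CTyWf (τ₁ :: Γ) τ₂ → τ₂ ≠ .ctx →
      HasCTm (τ₁ :: Γ) t τ₂ → HasCTm Γ s τ₁ →
      CTmEq Γ (.app τ₁ τ₂ (.fn τ₁ t) s) (t.inst s) (τ₂.inst s)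
  | eta {Γ : Ctx} {τ₁ τ₂ : CTy} {t : CTm} :
      WfCtx Γ → CTyWf Γ τ₁ → CTyWf (τ₁ :: Γ) τ₂ → τ₂ ≠ .ctx → HasCTm Γ t (.pi τ₁ τ₂) →
      CTmEq Γ t (.fn τ₁ (.app (τ₁.cren Nat.succ) (τ₂.cren (liftRen Nat.succ))
        (t.cren Nat.succ) (.var 0))) (.pi τ₁ τ₂)
  | boxEta {Γ : Ctx} {Ψ : DCtx} {A : DTy} {t : CTm} :
      WfCtx Γ → DCtxWf Γ Ψ → DTyWf Γ Ψ A → HasCTm Γ t (.box (.tm Ψ A)) →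
      CTmEq Γ t (.box (.mk Ψ (.unbox Ψ A t (.wk 0)))) (.box (.tm Ψ A))
end

end Cocon

/-! # Fitch-style dependent intuitionistic K

Dependent function types and the modality `□` with locks in contexts, extended by a universe
`Type` (à la Tarski) with the types of the object language and closed under dependent functions,
and by a universe `Ctx` with an empty context and context extension by families of small types.
Locks are not counted by de Bruijn indices. -/

namespace Fitch

mutual
/-- Types.  `el a` is the type with code `a : Type`, `elc φ` the type of instances of
`φ : Ctx`. -/
inductive Ty : Type
  | pi (A B : Ty) : Ty
  | box (A : Ty) : Ty
  | univ : Ty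
  | ctx : Ty
  | el (a : Tm) : Ty
  | elc (φ : Tm) : Ty

/-- Terms.  `app A B t s` is `t s` with `t : Π A B`, `unbox A t` is `unbox t` with `t : □ A`;
`pair`, `fst`, `snd` introduce and eliminate instances of `ext φ a`. -/
inductive Tm : Type
  | var (n : ℕ) : Tm
  | lam (A : Ty) (t : Tm) : Tm
  | app (A B : Ty) (t s : Tm) : Tm
  | box (t : Tm) : Tm
  | unbox (A : Ty) (t : Tm) : Tm
  | pic (a b : Tm) : Tm
  | tyc : Tm
  | trmc (m : Tm) : Tm
  | top : Tm
  | ext (φ a : Tm) : Tm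
  | unit : Tm
  | pair (φ a t s : Tm) : Tm
  | fst (φ a t : Tm) : Tm
  | snd (φ a t : Tm) : Tm
  | o : Tm
  | arr (a b : Tm) : Tm
  | lamc (a b f : Tm) : Tm
  | appc (a b m n : Tm) : Tm
end

/-- A renaming carried under a binder. -/
def liftRen (ρ : ℕ → ℕ) : ℕ → ℕ
  | 0 => 0
  | n + 1 => ρ n + 1

mutual
def Ty.ren : (ℕ → ℕ) → Ty → Ty
  | ρ, .pi A B => .pi (Ty.ren ρ A) (Ty.ren (liftRen ρ) B)
  | ρ, .box A => .box (Ty.ren ρ A)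
  | _, .univ => .univ
  | _, .ctx => .ctx
  | ρ, .el a => .el (Tm.ren ρ a)
  | ρ, .elc φ => .elc (Tm.ren ρ φ)

def Tm.ren : (ℕ → ℕ) → Tm → Tm
  | ρ, .var n => .var (ρ n)
  | ρ, .lam A t => .lam (Ty.ren ρ A) (Tm.ren (liftRen ρ) t)
  | ρ, .app A B t s =>
      .app (Ty.ren ρ A) (Ty.ren (liftRen ρ) B) (Tm.ren ρ t) (Tm.ren ρ s)
  | ρ, .box t => .box (Tm.ren ρ t)
  | ρ, .unbox A t => .unbox (Ty.ren ρ A) (Tm.ren ρ t)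
  | ρ, .pic a b => .pic (Tm.ren ρ a) (Tm.ren (liftRen ρ) b)
  | _, .tyc => .tyc
  | ρ, .trmc m => .trmc (Tm.ren ρ m)
  | _, .top => .top
  | ρ, .ext φ a => .ext (Tm.ren ρ φ) (Tm.ren ρ a)
  | _, .unit => .unit
  | ρ, .pair φ a t s => .pair (Tm.ren ρ φ) (Tm.ren ρ a) (Tm.ren ρ t) (Tm.ren ρ s)
  | ρ, .fst φ a t => .fst (Tm.ren ρ φ) (Tm.ren ρ a) (Tm.ren ρ t)
  | ρ, .snd φ a t => .snd (Tm.ren ρ φ) (Tm.ren ρ a) (Tm.ren ρ t)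
  | _, .o => .o
  | ρ, .arr a b => .arr (Tm.ren ρ a) (Tm.ren ρ b)
  | ρ, .lamc a b f => .lamc (Tm.ren ρ a) (Tm.ren ρ b) (Tm.ren ρ f)
  | ρ, .appc a b m n => .appc (Tm.ren ρ a) (Tm.ren ρ b) (Tm.ren ρ m) (Tm.ren ρ n)
end

/-- Weakening by `k` variables. -/
def Ty.up (k : ℕ) (A : Ty) : Ty := A.ren (· + k)

/-- Weakening by `k` variables. -/
def Tm.up (k : ℕ) (t : Tm) : Tm := t.ren (· + k)

/-- A substitution carried under a binder. -/
def liftSub (θ : ℕ → Tm) : ℕ → Tm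
  | 0 => .var 0
  | n + 1 => (θ n).up 1

mutual
def Ty.sub : (ℕ → Tm) → Ty → Ty
  | θ, .pi A B => .pi (Ty.sub θ A) (Ty.sub (liftSub θ) B)
  | θ, .box A => .box (Ty.sub θ A)
  | _, .univ => .univ
  | _, .ctx => .ctx
  | θ, .el a => .el (Tm.sub θ a)
  | θ, .elc φ => .elc (Tm.sub θ φ)

def Tm.sub : (ℕ → Tm) → Tm → Tm
  | θ, .var n => θ n
  | θ, .lam A t => .lam (Ty.sub θ A) (Tm.sub (liftSub θ) t)
  | θ, .app A B t s =>
      .app (Ty.sub θ A) (Ty.sub (liftSub θ) B) (Tm.sub θ t) (Tm.sub θ s)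
  | θ, .box t => .box (Tm.sub θ t)
  | θ, .unbox A t => .unbox (Ty.sub θ A) (Tm.sub θ t)
  | θ, .pic a b => .pic (Tm.sub θ a) (Tm.sub (liftSub θ) b)
  | _, .tyc => .tyc
  | θ, .trmc m => .trmc (Tm.sub θ m)
  | _, .top => .top
  | θ, .ext φ a => .ext (Tm.sub θ φ) (Tm.sub θ a)
  | _, .unit => .unit
  | θ, .pair φ a t s => .pair (Tm.sub θ φ) (Tm.sub θ a) (Tm.sub θ t) (Tm.sub θ s)
  | θ, .fst φ a t => .fst (Tm.sub θ φ) (Tm.sub θ a) (Tm.sub θ t)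
  | θ, .snd φ a t => .snd (Tm.sub θ φ) (Tm.sub θ a) (Tm.sub θ t)
  | _, .o => .o
  | θ, .arr a b => .arr (Tm.sub θ a) (Tm.sub θ b)
  | θ, .lamc a b f => .lamc (Tm.sub θ a) (Tm.sub θ b) (Tm.sub θ f)
  | θ, .appc a b m n => .appc (Tm.sub θ a) (Tm.sub θ b) (Tm.sub θ m) (Tm.sub θ n)
end

/-- The substitution of `s` for the innermost variable. -/
def single (s : Tm) : ℕ → Tm
  | 0 => s
  | n + 1 => .var n

/-- `[s/x]B`. -/
def Ty.inst (B : Ty) (s : Tm) : Ty := B.sub (single s)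

/-- `[s/x]t`. -/
def Tm.inst (t s : Tm) : Tm := t.sub (single s)

/-- Contexts with locks. -/
inductive Ctx : Type
  | nil : Ctx
  | snoc (Γ : Ctx) (A : Ty) : Ctx
  | lock (Γ : Ctx) : Ctx

/-- Extension of a context by lock-free declarations (innermost first). -/
def Ctx.append (Γ : Ctx) : List Ty → Ctx
  | [] => Γ
  | A :: Δ => .snoc (Γ.append Δ) A

/-- `x : A ∈ Γ` with no lock to the right of `x`. -/
inductive Look : Ctx → ℕ → Ty → Prop
  | here {Γ : Ctx} {A : Ty} : Look (.snoc Γ A) 0 (A.up 1)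
  | there {Γ : Ctx} {A B : Ty} {n : ℕ} : Look Γ n A → Look (.snoc Γ B) (n + 1) (A.up 1)

/-- `a u` for `a : Π (elc φ). Type`. -/
def apT (φ a u : Tm) : Tm := .app (.elc φ) .univ a u

/-- `Π u : φ. El (a u)`. -/
def piT (φ a : Tm) : Ty := .pi (.elc φ) (.el (apT (φ.up 1) (a.up 1) (.var 0)))

mutual
/-- `⊢ Γ`. -/
inductive Wf : Ctx → Prop
  | nil : Wf .nil
  | snoc {Γ : Ctx} {A : Ty} : Wf Γ → TyWf Γ A → Wf (.snoc Γ A)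
  | lock {Γ : Ctx} : Wf Γ → Wf (.lock Γ)

/-- `Γ ⊢ A type`. -/
inductive TyWf : Ctx → Ty → Prop
  | pi {Γ : Ctx} {A B : Ty} : TyWf Γ A → TyWf (.snoc Γ A) B → TyWf Γ (.pi A B)
  | box {Γ : Ctx} {A : Ty} : TyWf (.lock Γ) A → TyWf Γ (.box A)
  | univ {Γ : Ctx} : Wf Γ → TyWf Γ .univ
  | ctx {Γ : Ctx} : Wf Γ → TyWf Γ .ctx
  | el {Γ : Ctx} {a : Tm} : HasTm Γ a .univ → TyWf Γ (.el a)
  | elc {Γ : Ctx} {φ : Tm} : HasTm Γ φ .ctx → TyWf Γ (.elc φ)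

/-- `Γ ⊢ A ≡ A' type`. -/
inductive TyEq : Ctx → Ty → Ty → Prop
  | refl {Γ : Ctx} {A : Ty} : TyWf Γ A → TyEq Γ A A
  | symm {Γ : Ctx} {A A' : Ty} : TyEq Γ A A' → TyEq Γ A' A
  | trans {Γ : Ctx} {A A' A'' : Ty} : TyEq Γ A A' → TyEq Γ A' A'' → TyEq Γ A A''
  | pi {Γ : Ctx} {A A' B B' : Ty} :
      TyWf Γ A → TyEq Γ A A' → TyEq (.snoc Γ A) B B' → TyEq Γ (.pi A B) (.pi A' B')
  | box {Γ : Ctx} {A A' : Ty} : TyEq (.lock Γ) A A' → TyEq Γ (.box A) (.box A')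
  | el {Γ : Ctx} {a a' : Tm} : TmEq Γ a a' .univ → TyEq Γ (.el a) (.el a')
  | elc {Γ : Ctx} {φ φ' : Tm} : TmEq Γ φ φ' .ctx → TyEq Γ (.elc φ) (.elc φ')
  | elPi {Γ : Ctx} {a b : Tm} : HasTm Γ a .univ → HasTm (.snoc Γ (.el a)) b .univ →
      TyEq Γ (.el (.pic a b)) (.pi (.el a) (.el b))

/-- `Γ ⊢ t : A`. -/
inductive HasTm : Ctx → Tm → Ty → Prop
  | var {Γ : Ctx} {n : ℕ} {A : Ty} : Wf Γ → Look Γ n A → HasTm Γ (.var n) A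
  | conv {Γ : Ctx} {t : Tm} {A A' : Ty} : HasTm Γ t A → TyEq Γ A A' → HasTm Γ t A'
  | lam {Γ : Ctx} {A B : Ty} {t : Tm} :
      TyWf Γ A → HasTm (.snoc Γ A) t B → HasTm Γ (.lam A t) (.pi A B)
  | app {Γ : Ctx} {A B : Ty} {t s : Tm} :
      TyWf Γ A → TyWf (.snoc Γ A) B → HasTm Γ t (.pi A B) → HasTm Γ s A →
      HasTm Γ (.app A B t s) (B.inst s)
  | box {Γ : Ctx} {A : Ty} {t : Tm} : HasTm (.lock Γ) t A → HasTm Γ (.box t) (.box A)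
  | unbox {Γ : Ctx} {A : Ty} {t : Tm} {Δ : List Ty} :
      TyWf (.lock Γ) A → HasTm Γ t (.box A) → Wf ((Ctx.lock Γ).append Δ) →
      HasTm ((Ctx.lock Γ).append Δ) (.unbox (A.up Δ.length) (t.up Δ.length)) (A.up Δ.length)
  | pic {Γ : Ctx} {a b : Tm} :
      HasTm Γ a .univ → HasTm (.snoc Γ (.el a)) b .univ → HasTm Γ (.pic a b) .univ
  | tyc {Γ : Ctx} : Wf Γ → HasTm Γ .tyc .univ
  | trmc {Γ : Ctx} {m : Tm} : HasTm Γ m (.el .tyc) → HasTm Γ (.trmc m) .univ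
  | top {Γ : Ctx} : Wf Γ → HasTm Γ .top .ctx
  | ext {Γ : Ctx} {φ a : Tm} :
      HasTm Γ φ .ctx → HasTm Γ a (.pi (.elc φ) .univ) → HasTm Γ (.ext φ a) .ctx
  | unit {Γ : Ctx} : Wf Γ → HasTm Γ .unit (.elc .top)
  | pair {Γ : Ctx} {φ a t s : Tm} :
      HasTm Γ φ .ctx → HasTm Γ a (.pi (.elc φ) .univ) →
      HasTm Γ t (.elc φ) → HasTm Γ s (.el (apT φ a t)) →
      HasTm Γ (.pair φ a t s) (.elc (.ext φ a))
  | fst {Γ : Ctx} {φ a t : Tm} :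
      HasTm Γ φ .ctx → HasTm Γ a (.pi (.elc φ) .univ) → HasTm Γ t (.elc (.ext φ a)) →
      HasTm Γ (.fst φ a t) (.elc φ)
  | snd {Γ : Ctx} {φ a t : Tm} :
      HasTm Γ φ .ctx → HasTm Γ a (.pi (.elc φ) .univ) → HasTm Γ t (.elc (.ext φ a)) →
      HasTm Γ (.snd φ a t) (.el (apT φ a (.fst φ a t)))
  | o {Γ : Ctx} : Wf Γ → HasTm Γ .o (.el .tyc)
  | arr {Γ : Ctx} {a b : Tm} :
      HasTm Γ a (.el .tyc) → HasTm Γ b (.el .tyc) → HasTm Γ (.arr a b) (.el .tyc)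
  | lamc {Γ : Ctx} {a b f : Tm} :
      HasTm Γ a (.el .tyc) → HasTm Γ b (.el .tyc) →
      HasTm Γ f (.pi (.el (.trmc a)) (.el (.trmc (b.up 1)))) →
      HasTm Γ (.lamc a b f) (.el (.trmc (.arr a b)))
  | appc {Γ : Ctx} {a b m n : Tm} :
      HasTm Γ a (.el .tyc) → HasTm Γ b (.el .tyc) →
      HasTm Γ m (.el (.trmc (.arr a b))) → HasTm Γ n (.el (.trmc a)) →
      HasTm Γ (.appc a b m n) (.el (.trmc b))

/-- `Γ ⊢ t ≡ t' : A`: the congruence generated by `βη` for `Π`, `□`, `top` and `ext`. -/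
inductive TmEq : Ctx → Tm → Tm → Ty → Prop
  | refl {Γ : Ctx} {t : Tm} {A : Ty} : HasTm Γ t A → TmEq Γ t t A
  | symm {Γ : Ctx} {t t' : Tm} {A : Ty} : TmEq Γ t t' A → TmEq Γ t' t A
  | trans {Γ : Ctx} {t t' t'' : Tm} {A : Ty} :
      TmEq Γ t t' A → TmEq Γ t' t'' A → TmEq Γ t t'' A
  | conv {Γ : Ctx} {t t' : Tm} {A A' : Ty} : TmEq Γ t t' A → TyEq Γ A A' → TmEq Γ t t' A'
  | lam {Γ : Ctx} {A A' B : Ty} {t t' : Tm} :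
      TyWf Γ A → TyEq Γ A A' → TmEq (.snoc Γ A) t t' B →
      TmEq Γ (.lam A t) (.lam A' t') (.pi A B)
  | app {Γ : Ctx} {A A' B B' : Ty} {t t' s s' : Tm} :
      TyWf Γ A → TyEq Γ A A' → TyWf (.snoc Γ A) B → TyEq (.snoc Γ A) B B' →
      TmEq Γ t t' (.pi A B) → HasTm Γ s A → TmEq Γ s s' A →
      TmEq Γ (.app A B t s) (.app A' B' t' s') (B.inst s)
  | box {Γ : Ctx} {A : Ty} {t t' : Tm} :
      TmEq (.lock Γ) t t' A → TmEq Γ (.box t) (.box t') (.box A)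
  | unbox {Γ : Ctx} {A A' : Ty} {t t' : Tm} {Δ : List Ty} :
      TyWf (.lock Γ) A → TyEq (.lock Γ) A A' → TmEq Γ t t' (.box A) →
      Wf ((Ctx.lock Γ).append Δ) →
      TmEq ((Ctx.lock Γ).append Δ) (.unbox (A.up Δ.length) (t.up Δ.length))
        (.unbox (A'.up Δ.length) (t'.up Δ.length)) (A.up Δ.length)
  | pic {Γ : Ctx} {a a' b b' : Tm} :
      HasTm Γ a .univ → TmEq Γ a a' .univ → TmEq (.snoc Γ (.el a)) b b' .univ →
      TmEq Γ (.pic a b) (.pic a' b') .univ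
  | trmc {Γ : Ctx} {m m' : Tm} : TmEq Γ m m' (.el .tyc) → TmEq Γ (.trmc m) (.trmc m') .univ
  | ext {Γ : Ctx} {φ φ' a a' : Tm} :
      HasTm Γ φ .ctx → TmEq Γ φ φ' .ctx → TmEq Γ a a' (.pi (.elc φ) .univ) →
      TmEq Γ (.ext φ a) (.ext φ' a') .ctx
  | pair {Γ : Ctx} {φ φ' a a' t t' s s' : Tm} :
      HasTm Γ φ .ctx → TmEq Γ φ φ' .ctx →
      HasTm Γ a (.pi (.elc φ) .univ) → TmEq Γ a a' (.pi (.elc φ) .univ) →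
      HasTm Γ t (.elc φ) → TmEq Γ t t' (.elc φ) → TmEq Γ s s' (.el (apT φ a t)) →
      TmEq Γ (.pair φ a t s) (.pair φ' a' t' s') (.elc (.ext φ a))
  | fst {Γ : Ctx} {φ φ' a a' t t' : Tm} :
      HasTm Γ φ .ctx → TmEq Γ φ φ' .ctx →
      HasTm Γ a (.pi (.elc φ) .univ) → TmEq Γ a a' (.pi (.elc φ) .univ) →
      TmEq Γ t t' (.elc (.ext φ a)) → TmEq Γ (.fst φ a t) (.fst φ' a' t') (.elc φ)
  | snd {Γ : Ctx} {φ φ' a a' t t' : Tm} :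
      HasTm Γ φ .ctx → TmEq Γ φ φ' .ctx →
      HasTm Γ a (.pi (.elc φ) .univ) → TmEq Γ a a' (.pi (.elc φ) .univ) →
      HasTm Γ t (.elc (.ext φ a)) → TmEq Γ t t' (.elc (.ext φ a)) →
      TmEq Γ (.snd φ a t) (.snd φ' a' t') (.el (apT φ a (.fst φ a t)))
  | arr {Γ : Ctx} {a a' b b' : Tm} :
      TmEq Γ a a' (.el .tyc) → TmEq Γ b b' (.el .tyc) →
      TmEq Γ (.arr a b) (.arr a' b') (.el .tyc)
  | lamc {Γ : Ctx} {a a' b b' f f' : Tm} :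
      HasTm Γ a (.el .tyc) → HasTm Γ b (.el .tyc) →
      TmEq Γ a a' (.el .tyc) → TmEq Γ b b' (.el .tyc) →
      TmEq Γ f f' (.pi (.el (.trmc a)) (.el (.trmc (b.up 1)))) →
      TmEq Γ (.lamc a b f) (.lamc a' b' f') (.el (.trmc (.arr a b)))
  | appc {Γ : Ctx} {a a' b b' m m' n n' : Tm} :
      HasTm Γ a (.el .tyc) → HasTm Γ b (.el .tyc) →
      TmEq Γ a a' (.el .tyc) → TmEq Γ b b' (.el .tyc) →
      TmEq Γ m m' (.el (.trmc (.arr a b))) → TmEq Γ n n' (.el (.trmc a)) →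
      TmEq Γ (.appc a b m n) (.appc a' b' m' n') (.el (.trmc b))
  | piBeta {Γ : Ctx} {A B : Ty} {t s : Tm} :
      TyWf Γ A → TyWf (.snoc Γ A) B → HasTm (.snoc Γ A) t B → HasTm Γ s A →
      TmEq Γ (.app A B (.lam A t) s) (t.inst s) (B.inst s)
  | piEta {Γ : Ctx} {A B : Ty} {t : Tm} :
      TyWf Γ A → TyWf (.snoc Γ A) B → HasTm Γ t (.pi A B) →
      TmEq Γ t (.lam A (.app (A.up 1) (B.ren (liftRen (· + 1))) (t.up 1) (.var 0))) (.pi A B)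
  | boxBeta {Γ : Ctx} {A : Ty} {t : Tm} {Δ : List Ty} :
      TyWf (.lock Γ) A → HasTm (.lock Γ) t A → Wf ((Ctx.lock Γ).append Δ) →
      TmEq ((Ctx.lock Γ).append Δ) (.unbox (A.up Δ.length) ((Tm.box t).up Δ.length))
        (t.up Δ.length) (A.up Δ.length)
  | boxEta {Γ : Ctx} {A : Ty} {t : Tm} :
      TyWf (.lock Γ) A → HasTm Γ t (.box A) → TmEq Γ t (.box (.unbox A t)) (.box A)
  | topEta {Γ : Ctx} {t : Tm} : HasTm Γ t (.elc .top) → TmEq Γ t .unit (.elc .top)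
  | fstBeta {Γ : Ctx} {φ a t s : Tm} :
      HasTm Γ φ .ctx → HasTm Γ a (.pi (.elc φ) .univ) →
      HasTm Γ t (.elc φ) → HasTm Γ s (.el (apT φ a t)) →
      TmEq Γ (.fst φ a (.pair φ a t s)) t (.elc φ)
  | sndBeta {Γ : Ctx} {φ a t s : Tm} :
      HasTm Γ φ .ctx → HasTm Γ a (.pi (.elc φ) .univ) →
      HasTm Γ t (.elc φ) → HasTm Γ s (.el (apT φ a t)) →
      TmEq Γ (.snd φ a (.pair φ a t s)) s (.el (apT φ a t))
  | pairEta {Γ : Ctx} {φ a t : Tm} :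
      HasTm Γ φ .ctx → HasTm Γ a (.pi (.elc φ) .univ) → HasTm Γ t (.elc (.ext φ a)) →
      TmEq Γ t (.pair φ a (.fst φ a t) (.snd φ a t)) (.elc (.ext φ a))
end

end Fitch

/-! # The interpretation of Cocon in dependent intuitionistic K

Expressions of the domain level are interpreted in the locked context `⟦Γ⟧, 🔒`, as functions of
an instance `u` of the interpreted domain-level context. -/

namespace Cocon

open Fitch (apT piT)

/-- An interpreted domain-level context: the interpretation of its base (empty or a context
variable) and of the types declared on top of it. -/
inductive TCtx : Type
  | base (e : Fitch.Tm) : TCtx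
  | snoc (Θ : TCtx) (a : Fitch.Tm) : TCtx

/-- The element of `Ctx`. -/
def TCtx.code : TCtx → Fitch.Tm
  | .base e => e
  | .snoc Θ a => .ext Θ.code a

/-- `π₁ᵏ e`, one variable below `Θ`. -/
def TCtx.proj : TCtx → ℕ → Fitch.Tm → Fitch.Tm
  | _, 0, e => e
  | .base _, _ + 1, e => e
  | .snoc Θ a, k + 1, e => Θ.proj k (.fst (Θ.code.up 1) (a.up 1) e)

/-- `π₂ (π₁ⁿ e)`, one variable below `Θ`. -/
def TCtx.pick : TCtx → ℕ → Fitch.Tm → Fitch.Tm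
  | .base _, _, e => e
  | .snoc Θ a, 0, e => .snd (Θ.code.up 1) (a.up 1) e
  | .snoc Θ a, n + 1, e => Θ.pick n (.fst (Θ.code.up 1) (a.up 1) e)

/-- `λ u : φ. e`. -/
def abs (φ e : Fitch.Tm) : Fitch.Tm := .lam (.elc φ) e

/-- `m u` for `m : Π u : φ. El (a u)`. -/
def apM (φ a m u : Fitch.Tm) : Fitch.Tm :=
  .app (.elc φ) (.el (apT (φ.up 1) (a.up 1) (.var 0))) m u

/-- `s u` for `s : Π u : φ. ψ`. -/
def apS (φ ψ s u : Fitch.Tm) : Fitch.Tm := .app (.elc φ) (.elc (ψ.up 1)) s u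

/-- `m u` for `m : Π u : φ. ty`. -/
def apTy (φ m u : Fitch.Tm) : Fitch.Tm := .app (.elc φ) (.el .tyc) m u

/-- `m u` for `m : Π u : φ. trm (a u)`. -/
def apTrm (φ a m u : Fitch.Tm) : Fitch.Tm :=
  .app (.elc φ) (.el (.trmc (apTy (φ.up 1) (a.up 1) (.var 0)))) m u

/-- `f u` for `f : Π u : φ. trm (a u) → trm (b u)`. -/
def apFun (φ a b f u : Fitch.Tm) : Fitch.Tm :=
  .app (.elc φ)
    (.pi (.el (.trmc (apTy (φ.up 1) (a.up 1) (.var 0))))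
      (.el (.trmc (apTy (φ.up 2) (b.up 2) (.var 1))))) f u

/-- `m u` for `m : Π u : φ. trm (arr (a u) (b u))`. -/
def apArr (φ a b m u : Fitch.Tm) : Fitch.Tm :=
  .app (.elc φ)
    (.el (.trmc (.arr (apTy (φ.up 1) (a.up 1) (.var 0)) (apTy (φ.up 1) (b.up 1) (.var 0))))) m u

/-- `(u, x)` for `u : φ`, `x : El (a u)`, where `x` and `u` are the two innermost variables. -/
def pairUX (φ a : Fitch.Tm) : Fitch.Tm := .pair (φ.up 2) (a.up 2) (.var 1) (.var 0)

/-- `λ u. Π x : a u. b (u, x)`. -/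
def dPi (φ a b : Fitch.Tm) : Fitch.Tm :=
  abs φ (.pic (apT (φ.up 1) (a.up 1) (.var 0))
    (apT ((Fitch.Tm.ext φ a).up 2) (b.up 2) (pairUX φ a)))

mutual
/-- `⟦Γ; Ψ ⊢ A⟧`. -/
def trDTy : TCtx → DTy → Fitch.Tm
  | Θ, .ty => abs Θ.code .tyc
  | Θ, .trm M => abs Θ.code (.trmc (apTy (Θ.code.up 1) ((trDTm Θ M).up 1) (.var 0)))
  | Θ, .pi A B => dPi Θ.code (trDTy Θ A) (trDTy (Θ.snoc (trDTy Θ A)) B)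

/-- `⟦Γ; Ψ ⊢ M : A⟧`. -/
def trDTm : TCtx → DTm → Fitch.Tm
  | Θ, .var n => abs Θ.code (Θ.pick n (.var 0))
  | Θ, .lam A B M =>
      abs Θ.code
        (.lam (.el (apT (Θ.code.up 1) ((trDTy Θ A).up 1) (.var 0)))
          (apM ((Fitch.Tm.ext Θ.code (trDTy Θ A)).up 2)
            ((trDTy (Θ.snoc (trDTy Θ A)) B).up 2)
            ((trDTm (Θ.snoc (trDTy Θ A)) M).up 2) (pairUX Θ.code (trDTy Θ A))))
  | Θ, .app A B M N =>
      abs Θ.code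
        (.app (.el (apT (Θ.code.up 1) ((trDTy Θ A).up 1) (.var 0)))
          (.el (apT ((Fitch.Tm.ext Θ.code (trDTy Θ A)).up 2)
            ((trDTy (Θ.snoc (trDTy Θ A)) B).up 2) (pairUX Θ.code (trDTy Θ A))))
          (apM (Θ.code.up 1)
            ((dPi Θ.code (trDTy Θ A) (trDTy (Θ.snoc (trDTy Θ A)) B)).up 1)
            ((trDTm Θ M).up 1) (.var 0))
          (apM (Θ.code.up 1) ((trDTy Θ A).up 1) ((trDTm Θ N).up 1) (.var 0)))
  | Θ, .unbox Φ A t σ =>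
      abs Θ.code
        (apM ((trDCtx Φ).code.up 1) ((trDTy (trDCtx Φ) A).up 1)
          (.unbox ((piT (trDCtx Φ).code (trDTy (trDCtx Φ) A)).up 1) ((trCTm t).up 1))
          (apS (Θ.code.up 1) ((trDCtx Φ).code.up 1) ((trDSub Θ (trDCtx Φ) σ).up 1) (.var 0)))
  | Θ, .o => abs Θ.code .o
  | Θ, .arr a b =>
      abs Θ.code (.arr (apTy (Θ.code.up 1) ((trDTm Θ a).up 1) (.var 0))
        (apTy (Θ.code.up 1) ((trDTm Θ b).up 1) (.var 0)))
  | Θ, .lamc a b f =>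
      abs Θ.code (.lamc (apTy (Θ.code.up 1) ((trDTm Θ a).up 1) (.var 0))
        (apTy (Θ.code.up 1) ((trDTm Θ b).up 1) (.var 0))
        (apFun (Θ.code.up 1) ((trDTm Θ a).up 1) ((trDTm Θ b).up 1) ((trDTm Θ f).up 1) (.var 0)))
  | Θ, .appc a b m n =>
      abs Θ.code (.appc (apTy (Θ.code.up 1) ((trDTm Θ a).up 1) (.var 0))
        (apTy (Θ.code.up 1) ((trDTm Θ b).up 1) (.var 0))
        (apArr (Θ.code.up 1) ((trDTm Θ a).up 1) ((trDTm Θ b).up 1) ((trDTm Θ m).up 1) (.var 0))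
        (apTrm (Θ.code.up 1) ((trDTm Θ a).up 1) ((trDTm Θ n).up 1) (.var 0)))

/-- `⟦Γ; Ψ ⊢ σ : Φ⟧`, given the interpretations of `Ψ` and `Φ`. -/
def trDSub : TCtx → TCtx → DSub → Fitch.Tm
  | Θ, _, .nil => abs Θ.code .unit
  | Θ, _, .wk k => abs Θ.code (Θ.proj k (.var 0))
  | Θ, .base _, .cons _ _ => abs Θ.code .unit
  | Θ, .snoc Ξ a, .cons σ M =>
      abs Θ.code
        (.pair (Ξ.code.up 1) (a.up 1)
          (apS (Θ.code.up 1) (Ξ.code.up 1) ((trDSub Θ Ξ σ).up 1) (.var 0))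
          (.app (.elc (Θ.code.up 1))
            (.el (apT (Ξ.code.up 2) (a.up 2)
              (apS (Θ.code.up 2) (Ξ.code.up 2) ((trDSub Θ Ξ σ).up 2) (.var 0))))
            ((trDTm Θ M).up 1) (.var 0)))

/-- `⟦Γ ⊢ Ψ : ctx⟧`. -/
def trDCtx : DCtx → TCtx
  | .nil => .base .top
  | .var y => .base (.unbox .ctx (.var y))
  | .snoc Ψ A => .snoc (trDCtx Ψ) (trDTy (trDCtx Ψ) A)

/-- `⟦Γ ⊢ T⟧` for contextual types. -/
def trCxTy : CxTy → Fitch.Ty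
  | .tm Ψ A => piT (trDCtx Ψ).code (trDTy (trDCtx Ψ) A)
  | .vr Ψ A => piT (trDCtx Ψ).code (trDTy (trDCtx Ψ) A)

/-- `⟦Γ ⊢ C : T⟧` for contextual objects. -/
def trCxObj : CxObj → Fitch.Tm
  | .mk Ψ M => trDTm (trDCtx Ψ) M

/-- `⟦Γ ⊢ τ⟧`. -/
def trCTy : CTy → Fitch.Ty
  | .box T => .box (trCxTy T)
  | .pi τ₁ τ₂ => .pi (trCTy τ₁) (trCTy τ₂)
  | .ctx => .box .ctx

/-- `⟦Γ ⊢ t : τ⟧`.  A domain-level context used as an argument is boxed, since `ctx` is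
interpreted as `□ Ctx`. -/
def trCTm : CTm → Fitch.Tm
  | .var y => .var y
  | .box C => .box (trCxObj C)
  | .fn τ t => .lam (trCTy τ) (trCTm t)
  | .app τ₁ τ₂ t s => .app (trCTy τ₁) (trCTy τ₂) (trCTm t) (trCTm s)
  | .ctx Ψ => .box (trDCtx Ψ).code
end

/-- `⟦Γ⟧`. -/
def trCtx : Ctx → Fitch.Ctx
  | [] => .nil
  | τ :: Γ => .snoc (trCtx Γ) (trCTy τ)

end Cocon

/-! # Categories with families with a dependent right adjoint -/

universe u v w

/-- Categories with families.  Equations between terms of provably equal types are stated by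
heterogeneous equality. -/
structure CwF (C : Type u) [Category.{v} C] where
  /-- the empty context -/
  empty : C
  emptyIsTerminal : Limits.IsTerminal empty
  Ty : C → Type w
  tySub : {Δ Γ : C} → (Δ ⟶ Γ) → Ty Γ → Ty Δ
  tySub_id : ∀ {Γ : C} (A : Ty Γ), tySub (𝟙 Γ) A = A
  tySub_comp : ∀ {Θ Δ Γ : C} (δ : Θ ⟶ Δ) (σ : Δ ⟶ Γ) (A : Ty Γ),
    tySub (δ ≫ σ) A = tySub δ (tySub σ A)
  Tm : (Γ : C) → Ty Γ → Type w
  tmSub : {Δ Γ : C} → (σ : Δ ⟶ Γ) → {A : Ty Γ} → Tm Γ A → Tm Δ (tySub σ A)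
  tmSub_id : ∀ {Γ : C} {A : Ty Γ} (t : Tm Γ A), HEq (tmSub (𝟙 Γ) t) t
  tmSub_comp : ∀ {Θ Δ Γ : C} (δ : Θ ⟶ Δ) (σ : Δ ⟶ Γ) {A : Ty Γ} (t : Tm Γ A),
    HEq (tmSub (δ ≫ σ) t) (tmSub δ (tmSub σ t))
  /-- context comprehension `Γ.A` -/
  ext : (Γ : C) → Ty Γ → C
  p : {Γ : C} → (A : Ty Γ) → (ext Γ A ⟶ Γ)
  q : {Γ : C} → (A : Ty Γ) → Tm (ext Γ A) (tySub (p A) A)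
  /-- `⟨σ, t⟩` -/
  pair : {Δ Γ : C} → (σ : Δ ⟶ Γ) → {A : Ty Γ} → Tm Δ (tySub σ A) → (Δ ⟶ ext Γ A)
  pair_p : ∀ {Δ Γ : C} (σ : Δ ⟶ Γ) {A : Ty Γ} (t : Tm Δ (tySub σ A)), pair σ t ≫ p A = σ
  pair_q : ∀ {Δ Γ : C} (σ : Δ ⟶ Γ) {A : Ty Γ} (t : Tm Δ (tySub σ A)),
    HEq (tmSub (pair σ t) (q A)) t
  pair_eta : ∀ {Δ Γ : C} {A : Ty Γ} (τ : Δ ⟶ ext Γ A) (t : Tm Δ (tySub (τ ≫ p A) A)),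
    HEq t (tmSub τ (q A)) → pair (τ ≫ p A) t = τ

namespace CwF

variable {C : Type u} [Category.{v} C] (M : CwF.{u, v, w} C)

/-- Transport of a term along an equation between types. -/
def cast {Γ : C} {A B : M.Ty Γ} (h : A = B) (t : M.Tm Γ A) : M.Tm Γ B := h ▸ t

/-- `⟨id, t⟩`. -/
def inst {Γ : C} {A : M.Ty Γ} (t : M.Tm Γ A) : Γ ⟶ M.ext Γ A :=
  M.pair (𝟙 Γ) (M.cast (M.tySub_id A).symm t)

/-- `⟨σ ∘ p, q⟩`. -/
def lift {Δ Γ : C} (σ : Δ ⟶ Γ) (A : M.Ty Γ) : M.ext Δ (M.tySub σ A) ⟶ M.ext Γ A :=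
  M.pair (M.p (M.tySub σ A) ≫ σ) (M.cast (M.tySub_comp _ σ A).symm (M.q (M.tySub σ A)))

end CwF

/-- Categories with families with a dependent right adjoint. -/
structure CwFDRA (C : Type u) [Category.{v} C] extends CwF.{u, v, w} C where
  L : C ⥤ C
  R : {Γ : C} → Ty (L.obj Γ) → Ty Γ
  R_sub : ∀ {Δ Γ : C} (σ : Δ ⟶ Γ) (A : Ty (L.obj Γ)), tySub σ (R A) = R (tySub (L.map σ) A)
  transpose : {Γ : C} → {A : Ty (L.obj Γ)} → Tm (L.obj Γ) A ≃ Tm Γ (R A)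
  transpose_sub : ∀ {Δ Γ : C} (σ : Δ ⟶ Γ) {A : Ty (L.obj Γ)} (t : Tm (L.obj Γ) A),
    HEq (tmSub σ (transpose t)) (transpose (tmSub (L.map σ) t))

/-- Categories with families with a dependent right adjoint and with the type formers of
dependent intuitionistic K: `Π`-types, the universe `Type`, and the universe `Ctx`.  Stability
under substitution of an operation `F` is stated as `F(x){σ} = F(x')` for all `x'` equal
to `x{σ}`. -/
structure FitchModel (C : Type u) [Category.{v} C] extends CwFDRA.{u, v, w} C where
  Pi : {Γ : C} → (A : Ty Γ) → Ty (ext Γ A) → Ty Γ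
  Pi_sub : ∀ {Δ Γ : C} (σ : Δ ⟶ Γ) (A : Ty Γ) (B : Ty (ext Γ A)),
    tySub σ (Pi A B) = Pi (tySub σ A) (tySub (toCwF.lift σ A) B)
  lam : {Γ : C} → {A : Ty Γ} → {B : Ty (ext Γ A)} → Tm (ext Γ A) B → Tm Γ (Pi A B)
  lam_sub : ∀ {Δ Γ : C} (σ : Δ ⟶ Γ) {A : Ty Γ} {B : Ty (ext Γ A)} (t : Tm (ext Γ A) B),
    HEq (tmSub σ (lam t)) (lam (tmSub (toCwF.lift σ A) t))
  app : {Γ : C} → {A : Ty Γ} → {B : Ty (ext Γ A)} → Tm Γ (Pi A B) → (s : Tm Γ A) →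
    Tm Γ (tySub (toCwF.inst s) B)
  app_sub : ∀ {Δ Γ : C} (σ : Δ ⟶ Γ) {A : Ty Γ} {B : Ty (ext Γ A)} (t : Tm Γ (Pi A B))
    (s : Tm Γ A) (t' : Tm Δ (Pi (tySub σ A) (tySub (toCwF.lift σ A) B))),
    HEq t' (tmSub σ t) → HEq (tmSub σ (app t s)) (app t' (tmSub σ s))
  Pi_beta : ∀ {Γ : C} {A : Ty Γ} {B : Ty (ext Γ A)} (t : Tm (ext Γ A) B) (s : Tm Γ A),
    app (lam t) s = tmSub (toCwF.inst s) t
  Pi_eta : ∀ {Γ : C} {A : Ty Γ} {B : Ty (ext Γ A)} (t : Tm Γ (Pi A B))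
    (t' : Tm (ext Γ A) (Pi (tySub (p A) A) (tySub (toCwF.lift (p A) A) B))),
    HEq t' (tmSub (p A) t) → HEq (lam (app t' (q A))) t
  /-- the universe `Type` -/
  U : (Γ : C) → Ty Γ
  U_sub : ∀ {Δ Γ : C} (σ : Δ ⟶ Γ), tySub σ (U Γ) = U Δ
  El : {Γ : C} → Tm Γ (U Γ) → Ty Γ
  El_sub : ∀ {Δ Γ : C} (σ : Δ ⟶ Γ) (a : Tm Γ (U Γ)) (a' : Tm Δ (U Δ)),
    HEq a' (tmSub σ a) → tySub σ (El a) = El a'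
  piC : {Γ : C} → (a : Tm Γ (U Γ)) → Tm (ext Γ (El a)) (U (ext Γ (El a))) → Tm Γ (U Γ)
  piC_sub : ∀ {Δ Γ : C} (σ : Δ ⟶ Γ) (a : Tm Γ (U Γ))
    (b : Tm (ext Γ (El a)) (U (ext Γ (El a)))) (a' : Tm Δ (U Δ))
    (b' : Tm (ext Δ (El a')) (U (ext Δ (El a')))),
    HEq a' (tmSub σ a) → HEq b' (tmSub (toCwF.lift σ (El a)) b) →
    HEq (tmSub σ (piC a b)) (piC a' b')
  El_piC : ∀ {Γ : C} (a : Tm Γ (U Γ)) (b : Tm (ext Γ (El a)) (U (ext Γ (El a)))),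
    El (piC a b) = Pi (El a) (El b)
  tyC : (Γ : C) → Tm Γ (U Γ)
  tyC_sub : ∀ {Δ Γ : C} (σ : Δ ⟶ Γ), HEq (tmSub σ (tyC Γ)) (tyC Δ)
  trmC : {Γ : C} → Tm Γ (El (tyC Γ)) → Tm Γ (U Γ)
  trmC_sub : ∀ {Δ Γ : C} (σ : Δ ⟶ Γ) (m : Tm Γ (El (tyC Γ))) (m' : Tm Δ (El (tyC Δ))),
    HEq m' (tmSub σ m) → HEq (tmSub σ (trmC m)) (trmC m')
  o : (Γ : C) → Tm Γ (El (tyC Γ))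
  o_sub : ∀ {Δ Γ : C} (σ : Δ ⟶ Γ), HEq (tmSub σ (o Γ)) (o Δ)
  arr : {Γ : C} → Tm Γ (El (tyC Γ)) → Tm Γ (El (tyC Γ)) → Tm Γ (El (tyC Γ))
  arr_sub : ∀ {Δ Γ : C} (σ : Δ ⟶ Γ) (a b : Tm Γ (El (tyC Γ))) (a' b' : Tm Δ (El (tyC Δ))),
    HEq a' (tmSub σ a) → HEq b' (tmSub σ b) → HEq (tmSub σ (arr a b)) (arr a' b')
  lamC : {Γ : C} → (a b : Tm Γ (El (tyC Γ))) →
    Tm Γ (Pi (El (trmC a)) (tySub (p (El (trmC a))) (El (trmC b)))) →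
    Tm Γ (El (trmC (arr a b)))
  lamC_sub : ∀ {Δ Γ : C} (σ : Δ ⟶ Γ) (a b : Tm Γ (El (tyC Γ)))
    (f : Tm Γ (Pi (El (trmC a)) (tySub (p (El (trmC a))) (El (trmC b)))))
    (a' b' : Tm Δ (El (tyC Δ)))
    (f' : Tm Δ (Pi (El (trmC a')) (tySub (p (El (trmC a'))) (El (trmC b'))))),
    HEq a' (tmSub σ a) → HEq b' (tmSub σ b) → HEq f' (tmSub σ f) →
    HEq (tmSub σ (lamC a b f)) (lamC a' b' f')
  appC : {Γ : C} → (a b : Tm Γ (El (tyC Γ))) → Tm Γ (El (trmC (arr a b))) →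
    Tm Γ (El (trmC a)) → Tm Γ (El (trmC b))
  appC_sub : ∀ {Δ Γ : C} (σ : Δ ⟶ Γ) (a b : Tm Γ (El (tyC Γ)))
    (m : Tm Γ (El (trmC (arr a b)))) (n : Tm Γ (El (trmC a))) (a' b' : Tm Δ (El (tyC Δ)))
    (m' : Tm Δ (El (trmC (arr a' b')))) (n' : Tm Δ (El (trmC a'))),
    HEq a' (tmSub σ a) → HEq b' (tmSub σ b) → HEq m' (tmSub σ m) → HEq n' (tmSub σ n) →
    HEq (tmSub σ (appC a b m n)) (appC a' b' m' n')
  /-- the universe `Ctx` -/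
  Ctx : (Γ : C) → Ty Γ
  Ctx_sub : ∀ {Δ Γ : C} (σ : Δ ⟶ Γ), tySub σ (Ctx Γ) = Ctx Δ
  Elc : {Γ : C} → Tm Γ (Ctx Γ) → Ty Γ
  Elc_sub : ∀ {Δ Γ : C} (σ : Δ ⟶ Γ) (φ : Tm Γ (Ctx Γ)) (φ' : Tm Δ (Ctx Δ)),
    HEq φ' (tmSub σ φ) → tySub σ (Elc φ) = Elc φ'
  top : (Γ : C) → Tm Γ (Ctx Γ)
  top_sub : ∀ {Δ Γ : C} (σ : Δ ⟶ Γ), HEq (tmSub σ (top Γ)) (top Δ)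
  unit : (Γ : C) → Tm Γ (Elc (top Γ))
  unit_eta : ∀ {Γ : C} (t : Tm Γ (Elc (top Γ))), t = unit Γ
  cext : {Γ : C} → (φ : Tm Γ (Ctx Γ)) → Tm Γ (Pi (Elc φ) (U (ext Γ (Elc φ)))) → Tm Γ (Ctx Γ)
  cext_sub : ∀ {Δ Γ : C} (σ : Δ ⟶ Γ) (φ : Tm Γ (Ctx Γ))
    (a : Tm Γ (Pi (Elc φ) (U (ext Γ (Elc φ))))) (φ' : Tm Δ (Ctx Δ))
    (a' : Tm Δ (Pi (Elc φ') (U (ext Δ (Elc φ'))))),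
    HEq φ' (tmSub σ φ) → HEq a' (tmSub σ a) → HEq (tmSub σ (cext φ a)) (cext φ' a')
  cpair : {Γ : C} → (φ : Tm Γ (Ctx Γ)) → (a : Tm Γ (Pi (Elc φ) (U (ext Γ (Elc φ))))) →
    (t : Tm Γ (Elc φ)) → Tm Γ (El (toCwF.cast (U_sub (toCwF.inst t)) (app a t))) →
    Tm Γ (Elc (cext φ a))
  cfst : {Γ : C} → (φ : Tm Γ (Ctx Γ)) → (a : Tm Γ (Pi (Elc φ) (U (ext Γ (Elc φ))))) →
    Tm Γ (Elc (cext φ a)) → Tm Γ (Elc φ)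
  csnd : {Γ : C} → (φ : Tm Γ (Ctx Γ)) → (a : Tm Γ (Pi (Elc φ) (U (ext Γ (Elc φ))))) →
    (t : Tm Γ (Elc (cext φ a))) →
    Tm Γ (El (toCwF.cast (U_sub (toCwF.inst (cfst φ a t))) (app a (cfst φ a t))))
  cpair_sub : ∀ {Δ Γ : C} (σ : Δ ⟶ Γ) (φ : Tm Γ (Ctx Γ))
    (a : Tm Γ (Pi (Elc φ) (U (ext Γ (Elc φ))))) (t : Tm Γ (Elc φ))
    (s : Tm Γ (El (toCwF.cast (U_sub (toCwF.inst t)) (app a t)))) (φ' : Tm Δ (Ctx Δ))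
    (a' : Tm Δ (Pi (Elc φ') (U (ext Δ (Elc φ'))))) (t' : Tm Δ (Elc φ'))
    (s' : Tm Δ (El (toCwF.cast (U_sub (toCwF.inst t')) (app a' t')))),
    HEq φ' (tmSub σ φ) → HEq a' (tmSub σ a) → HEq t' (tmSub σ t) → HEq s' (tmSub σ s) →
    HEq (tmSub σ (cpair φ a t s)) (cpair φ' a' t' s')
  cfst_pair : ∀ {Γ : C} (φ : Tm Γ (Ctx Γ)) (a : Tm Γ (Pi (Elc φ) (U (ext Γ (Elc φ)))))
    (t : Tm Γ (Elc φ)) (s : Tm Γ (El (toCwF.cast (U_sub (toCwF.inst t)) (app a t)))),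
    cfst φ a (cpair φ a t s) = t
  csnd_pair : ∀ {Γ : C} (φ : Tm Γ (Ctx Γ)) (a : Tm Γ (Pi (Elc φ) (U (ext Γ (Elc φ)))))
    (t : Tm Γ (Elc φ)) (s : Tm Γ (El (toCwF.cast (U_sub (toCwF.inst t)) (app a t)))),
    HEq (csnd φ a (cpair φ a t s)) s
  cpair_eta : ∀ {Γ : C} (φ : Tm Γ (Ctx Γ)) (a : Tm Γ (Pi (Elc φ) (U (ext Γ (Elc φ)))))
    (t : Tm Γ (Elc (cext φ a))), cpair φ a (cfst φ a t) (csnd φ a t) = t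

namespace FitchModel

variable {C : Type u} [Category.{v} C] (M : FitchModel.{u, v, w} C)

/-- Interpreted contexts of K.  A declaration records the object over which its type lives. -/
inductive Env : Type (max u w)
  | nil : Env
  | snoc (S : Env) (G : C) (a : M.Ty G) : Env
  | lock (S : Env) : Env

variable {M}

/-- The object that interprets the context. -/
def Env.obj : Env M → C
  | .nil => M.empty
  | .snoc _ G a => M.ext G a
  | .lock S => M.L.obj S.obj

/-- Extension of an interpreted context by a type over it. -/
def Env.push (S : Env M) (a : M.Ty S.obj) : Env M := .snoc S S.obj a

/-- `Wk S k S' π`: the environment `S` extends `S'` by `k` declarations and no lock, and `π` is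
the projection. -/
inductive Wk : (S : Env M) → ℕ → (S' : Env M) → (S.obj ⟶ S'.obj) → Prop
  | zero {S : Env M} : Wk S 0 S (𝟙 S.obj)
  | succ {S S' : Env M} {k : ℕ} {π : S.obj ⟶ S'.obj} (a : M.Ty S.obj) :
      Wk S k S' π → Wk (S.push a) (k + 1) S' (M.p a ≫ π)

mutual
/-- The type `A` of K denotes the semantic type `a` in the environment `S`. -/
inductive DenTy : (S : Env M) → Fitch.Ty → M.Ty S.obj → Prop
  | pi {S : Env M} {A B : Fitch.Ty} {a : M.Ty S.obj} {b : M.Ty (S.push a).obj} :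
      DenTy S A a → DenTy (S.push a) B b → DenTy S (.pi A B) (M.Pi a b)
  | box {S : Env M} {A : Fitch.Ty} {a : M.Ty S.lock.obj} :
      DenTy S.lock A a → DenTy S (.box A) (M.R a)
  | univ {S : Env M} : DenTy S .univ (M.U S.obj)
  | ctx {S : Env M} : DenTy S .ctx (M.Ctx S.obj)
  | el {S : Env M} {t : Fitch.Tm} {a : M.Tm S.obj (M.U S.obj)} :
      DenTm S t (M.U S.obj) a → DenTy S (.el t) (M.El a)
  | elc {S : Env M} {t : Fitch.Tm} {φ : M.Tm S.obj (M.Ctx S.obj)} :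
      DenTm S t (M.Ctx S.obj) φ → DenTy S (.elc t) (M.Elc φ)

/-- The term `t` of K denotes the semantic term `m` of semantic type `a` in the
environment `S`. -/
inductive DenTm : (S : Env M) → Fitch.Tm → (a : M.Ty S.obj) → M.Tm S.obj a → Prop
  | var {S S' : Env M} {k : ℕ} {a : M.Ty S'.obj} {π : S.obj ⟶ (S'.push a).obj} :
      Wk S k (S'.push a) π →
      DenTm S (.var k) (M.tySub π (M.tySub (M.p a) a)) (M.tmSub π (M.q a))
  | lam {S : Env M} {A : Fitch.Ty} {t : Fitch.Tm} {a : M.Ty S.obj} {b : M.Ty (S.push a).obj}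
      {m : M.Tm (S.push a).obj b} :
      DenTy S A a → DenTm (S.push a) t b m → DenTm S (.lam A t) (M.Pi a b) (M.lam m)
  | app {S : Env M} {A B : Fitch.Ty} {t s : Fitch.Tm} {a : M.Ty S.obj}
      {b : M.Ty (S.push a).obj} {m : M.Tm S.obj (M.Pi a b)} {n : M.Tm S.obj a} :
      DenTy S A a → DenTy (S.push a) B b → DenTm S t (M.Pi a b) m → DenTm S s a n →
      DenTm S (.app A B t s) (M.tySub (M.inst n) b) (M.app m n)
  | box {S : Env M} {t : Fitch.Tm} {a : M.Ty S.lock.obj} {m : M.Tm S.lock.obj a} :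
      DenTm S.lock t a m → DenTm S (.box t) (M.R a) (M.transpose m)
  | unbox {S S' : Env M} {k : ℕ} {π : S.obj ⟶ S'.lock.obj} {A : Fitch.Ty} {t : Fitch.Tm}
      {a : M.Ty S'.lock.obj} {m : M.Tm S'.obj (M.R a)} :
      Wk S k S'.lock π → DenTy S'.lock A a → DenTm S' t (M.R a) m →
      DenTm S (.unbox (A.up k) (t.up k)) (M.tySub π a) (M.tmSub π (M.transpose.symm m))
  | pic {S : Env M} {t s : Fitch.Tm} {a : M.Tm S.obj (M.U S.obj)}
      {b : M.Tm (S.push (M.El a)).obj (M.U (S.push (M.El a)).obj)} :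
      DenTm S t (M.U S.obj) a →
      DenTm (S.push (M.El a)) s (M.U (S.push (M.El a)).obj) b →
      DenTm S (.pic t s) (M.U S.obj) (M.piC a b)
  | tyc {S : Env M} : DenTm S .tyc (M.U S.obj) (M.tyC S.obj)
  | trmc {S : Env M} {t : Fitch.Tm} {m : M.Tm S.obj (M.El (M.tyC S.obj))} :
      DenTm S t (M.El (M.tyC S.obj)) m → DenTm S (.trmc t) (M.U S.obj) (M.trmC m)
  | top {S : Env M} : DenTm S .top (M.Ctx S.obj) (M.top S.obj)
  | ext {S : Env M} {t s : Fitch.Tm} {φ : M.Tm S.obj (M.Ctx S.obj)}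
      {a : M.Tm S.obj (M.Pi (M.Elc φ) (M.U (M.ext S.obj (M.Elc φ))))} :
      DenTm S t (M.Ctx S.obj) φ → DenTm S s (M.Pi (M.Elc φ) (M.U _)) a →
      DenTm S (.ext t s) (M.Ctx S.obj) (M.cext φ a)
  | unit {S : Env M} : DenTm S .unit (M.Elc (M.top S.obj)) (M.unit S.obj)
  | pair {S : Env M} {e f t s : Fitch.Tm} {φ : M.Tm S.obj (M.Ctx S.obj)}
      {a : M.Tm S.obj (M.Pi (M.Elc φ) (M.U (M.ext S.obj (M.Elc φ))))}
      {m : M.Tm S.obj (M.Elc φ)}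
      {n : M.Tm S.obj (M.El (M.cast (M.U_sub (M.inst m)) (M.app a m)))} :
      DenTm S e (M.Ctx S.obj) φ → DenTm S f (M.Pi (M.Elc φ) (M.U _)) a →
      DenTm S t (M.Elc φ) m →
      DenTm S s (M.El (M.cast (M.U_sub (M.inst m)) (M.app a m))) n →
      DenTm S (.pair e f t s) (M.Elc (M.cext φ a)) (M.cpair φ a m n)
  | fst {S : Env M} {e f t : Fitch.Tm} {φ : M.Tm S.obj (M.Ctx S.obj)}
      {a : M.Tm S.obj (M.Pi (M.Elc φ) (M.U (M.ext S.obj (M.Elc φ))))}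
      {m : M.Tm S.obj (M.Elc (M.cext φ a))} :
      DenTm S e (M.Ctx S.obj) φ → DenTm S f (M.Pi (M.Elc φ) (M.U _)) a →
      DenTm S t (M.Elc (M.cext φ a)) m →
      DenTm S (.fst e f t) (M.Elc φ) (M.cfst φ a m)
  | snd {S : Env M} {e f t : Fitch.Tm} {φ : M.Tm S.obj (M.Ctx S.obj)}
      {a : M.Tm S.obj (M.Pi (M.Elc φ) (M.U (M.ext S.obj (M.Elc φ))))}
      {m : M.Tm S.obj (M.Elc (M.cext φ a))} :
      DenTm S e (M.Ctx S.obj) φ → DenTm S f (M.Pi (M.Elc φ) (M.U _)) a →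
      DenTm S t (M.Elc (M.cext φ a)) m →
      DenTm S (.snd e f t)
        (M.El (M.cast (M.U_sub (M.inst (M.cfst φ a m))) (M.app a (M.cfst φ a m))))
        (M.csnd φ a m)
  | o {S : Env M} : DenTm S .o (M.El (M.tyC S.obj)) (M.o S.obj)
  | arr {S : Env M} {t s : Fitch.Tm} {a b : M.Tm S.obj (M.El (M.tyC S.obj))} :
      DenTm S t (M.El (M.tyC S.obj)) a → DenTm S s (M.El (M.tyC S.obj)) b →
      DenTm S (.arr t s) (M.El (M.tyC S.obj)) (M.arr a b)
  | lamc {S : Env M} {t s r : Fitch.Tm} {a b : M.Tm S.obj (M.El (M.tyC S.obj))}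
      {f : M.Tm S.obj (M.Pi (M.El (M.trmC a)) (M.tySub (M.p (M.El (M.trmC a)))
        (M.El (M.trmC b))))} :
      DenTm S t (M.El (M.tyC S.obj)) a → DenTm S s (M.El (M.tyC S.obj)) b →
      DenTm S r _ f → DenTm S (.lamc t s r) (M.El (M.trmC (M.arr a b))) (M.lamC a b f)
  | appc {S : Env M} {t s r r' : Fitch.Tm} {a b : M.Tm S.obj (M.El (M.tyC S.obj))}
      {m : M.Tm S.obj (M.El (M.trmC (M.arr a b)))} {n : M.Tm S.obj (M.El (M.trmC a))} :
      DenTm S t (M.El (M.tyC S.obj)) a → DenTm S s (M.El (M.tyC S.obj)) b →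
      DenTm S r (M.El (M.trmC (M.arr a b))) m → DenTm S r' (M.El (M.trmC a)) n →
      DenTm S (.appc t s r r') (M.El (M.trmC b)) (M.appC a b m n)
end

/-- The context `Γ` of K denotes the environment `S`. -/
inductive DenCtx : Fitch.Ctx → Env M → Prop
  | nil : DenCtx .nil .nil
  | snoc {Γ : Fitch.Ctx} {A : Fitch.Ty} {S : Env M} {a : M.Ty S.obj} :
      DenCtx Γ S → DenTy S A a → DenCtx (.snoc Γ A) (S.push a)
  | lock {Γ : Fitch.Ctx} {S : Env M} : DenCtx Γ S → DenCtx (.lock Γ) S.lock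

/-- The type `A` has exactly one denotation in `S`. -/
def TypeDefined (S : Env M) (A : Fitch.Ty) : Prop := ∃! a : M.Ty S.obj, DenTy S A a

/-- The term `t` has exactly one denotation in `S`, and it is a semantic term of the semantic
type denoted by `A`. -/
def TermDefined (S : Env M) (t : Fitch.Tm) (A : Fitch.Ty) : Prop :=
  ∃ a : M.Ty S.obj, DenTy S A a ∧ ∃ m : M.Tm S.obj a, DenTm S t a m ∧
    ∀ (a' : M.Ty S.obj) (m' : M.Tm S.obj a'), DenTm S t a' m' → a' = a ∧ HEq m' m

/-- The types `A` and `A'` denote the same semantic type. -/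
def TypeEqual (S : Env M) (A A' : Fitch.Ty) : Prop :=
  ∃ a : M.Ty S.obj, DenTy S A a ∧ DenTy S A' a

/-- The terms `t` and `t'` denote the same semantic term of the semantic type denoted by `A`. -/
def TermEqual (S : Env M) (t t' : Fitch.Tm) (A : Fitch.Ty) : Prop :=
  ∃ a : M.Ty S.obj, DenTy S A a ∧ ∃ m : M.Tm S.obj a, DenTm S t a m ∧ DenTm S t' a m

end FitchModel

namespace Fitch

theorem liftSub_var (ρ : ℕ → ℕ) :
    liftSub (fun n => .var (ρ n)) = fun n => .var (liftRen ρ n) := by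
  funext n; cases n <;> simp [liftSub, liftRen, Tm.up, Tm.ren]

mutual
theorem Ty.ren_eq_sub (A : Ty) (ρ : ℕ → ℕ) : A.ren ρ = A.sub (fun n => .var (ρ n)) := by
  cases A <;> simp only [Ty.ren, Ty.sub, liftSub_var] <;> simp only [Ty.ren_eq_sub, Tm.ren_eq_sub]
theorem Tm.ren_eq_sub (t : Tm) (ρ : ℕ → ℕ) : t.ren ρ = t.sub (fun n => .var (ρ n)) := by
  cases t <;> simp only [Tm.ren, Tm.sub, liftSub_var] <;> simp only [Ty.ren_eq_sub, Tm.ren_eq_sub]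
end

theorem liftSub_liftRen (θ : ℕ → Tm) (ρ : ℕ → ℕ) :
    liftSub (fun n => θ (ρ n)) = fun n => liftSub θ (liftRen ρ n) := by
  funext n; cases n <;> simp [liftSub, liftRen]

mutual
theorem Ty.sub_ren (A : Ty) (ρ : ℕ → ℕ) (θ : ℕ → Tm) :
    (A.ren ρ).sub θ = A.sub (fun n => θ (ρ n)) := by
  cases A <;> simp only [Ty.ren, Ty.sub, liftSub_liftRen] <;> simp only [Ty.sub_ren, Tm.sub_ren]
theorem Tm.sub_ren (t : Tm) (ρ : ℕ → ℕ) (θ : ℕ → Tm) :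
    (t.ren ρ).sub θ = t.sub (fun n => θ (ρ n)) := by
  cases t <;> simp only [Tm.ren, Tm.sub, liftSub_liftRen] <;> simp only [Ty.sub_ren, Tm.sub_ren]
end

theorem Ty.ren_ren (A : Ty) (ρ ρ' : ℕ → ℕ) : (A.ren ρ).ren ρ' = A.ren (fun n => ρ' (ρ n)) := by
  rw [Ty.ren_eq_sub _ ρ', Ty.sub_ren, ← Ty.ren_eq_sub]
theorem Tm.ren_ren (t : Tm) (ρ ρ' : ℕ → ℕ) : (t.ren ρ).ren ρ' = t.ren (fun n => ρ' (ρ n)) := by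
  rw [Tm.ren_eq_sub _ ρ', Tm.sub_ren, ← Tm.ren_eq_sub]

theorem liftSub_ren (θ : ℕ → Tm) (ρ : ℕ → ℕ) :
    liftSub (fun n => (θ n).ren ρ) = fun n => (liftSub θ n).ren (liftRen ρ) := by
  funext n; cases n <;> simp [liftSub, liftRen, Tm.up, Tm.ren_ren, Tm.ren]

mutual
theorem Ty.ren_sub (A : Ty) (θ : ℕ → Tm) (ρ : ℕ → ℕ) :
    (A.sub θ).ren ρ = A.sub (fun n => (θ n).ren ρ) := by
  cases A <;> simp only [Ty.ren, Ty.sub, liftSub_ren] <;> simp only [Ty.ren_sub, Tm.ren_sub]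
theorem Tm.ren_sub (t : Tm) (θ : ℕ → Tm) (ρ : ℕ → ℕ) :
    (t.sub θ).ren ρ = t.sub (fun n => (θ n).ren ρ) := by
  cases t <;> simp only [Tm.ren, Tm.sub, liftSub_ren] <;> simp only [Ty.ren_sub, Tm.ren_sub]
end

theorem liftSub_sub (θ θ' : ℕ → Tm) :
    liftSub (fun n => (θ n).sub θ') = fun n => (liftSub θ n).sub (liftSub θ') := by
  funext n; cases n <;> simp [liftSub, Tm.up, Tm.ren_sub, Tm.sub_ren, Tm.sub]

mutual
theorem Ty.sub_sub (A : Ty) (θ θ' : ℕ → Tm) :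
    (A.sub θ).sub θ' = A.sub (fun n => (θ n).sub θ') := by
  cases A <;> simp only [Ty.sub, liftSub_sub] <;> simp only [Ty.sub_sub, Tm.sub_sub]
theorem Tm.sub_sub (t : Tm) (θ θ' : ℕ → Tm) :
    (t.sub θ).sub θ' = t.sub (fun n => (θ n).sub θ') := by
  cases t <;> simp only [Tm.sub, liftSub_sub] <;> simp only [Ty.sub_sub, Tm.sub_sub]
end

theorem liftSub_id : liftSub Tm.var = Tm.var := by
  funext n; cases n <;> simp [liftSub, Tm.up, Tm.ren]

mutual
theorem Ty.sub_id (A : Ty) : A.sub Tm.var = A := by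
  cases A <;> simp only [Ty.sub, liftSub_id] <;> simp only [Ty.sub_id, Tm.sub_id]
theorem Tm.sub_id (t : Tm) : t.sub Tm.var = t := by
  cases t <;> simp only [Tm.sub, liftSub_id] <;> simp only [Ty.sub_id, Tm.sub_id]
end

theorem Ty.up_zero (A : Ty) : A.up 0 = A := by
  rw [Ty.up, Ty.ren_eq_sub]; exact A.sub_id
theorem Tm.up_zero (t : Tm) : t.up 0 = t := by
  rw [Tm.up, Tm.ren_eq_sub]; exact t.sub_id

theorem Tm.up_up (t : Tm) (j k : ℕ) : (t.up j).up k = t.up (j + k) := by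
  simp [Tm.up, Tm.ren_ren, Nat.add_assoc]

theorem Ty.sub_up (A : Ty) (k : ℕ) (θ : ℕ → Tm) : (A.up k).sub θ = A.sub (fun n => θ (n + k)) :=
  A.sub_ren _ _
theorem Tm.sub_up (t : Tm) (k : ℕ) (θ : ℕ → Tm) : (t.up k).sub θ = t.sub (fun n => θ (n + k)) :=
  t.sub_ren _ _
theorem Ty.up_sub (A : Ty) (k : ℕ) (θ : ℕ → Tm) : (A.sub θ).up k = A.sub (fun n => (θ n).up k) :=
  A.ren_sub _ _
theorem Tm.up_sub (t : Tm) (k : ℕ) (θ : ℕ → Tm) : (t.sub θ).up k = t.sub (fun n => (θ n).up k) :=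
  t.ren_sub _ _

/-- The substitution `θ, s`. -/
def scons (s : Tm) (θ : ℕ → Tm) : ℕ → Tm
  | 0 => s
  | n + 1 => θ n

theorem single_eq (s : Tm) : single s = scons s Tm.var := by
  funext n; cases n <;> rfl

theorem scons_sub (s : Tm) (θ θ' : ℕ → Tm) :
    (fun n => (scons s θ n).sub θ') = scons (s.sub θ') (fun n => (θ n).sub θ') := by
  funext n; cases n <;> rfl

theorem scons_eta (θ : ℕ → Tm) : scons (θ 0) (fun n => θ (n + 1)) = θ := by
  funext n; cases n <;> rfl

theorem liftSub_scons (θ θ' : ℕ → Tm) (s : Tm) :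
    (fun n => (liftSub θ n).sub (scons s θ')) = scons s (fun n => (θ n).sub θ') := by
  funext n; cases n
  · rfl
  · simp [liftSub, scons, Tm.sub_up]

theorem Ty.inst_sub (B : Ty) (s : Tm) (θ : ℕ → Tm) :
    (B.inst s).sub θ = (B.sub (liftSub θ)).inst (s.sub θ) := by
  simp only [Ty.inst, single_eq, Ty.sub_sub, scons_sub, liftSub_scons, Tm.sub, Tm.sub_id]
theorem Tm.inst_sub (t : Tm) (s : Tm) (θ : ℕ → Tm) :
    (t.inst s).sub θ = (t.sub (liftSub θ)).inst (s.sub θ) := by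
  simp only [Tm.inst, single_eq, Tm.sub_sub, scons_sub, liftSub_scons, Tm.sub, Tm.sub_id]

theorem Ty.sub_liftSub_inst (B : Ty) (θ : ℕ → Tm) (s : Tm) :
    (B.sub (liftSub θ)).inst s = B.sub (scons s θ) := by
  simp only [Ty.inst, single_eq, Ty.sub_sub, liftSub_scons, Tm.sub_id]
theorem Tm.sub_liftSub_inst (t : Tm) (θ : ℕ → Tm) (s : Tm) :
    (t.sub (liftSub θ)).inst s = t.sub (scons s θ) := by
  simp only [Tm.inst, single_eq, Tm.sub_sub, liftSub_scons, Tm.sub_id]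

theorem Ty.up_one_liftSub (A : Ty) (θ : ℕ → Tm) : (A.up 1).sub (liftSub θ) = (A.sub θ).up 1 := by
  rw [Ty.sub_up, Ty.up_sub]; rfl
theorem Tm.up_one_liftSub (t : Tm) (θ : ℕ → Tm) : (t.up 1).sub (liftSub θ) = (t.sub θ).up 1 := by
  rw [Tm.sub_up, Tm.up_sub]; rfl

theorem Ty.ren_lift_inst_var (B : Ty) : (B.ren (liftRen (· + 1))).inst (.var 0) = B := by
  rw [Ty.inst, Ty.sub_ren]
  conv_rhs => rw [← B.sub_id]
  congr 1; funext n; cases n <;> rfl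

theorem Ty.ren_lift_sub (B : Ty) (θ : ℕ → Tm) :
    (B.ren (liftRen (· + 1))).sub (liftSub (liftSub θ)) =
      (B.sub (liftSub θ)).ren (liftRen (· + 1)) := by
  rw [Ty.sub_ren, Ty.ren_sub]; congr 1; funext n
  cases n
  · rfl
  · simp [liftRen, liftSub, Tm.up, Tm.ren_ren]

theorem Ty.up_sub_sub (A : Ty) (k : ℕ) : (A.up k).sub (fun n => .var (n - k)) = A := by
  rw [Ty.sub_up]; simpa using A.sub_id
theorem Tm.up_sub_sub (t : Tm) (k : ℕ) : (t.up k).sub (fun n => .var (n - k)) = t := by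
  rw [Tm.sub_up]; simpa using t.sub_id

theorem Ty.up_injective {A B : Ty} {k : ℕ} (e : A.up k = B.up k) : A = B := by
  rw [← A.up_sub_sub k, e, B.up_sub_sub]
theorem Tm.up_injective {t s : Tm} {k : ℕ} (e : t.up k = s.up k) : t = s := by
  rw [← t.up_sub_sub k, e, s.up_sub_sub]

end Fitch

namespace Fitch

mutual
theorem TyWf.wf {Γ A} : TyWf Γ A → Wf Γ
  | .pi h _ => h.wf
  | .box h => match h.wf with | .lock h => h
  | .univ h => h
  | .ctx h => h
  | .el h => h.wf
  | .elc h => h.wf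
theorem HasTm.wf {Γ t A} : HasTm Γ t A → Wf Γ
  | .var h _ => h
  | .conv h _ => h.wf
  | .lam h _ => h.wf
  | .app h _ _ _ => h.wf
  | .box h => match h.wf with | .lock h => h
  | .unbox _ _ h => h
  | .pic h _ => h.wf
  | .tyc h => h
  | .trmc h => h.wf
  | .top h => h
  | .ext h _ => h.wf
  | .unit h => h
  | .pair h _ _ _ => h.wf
  | .fst h _ _ => h.wf
  | .snd h _ _ => h.wf
  | .o h => h
  | .arr h _ => h.wf
  | .lamc h _ _ => h.wf
  | .appc h _ _ _ => h.wf
end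

theorem Wf.tyWf {Γ A} : Wf (.snoc Γ A) → TyWf Γ A
  | .snoc _ h => h

theorem Wf.tail {Γ A} : Wf (.snoc Γ A) → Wf Γ
  | .snoc h _ => h

theorem Wf.of_lock {Γ} : Wf (.lock Γ) → Wf Γ
  | .lock h => h

/-- A class of typed terms closed under weakening that contains the innermost variable. -/
structure Kit (V : Ctx → Tm → Ty → Prop) : Prop where
  hasTm : ∀ {Γ t A}, V Γ t A → HasTm Γ t A
  weaken : ∀ {Γ t A B}, V Γ t A → TyWf Γ B → V (.snoc Γ B) (t.up 1) (A.up 1)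
  var : ∀ {Γ A}, TyWf Γ A → V (.snoc Γ A) (.var 0) (A.up 1)

/-- `Γ' ⊢ θ : Γ`, for a substitution by terms of the class `V`. -/
inductive SbV (V : Ctx → Tm → Ty → Prop) : Ctx → (ℕ → Tm) → Ctx → Prop
  | nil {Γ' θ} : Wf Γ' → SbV V Γ' θ .nil
  | snoc {Γ' θ Γ A} : SbV V Γ' (fun n => θ (n + 1)) Γ →
      V Γ' (θ 0) (A.sub (fun n => θ (n + 1))) → SbV V Γ' θ (.snoc Γ A)
  | lock {Γ' Δ θ θ' Γ} : SbV V Γ' θ Γ → Wf ((Ctx.lock Γ').append Δ) →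
      (∀ n, θ' n = (θ n).up Δ.length) → SbV V ((Ctx.lock Γ').append Δ) θ' (.lock Γ)

namespace SbV

variable {V : Ctx → Tm → Ty → Prop}

theorem wf {Γ' θ Γ} (h : SbV V Γ' θ Γ) : Wf Γ' := by
  induction h with
  | nil h => exact h
  | snoc _ _ ih => exact ih
  | lock _ h _ _ => exact h

theorem weaken (K : Kit V) {Γ' θ Γ B} (h : SbV V Γ' θ Γ) (hB : TyWf Γ' B) :
    SbV V (.snoc Γ' B) (fun n => (θ n).up 1) Γ := by
  induction h with
  | nil h => exact .nil (.snoc h hB)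
  | snoc _ h ih => exact .snoc (ih hB) (by simpa only [Ty.up_sub] using K.weaken h hB)
  | @lock _ Δ _ _ _ h hw e _ =>
    exact .lock (Δ := B :: Δ) h (.snoc hw hB) fun _ => by simp [e, Tm.up_up]

theorem lift (K : Kit V) {Γ' θ Γ A} (h : SbV V Γ' θ Γ) (hA : TyWf Γ' (A.sub θ)) :
    SbV V (.snoc Γ' (A.sub θ)) (liftSub θ) (.snoc Γ A) :=
  .snoc (h.weaken K hA) (by simpa only [liftSub, Ty.up_sub] using K.var hA)

theorem liftEl (K : Kit V) {Γ' θ Γ a} (h : SbV V Γ' θ Γ) (ha : HasTm Γ' (a.sub θ) .univ) :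
    SbV V (.snoc Γ' (.el (a.sub θ))) (liftSub θ) (.snoc Γ (.el a)) :=
  h.lift K (A := .el a) (.el ha)

theorem locked {Γ' θ Γ} (h : SbV V Γ' θ Γ) : SbV V (.lock Γ') θ (.lock Γ) :=
  .lock (Δ := []) h (.lock h.wf) fun _ => (Tm.up_zero _).symm

theorem look (K : Kit V) {Γ n A} (l : Look Γ n A) :
    ∀ {Γ' θ}, SbV V Γ' θ Γ → HasTm Γ' (θ n) (A.sub θ) := by
  induction l with
  | here => rintro _ _ (_ | ⟨_, h⟩); simpa only [Ty.sub_up] using K.hasTm h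
  | there _ ih => rintro _ _ (_ | ⟨h, _⟩); simpa only [Ty.sub_up] using ih h

theorem split {Γ Δ} : ∀ {Γ' θ}, SbV V Γ' θ ((Ctx.lock Γ).append Δ) →
    ∃ Γ₀ Δ' θ₀, Γ' = (Ctx.lock Γ₀).append Δ' ∧ SbV V Γ₀ θ₀ Γ ∧
      ∀ n, θ (n + Δ.length) = (θ₀ n).up Δ'.length := by
  induction Δ with
  | nil => rintro _ _ (_ | _ | ⟨h, _, e⟩); exact ⟨_, _, _, rfl, h, e⟩
  | cons A Δ ih =>
    rintro _ _ (_ | ⟨h, _⟩)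
    obtain ⟨Γ₀, Δ', θ₀, rfl, h, e⟩ := ih h
    exact ⟨_, _, _, rfl, h, e⟩

end SbV

mutual
theorem TyWf.subV {V} (K : Kit V) {Γ A} : TyWf Γ A → ∀ {Γ' θ}, SbV V Γ' θ Γ → TyWf Γ' (A.sub θ)
  | .pi hA hB, _, _, h => .pi (hA.subV K h) (hB.subV K (h.lift K (hA.subV K h)))
  | .box hA, _, _, h => .box (hA.subV K h.locked)
  | .univ _, _, _, h => .univ h.wf
  | .ctx _, _, _, h => .ctx h.wf
  | .el ha, _, _, h => .el (ha.subV K h)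
  | .elc ha, _, _, h => .elc (ha.subV K h)
theorem TyEq.subV {V} (K : Kit V) {Γ A A'} :
    TyEq Γ A A' → ∀ {Γ' θ}, SbV V Γ' θ Γ → TyEq Γ' (A.sub θ) (A'.sub θ)
  | .refl e, _, _, h => .refl (e.subV K h)
  | .symm e, _, _, h => .symm (e.subV K h)
  | .trans e e', _, _, h => .trans (e.subV K h) (e'.subV K h)
  | .pi hA eA eB, _, _, h =>
    .pi (hA.subV K h) (eA.subV K h) (eB.subV K (h.lift K (hA.subV K h)))
  | .box e, _, _, h => .box (e.subV K h.locked)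
  | .el e, _, _, h => .el (e.subV K h)
  | .elc e, _, _, h => .elc (e.subV K h)
  | .elPi ha hb, _, _, h => .elPi (ha.subV K h) (hb.subV K (h.liftEl K (ha.subV K h)))
theorem HasTm.subV {V} (K : Kit V) {Γ t A} :
    HasTm Γ t A → ∀ {Γ' θ}, SbV V Γ' θ Γ → HasTm Γ' (t.sub θ) (A.sub θ)
  | .var _ l, _, _, h => h.look K l
  | .conv ht e, _, _, h => .conv (ht.subV K h) (e.subV K h)
  | .lam hA ht, _, _, h => .lam (hA.subV K h) (ht.subV K (h.lift K (hA.subV K h)))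
  | .app hA hB ht hs, _, _, h => by
    rw [Ty.inst_sub]
    exact .app (hA.subV K h) (hB.subV K (h.lift K (hA.subV K h))) (ht.subV K h) (hs.subV K h)
  | .box ht, _, _, h => .box (ht.subV K h.locked)
  | .unbox (A := A) (t := t) hA ht _, _, _, h => by
    obtain ⟨Γ₀, Δ', θ₀, rfl, h₀, e⟩ := h.split
    simp only [Tm.sub, Ty.sub_up, Tm.sub_up, e, ← Ty.up_sub, ← Tm.up_sub]
    exact .unbox (hA.subV K h₀.locked) (ht.subV K h₀) h.wf
  | .pic ha hb, _, _, h => .pic (ha.subV K h) (hb.subV K (h.liftEl K (ha.subV K h)))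
  | .tyc _, _, _, h => .tyc h.wf
  | .trmc hm, _, _, h => .trmc (hm.subV K h)
  | .top _, _, _, h => .top h.wf
  | .ext hφ ha, _, _, h => .ext (hφ.subV K h) (ha.subV K h)
  | .unit _, _, _, h => .unit h.wf
  | .pair hφ ha ht hs, _, _, h => .pair (hφ.subV K h) (ha.subV K h) (ht.subV K h) (hs.subV K h)
  | .fst hφ ha ht, _, _, h => .fst (hφ.subV K h) (ha.subV K h) (ht.subV K h)
  | .snd hφ ha ht, _, _, h => .snd (hφ.subV K h) (ha.subV K h) (ht.subV K h)
  | .o _, _, _, h => .o h.wf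
  | .arr ha hb, _, _, h => .arr (ha.subV K h) (hb.subV K h)
  | .lamc ha hb hf, _, _, h =>
    .lamc (ha.subV K h) (hb.subV K h) (by
      simpa only [Ty.sub, Tm.sub, Tm.up_one_liftSub] using hf.subV K h)
  | .appc ha hb hm hn, _, _, h =>
    .appc (ha.subV K h) (hb.subV K h) (hm.subV K h) (hn.subV K h)
theorem TmEq.subV {V} (K : Kit V) {Γ t t' A} :
    TmEq Γ t t' A → ∀ {Γ' θ}, SbV V Γ' θ Γ → TmEq Γ' (t.sub θ) (t'.sub θ) (A.sub θ)
  | .refl ht, _, _, h => .refl (ht.subV K h)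
  | .symm e, _, _, h => .symm (e.subV K h)
  | .trans e e', _, _, h => .trans (e.subV K h) (e'.subV K h)
  | .conv e e', _, _, h => .conv (e.subV K h) (e'.subV K h)
  | .lam hA e et, _, _, h =>
    .lam (hA.subV K h) (e.subV K h) (et.subV K (h.lift K (hA.subV K h)))
  | .app hA eA hB eB et hs es, _, _, h => by
    rw [Ty.inst_sub]
    exact .app (hA.subV K h) (eA.subV K h) (hB.subV K (h.lift K (hA.subV K h)))
      (eB.subV K (h.lift K (hA.subV K h))) (et.subV K h) (hs.subV K h) (es.subV K h)
  | .box e, _, _, h => .box (e.subV K h.locked)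
  | .unbox hA eA et _, _, _, h => by
    obtain ⟨Γ₀, Δ', θ₀, rfl, h₀, e⟩ := h.split
    simp only [Tm.sub, Ty.sub_up, Tm.sub_up, e, ← Ty.up_sub, ← Tm.up_sub]
    exact .unbox (hA.subV K h₀.locked) (eA.subV K h₀.locked) (et.subV K h₀) h.wf
  | .pic ha ea eb, _, _, h =>
    .pic (ha.subV K h) (ea.subV K h) (eb.subV K (h.liftEl K (ha.subV K h)))
  | .trmc e, _, _, h => .trmc (e.subV K h)
  | .ext hφ eφ ea, _, _, h => .ext (hφ.subV K h) (eφ.subV K h) (ea.subV K h)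
  | .pair hφ eφ ha ea ht et es, _, _, h =>
    .pair (hφ.subV K h) (eφ.subV K h) (ha.subV K h) (ea.subV K h) (ht.subV K h) (et.subV K h)
      (es.subV K h)
  | .fst hφ eφ ha ea et, _, _, h =>
    .fst (hφ.subV K h) (eφ.subV K h) (ha.subV K h) (ea.subV K h) (et.subV K h)
  | .snd hφ eφ ha ea ht et, _, _, h =>
    .snd (hφ.subV K h) (eφ.subV K h) (ha.subV K h) (ea.subV K h) (ht.subV K h) (et.subV K h)
  | .arr ea eb, _, _, h => .arr (ea.subV K h) (eb.subV K h)
  | .lamc ha hb ea eb ef, _, _, h =>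
    .lamc (ha.subV K h) (hb.subV K h) (ea.subV K h) (eb.subV K h) (by
      simpa only [Ty.sub, Tm.sub, Tm.up_one_liftSub] using ef.subV K h)
  | .appc ha hb ea eb em en, _, _, h =>
    .appc (ha.subV K h) (hb.subV K h) (ea.subV K h) (eb.subV K h) (em.subV K h) (en.subV K h)
  | .piBeta hA hB ht hs, _, _, h => by
    rw [Ty.inst_sub, Tm.inst_sub]
    exact .piBeta (hA.subV K h) (hB.subV K (h.lift K (hA.subV K h)))
      (ht.subV K (h.lift K (hA.subV K h))) (hs.subV K h)
  | .piEta hA hB ht, _, _, h => by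
    simp only [Ty.sub, Tm.sub, Ty.up_one_liftSub, Tm.up_one_liftSub, Ty.ren_lift_sub]
    exact .piEta (hA.subV K h) (hB.subV K (h.lift K (hA.subV K h))) (ht.subV K h)
  | .boxBeta hA ht _, _, _, h => by
    obtain ⟨Γ₀, Δ', θ₀, rfl, h₀, e⟩ := h.split
    simp only [Tm.sub, Ty.sub_up, Tm.sub_up, e, ← Ty.up_sub, ← Tm.up_sub]
    exact .boxBeta (hA.subV K h₀.locked) (ht.subV K h₀.locked) h.wf
  | .boxEta hA ht, _, _, h => .boxEta (hA.subV K h.locked) (ht.subV K h)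
  | .topEta ht, _, _, h => .topEta (ht.subV K h)
  | .fstBeta hφ ha ht hs, _, _, h =>
    .fstBeta (hφ.subV K h) (ha.subV K h) (ht.subV K h) (hs.subV K h)
  | .sndBeta hφ ha ht hs, _, _, h =>
    .sndBeta (hφ.subV K h) (ha.subV K h) (ht.subV K h) (hs.subV K h)
  | .pairEta hφ ha ht, _, _, h => .pairEta (hφ.subV K h) (ha.subV K h) (ht.subV K h)
end

end Fitch

namespace Fitch

/-- Typed variables. -/
def IsVar (Γ : Ctx) (t : Tm) (A : Ty) : Prop := Wf Γ ∧ ∃ n, t = .var n ∧ Look Γ n A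

theorem kitVar : Kit IsVar where
  hasTm := by rintro _ _ _ ⟨h, n, rfl, l⟩; exact .var h l
  weaken := by rintro _ _ _ _ ⟨h, n, rfl, l⟩ hB; exact ⟨.snoc h hB, _, rfl, l.there⟩
  var := fun hA => ⟨.snoc hA.wf hA, _, rfl, .here⟩

theorem SbV.id {V} (K : Kit V) {Γ} (h : Wf Γ) : SbV V Γ Tm.var Γ := by
  induction Γ with
  | nil => exact .nil h
  | snoc Γ A ih =>
    have hA := h.tyWf
    have := (ih h.tail).weaken K hA
    refine .snoc this ?_
    have e : A.sub (fun n => .var (n + 1)) = A.up 1 := by rw [Ty.up, Ty.ren_eq_sub]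
    rw [e]; exact K.var hA
  | lock Γ ih => exact (ih h.of_lock).locked

theorem SbV.up {V} (K : Kit V) {Γ Δ} (h : Wf (.append Γ Δ)) :
    SbV V (.append Γ Δ) (fun n => .var (n + Δ.length)) Γ := by
  induction Δ with
  | nil => exact .id K h
  | cons B Δ ih => exact (ih h.tail).weaken K h.tyWf

theorem TyWf.weaken {Γ A B} (h : TyWf Γ A) (hB : TyWf Γ B) : TyWf (.snoc Γ B) (A.up 1) := by
  rw [Ty.up, Ty.ren_eq_sub]; exact h.subV kitVar (.up (Δ := [B]) kitVar (.snoc h.wf hB))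
theorem TyEq.weaken {Γ A A' B} (h : TyEq Γ A A') (hB : TyWf Γ B) :
    TyEq (.snoc Γ B) (A.up 1) (A'.up 1) := by
  simp only [Ty.up, Ty.ren_eq_sub]; exact h.subV kitVar (.up (Δ := [B]) kitVar (.snoc hB.wf hB))
theorem HasTm.weaken {Γ t A B} (h : HasTm Γ t A) (hB : TyWf Γ B) :
    HasTm (.snoc Γ B) (t.up 1) (A.up 1) := by
  simp only [Ty.up, Tm.up, Ty.ren_eq_sub, Tm.ren_eq_sub]
  exact h.subV kitVar (.up (Δ := [B]) kitVar (.snoc h.wf hB))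
theorem TmEq.weaken {Γ t t' A B} (h : TmEq Γ t t' A) (hB : TyWf Γ B) :
    TmEq (.snoc Γ B) (t.up 1) (t'.up 1) (A.up 1) := by
  simp only [Ty.up, Tm.up, Ty.ren_eq_sub, Tm.ren_eq_sub]
  exact h.subV kitVar (.up (Δ := [B]) kitVar (.snoc hB.wf hB))

theorem TyWf.weakens {Γ A} (Δ) (h : TyWf Γ A) (hw : Wf (.append Γ Δ)) :
    TyWf (.append Γ Δ) (A.up Δ.length) := by
  rw [Ty.up, Ty.ren_eq_sub]; exact h.subV kitVar (.up kitVar hw)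
theorem TyEq.weakens {Γ A A'} (Δ) (h : TyEq Γ A A') (hw : Wf (.append Γ Δ)) :
    TyEq (.append Γ Δ) (A.up Δ.length) (A'.up Δ.length) := by
  simp only [Ty.up, Ty.ren_eq_sub]; exact h.subV kitVar (.up kitVar hw)
theorem HasTm.weakens {Γ t A} (Δ) (h : HasTm Γ t A) (hw : Wf (.append Γ Δ)) :
    HasTm (.append Γ Δ) (t.up Δ.length) (A.up Δ.length) := by
  simp only [Ty.up, Tm.up, Ty.ren_eq_sub, Tm.ren_eq_sub]; exact h.subV kitVar (.up kitVar hw)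

theorem kitTm : Kit HasTm where
  hasTm h := h
  weaken h hB := h.weaken hB
  var hA := .var (.snoc hA.wf hA) .here

/-- `Γ' ⊢ θ : Γ`. -/
abbrev Sb : Ctx → (ℕ → Tm) → Ctx → Prop := SbV HasTm

theorem TyWf.sub {Γ Γ' A θ} (h : TyWf Γ A) (s : Sb Γ' θ Γ) : TyWf Γ' (A.sub θ) := h.subV kitTm s
theorem TyEq.sub {Γ Γ' A A' θ} (h : TyEq Γ A A') (s : Sb Γ' θ Γ) :
    TyEq Γ' (A.sub θ) (A'.sub θ) := h.subV kitTm s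
theorem HasTm.sub {Γ Γ' t A θ} (h : HasTm Γ t A) (s : Sb Γ' θ Γ) :
    HasTm Γ' (t.sub θ) (A.sub θ) := h.subV kitTm s
theorem TmEq.sub {Γ Γ' t t' A θ} (h : TmEq Γ t t' A) (s : Sb Γ' θ Γ) :
    TmEq Γ' (t.sub θ) (t'.sub θ) (A.sub θ) := h.subV kitTm s

theorem SbV.comp {Γ Γ' Γ'' θ θ'} (h : Sb Γ' θ Γ) (h' : Sb Γ'' θ' Γ') :
    Sb Γ'' (fun n => (θ n).sub θ') Γ := by
  induction h generalizing Γ'' θ' with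
  | nil _ => exact .nil h'.wf
  | snoc _ h ih => exact .snoc (ih h') (by simpa only [Ty.sub_sub] using h.sub h')
  | @lock _ Δ _ _ _ h _ e ih =>
    obtain ⟨Γ₀, Δ', θ₀, rfl, h₀, e'⟩ := h'.split
    exact .lock (ih h₀) h'.wf fun n => by simp only [e, Tm.sub_up, e', Tm.up_sub]

theorem SbV.scons {Γ Γ' θ t A} (h : Sb Γ' θ Γ) (ht : HasTm Γ' t (A.sub θ)) :
    Sb Γ' (scons t θ) (.snoc Γ A) := .snoc h ht

theorem SbV.single {Γ s A} (hs : HasTm Γ s A) : Sb Γ (single s) (.snoc Γ A) := by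
  rw [single_eq]; exact .scons (.id kitTm hs.wf) (by rwa [Ty.sub_id])

theorem SbV.conv {Γ Γ' θ A A'} (h : Sb Γ' θ Γ) (hA : TyWf Γ' A') (e : TyEq Γ' (A.sub θ) A') :
    Sb (.snoc Γ' A') (liftSub θ) (.snoc Γ A) :=
  .snoc (h.weaken kitTm hA) (.conv (.var (.snoc h.wf hA) .here)
    (by simpa only [liftSub, Ty.up_sub] using e.symm.weaken hA))

theorem SbV.conv_id {Γ A A'} (hA : TyWf Γ A') (e : TyEq Γ A A') :
    Sb (.snoc Γ A') Tm.var (.snoc Γ A) := by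
  have := (SbV.id kitTm hA.wf).conv (A := A) hA (by rwa [Ty.sub_id])
  rwa [liftSub_id] at this

theorem TyWf.convCtx {Γ A A' B} (h : TyWf (.snoc Γ A) B) (hA : TyWf Γ A') (e : TyEq Γ A A') :
    TyWf (.snoc Γ A') B := by simpa only [Ty.sub_id] using h.sub (.conv_id hA e)
theorem HasTm.convCtx {Γ A A' t B} (h : HasTm (.snoc Γ A) t B) (hA : TyWf Γ A')
    (e : TyEq Γ A A') : HasTm (.snoc Γ A') t B := by
  simpa only [Ty.sub_id, Tm.sub_id] using h.sub (.conv_id hA e)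

theorem TyWf.inst {Γ A B s} (h : TyWf (.snoc Γ A) B) (hs : HasTm Γ s A) : TyWf Γ (B.inst s) :=
  h.sub (.single hs)
theorem HasTm.inst {Γ A B t s} (h : HasTm (.snoc Γ A) t B) (hs : HasTm Γ s A) :
    HasTm Γ (t.inst s) (B.inst s) := h.sub (.single hs)
theorem TyEq.inst {Γ A B B' s} (h : TyEq (.snoc Γ A) B B') (hs : HasTm Γ s A) :
    TyEq Γ (B.inst s) (B'.inst s) := h.sub (.single hs)

/-- `Γ' ⊢ θ ≡ θ' : Γ`, where `Γ' ⊢ θ : Γ`. -/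
inductive SbEq : Ctx → (ℕ → Tm) → (ℕ → Tm) → Ctx → Prop
  | nil {Γ' θ θ'} : Wf Γ' → SbEq Γ' θ θ' .nil
  | snoc {Γ' θ θ' Γ A} : SbEq Γ' (fun n => θ (n + 1)) (fun n => θ' (n + 1)) Γ →
      HasTm Γ' (θ 0) (A.sub (fun n => θ (n + 1))) →
      TmEq Γ' (θ 0) (θ' 0) (A.sub (fun n => θ (n + 1))) → SbEq Γ' θ θ' (.snoc Γ A)
  | lock {Γ' Δ θ θ' η η' Γ} : SbEq Γ' θ θ' Γ → Wf ((Ctx.lock Γ').append Δ) →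
      (∀ n, η n = (θ n).up Δ.length) → (∀ n, η' n = (θ' n).up Δ.length) →
      SbEq ((Ctx.lock Γ').append Δ) η η' (.lock Γ)

namespace SbEq

theorem sb {Γ' θ θ' Γ} (h : SbEq Γ' θ θ' Γ) : Sb Γ' θ Γ := by
  induction h with
  | nil h => exact .nil h
  | snoc _ h _ ih => exact .snoc ih h
  | lock _ h e _ ih => exact .lock ih h e

theorem refl {Γ' θ Γ} (h : Sb Γ' θ Γ) : SbEq Γ' θ θ Γ := by
  induction h with
  | nil h => exact .nil h
  | snoc _ h ih => exact .snoc ih h (.refl h)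
  | lock _ h e ih => exact .lock ih h e e

theorem weaken {Γ' θ θ' Γ B} (h : SbEq Γ' θ θ' Γ) (hB : TyWf Γ' B) :
    SbEq (.snoc Γ' B) (fun n => (θ n).up 1) (fun n => (θ' n).up 1) Γ := by
  induction h with
  | nil h => exact .nil (.snoc h hB)
  | snoc _ h e ih =>
    exact .snoc (ih hB) (by simpa only [Ty.up_sub] using h.weaken hB)
      (by simpa only [Ty.up_sub] using e.weaken hB)
  | @lock _ Δ _ _ _ _ _ h hw e e' _ =>
    exact .lock (Δ := B :: Δ) h (.snoc hw hB) (fun _ => by simp [e, Tm.up_up])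
      (fun _ => by simp [e', Tm.up_up])

theorem lift {Γ' θ θ' Γ A} (h : SbEq Γ' θ θ' Γ) (hA : TyWf Γ' (A.sub θ)) :
    SbEq (.snoc Γ' (A.sub θ)) (liftSub θ) (liftSub θ') (.snoc Γ A) := by
  have hv : HasTm (.snoc Γ' (A.sub θ)) (.var 0) (A.sub fun n => liftSub θ (n + 1)) := by
    simpa only [liftSub, Ty.up_sub] using kitTm.var hA
  exact .snoc (h.weaken hA) hv (.refl hv)

theorem liftEl {Γ' θ θ' Γ a} (h : SbEq Γ' θ θ' Γ) (ha : HasTm Γ' (a.sub θ) .univ) :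
    SbEq (.snoc Γ' (.el (a.sub θ))) (liftSub θ) (liftSub θ') (.snoc Γ (.el a)) :=
  h.lift (A := .el a) (.el ha)

theorem locked {Γ' θ θ' Γ} (h : SbEq Γ' θ θ' Γ) : SbEq (.lock Γ') θ θ' (.lock Γ) :=
  .lock (Δ := []) h (.lock h.sb.wf) (fun _ => (Tm.up_zero _).symm) fun _ => (Tm.up_zero _).symm

theorem look {Γ n A} (l : Look Γ n A) :
    ∀ {Γ' θ θ'}, SbEq Γ' θ θ' Γ → TmEq Γ' (θ n) (θ' n) (A.sub θ) := by
  induction l with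
  | here => rintro _ _ _ (_ | ⟨_, _, h⟩); simpa only [Ty.sub_up] using h
  | there _ ih => rintro _ _ _ (_ | ⟨h, _⟩); simpa only [Ty.sub_up] using ih h

theorem split {Γ Δ} : ∀ {Γ' θ θ'}, SbEq Γ' θ θ' ((Ctx.lock Γ).append Δ) →
    ∃ Γ₀ Δ' θ₀ θ₀', Γ' = (Ctx.lock Γ₀).append Δ' ∧ SbEq Γ₀ θ₀ θ₀' Γ ∧
      (∀ n, θ (n + Δ.length) = (θ₀ n).up Δ'.length) ∧
      ∀ n, θ' (n + Δ.length) = (θ₀' n).up Δ'.length := by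
  induction Δ with
  | nil => rintro _ _ _ (_ | _ | ⟨h, _, e, e'⟩); exact ⟨_, _, _, _, rfl, h, e, e'⟩
  | cons A Δ ih =>
    rintro _ _ _ (_ | ⟨h, _⟩)
    obtain ⟨Γ₀, Δ', θ₀, θ₀', rfl, h, e, e'⟩ := ih h
    exact ⟨_, _, _, _, rfl, h, e, e'⟩

end SbEq

mutual
theorem TyWf.subEq {Γ A} : TyWf Γ A → ∀ {Γ' θ θ'}, SbEq Γ' θ θ' Γ → TyEq Γ' (A.sub θ) (A.sub θ')
  | .pi hA hB, _, _, _, h =>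
    .pi (hA.sub h.sb) (hA.subEq h) (hB.subEq (h.lift (hA.sub h.sb)))
  | .box hA, _, _, _, h => .box (hA.subEq h.locked)
  | .univ _, _, _, _, h => .refl (.univ h.sb.wf)
  | .ctx _, _, _, _, h => .refl (.ctx h.sb.wf)
  | .el ha, _, _, _, h => .el (ha.subEq h)
  | .elc ha, _, _, _, h => .elc (ha.subEq h)
theorem HasTm.subEq {Γ t A} :
    HasTm Γ t A → ∀ {Γ' θ θ'}, SbEq Γ' θ θ' Γ → TmEq Γ' (t.sub θ) (t.sub θ') (A.sub θ)
  | .var _ l, _, _, _, h => h.look l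
  | .conv ht e, _, _, _, h => .conv (ht.subEq h) (e.sub h.sb)
  | .lam hA ht, _, _, _, h =>
    .lam (hA.sub h.sb) (hA.subEq h) (ht.subEq (h.lift (hA.sub h.sb)))
  | .app hA hB ht hs, _, _, _, h => by
    rw [Ty.inst_sub]
    exact .app (hA.sub h.sb) (hA.subEq h) (hB.sub (h.sb.lift kitTm (hA.sub h.sb)))
      (hB.subEq (h.lift (hA.sub h.sb))) (ht.subEq h) (hs.sub h.sb) (hs.subEq h)
  | .box ht, _, _, _, h => .box (ht.subEq h.locked)
  | .unbox hA ht _, _, _, _, h => by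
    obtain ⟨Γ₀, Δ', θ₀, θ₀', rfl, h₀, e, e'⟩ := h.split
    simp only [Tm.sub, Ty.sub_up, Tm.sub_up, e, e', ← Ty.up_sub, ← Tm.up_sub]
    exact .unbox (hA.sub h₀.locked.sb) (hA.subEq h₀.locked) (ht.subEq h₀) h.sb.wf
  | .pic ha hb, _, _, _, h =>
    .pic (ha.sub h.sb) (ha.subEq h) (hb.subEq (h.liftEl (ha.sub h.sb)))
  | .tyc _, _, _, _, h => .refl (.tyc h.sb.wf)
  | .trmc hm, _, _, _, h => .trmc (hm.subEq h)
  | .top _, _, _, _, h => .refl (.top h.sb.wf)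
  | .ext hφ ha, _, _, _, h => .ext (hφ.sub h.sb) (hφ.subEq h) (ha.subEq h)
  | .unit _, _, _, _, h => .refl (.unit h.sb.wf)
  | .pair hφ ha ht hs, _, _, _, h =>
    .pair (hφ.sub h.sb) (hφ.subEq h) (ha.sub h.sb) (ha.subEq h) (ht.sub h.sb) (ht.subEq h)
      (hs.subEq h)
  | .fst hφ ha ht, _, _, _, h =>
    .fst (hφ.sub h.sb) (hφ.subEq h) (ha.sub h.sb) (ha.subEq h) (ht.subEq h)
  | .snd hφ ha ht, _, _, _, h =>
    .snd (hφ.sub h.sb) (hφ.subEq h) (ha.sub h.sb) (ha.subEq h) (ht.sub h.sb) (ht.subEq h)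
  | .o _, _, _, _, h => .refl (.o h.sb.wf)
  | .arr ha hb, _, _, _, h => .arr (ha.subEq h) (hb.subEq h)
  | .lamc ha hb hf, _, _, _, h =>
    .lamc (ha.sub h.sb) (hb.sub h.sb) (ha.subEq h) (hb.subEq h) (by
      simpa only [Ty.sub, Tm.sub, Tm.up_one_liftSub] using hf.subEq h)
  | .appc ha hb hm hn, _, _, _, h =>
    .appc (ha.sub h.sb) (hb.sub h.sb) (ha.subEq h) (hb.subEq h) (hm.subEq h) (hn.subEq h)
end

theorem SbEq.single {Γ s s' A} (hs : HasTm Γ s A) (e : TmEq Γ s s' A) :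
    SbEq Γ (single s) (single s') (.snoc Γ A) := by
  rw [single_eq, single_eq]
  exact .snoc (.refl (.id kitTm hs.wf)) (by simpa only [scons, Ty.sub_id])
    (by simpa only [scons, Ty.sub_id])

theorem Look.tyWf {Γ n A} (l : Look Γ n A) (h : Wf Γ) : TyWf Γ A := by
  induction l with
  | here => exact h.tyWf.weaken h.tyWf
  | there _ ih => exact (ih h.tail).weaken h.tyWf

theorem HasTm.apT {Γ φ a u} (hφ : HasTm Γ φ .ctx) (ha : HasTm Γ a (.pi (.elc φ) .univ))
    (hu : HasTm Γ u (.elc φ)) : HasTm Γ (apT φ a u) .univ :=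
  .app (.elc hφ) (.univ (.snoc hφ.wf (.elc hφ))) ha hu

theorem TmEq.apT {Γ φ φ' a a' u u'} (hφ : HasTm Γ φ .ctx) (eφ : TmEq Γ φ φ' .ctx)
    (ea : TmEq Γ a a' (.pi (.elc φ) .univ))
    (hu : HasTm Γ u (.elc φ)) (eu : TmEq Γ u u' (.elc φ)) :
    TmEq Γ (Fitch.apT φ a u) (Fitch.apT φ' a' u') .univ :=
  have h := TyWf.univ (.snoc hφ.wf (.elc hφ))
  .app (.elc hφ) (.elc eφ) h (.refl h) ea hu eu

theorem TyEq.piElcUniv {Γ φ φ'} (hφ : HasTm Γ φ .ctx) (eφ : TmEq Γ φ φ' .ctx) :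
    TyEq Γ (.pi (.elc φ) .univ) (.pi (.elc φ') .univ) :=
  .pi (.elc hφ) (.elc eφ) (.refl (.univ (.snoc hφ.wf (.elc hφ))))

mutual
theorem TyEq.valid {Γ A A'} : TyEq Γ A A' → TyWf Γ A ∧ TyWf Γ A'
  | .refl h => ⟨h, h⟩
  | .symm h => h.valid.symm
  | .trans h h' => ⟨h.valid.1, h'.valid.2⟩
  | .pi hA eA eB =>
    ⟨.pi hA eB.valid.1, .pi eA.valid.2 (eB.valid.2.convCtx eA.valid.2 eA)⟩
  | .box e => ⟨.box e.valid.1, .box e.valid.2⟩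
  | .el e => ⟨.el e.valid.2.1, .el e.valid.2.2⟩
  | .elc e => ⟨.elc e.valid.2.1, .elc e.valid.2.2⟩
  | .elPi ha hb => ⟨.el (.pic ha hb), .pi (.el ha) (.el hb)⟩
theorem HasTm.tyWf {Γ t A} : HasTm Γ t A → TyWf Γ A
  | .var h l => l.tyWf h
  | .conv _ e => e.valid.2
  | .lam hA ht => .pi hA ht.tyWf
  | .app _ hB _ hs => hB.inst hs
  | .box h => .box h.tyWf
  | .unbox hA _ h => hA.weakens _ h
  | .pic h _ => .univ h.wf
  | .tyc h => .univ h
  | .trmc h => .univ h.wf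
  | .top h => .ctx h
  | .ext h _ => .ctx h.wf
  | .unit h => .elc (.top h)
  | .pair h h' _ _ => .elc (.ext h h')
  | .fst h _ _ => .elc h
  | .snd h h' h'' => .el (.apT h h' (.fst h h' h''))
  | .o h => .el (.tyc h)
  | .arr h _ => .el (.tyc h.wf)
  | .lamc h h' _ => .el (.trmc (.arr h h'))
  | .appc _ h _ _ => .el (.trmc h)
theorem TmEq.valid {Γ t t' A} : TmEq Γ t t' A → TyWf Γ A ∧ HasTm Γ t A ∧ HasTm Γ t' A
  | .refl h => ⟨h.tyWf, h, h⟩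
  | .symm h => ⟨h.valid.1, h.valid.2.symm⟩
  | .trans h h' => ⟨h.valid.1, h.valid.2.1, h'.valid.2.2⟩
  | .conv h e => ⟨e.valid.2, h.valid.2.1.conv e, h.valid.2.2.conv e⟩
  | .lam hA eA et =>
    ⟨.pi hA et.valid.1, .lam hA et.valid.2.1, .conv (.lam eA.valid.2 (et.valid.2.2.convCtx eA.valid.2 eA))
      (.symm (.pi hA eA (.refl et.valid.1)))⟩
  | .app hA eA hB eB et hs es =>
    ⟨hB.inst hs, .app hA hB et.valid.2.1 hs, .conv
      (.app eA.valid.2 (eB.valid.2.convCtx eA.valid.2 eA) (et.valid.2.2.conv (.pi hA eA eB))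
        (es.valid.2.2.conv eA))
      (.symm (.trans (hB.subEq (.single hs es)) (eB.inst es.valid.2.2)))⟩
  | .box e => ⟨.box e.valid.1, .box e.valid.2.1, .box e.valid.2.2⟩
  | .unbox hA eA et h =>
    ⟨hA.weakens _ h, .unbox hA et.valid.2.1 h, .conv (.unbox eA.valid.2 (et.valid.2.2.conv (.box eA)) h)
      (eA.symm.weakens _ h)⟩
  | .pic ha ea eb =>
    ⟨.univ ha.wf, .pic ha eb.valid.2.1, .pic ea.valid.2.2 (eb.valid.2.2.convCtx (.el ea.valid.2.2) (.el ea))⟩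
  | .trmc e => ⟨.univ e.valid.2.1.wf, .trmc e.valid.2.1, .trmc e.valid.2.2⟩
  | .ext hφ eφ ea =>
    ⟨.ctx hφ.wf, .ext hφ ea.valid.2.1, .ext eφ.valid.2.2 (ea.valid.2.2.conv (.piElcUniv hφ eφ))⟩
  | .pair hφ eφ ha ea ht et es =>
    ⟨.elc (.ext hφ ha), .pair hφ ha ht es.valid.2.1, .conv
      (.pair eφ.valid.2.2 (ea.valid.2.2.conv (.piElcUniv hφ eφ)) (et.valid.2.2.conv (.elc eφ))
        (es.valid.2.2.conv (.el (.apT hφ eφ ea ht et))))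
      (.symm (.elc (.ext hφ eφ ea)))⟩
  | .fst hφ eφ ha ea et =>
    ⟨.elc hφ, .fst hφ ha et.valid.2.1, .conv
      (.fst eφ.valid.2.2 (ea.valid.2.2.conv (.piElcUniv hφ eφ)) (et.valid.2.2.conv (.elc (.ext hφ eφ ea))))
      (.symm (.elc eφ))⟩
  | .snd hφ eφ ha ea ht et =>
    ⟨.el (.apT hφ ha (.fst hφ ha ht)), .snd hφ ha ht, .conv
      (.snd eφ.valid.2.2 (ea.valid.2.2.conv (.piElcUniv hφ eφ)) (et.valid.2.2.conv (.elc (.ext hφ eφ ea))))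
      (.symm (.el (.apT hφ eφ ea (.fst hφ ha ht) (.fst hφ eφ ha ea et))))⟩
  | .arr e e' => ⟨e.valid.1, .arr e.valid.2.1 e'.valid.2.1, .arr e.valid.2.2 e'.valid.2.2⟩
  | .lamc (b := b) (b' := b') ha hb ea eb ef =>
    have hw : TyWf _ (.el (.trmc _)) := .el (.trmc ha)
    have e₂ : TmEq _ (b.up 1) (b'.up 1) (.el .tyc) := eb.weaken hw
    ⟨.el (.trmc (.arr ha hb)), .lamc ha hb ef.valid.2.1, .conv
      (.lamc ea.valid.2.2 eb.valid.2.2 (ef.valid.2.2.conv (.pi hw (.el (.trmc ea)) (.el (.trmc e₂)))))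
      (.symm (.el (.trmc (.arr ea eb))))⟩
  | .appc ha hb ea eb em en =>
    ⟨.el (.trmc hb), .appc ha hb em.valid.2.1 en.valid.2.1, .conv
      (.appc ea.valid.2.2 eb.valid.2.2 (em.valid.2.2.conv (.el (.trmc (.arr ea eb))))
        (en.valid.2.2.conv (.el (.trmc ea))))
      (.symm (.el (.trmc eb)))⟩
  | .piBeta hA hB ht hs => ⟨hB.inst hs, .app hA hB (.lam hA ht) hs, ht.inst hs⟩
  | .piEta (A := A) (B := B) (t := t) hA hB ht =>
    have hB' : TyWf (.snoc (.snoc _ A) (A.up 1)) (B.ren (liftRen (· + 1))) := by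
      have h := SbV.up (Γ := Γ) (Δ := [A]) kitTm (.snoc hA.wf hA)
      have := hB.sub (h.lift kitTm (hA.sub h))
      rwa [liftSub_var, ← Ty.ren_eq_sub, ← Ty.ren_eq_sub] at this
    ⟨.pi hA hB, ht, .lam hA (by
      have := HasTm.app (hA.weaken hA) hB' (ht.weaken hA) (.var (.snoc hA.wf hA) .here)
      rwa [Ty.ren_lift_inst_var] at this)⟩
  | .boxBeta hA ht h => ⟨hA.weakens _ h, .unbox hA (.box ht) h, ht.weakens _ h⟩
  | .boxEta hA ht =>
    ⟨.box hA, ht, .box (by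
      have := HasTm.unbox (Δ := []) hA ht (.lock ht.wf)
      rwa [List.length_nil, Ty.up_zero, Tm.up_zero] at this)⟩
  | .topEta h => ⟨.elc (.top h.wf), h, .unit h.wf⟩
  | .fstBeta hφ ha ht hs => ⟨.elc hφ, .fst hφ ha (.pair hφ ha ht hs), ht⟩
  | .sndBeta hφ ha ht hs =>
    ⟨.el (.apT hφ ha ht), .conv (.snd hφ ha (.pair hφ ha ht hs)) (.el (.apT hφ (.refl hφ) (.refl ha)
      (.fst hφ ha (.pair hφ ha ht hs)) (.fstBeta hφ ha ht hs))), hs⟩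
  | .pairEta hφ ha ht => ⟨.elc (.ext hφ ha), ht, .pair hφ ha (.fst hφ ha ht) (.snd hφ ha ht)⟩
end

theorem TmEq.left {Γ t t' A} (h : TmEq Γ t t' A) : HasTm Γ t A := h.valid.2.1
theorem TmEq.right {Γ t t' A} (h : TmEq Γ t t' A) : HasTm Γ t' A := h.valid.2.2
theorem TyEq.left {Γ A A'} (h : TyEq Γ A A') : TyWf Γ A := h.valid.1
theorem TyEq.right {Γ A A'} (h : TyEq Γ A A') : TyWf Γ A' := h.valid.2
theorem TyEq.wf {Γ A A'} (h : TyEq Γ A A') : Wf Γ := h.left.wf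

theorem TyWf.of_el {Γ a} : TyWf Γ (.el a) → HasTm Γ a .univ
  | .el h => h

end Fitch

namespace Cocon

open Fitch (Tm scons)

/-- The number of variables of the telescope of a domain-level context: one for its base and one
for every declaration. -/
def DCtx.len : DCtx → ℕ
  | .nil => 1
  | .var _ => 1
  | .snoc Ψ _ => Ψ.len + 1

mutual
/-- Scoping of domain-level variables, in telescopes of given lengths. -/
def DTy.Sc : ℕ → DTy → Prop
  | _, .ty => True
  | n, .trm M => DTm.Sc n M
  | n, .pi A B => DTy.Sc n A ∧ DTy.Sc (n + 1) B

def DTm.Sc : ℕ → DTm → Prop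
  | n, .var i => i + 1 < n
  | n, .lam A B M => DTy.Sc n A ∧ DTy.Sc (n + 1) B ∧ DTm.Sc (n + 1) M
  | n, .app A B M N => DTy.Sc n A ∧ DTy.Sc (n + 1) B ∧ DTm.Sc n M ∧ DTm.Sc n N
  | n, .unbox Φ A t σ => DCtx.Sc Φ ∧ DTy.Sc Φ.len A ∧ CTm.Sc t ∧ DSub.Sc n Φ.len σ
  | _, .o => True
  | n, .arr a b => DTm.Sc n a ∧ DTm.Sc n b
  | n, .lamc a b f => DTm.Sc n a ∧ DTm.Sc n b ∧ DTm.Sc n f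
  | n, .appc a b m k => DTm.Sc n a ∧ DTm.Sc n b ∧ DTm.Sc n m ∧ DTm.Sc n k

/-- `σ` goes from a telescope of length `n` to one of length `m`. -/
def DSub.Sc : ℕ → ℕ → DSub → Prop
  | _, m, .nil => m = 1
  | n, m, .wk k => n = m + k ∧ 1 ≤ m
  | n, m, .cons σ M => 2 ≤ m ∧ DSub.Sc n (m - 1) σ ∧ DTm.Sc n M

def DCtx.Sc : DCtx → Prop
  | .nil => True
  | .var _ => True
  | .snoc Ψ A => DCtx.Sc Ψ ∧ DTy.Sc Ψ.len A

def CxTy.Sc : CxTy → Prop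
  | .tm Ψ A => DCtx.Sc Ψ ∧ DTy.Sc Ψ.len A
  | .vr Ψ A => DCtx.Sc Ψ ∧ DTy.Sc Ψ.len A

def CxObj.Sc : CxObj → Prop
  | .mk Ψ M => DCtx.Sc Ψ ∧ DTm.Sc Ψ.len M

def CTy.Sc : CTy → Prop
  | .box T => CxTy.Sc T
  | .pi τ₁ τ₂ => CTy.Sc τ₁ ∧ CTy.Sc τ₂
  | .ctx => True

def CTm.Sc : CTm → Prop
  | .var _ => True
  | .box C => CxObj.Sc C
  | .fn τ t => CTy.Sc τ ∧ CTm.Sc t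
  | .app τ₁ τ₂ t s => CTy.Sc τ₁ ∧ CTy.Sc τ₂ ∧ CTm.Sc t ∧ CTm.Sc s
  | .ctx Ψ => DCtx.Sc Ψ
end

/-! ### The open translation

The open translation interprets domain-level expressions over `Ψ` in a telescope, which has a
variable for an instance of the base of `Ψ` and one for every declaration. -/

mutual
/-- The code of a domain-level type, in a telescope of length `n`. -/
def oTy : ℕ → DTy → Tm
  | _, .ty => .tyc
  | n, .trm M => .trmc (oTm n M)
  | n, .pi A B => .pic (oTy n A) (oTy (n + 1) B)

def oTm : ℕ → DTm → Tm
  | _, .var i => .var i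
  | n, .lam A _ M => .lam (.el (oTy n A)) (oTm (n + 1) M)
  | n, .app A B M N => .app (.el (oTy n A)) (.el (oTy (n + 1) B)) (oTm n M) (oTm n N)
  | n, .unbox Φ A t σ =>
      .app ((Fitch.Ty.elc (oCode Φ)).up n)
        ((Fitch.Ty.el ((oTy Φ.len A).sub (oProj Φ))).ren (Fitch.liftRen (· + n)))
        (.unbox ((Fitch.Ty.pi (.elc (oCode Φ)) (.el ((oTy Φ.len A).sub (oProj Φ)))).up n)
          ((oCTm t).up n))
        ((oTup Φ).sub (oSub n σ))
  | _, .o => .o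
  | n, .arr a b => .arr (oTm n a) (oTm n b)
  | n, .lamc a b f => .lamc (oTm n a) (oTm n b) (oTm n f)
  | n, .appc a b m k => .appc (oTm n a) (oTm n b) (oTm n m) (oTm n k)

/-- A domain-level substitution, as a substitution between telescopes. -/
def oSub : ℕ → DSub → ℕ → Tm
  | n, .nil => scons .unit (fun i => .var (i + n))
  | _, .wk k => fun i => .var (i + k)
  | n, .cons σ M => scons (oTm n M) (oSub n σ)

def oCode : DCtx → Tm
  | .nil => .top
  | .var y => .unbox .ctx (.var y)
  | .snoc Ψ A => .ext (oCode Ψ) (.lam (.elc (oCode Ψ)) ((oTy Ψ.len A).sub (oProj Ψ)))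

/-- The substitution that computes the variables of the telescope from an instance of the
context. -/
def oProj : DCtx → ℕ → Tm
  | .nil => Tm.var
  | .var _ => Tm.var
  | .snoc Ψ A =>
      scons (.snd ((oCode Ψ).up 1)
          ((Tm.lam (.elc (oCode Ψ)) ((oTy Ψ.len A).sub (oProj Ψ))).up 1) (.var 0))
        (fun i => (oProj Ψ i).sub (scons (.fst ((oCode Ψ).up 1)
          ((Tm.lam (.elc (oCode Ψ)) ((oTy Ψ.len A).sub (oProj Ψ))).up 1) (.var 0))
          (fun j => .var (j + 1))))

/-- The instance of the context formed from the variables of the telescope. -/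
def oTup : DCtx → Tm
  | .nil => .var 0
  | .var _ => .var 0
  | .snoc Ψ A =>
      .pair ((oCode Ψ).up (Ψ.len + 1))
        ((Tm.lam (.elc (oCode Ψ)) ((oTy Ψ.len A).sub (oProj Ψ))).up (Ψ.len + 1))
        ((oTup Ψ).up 1) (.var 0)

def oCxTy : CxTy → Fitch.Ty
  | .tm Ψ A => .pi (.elc (oCode Ψ)) (.el ((oTy Ψ.len A).sub (oProj Ψ)))
  | .vr Ψ A => .pi (.elc (oCode Ψ)) (.el ((oTy Ψ.len A).sub (oProj Ψ)))

def oCxObj : CxObj → Tm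
  | .mk Ψ M => .lam (.elc (oCode Ψ)) ((oTm Ψ.len M).sub (oProj Ψ))

def oCTy : CTy → Fitch.Ty
  | .box T => .box (oCxTy T)
  | .pi τ₁ τ₂ => .pi (oCTy τ₁) (oCTy τ₂)
  | .ctx => .box .ctx

def oCTm : CTm → Tm
  | .var y => .var y
  | .box C => .box (oCxObj C)
  | .fn τ t => .lam (oCTy τ) (oCTm t)
  | .app τ₁ τ₂ t s => .app (oCTy τ₁) (oCTy τ₂) (oCTm t) (oCTm s)
  | .ctx Ψ => .box (oCode Ψ)
end

/-- The family of small types over the code of `Ψ` given by a domain-level type. -/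
def oFam (Ψ : DCtx) (A : DTy) : Tm := .lam (.elc (oCode Ψ)) ((oTy Ψ.len A).sub (oProj Ψ))

theorem oCode_snoc (Ψ A) : oCode (.snoc Ψ A) = .ext (oCode Ψ) (oFam Ψ A) := rfl
theorem oTup_snoc (Ψ : DCtx) (A) : oTup (.snoc Ψ A) =
    .pair ((oCode Ψ).up (Ψ.len + 1)) ((oFam Ψ A).up (Ψ.len + 1)) ((oTup Ψ).up 1) (.var 0) := rfl
theorem oProj_snoc (Ψ A) : oProj (.snoc Ψ A) =
    scons (.snd ((oCode Ψ).up 1) ((oFam Ψ A).up 1) (.var 0))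
      (fun i => (oProj Ψ i).sub (scons (.fst ((oCode Ψ).up 1) ((oFam Ψ A).up 1) (.var 0))
        (fun j => .var (j + 1)))) := rfl

theorem DCtx.one_le_len : ∀ Ψ : DCtx, 1 ≤ Ψ.len
  | .nil => le_rfl
  | .var _ => le_rfl
  | .snoc _ _ => Nat.le_add_left _ _

theorem DSub.Sc.one_le : ∀ {σ : DSub} {n m : ℕ}, DSub.Sc n m σ → 1 ≤ m
  | .nil, _, _, h => by simp [DSub.Sc] at h; omega
  | .wk _, _, _, h => h.2
  | .cons _ _, _, _, h => by have := h.1; omega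

/-- The renaming that skips variable `c`. -/
def skip (c i : ℕ) : ℕ := if i < c then i else i + 1

theorem liftRen_skip (c : ℕ) : Fitch.liftRen (skip c) = skip (c + 1) := by
  funext i; cases i <;> simp [Fitch.liftRen, skip]; split <;> rfl

theorem oSub_chain (n : ℕ) : ∀ c j i, oSub n (DSub.chain j c) i = .var (skip c i + j)
  | 0, j, i => by simp [DSub.chain, oSub, skip]; omega
  | c + 1, j, 0 => by simp [DSub.chain, oSub, skip, scons, oTm]
  | c + 1, j, i + 1 => by
    simp only [DSub.chain, oSub, scons, oSub_chain n c, skip]; congr 1; split <;> split <;> omega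

theorem DSub.Sc.chain {n} : ∀ {c j m}, n = m + j → c < m → DSub.Sc (n + 1) m (DSub.chain j c)
  | 0, j, m, h, h' => ⟨by omega, by omega⟩
  | c + 1, j, m, h, h' => ⟨by omega, DSub.Sc.chain (by omega) (by omega), by
      simp only [DTm.Sc]; omega⟩

theorem up_ren_skip (t : Tm) {c n : ℕ} (h : c ≤ n) : (t.up n).ren (skip c) = t.up (n + 1) := by
  rw [Tm.up, Tm.ren_ren, Tm.up]; congr 1; funext i; simp only [skip]; rw [if_neg (by omega)]; omega
theorem Ty_up_ren_skip (t : Fitch.Ty) {c n : ℕ} (h : c ≤ n) :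
    (t.up n).ren (skip c) = t.up (n + 1) := by
  rw [Fitch.Ty.up, Fitch.Ty.ren_ren, Fitch.Ty.up]; congr 1; funext i; simp only [skip]
  rw [if_neg (by omega)]; omega

mutual
theorem DTy.o_shift : ∀ {A : DTy} {n c : ℕ}, DTy.Sc n A → c < n →
    oTy (n + 1) (A.shift c) = (oTy n A).ren (skip c) ∧ DTy.Sc (n + 1) (A.shift c)
  | .ty, _, _, _, _ => ⟨rfl, trivial⟩
  | .trm M, _, _, h, hc => by
    have := DTm.o_shift (M := M) h hc
    simpa [oTy, Tm.ren, DTy.Sc, DTy.shift] using this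
  | .pi A B, _, _, h, hc => by
    have h₁ := DTy.o_shift (A := A) h.1 hc
    have h₂ := DTy.o_shift (A := B) h.2 (Nat.succ_lt_succ hc)
    simp [oTy, Tm.ren, DTy.Sc, DTy.shift, liftRen_skip, h₁, h₂]
theorem DTm.o_shift : ∀ {M : DTm} {n c : ℕ}, DTm.Sc n M → c < n →
    oTm (n + 1) (M.shift c) = (oTm n M).ren (skip c) ∧ DTm.Sc (n + 1) (M.shift c)
  | .var i, _, _, h, hc => by
    simp only [DTm.Sc] at h
    simp only [DTm.shift, oTm, Tm.ren, DTm.Sc, skip, true_and]; split <;> omega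
  | .lam A B M, _, _, h, hc => by
    have h₁ := DTy.o_shift (A := A) h.1 hc
    have h₂ := DTy.o_shift (A := B) h.2.1 (Nat.succ_lt_succ hc)
    have h₃ := DTm.o_shift (M := M) h.2.2 (Nat.succ_lt_succ hc)
    simp [oTm, Tm.ren, Fitch.Ty.ren, DTm.Sc, DTm.shift, liftRen_skip, h₁, h₂, h₃]
  | .app A B M N, _, _, h, hc => by
    have h₁ := DTy.o_shift (A := A) h.1 hc
    have h₂ := DTy.o_shift (A := B) h.2.1 (Nat.succ_lt_succ hc)
    have h₃ := DTm.o_shift (M := M) h.2.2.1 hc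
    have h₄ := DTm.o_shift (M := N) h.2.2.2 hc
    simp [oTm, Tm.ren, Fitch.Ty.ren, DTm.Sc, DTm.shift, liftRen_skip, h₁, h₂, h₃, h₄]
  | .unbox Φ A t σ, n, c, h, hc => by
    have h₄ := DSub.o_shift (σ := σ) h.2.2.2 hc
    refine ⟨?_, h.1, h.2.1, h.2.2.1, h₄.2⟩
    have e : oSub (n + 1) (σ.shift c) = fun i => (oSub n σ i).ren (skip c) := funext h₄.1
    have := Ty_up_ren_skip (.pi (.elc (oCode Φ)) (.el ((oTy Φ.len A).sub (oProj Φ)))) hc.le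
    simp only [DTm.shift, oTm, Tm.ren, up_ren_skip _ hc.le, this, Tm.ren_sub, e]
    simp only [Fitch.Ty.up, Fitch.Ty.ren, Fitch.Ty.pi.injEq] at this ⊢
    rw [this.1, this.2]
  | .o, _, _, _, _ => ⟨rfl, trivial⟩
  | .arr a b, _, _, h, hc => by
    have h₁ := DTm.o_shift (M := a) h.1 hc
    have h₂ := DTm.o_shift (M := b) h.2 hc
    simp [oTm, Tm.ren, DTm.Sc, DTm.shift, h₁, h₂]
  | .lamc a b f, _, _, h, hc => by
    have h₁ := DTm.o_shift (M := a) h.1 hc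
    have h₂ := DTm.o_shift (M := b) h.2.1 hc
    have h₃ := DTm.o_shift (M := f) h.2.2 hc
    simp [oTm, Tm.ren, DTm.Sc, DTm.shift, h₁, h₂, h₃]
  | .appc a b m k, _, _, h, hc => by
    have h₁ := DTm.o_shift (M := a) h.1 hc
    have h₂ := DTm.o_shift (M := b) h.2.1 hc
    have h₃ := DTm.o_shift (M := m) h.2.2.1 hc
    have h₄ := DTm.o_shift (M := k) h.2.2.2 hc
    simp [oTm, Tm.ren, DTm.Sc, DTm.shift, h₁, h₂, h₃, h₄]
theorem DSub.o_shift : ∀ {σ : DSub} {n m c : ℕ}, DSub.Sc n m σ → c < n →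
    (∀ i, oSub (n + 1) (σ.shift c) i = (oSub n σ i).ren (skip c)) ∧ DSub.Sc (n + 1) m (σ.shift c)
  | .nil, n, m, c, h, hc => by
    refine ⟨?_, h⟩
    rintro (_ | i)
    · rfl
    · simp only [DSub.shift, oSub, scons, Tm.ren, skip]; rw [if_neg (by omega)]; rfl
  | .wk k, n, m, c, h, hc => by
    refine ⟨fun i => ?_, ?_⟩
    · simp only [DSub.shift, oSub_chain, oSub, Tm.ren, skip]
      congr 1; split <;> split <;> omega
    · simp only [DSub.Sc] at h
      exact .chain h.1 (by omega)
  | .cons σ M, n, m, c, h, hc => by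
    have h₁ := DSub.o_shift (σ := σ) h.2.1 hc
    have h₂ := DTm.o_shift (M := M) h.2.2 hc
    refine ⟨?_, h.1, h₁.2, h₂.2⟩
    rintro (_ | i)
    · exact h₂.1
    · exact h₁.1 i
end

theorem skip_zero : skip 0 = (· + 1) := by funext i; simp [skip]

theorem DTy.o_shift_zero {A : DTy} {n : ℕ} (h : DTy.Sc n A) (hn : 0 < n) :
    oTy (n + 1) (A.shift 0) = (oTy n A).up 1 := by
  rw [(DTy.o_shift h hn).1, skip_zero]; rfl
theorem DTm.o_shift_zero {A : DTm} {n : ℕ} (h : DTm.Sc n A) (hn : 0 < n) :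
    oTm (n + 1) (A.shift 0) = (oTm n A).up 1 := by
  rw [(DTm.o_shift h hn).1, skip_zero]; rfl

theorem DSub.oSub_tail : ∀ {σ : DSub} {n' n : ℕ}, DSub.Sc n' n σ →
    ∀ i, oSub n' σ (i + n) = .var (i + n')
  | .nil, _, _, h, i => by obtain rfl := h; rfl
  | .wk k, _, _, h, i => by simp [oSub, h.1]; omega
  | .cons σ M, _, n, h, i => by
    obtain ⟨n, rfl⟩ : ∃ k, n = k + 1 := ⟨n - 1, by have := h.1; omega⟩
    exact DSub.oSub_tail (σ := σ) h.2.1 i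

theorem up_sub_oSub (t : Tm) {σ n' n} (h : DSub.Sc n' n σ) :
    (t.up n).sub (oSub n' σ) = t.up n' := by
  rw [Tm.sub_up, Tm.up, Tm.ren_eq_sub]; congr 1; funext i; exact DSub.oSub_tail h i
theorem Ty_up_sub_oSub (t : Fitch.Ty) {σ n' n} (h : DSub.Sc n' n σ) :
    (t.up n).sub (oSub n' σ) = t.up n' := by
  rw [Fitch.Ty.sub_up, Fitch.Ty.up, Fitch.Ty.ren_eq_sub]; congr 1; funext i
  exact DSub.oSub_tail h i

theorem DSub.Sc.lift {σ n' n} (h : DSub.Sc n' n σ) (hn : 0 < n') :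
    DSub.Sc (n' + 1) (n + 1) σ.lift :=
  ⟨by have := h.one_le; omega, (DSub.o_shift h hn).2, by simp only [DTm.Sc]; omega⟩

theorem oSub_lift {σ n' n} (h : DSub.Sc n' n σ) (hn : 0 < n') :
    oSub (n' + 1) σ.lift = Fitch.liftSub (oSub n' σ) := by
  funext i
  cases i with
  | zero => rfl
  | succ i =>
    have := (DSub.o_shift h hn).1 i
    rw [skip_zero] at this
    exact this

theorem DSub.o_lookup : ∀ {σ n' n i}, DSub.Sc n' n σ → i + 1 < n →
    oTm n' (σ.lookup i) = oSub n' σ i ∧ DTm.Sc n' (σ.lookup i)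
  | .nil, _, _, i, h, hi => by simp only [DSub.Sc] at h; omega
  | .wk k, _, _, i, h, hi => by
    simp only [DSub.Sc] at h
    refine ⟨rfl, ?_⟩
    simp only [DSub.lookup, DTm.Sc]; omega
  | .cons σ M, _, _, 0, h, hi => ⟨rfl, h.2.2⟩
  | .cons σ M, _, n, i + 1, h, hi => DSub.o_lookup (σ := σ) h.2.1 (by omega)

theorem DSub.o_drop : ∀ {σ n' n k m}, DSub.Sc n' n σ → n = m + k → 1 ≤ m →
    (∀ i, oSub n' (σ.drop k) i = oSub n' σ (i + k)) ∧ DSub.Sc n' m (σ.drop k)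
  | σ, _, _, 0, _, h, e, hm => by
    obtain rfl := e
    exact ⟨by simp [DSub.drop], by simpa [DSub.drop] using h⟩
  | .nil, _, _, k + 1, _, h, e, hm => by simp only [DSub.Sc] at h; omega
  | .wk j, _, _, k + 1, _, h, e, hm => by
    simp only [DSub.Sc] at h
    refine ⟨fun i => by simp [DSub.drop, oSub]; omega, ?_⟩
    simp only [DSub.drop, DSub.Sc]; omega
  | .cons σ M, _, n, k + 1, m, h, e, hm => DSub.o_drop (σ := σ) h.2.1 (by omega) hm

mutual
theorem DTy.o_sub : ∀ {A : DTy} {σ n' n}, DTy.Sc n A → DSub.Sc n' n σ → 0 < n' →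
    oTy n' (A.sub σ) = (oTy n A).sub (oSub n' σ) ∧ DTy.Sc n' (A.sub σ)
  | .ty, _, _, _, _, _, _ => ⟨rfl, trivial⟩
  | .trm M, _, _, _, h, hσ, hn => by
    have := DTm.o_sub (M := M) h hσ hn
    simpa [oTy, Tm.sub, DTy.Sc, DTy.sub] using this
  | .pi A B, _, _, _, h, hσ, hn => by
    have h₁ := DTy.o_sub (A := A) h.1 hσ hn
    have h₂ := DTy.o_sub (A := B) h.2 (hσ.lift hn) (Nat.succ_pos _)
    simp [oTy, Tm.sub, DTy.Sc, DTy.sub, oSub_lift hσ hn, h₁, h₂]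
theorem DTm.o_sub : ∀ {M : DTm} {σ n' n}, DTm.Sc n M → DSub.Sc n' n σ → 0 < n' →
    oTm n' (M.sub σ) = (oTm n M).sub (oSub n' σ) ∧ DTm.Sc n' (M.sub σ)
  | .var i, _, _, _, h, hσ, hn => DSub.o_lookup hσ h
  | .lam A B M, _, _, _, h, hσ, hn => by
    have h₁ := DTy.o_sub (A := A) h.1 hσ hn
    have h₂ := DTy.o_sub (A := B) h.2.1 (hσ.lift hn) (Nat.succ_pos _)
    have h₃ := DTm.o_sub (M := M) h.2.2 (hσ.lift hn) (Nat.succ_pos _)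
    simp [oTm, Tm.sub, Fitch.Ty.sub, DTm.Sc, DTm.sub, oSub_lift hσ hn, h₁, h₂, h₃]
  | .app A B M N, _, _, _, h, hσ, hn => by
    have h₁ := DTy.o_sub (A := A) h.1 hσ hn
    have h₂ := DTy.o_sub (A := B) h.2.1 (hσ.lift hn) (Nat.succ_pos _)
    have h₃ := DTm.o_sub (M := M) h.2.2.1 hσ hn
    have h₄ := DTm.o_sub (M := N) h.2.2.2 hσ hn
    simp [oTm, Tm.sub, Fitch.Ty.sub, DTm.Sc, DTm.sub, oSub_lift hσ hn, h₁, h₂, h₃, h₄]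
  | .unbox Φ A t τ, σ, n', n, h, hσ, hn => by
    have h₄ := DSub.o_sub (τ := τ) h.2.2.2 hσ hn
    refine ⟨?_, h.1, h.2.1, h.2.2.1, h₄.2⟩
    have e : oSub n' (σ.sub τ) = fun i => (oSub n τ i).sub (oSub n' σ) := funext h₄.1
    have := Ty_up_sub_oSub (.pi (.elc (oCode Φ)) (.el ((oTy Φ.len A).sub (oProj Φ)))) hσ
    simp only [DTm.sub, oTm, Tm.sub, up_sub_oSub _ hσ, this, Tm.sub_sub, e]
    simp only [Fitch.Ty.up, Fitch.Ty.ren, Fitch.Ty.sub, Fitch.Ty.pi.injEq] at this ⊢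
    rw [this.1, this.2]
  | .o, _, _, _, _, _, _ => ⟨rfl, trivial⟩
  | .arr a b, _, _, _, h, hσ, hn => by
    have h₁ := DTm.o_sub (M := a) h.1 hσ hn
    have h₂ := DTm.o_sub (M := b) h.2 hσ hn
    simp [oTm, Tm.sub, DTm.Sc, DTm.sub, h₁, h₂]
  | .lamc a b f, _, _, _, h, hσ, hn => by
    have h₁ := DTm.o_sub (M := a) h.1 hσ hn
    have h₂ := DTm.o_sub (M := b) h.2.1 hσ hn
    have h₃ := DTm.o_sub (M := f) h.2.2 hσ hn
    simp [oTm, Tm.sub, DTm.Sc, DTm.sub, h₁, h₂, h₃]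
  | .appc a b m k, _, _, _, h, hσ, hn => by
    have h₁ := DTm.o_sub (M := a) h.1 hσ hn
    have h₂ := DTm.o_sub (M := b) h.2.1 hσ hn
    have h₃ := DTm.o_sub (M := m) h.2.2.1 hσ hn
    have h₄ := DTm.o_sub (M := k) h.2.2.2 hσ hn
    simp [oTm, Tm.sub, DTm.Sc, DTm.sub, h₁, h₂, h₃, h₄]
theorem DSub.o_sub : ∀ {τ σ : DSub} {n' n m}, DSub.Sc n m τ → DSub.Sc n' n σ → 0 < n' →
    (∀ i, oSub n' (σ.sub τ) i = (oSub n τ i).sub (oSub n' σ)) ∧ DSub.Sc n' m (σ.sub τ)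
  | .nil, σ, n', n, m, h, hσ, hn => by
    refine ⟨?_, h⟩
    rintro (_ | i)
    · rfl
    · exact (DSub.oSub_tail hσ i).symm
  | .wk k, _, _, _, _, h, hσ, hn => DSub.o_drop hσ h.1 h.2
  | .cons τ M, _, _, _, _, h, hσ, hn => by
    have h₁ := DSub.o_sub (τ := τ) h.2.1 hσ hn
    have h₂ := DTm.o_sub (M := M) h.2.2 hσ hn
    refine ⟨?_, h.1, h₁.2, h₂.2⟩
    rintro (_ | i)
    · exact h₂.1
    · exact h₁.1 i
end

end Cocon

namespace Cocon

open Fitch (Tm scons)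

/-- A renaming under `n` variables. -/
def liftN (n : ℕ) (ρ : ℕ → ℕ) (i : ℕ) : ℕ := if i < n then i else ρ (i - n) + n

theorem liftRen_liftN (n : ℕ) (ρ : ℕ → ℕ) : Fitch.liftRen (liftN n ρ) = liftN (n + 1) ρ := by
  funext i
  cases i with
  | zero => simp [Fitch.liftRen, liftN]
  | succ i =>
    simp only [Fitch.liftRen, liftN, Nat.add_lt_add_iff_right, Nat.add_sub_add_right]
    split <;> omega

theorem liftRen_eq (ρ : ℕ → ℕ) : liftRen ρ = Fitch.liftRen ρ := by
  funext i; cases i <;> rfl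

theorem liftN_one (ρ : ℕ → ℕ) : liftN 1 ρ = Fitch.liftRen ρ := by
  funext i; cases i <;> simp [liftN, Fitch.liftRen]

theorem up_ren_liftN (t : Tm) (n ρ) : (t.up n).ren (liftN n ρ) = (t.ren ρ).up n := by
  simp only [Tm.up, Tm.ren_ren]; congr 1; funext i; simp [liftN]
theorem Ty_up_ren_liftN (t : Fitch.Ty) (n ρ) : (t.up n).ren (liftN n ρ) = (t.ren ρ).up n := by
  simp only [Fitch.Ty.up, Fitch.Ty.ren_ren]; congr 1; funext i; simp [liftN]

theorem DCtx.len_cren (ρ : ℕ → ℕ) : ∀ Ψ : DCtx, (Ψ.cren ρ).len = Ψ.len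
  | .nil => rfl
  | .var _ => rfl
  | .snoc Ψ _ => congrArg (· + 1) (DCtx.len_cren ρ Ψ)

theorem up_one_ren (t : Tm) (ρ) : (t.up 1).ren (Fitch.liftRen ρ) = (t.ren ρ).up 1 := by
  rw [← liftN_one]; exact up_ren_liftN t 1 ρ

theorem sub_oProj_ren {X X' : Tm} {Ψ : DCtx} {ρ : ℕ → ℕ}
    (hX : X' = X.ren (liftN Ψ.len ρ))
    (hp : ∀ i, oProj (Ψ.cren ρ) (liftN Ψ.len ρ i) = (oProj Ψ i).ren (Fitch.liftRen ρ)) :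
    X'.sub (oProj (Ψ.cren ρ)) = (X.sub (oProj Ψ)).ren (Fitch.liftRen ρ) := by
  rw [hX, Tm.sub_ren, Tm.ren_sub]; congr 1; exact funext hp

set_option linter.unusedSimpArgs false in
mutual
theorem DTy.o_cren : ∀ {A : DTy} {n : ℕ} (ρ : ℕ → ℕ), DTy.Sc n A →
    oTy n (A.cren ρ) = (oTy n A).ren (liftN n ρ) ∧ DTy.Sc n (A.cren ρ)
  | .ty, _, _, _ => ⟨rfl, trivial⟩
  | .trm M, _, ρ, h => by
    have := DTm.o_cren (M := M) ρ h
    simpa [oTy, Tm.ren, DTy.Sc, DTy.cren] using this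
  | .pi A B, _, ρ, h => by
    have h₁ := DTy.o_cren (A := A) ρ h.1
    have h₂ := DTy.o_cren (A := B) ρ h.2
    simp [oTy, Tm.ren, DTy.Sc, DTy.cren, liftRen_liftN, h₁, h₂]
theorem DTm.o_cren : ∀ {M : DTm} {n : ℕ} (ρ : ℕ → ℕ), DTm.Sc n M →
    oTm n (M.cren ρ) = (oTm n M).ren (liftN n ρ) ∧ DTm.Sc n (M.cren ρ)
  | .var i, n, _, h => by
    refine ⟨?_, h⟩
    simp only [DTm.Sc] at h
    simp only [DTm.cren, oTm, Tm.ren, liftN]; rw [if_pos (by omega)]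
  | .lam A B M, _, ρ, h => by
    have h₁ := DTy.o_cren (A := A) ρ h.1
    have h₂ := DTy.o_cren (A := B) ρ h.2.1
    have h₃ := DTm.o_cren (M := M) ρ h.2.2
    simp [oTm, Tm.ren, Fitch.Ty.ren, DTm.Sc, DTm.cren, liftRen_liftN, h₁, h₂, h₃]
  | .app A B M N, _, ρ, h => by
    have h₁ := DTy.o_cren (A := A) ρ h.1
    have h₂ := DTy.o_cren (A := B) ρ h.2.1
    have h₃ := DTm.o_cren (M := M) ρ h.2.2.1
    have h₄ := DTm.o_cren (M := N) ρ h.2.2.2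
    simp [oTm, Tm.ren, Fitch.Ty.ren, DTm.Sc, DTm.cren, liftRen_liftN, h₁, h₂, h₃, h₄]
  | .unbox Φ A t σ, n, ρ, h => by
    have h₁ := DCtx.o_cren (Ψ := Φ) ρ h.1
    have h₂ := DTy.o_cren (A := A) ρ h.2.1
    have h₃ := CTm.o_cren (t := t) ρ h.2.2.1
    have h₄ := DSub.o_cren (σ := σ) ρ h.2.2.2
    refine ⟨?_, h₁.2.2.2, by rw [DCtx.len_cren]; exact h₂.2, h₃.2,
      by rw [DCtx.len_cren]; exact h₄.2⟩
    have e₁ := sub_oProj_ren h₂.1 h₁.2.1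
    have e := Ty_up_ren_liftN (.pi (.elc (oCode Φ)) (.el ((oTy Φ.len A).sub (oProj Φ)))) n ρ
    simp only [DTm.cren, oTm, Tm.ren, up_ren_liftN, e, DCtx.len_cren, e₁, h₁.1, h₃.1]
    have e₃ : (oTup (Φ.cren ρ)).sub (oSub n (DSub.cren ρ σ)) =
        ((oTup Φ).sub (oSub n σ)).ren (liftN n ρ) := by
      rw [h₁.2.2.1, Tm.sub_ren, Tm.ren_sub]; congr 1; exact funext h₄.1
    simp only [Fitch.Ty.up, Fitch.Ty.ren, Fitch.Ty.pi.injEq] at e ⊢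
    rw [e.1, e.2, e₃]
  | .o, _, _, _ => ⟨rfl, trivial⟩
  | .arr a b, _, ρ, h => by
    have h₁ := DTm.o_cren (M := a) ρ h.1
    have h₂ := DTm.o_cren (M := b) ρ h.2
    simp [oTm, Tm.ren, DTm.Sc, DTm.cren, h₁, h₂]
  | .lamc a b f, _, ρ, h => by
    have h₁ := DTm.o_cren (M := a) ρ h.1
    have h₂ := DTm.o_cren (M := b) ρ h.2.1
    have h₃ := DTm.o_cren (M := f) ρ h.2.2
    simp [oTm, Tm.ren, DTm.Sc, DTm.cren, h₁, h₂, h₃]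
  | .appc a b m k, _, ρ, h => by
    have h₁ := DTm.o_cren (M := a) ρ h.1
    have h₂ := DTm.o_cren (M := b) ρ h.2.1
    have h₃ := DTm.o_cren (M := m) ρ h.2.2.1
    have h₄ := DTm.o_cren (M := k) ρ h.2.2.2
    simp [oTm, Tm.ren, DTm.Sc, DTm.cren, h₁, h₂, h₃, h₄]
theorem DSub.o_cren : ∀ {σ : DSub} {n m : ℕ} (ρ : ℕ → ℕ), DSub.Sc n m σ →
    (∀ i, oSub n (DSub.cren ρ σ) (liftN m ρ i) = (oSub n σ i).ren (liftN n ρ)) ∧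
      DSub.Sc n m (DSub.cren ρ σ)
  | .nil, n, m, ρ, h => by
    refine ⟨?_, h⟩
    obtain rfl := h
    rw [liftN_one]
    rintro (_ | i)
    · rfl
    · simp [Fitch.liftRen, DSub.cren, oSub, scons, Tm.ren, liftN]
  | .wk k, n, m, ρ, h => by
    refine ⟨fun i => ?_, h⟩
    simp only [DSub.Sc] at h
    have e : i + k - n = i - m := by omega
    simp only [DSub.cren, oSub, Tm.ren, liftN, e]
    congr 1; split <;> split <;> omega
  | .cons σ M, n, m, ρ, h => by
    have h₁ := DSub.o_cren (σ := σ) ρ h.2.1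
    have h₂ := DTm.o_cren (M := M) ρ h.2.2
    refine ⟨?_, h.1, h₁.2, h₂.2⟩
    obtain ⟨m, rfl⟩ : ∃ k, m = k + 1 := ⟨m - 1, by have := h.1; omega⟩
    rw [← liftRen_liftN]
    rintro (_ | i)
    · exact h₂.1
    · exact h₁.1 i
theorem DCtx.o_cren : ∀ {Ψ : DCtx} (ρ : ℕ → ℕ), DCtx.Sc Ψ →
    oCode (Ψ.cren ρ) = (oCode Ψ).ren ρ ∧
      (∀ i, oProj (Ψ.cren ρ) (liftN Ψ.len ρ i) = (oProj Ψ i).ren (Fitch.liftRen ρ)) ∧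
      oTup (Ψ.cren ρ) = (oTup Ψ).ren (liftN Ψ.len ρ) ∧ DCtx.Sc (Ψ.cren ρ)
  | .nil, ρ, _ => ⟨rfl, fun i => congrArg Tm.var (congrFun (liftN_one ρ) i), rfl, trivial⟩
  | .var _, ρ, _ => ⟨rfl, fun i => congrArg Tm.var (congrFun (liftN_one ρ) i), rfl, trivial⟩
  | .snoc Ψ A, ρ, h => by
    have h₁ := DCtx.o_cren (Ψ := Ψ) ρ h.1
    have h₂ := DTy.o_cren (A := A) ρ h.2
    have e₁ := sub_oProj_ren h₂.1 h₁.2.1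
    have e₂ : oFam (Ψ.cren ρ) (A.cren ρ) = (oFam Ψ A).ren ρ := by
      simp only [oFam, Tm.ren, Fitch.Ty.ren, e₁, h₁.1, DCtx.len_cren]
    refine ⟨?_, ?_, ?_, h₁.2.2.2, by rw [DCtx.len_cren]; exact h₂.2⟩
    · rw [DCtx.cren, oCode_snoc, oCode_snoc, e₂, h₁.1]; rfl
    · intro i
      rw [DCtx.cren, oProj_snoc, oProj_snoc, e₂, h₁.1, DCtx.len, ← liftRen_liftN,
        ← up_one_ren, ← up_one_ren]
      cases i with
      | zero => rfl
      | succ i =>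
        simp only [Fitch.liftRen, scons, h₁.2.1, Tm.sub_ren, Tm.ren_sub]
        congr 1; funext j; cases j <;> rfl
    · rw [DCtx.cren, oTup_snoc, oTup_snoc, e₂, h₁.1, DCtx.len_cren, h₁.2.2.1, DCtx.len]
      simp only [Tm.ren, up_ren_liftN]
      rw [← liftRen_liftN, up_one_ren]; rfl
theorem CxTy.o_cren : ∀ {T : CxTy} (ρ : ℕ → ℕ), CxTy.Sc T →
    oCxTy (T.cren ρ) = (oCxTy T).ren ρ ∧ CxTy.Sc (T.cren ρ)
  | .tm Ψ A, ρ, h => by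
    have h₁ := DCtx.o_cren (Ψ := Ψ) ρ h.1
    have h₂ := DTy.o_cren (A := A) ρ h.2
    have e₁ := sub_oProj_ren h₂.1 h₁.2.1
    simp [CxTy.cren, oCxTy, CxTy.Sc, DCtx.len_cren, h₁.1, h₁.2.2.2, h₂.2, e₁, Fitch.Ty.ren]
  | .vr Ψ A, ρ, h => by
    have h₁ := DCtx.o_cren (Ψ := Ψ) ρ h.1
    have h₂ := DTy.o_cren (A := A) ρ h.2
    have e₁ := sub_oProj_ren h₂.1 h₁.2.1
    simp [CxTy.cren, oCxTy, CxTy.Sc, DCtx.len_cren, h₁.1, h₁.2.2.2, h₂.2, e₁, Fitch.Ty.ren]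
theorem CxObj.o_cren : ∀ {C : CxObj} (ρ : ℕ → ℕ), CxObj.Sc C →
    oCxObj (C.cren ρ) = (oCxObj C).ren ρ ∧ CxObj.Sc (C.cren ρ)
  | .mk Ψ M, ρ, h => by
    have h₁ := DCtx.o_cren (Ψ := Ψ) ρ h.1
    have h₂ := DTm.o_cren (M := M) ρ h.2
    have e₁ := sub_oProj_ren h₂.1 h₁.2.1
    simp [CxObj.cren, oCxObj, CxObj.Sc, DCtx.len_cren, h₁.1, h₁.2.2.2, h₂.2, e₁, Fitch.Ty.ren,
      Tm.ren]
theorem CTy.o_cren : ∀ {τ : CTy} (ρ : ℕ → ℕ), CTy.Sc τ →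
    oCTy (τ.cren ρ) = (oCTy τ).ren ρ ∧ CTy.Sc (τ.cren ρ)
  | .box T, ρ, h => by
    have h₁ := CxTy.o_cren (T := T) ρ h
    simp [CTy.cren, oCTy, CTy.Sc, h₁, Fitch.Ty.ren]
  | .pi τ₁ τ₂, ρ, h => by
    have h₁ := CTy.o_cren (τ := τ₁) ρ h.1
    have h₂ := CTy.o_cren (τ := τ₂) (liftRen ρ) h.2
    simp [CTy.cren, oCTy, CTy.Sc, h₁, h₂, Fitch.Ty.ren, liftRen_eq] at h₂ ⊢
    exact h₂
  | .ctx, _, _ => ⟨rfl, trivial⟩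
theorem CTm.o_cren : ∀ {t : CTm} (ρ : ℕ → ℕ), CTm.Sc t →
    oCTm (t.cren ρ) = (oCTm t).ren ρ ∧ CTm.Sc (t.cren ρ)
  | .var _, _, _ => ⟨rfl, trivial⟩
  | .box C, ρ, h => by
    have h₁ := CxObj.o_cren (C := C) ρ h
    simp [CTm.cren, oCTm, CTm.Sc, h₁, Tm.ren]
  | .fn τ t, ρ, h => by
    have h₁ := CTy.o_cren (τ := τ) ρ h.1
    have h₂ := CTm.o_cren (t := t) (liftRen ρ) h.2
    rw [liftRen_eq] at h₂
    simp [CTm.cren, oCTm, CTm.Sc, h₁, h₂, Tm.ren, liftRen_eq]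
  | .app τ₁ τ₂ t s, ρ, h => by
    have h₁ := CTy.o_cren (τ := τ₁) ρ h.1
    have h₂ := CTy.o_cren (τ := τ₂) (liftRen ρ) h.2.1
    have h₃ := CTm.o_cren (t := t) ρ h.2.2.1
    have h₄ := CTm.o_cren (t := s) ρ h.2.2.2
    rw [liftRen_eq] at h₂
    simp [CTm.cren, oCTm, CTm.Sc, h₁, h₂, h₃, h₄, Tm.ren, liftRen_eq]
  | .ctx Ψ, ρ, h => by
    have h₁ := DCtx.o_cren (Ψ := Ψ) ρ h
    simp [CTm.cren, oCTm, CTm.Sc, h₁, Tm.ren]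
end

end Cocon

namespace Fitch

theorem Ctx.append_lock_inj : ∀ {Γ Γ' : Ctx} {Δ Δ' : List Ty},
    Γ.lock.append Δ = Γ'.lock.append Δ' → Γ = Γ' ∧ Δ = Δ'
  | _, _, [], [], h => by cases h; exact ⟨rfl, rfl⟩
  | _, _, [], _ :: _, h => by cases h
  | _, _, _ :: _, [], h => by cases h
  | _, _, A :: Δ, A' :: Δ', h => by
    simp only [Ctx.append, Ctx.snoc.injEq] at h
    obtain ⟨rfl, rfl⟩ := Ctx.append_lock_inj h.1
    exact ⟨rfl, by rw [h.2]⟩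

namespace SbEq

theorem symm {Γ' θ θ' Γ} (h : SbEq Γ' θ θ' Γ) (hΓ : Wf Γ) : SbEq Γ' θ' θ Γ := by
  induction h with
  | nil h => exact .nil h
  | snoc h _ e ih =>
    have c := hΓ.tyWf.subEq h
    exact .snoc (ih hΓ.tail) (e.right.conv c) (e.symm.conv c)
  | lock _ h e e' ih => exact .lock (ih hΓ.of_lock) h e' e

theorem trans {Γ' θ θ' θ'' Γ} (h : SbEq Γ' θ θ' Γ) (h' : SbEq Γ' θ' θ'' Γ) (hΓ : Wf Γ) :
    SbEq Γ' θ θ'' Γ := by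
  induction h generalizing θ'' with
  | nil h => exact .nil h
  | snoc h ht e ih =>
    cases h' with
    | snoc h' _ e' =>
      exact .snoc (ih h' hΓ.tail) ht (e.trans (e'.conv (hΓ.tyWf.subEq h).symm))
  | @lock _ Δ _ _ _ _ _ _ hw e₁ e₂ ih =>
    obtain ⟨Γ₀, Δ', θ₀, θ₀', e, h₀, e₃, e₄⟩ := h'.split (Δ := [])
    obtain ⟨rfl, rfl⟩ := Ctx.append_lock_inj e
    refine .lock (θ' := θ₀') (ih ?_ hΓ.of_lock) hw e₁ e₄
    convert h₀ using 1
    funext n; exact Tm.up_injective ((e₂ n).symm.trans (e₃ n))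

theorem comp {Γ Γ' Γ'' θ θ' η η'} (h : SbEq Γ' θ θ' Γ) (h' : SbEq Γ'' η η' Γ') :
    SbEq Γ'' (fun n => (θ n).sub η) (fun n => (θ' n).sub η') Γ := by
  induction h generalizing Γ'' η η' with
  | nil _ => exact .nil h'.sb.wf
  | snoc _ h e ih =>
    exact .snoc (ih h') (by simpa only [Ty.sub_sub] using h.sub h'.sb)
      (by simpa only [Ty.sub_sub] using (e.sub h'.sb).trans (e.right.subEq h'))
  | @lock _ Δ _ _ _ _ _ h _ e₁ e₂ ih =>
    obtain ⟨Γ₀, Δ', θ₀, θ₀', rfl, h₀, e₃, e₄⟩ := h'.split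
    exact .lock (ih h₀) h'.sb.wf (fun n => by simp only [e₁, Tm.sub_up, e₃, Tm.up_sub])
      (fun n => by simp only [e₂, Tm.sub_up, e₄, Tm.up_sub])

theorem scons {Γ Γ' θ θ' t t' A} (h : SbEq Γ' θ θ' Γ) (e : TmEq Γ' t t' (A.sub θ)) :
    SbEq Γ' (scons t θ) (scons t' θ') (.snoc Γ A) := .snoc h e.left e

end SbEq

/-- The weakening substitution. -/
def wkn (n : ℕ) : ℕ → Tm := fun j => .var (j + n)

theorem Tm.up_eq (t : Tm) (k : ℕ) : t.up k = t.sub (wkn k) := t.ren_eq_sub _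
theorem Ty.up_eq (t : Ty) (k : ℕ) : t.up k = t.sub (wkn k) := t.ren_eq_sub _

theorem elc_wkn_scons (c t : Tm) (n : ℕ) :
    (Ty.elc (c.sub (wkn 1))).sub (scons t (wkn n)) = .elc (c.sub (wkn n)) :=
  congrArg Ty.elc (Tm.sub_sub _ _ _)

section Extension

variable {D Γ : Ctx} {c X : Tm} {θ : ℕ → Tm}

theorem HasTm.fam (hc : HasTm D c .ctx) (hX : HasTm (.snoc D (.elc c)) X .univ) :
    HasTm D (.lam (.elc c) X) (.pi (.elc c) .univ) := .lam (.elc hc) hX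

theorem TmEq.apT_lam {u : Tm} (hc : HasTm D c .ctx) (hX : HasTm (.snoc D (.elc c)) X .univ)
    (h : Sb Γ θ D) (hu : HasTm Γ u (.elc (c.sub θ))) :
    TmEq Γ (Fitch.apT (c.sub θ) ((Tm.lam (.elc c) X).sub θ) u) (X.sub (scons u θ)) .univ := by
  have hE : TyWf Γ (.elc (c.sub θ)) := .elc (hc.sub h)
  have := TmEq.piBeta hE (.univ (.snoc h.wf hE)) (hX.sub (h.lift kitTm (A := .elc c) hE)) hu
  rwa [Tm.sub_liftSub_inst] at this

theorem HasTm.fst_sub {u : Tm} (hc : HasTm D c .ctx) (hX : HasTm (.snoc D (.elc c)) X .univ)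
    (h : Sb Γ θ D) (hu : HasTm Γ u (.elc ((Tm.ext c (.lam (.elc c) X)).sub θ))) :
    HasTm Γ (.fst (c.sub θ) ((Tm.lam (.elc c) X).sub θ) u) (.elc (c.sub θ)) :=
  .fst (hc.sub h) ((HasTm.fam hc hX).sub h) hu

theorem HasTm.snd_sub {u : Tm} (hc : HasTm D c .ctx) (hX : HasTm (.snoc D (.elc c)) X .univ)
    (h : Sb Γ θ D) (hu : HasTm Γ u (.elc ((Tm.ext c (.lam (.elc c) X)).sub θ))) :
    HasTm Γ (.snd (c.sub θ) ((Tm.lam (.elc c) X).sub θ) u)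
      (.el (X.sub (scons (.fst (c.sub θ) ((Tm.lam (.elc c) X).sub θ) u) θ))) :=
  .conv (.snd (hc.sub h) ((HasTm.fam hc hX).sub h) hu)
    (.el (.apT_lam hc hX h (.fst_sub hc hX h hu)))

theorem HasTm.el_apT {t s : Tm} (hc : HasTm D c .ctx) (hX : HasTm (.snoc D (.elc c)) X .univ)
    (h : Sb Γ θ D) (ht : HasTm Γ t (.elc (c.sub θ))) (hs : HasTm Γ s (.el (X.sub (scons t θ)))) :
    HasTm Γ s (.el (Fitch.apT (c.sub θ) ((Tm.lam (.elc c) X).sub θ) t)) :=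
  .conv hs (.symm (.el (.apT_lam hc hX h ht)))

theorem HasTm.pair_sub {t s : Tm} (hc : HasTm D c .ctx) (hX : HasTm (.snoc D (.elc c)) X .univ)
    (h : Sb Γ θ D) (ht : HasTm Γ t (.elc (c.sub θ))) (hs : HasTm Γ s (.el (X.sub (scons t θ)))) :
    HasTm Γ (.pair (c.sub θ) ((Tm.lam (.elc c) X).sub θ) t s)
      (.elc ((Tm.ext c (.lam (.elc c) X)).sub θ)) :=
  .pair (hc.sub h) ((HasTm.fam hc hX).sub h) ht (.el_apT hc hX h ht hs)

theorem TmEq.pair_sub {t t' s s' : Tm} (hc : HasTm D c .ctx)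
    (hX : HasTm (.snoc D (.elc c)) X .univ)
    (h : Sb Γ θ D) (ht : TmEq Γ t t' (.elc (c.sub θ)))
    (hs : TmEq Γ s s' (.el (X.sub (scons t θ)))) :
    TmEq Γ (.pair (c.sub θ) ((Tm.lam (.elc c) X).sub θ) t s)
      (.pair (c.sub θ) ((Tm.lam (.elc c) X).sub θ) t' s')
      (.elc ((Tm.ext c (.lam (.elc c) X)).sub θ)) :=
  .pair (hc.sub h) (.refl (hc.sub h)) ((HasTm.fam hc hX).sub h) (.refl ((HasTm.fam hc hX).sub h))
    ht.left ht (.conv hs (.symm (.el (.apT_lam hc hX h ht.left))))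

end Extension

end Fitch

namespace Cocon

open Fitch (Tm Ty scons wkn Sb SbEq HasTm TmEq TyEq TyWf Wf Look kitTm)

theorem oProj_tail : ∀ (Ψ : DCtx) (i : ℕ), oProj Ψ (i + Ψ.len) = .var (i + 1)
  | .nil, _ => rfl
  | .var _, _ => rfl
  | .snoc Ψ A, i => by
    have := oProj_tail Ψ i
    rw [oProj_snoc, DCtx.len, ← Nat.add_assoc]; simp only [scons, this]; rfl

theorem up_sub_oProj (t : Tm) (Ψ : DCtx) : (t.up Ψ.len).sub (oProj Ψ) = t.up 1 := by
  rw [Tm.sub_up, Tm.up, Tm.ren_eq_sub]; congr 1; funext i; exact oProj_tail Ψ i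

/-- The telescope of a domain-level context. -/
def tel (K : Fitch.Ctx) : DCtx → Fitch.Ctx
  | .nil => K.lock.snoc (.elc .top)
  | .var y => K.lock.snoc (.elc (.unbox .ctx (.var y)))
  | .snoc Ψ A => (tel K Ψ).snoc (.el (oTy Ψ.len A))

theorem tel_eq (K : Fitch.Ctx) :
    ∀ Ψ : DCtx, ∃ Δ : List Ty, tel K Ψ = K.lock.append Δ ∧ Δ.length = Ψ.len
  | .nil => ⟨[_], rfl, rfl⟩
  | .var _ => ⟨[_], rfl, rfl⟩
  | .snoc Ψ A => by
    obtain ⟨Δ, e, h⟩ := tel_eq K Ψ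
    exact ⟨_ :: Δ, congrArg₂ _ e rfl, congrArg (· + 1) h⟩

/-- Domain-level contexts whose telescopes are well formed. -/
inductive SemCtx (K : Fitch.Ctx) : DCtx → Prop
  | nil : Wf K → SemCtx K .nil
  | var {y} : Wf K → Look K y (.box .ctx) → SemCtx K (.var y)
  | snoc {Ψ A} : SemCtx K Ψ → HasTm (tel K Ψ) (oTy Ψ.len A) .univ → SemCtx K (.snoc Ψ A)

theorem HasTm.unbox_ctx {K y} (h : Wf K) (l : Look K y (.box .ctx)) :
    HasTm K.lock (.unbox .ctx (.var y)) .ctx := by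
  have := HasTm.unbox (Δ := []) (.ctx (.lock h)) (.var h l) (.lock h)
  rw [List.length_nil, Tm.up_zero] at this
  exact this

namespace SemCtx

variable {K : Fitch.Ctx} {Ψ : DCtx} {A : DTy}

theorem wfBase (h : SemCtx K Ψ) : Wf K := by induction h <;> assumption

theorem tail (h : SemCtx K (.snoc Ψ A)) : SemCtx K Ψ := by cases h; assumption
theorem head (h : SemCtx K (.snoc Ψ A)) : HasTm (tel K Ψ) (oTy Ψ.len A) .univ := by
  cases h; assumption

theorem wf (h : SemCtx K Ψ) : Wf (tel K Ψ) := by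
  induction h with
  | nil h => exact .snoc (.lock h) (.elc (.top (.lock h)))
  | var h l => exact .snoc (.lock h) (.elc (HasTm.unbox_ctx h l))
  | snoc _ h ih => exact .snoc ih (.el h)

theorem wk (h : SemCtx K Ψ) : Sb (tel K Ψ) (wkn Ψ.len) K.lock := by
  obtain ⟨Δ, e, l⟩ := tel_eq K Ψ
  have := h.wf
  rw [e] at this ⊢
  rw [← l]; exact .up kitTm this

theorem code_proj (h : SemCtx K Ψ) : HasTm K.lock (oCode Ψ) .ctx ∧
    Sb (K.lock.snoc (.elc (oCode Ψ))) (oProj Ψ) (tel K Ψ) := by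
  induction h with
  | nil h =>
    exact ⟨.top (.lock h), .id kitTm (.snoc (.lock h) (.elc (.top (.lock h))))⟩
  | var h l =>
    have := HasTm.unbox_ctx h l
    exact ⟨this, .id kitTm (.snoc (.lock h) (.elc this))⟩
  | @snoc Ψ A h hA ih =>
    have hX := hA.sub ih.2
    have hE : HasTm K.lock (oCode (.snoc Ψ A)) .ctx := .ext ih.1 (.fam ih.1 hX)
    have hs : Sb (K.lock.snoc (.elc (oCode (.snoc Ψ A)))) (wkn 1) K.lock :=
      .up (Δ := [_]) kitTm (.snoc hE.wf (.elc hE))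
    have hv : HasTm (K.lock.snoc (.elc (oCode (.snoc Ψ A)))) (.var 0)
        (.elc ((oCode (.snoc Ψ A)).sub (wkn 1))) := by
      rw [← Tm.up_eq]; exact .var (.snoc hE.wf (.elc hE)) .here
    refine ⟨hE, ?_⟩
    rw [oProj_snoc, Tm.up_eq, Tm.up_eq]
    refine .scons ?_ ?_
    · exact ih.2.comp (.scons hs (.fst_sub ih.1 hX hs hv))
    · have := HasTm.snd_sub ih.1 hX hs hv
      rwa [Tm.sub_sub] at this

theorem code (h : SemCtx K Ψ) : HasTm K.lock (oCode Ψ) .ctx := h.code_proj.1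
theorem proj (h : SemCtx K Ψ) : Sb (K.lock.snoc (.elc (oCode Ψ))) (oProj Ψ) (tel K Ψ) :=
  h.code_proj.2

theorem wfCode (h : SemCtx K Ψ) : Wf (K.lock.snoc (.elc (oCode Ψ))) :=
  .snoc h.code.wf (.elc h.code)

theorem tup_beta (h : SemCtx K Ψ) : HasTm (tel K Ψ) (oTup Ψ) (.elc ((oCode Ψ).sub (wkn Ψ.len))) ∧
    SbEq (tel K Ψ) (fun i => (oProj Ψ i).sub (scons (oTup Ψ) (wkn Ψ.len))) Tm.var (tel K Ψ) := by
  have base : scons (.var 0) (wkn 1) = Tm.var := by funext i; cases i <;> rfl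
  induction h with
  | nil h =>
    have hw := (SemCtx.nil h).wf
    refine ⟨?_, ?_⟩
    · have := HasTm.var hw .here
      rw [Ty.up_eq] at this; exact this
    · have := SbEq.refl (.id kitTm hw)
      convert this using 2; rename_i i
      simp only [oTup, DCtx.len, base, Tm.sub_id]; rfl
  | var h l =>
    have hw := (SemCtx.var h l).wf
    refine ⟨?_, ?_⟩
    · have := HasTm.var hw .here
      rw [Ty.up_eq] at this; exact this
    · have := SbEq.refl (.id kitTm hw)
      convert this using 2; rename_i i
      simp only [oTup, DCtx.len, base, Tm.sub_id]; rfl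
  | @snoc Ψ A h hA ih =>
    have h' : SemCtx K (.snoc Ψ A) := .snoc h hA
    have hX := hA.sub h.proj
    have e₁ : ∀ t : Tm, t.sub (wkn (Ψ.len + 1)) = (t.sub (wkn Ψ.len)).up 1 := fun t => by
      rw [Tm.up_sub]; rfl
    have hs : Sb (tel K (.snoc Ψ A)) (wkn (Ψ.len + 1)) K.lock := h'.wk
    have ht : HasTm (tel K (.snoc Ψ A)) ((oTup Ψ).up 1)
        (.elc ((oCode Ψ).sub (wkn (Ψ.len + 1)))) := by
      rw [e₁]; exact ih.1.weaken (.el hA)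
    have e₂ : SbEq (tel K (.snoc Ψ A))
        (fun i => (oProj Ψ i).sub (scons ((oTup Ψ).up 1) (wkn (Ψ.len + 1)))) (wkn 1)
        (tel K Ψ) := by
      have := ih.2.weaken (B := .el (oTy Ψ.len A)) (.el hA)
      have hf : (fun i => (oProj Ψ i).sub (scons ((oTup Ψ).up 1) (wkn (Ψ.len + 1)))) =
          fun i => ((oProj Ψ i).sub (scons (oTup Ψ) (wkn Ψ.len))).up 1 := by
        funext i
        rw [Tm.up_sub]; congr 1; funext j; cases j <;> rfl
      rw [hf]; exact this
    have e₃ := hA.subEq e₂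
    have hv : HasTm (tel K (.snoc Ψ A)) (.var 0)
        (.el (((oTy Ψ.len A).sub (oProj Ψ)).sub
          (scons ((oTup Ψ).up 1) (wkn (Ψ.len + 1))))) := by
      rw [Tm.sub_sub]
      refine .conv (.var h'.wf .here) (.symm (.el ?_))
      rwa [← Tm.up_eq] at e₃
    have hp := HasTm.pair_sub h.code hX hs ht hv
    have ep := TmEq.fstBeta (h.code.sub hs) ((HasTm.fam h.code hX).sub hs) ht
      (.el_apT h.code hX hs ht hv)
    have eq := TmEq.sndBeta (h.code.sub hs) ((HasTm.fam h.code hX).sub hs) ht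
      (.el_apT h.code hX hs ht hv)
    have tup : oTup (.snoc Ψ A) = .pair ((oCode Ψ).sub (wkn (Ψ.len + 1)))
        ((oFam Ψ A).sub (wkn (Ψ.len + 1))) ((oTup Ψ).up 1) (.var 0) := by
      rw [oTup_snoc, Tm.up_eq, Tm.up_eq]
    refine ⟨by rw [tup]; exact hp, ?_⟩
    have up : ∀ t s : Tm, (t.up 1).sub (scons s (wkn (Ψ.len + 1))) = t.sub (wkn (Ψ.len + 1)) :=
      fun t s => Tm.sub_up _ _ _
    have eθ : (fun i => (oProj (.snoc Ψ A) i).sub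
          (scons (oTup (.snoc Ψ A)) (wkn (DCtx.snoc Ψ A).len))) =
        scons (.snd ((oCode Ψ).sub (wkn (Ψ.len + 1))) ((oFam Ψ A).sub (wkn (Ψ.len + 1)))
            (oTup (.snoc Ψ A)))
          (fun i => (oProj Ψ i).sub (scons (.fst ((oCode Ψ).sub (wkn (Ψ.len + 1)))
            ((oFam Ψ A).sub (wkn (Ψ.len + 1))) (oTup (.snoc Ψ A))) (wkn (Ψ.len + 1)))) := by
      funext i
      rw [oProj_snoc, DCtx.len]
      cases i with
      | zero => simp only [scons, Tm.sub, up]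
      | succ i =>
        simp only [scons, Tm.sub_sub]; congr 1; funext j
        cases j with
        | zero => simp only [scons, Tm.sub, up]
        | succ j => rfl
    rw [eθ]
    have e₄ : SbEq (tel K (.snoc Ψ A))
        (fun i => (oProj Ψ i).sub (scons (.fst ((oCode Ψ).sub (wkn (Ψ.len + 1)))
            ((oFam Ψ A).sub (wkn (Ψ.len + 1))) (oTup (.snoc Ψ A))) (wkn (Ψ.len + 1))))
        (fun i => (oProj Ψ i).sub (scons ((oTup Ψ).up 1) (wkn (Ψ.len + 1)))) (tel K Ψ) := by
      refine (SbEq.refl h.proj).comp (.scons (.refl hs) ?_)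
      rw [tup]; exact ep
    have e₅ := e₄.trans e₂ h.wf
    rw [← Fitch.scons_eta Tm.var]
    refine .scons e₅ ?_
    rw [tup]
    refine .conv eq (.trans (.el (.apT_lam h.code hX hs ht)) ?_)
    rw [Tm.sub_sub]
    exact .trans (.el e₃) (.symm (.el (hA.subEq (by rwa [tup] at e₅))))

theorem tup (h : SemCtx K Ψ) : HasTm (tel K Ψ) (oTup Ψ) (.elc ((oCode Ψ).sub (wkn Ψ.len))) :=
  h.tup_beta.1
theorem proj_tup (h : SemCtx K Ψ) :
    SbEq (tel K Ψ) (fun i => (oProj Ψ i).sub (scons (oTup Ψ) (wkn Ψ.len))) Tm.var (tel K Ψ) :=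
  h.tup_beta.2

theorem tup_proj (h : SemCtx K Ψ) : TmEq (K.lock.snoc (.elc (oCode Ψ)))
    ((oTup Ψ).sub (oProj Ψ)) (.var 0) (.elc ((oCode Ψ).sub (wkn 1))) := by
  have hv := h.wfCode
  have : HasTm (K.lock.snoc (.elc (oCode Ψ))) (.var 0) (.elc ((oCode Ψ).sub (wkn 1))) := by
    rw [← Tm.up_eq]; exact .var hv .here
  induction h with
  | nil h => exact .refl this
  | var h l => exact .refl this
  | @snoc Ψ A h hA ih =>
    have hX := hA.sub h.proj
    have ih := ih h.wfCode (by rw [← Tm.up_eq]; exact .var h.wfCode .here)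
    have hs : Sb (K.lock.snoc (.elc (oCode (.snoc Ψ A)))) (wkn 1) K.lock :=
      .up (Δ := [_]) kitTm hv
    have e := ih.sub (.scons hs (.fst_sub h.code hX hs this))
    rw [Tm.sub_sub, Fitch.elc_wkn_scons] at e
    have ee : (oTup (.snoc Ψ A)).sub (oProj (.snoc Ψ A)) =
        .pair ((oCode Ψ).sub (wkn 1)) ((oFam Ψ A).sub (wkn 1))
          ((oTup Ψ).sub fun i => oProj (.snoc Ψ A) (i + 1)) (oProj (.snoc Ψ A) 0) := by
      have e₁ := up_sub_oProj (oCode Ψ) (.snoc Ψ A)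
      have e₂ := up_sub_oProj (oFam Ψ A) (.snoc Ψ A)
      have e₃ := Tm.sub_up (oTup Ψ) 1 (oProj (.snoc Ψ A))
      rw [oTup_snoc, ← Tm.up_eq, ← Tm.up_eq, ← e₁, ← e₂, ← e₃]
      rfl
    rw [ee]
    have e' := TmEq.pair_sub h.code hX hs (t := (oTup Ψ).sub fun i => oProj (.snoc Ψ A) (i + 1))
      (t' := .fst ((oCode Ψ).sub (wkn 1)) ((oFam Ψ A).sub (wkn 1)) (.var 0))
      (s := oProj (.snoc Ψ A) 0) (s' := oProj (.snoc Ψ A) 0)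
      (by
        rw [oProj_snoc, Tm.up_eq, Tm.up_eq]
        exact e)
      (by
        refine .refl ?_
        rw [oProj_snoc, Tm.up_eq, Tm.up_eq]
        exact .conv (.snd_sub h.code hX hs this) (.el (.symm (hX.subEq (.scons (.refl hs) e)))))
    refine e'.trans ?_
    rw [oProj_snoc, Tm.up_eq, Tm.up_eq]
    exact .symm (.pairEta (h.code.sub hs) ((HasTm.fam h.code hX).sub hs) this)

end SemCtx

end Cocon

namespace Fitch

theorem SbV.id_snoc {Γ Γ' A A'} (h : Sb Γ' Tm.var Γ) (hA : TyWf Γ' A') (e : TyEq Γ' A A') :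
    Sb (.snoc Γ' A') Tm.var (.snoc Γ A) := by
  have := h.conv (A := A) hA (by rwa [Ty.sub_id])
  rwa [liftSub_id] at this

end Fitch

namespace Cocon

open Fitch (Tm Ty scons wkn Sb SbEq HasTm TmEq TyEq TyWf Wf Look kitTm)

/-- Pointwise equality of the open translations of domain-level contexts. -/
inductive CtxEqv (K : Fitch.Ctx) : DCtx → DCtx → Prop
  | nil : CtxEqv K .nil .nil
  | var {y} : CtxEqv K (.var y) (.var y)
  | snoc {Ψ Ψ' A A'} : CtxEqv K Ψ Ψ' → TmEq (tel K Ψ) (oTy Ψ.len A) (oTy Ψ.len A') .univ →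
      CtxEqv K (.snoc Ψ A) (.snoc Ψ' A')

namespace CtxEqv

variable {K : Fitch.Ctx} {Ψ Ψ' Ψ'' : DCtx}

theorem len (h : CtxEqv K Ψ Ψ') : Ψ.len = Ψ'.len := by
  induction h with
  | nil => rfl
  | var => rfl
  | snoc _ _ ih => exact congrArg (· + 1) ih

theorem refl (h : SemCtx K Ψ) : CtxEqv K Ψ Ψ := by
  induction h with
  | nil => exact .nil
  | var => exact .var
  | snoc _ h ih => exact .snoc ih (.refl h)

theorem sem_ids (h : CtxEqv K Ψ Ψ') (hΨ : SemCtx K Ψ) :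
    SemCtx K Ψ' ∧ Sb (tel K Ψ) Tm.var (tel K Ψ') ∧ Sb (tel K Ψ') Tm.var (tel K Ψ) := by
  induction h with
  | nil => exact ⟨hΨ, .id kitTm hΨ.wf, .id kitTm hΨ.wf⟩
  | var => exact ⟨hΨ, .id kitTm hΨ.wf, .id kitTm hΨ.wf⟩
  | snoc h e ih =>
    obtain ⟨h', i, j⟩ := ih hΨ.tail
    have e' := e.sub j
    simp only [Tm.sub_id] at e'
    have hA := e'.right
    rw [h.len] at hA
    refine ⟨.snoc h' hA, ?_, ?_⟩
    · rw [tel, tel, ← h.len]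
      exact i.id_snoc (.el hΨ.head) (.el e.symm)
    · rw [tel, tel, ← h.len]
      exact j.id_snoc (.el e'.right) (.el e')

theorem sem (h : CtxEqv K Ψ Ψ') (hΨ : SemCtx K Ψ) : SemCtx K Ψ' := (h.sem_ids hΨ).1
theorem id (h : CtxEqv K Ψ Ψ') (hΨ : SemCtx K Ψ) : Sb (tel K Ψ) Tm.var (tel K Ψ') :=
  (h.sem_ids hΨ).2.1
theorem di (h : CtxEqv K Ψ Ψ') (hΨ : SemCtx K Ψ) : Sb (tel K Ψ') Tm.var (tel K Ψ) :=
  (h.sem_ids hΨ).2.2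

theorem symm (h : CtxEqv K Ψ Ψ') (hΨ : SemCtx K Ψ) : CtxEqv K Ψ' Ψ := by
  induction h with
  | nil => exact .nil
  | var => exact .var
  | snoc h e ih =>
    have e' := e.symm.sub (h.di hΨ.tail)
    simp only [Tm.sub_id, h.len] at e'
    exact .snoc (ih hΨ.tail) e'

theorem trans (h : CtxEqv K Ψ Ψ') (h' : CtxEqv K Ψ' Ψ'') (hΨ : SemCtx K Ψ) : CtxEqv K Ψ Ψ'' := by
  induction h generalizing Ψ'' with
  | nil => exact h'
  | var => exact h'
  | snoc h e ih =>
    cases h' with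
    | snoc h' e' =>
      have e'' := e'.sub (h.id hΨ.tail)
      simp only [Tm.sub_id, ← h.len] at e''
      exact .snoc (ih h' hΨ.tail) (e.trans e'')

theorem code_proj (h : CtxEqv K Ψ Ψ') (hΨ : SemCtx K Ψ) :
    TmEq K.lock (oCode Ψ) (oCode Ψ') .ctx ∧
    SbEq (K.lock.snoc (.elc (oCode Ψ))) (oProj Ψ) (oProj Ψ') (tel K Ψ) := by
  induction h with
  | nil => exact ⟨.refl hΨ.code, .refl hΨ.proj⟩
  | var => exact ⟨.refl hΨ.code, .refl hΨ.proj⟩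
  | @snoc Ψ Ψ' A A' h e ih =>
    have h₀ := hΨ.tail
    obtain ⟨ec, ep⟩ := ih h₀
    have eX := (e.sub h₀.proj).trans (e.right.subEq ep)
    have eF : TmEq K.lock (oFam Ψ A) (oFam Ψ' A') (.pi (.elc (oCode Ψ)) .univ) := by
      rw [oFam, oFam, ← h.len]
      exact .lam (.elc h₀.code) (.elc ec) eX
    have eC : TmEq K.lock (oCode (.snoc Ψ A)) (oCode (.snoc Ψ' A')) .ctx := .ext h₀.code ec eF
    refine ⟨eC, ?_⟩
    have hX := hΨ.head.sub h₀.proj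
    have hE := hΨ.code
    have hs : Sb (K.lock.snoc (.elc (oCode (.snoc Ψ A)))) (wkn 1) K.lock :=
      .up (Δ := [_]) kitTm (.snoc hE.wf (.elc hE))
    have hv : HasTm (K.lock.snoc (.elc (oCode (.snoc Ψ A)))) (.var 0)
        (.elc ((oCode (.snoc Ψ A)).sub (wkn 1))) := by
      rw [← Tm.up_eq]; exact .var (.snoc hE.wf (.elc hE)) .here
    rw [oProj_snoc, oProj_snoc]
    simp only [Tm.up_eq]
    have hc' := h₀.code.sub hs
    have ec' := ec.sub hs
    have hF' := eF.left.sub hs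
    have eF' := eF.sub hs
    have e₁ := TmEq.fst hc' ec' hF' eF' (.refl hv)
    have e₂ := ep.comp (.scons (.refl hs) (A := .elc (oCode Ψ)) e₁)
    refine .scons e₂ ?_
    refine .conv (.snd hc' ec' hF' eF' hv (.refl hv)) ?_
    have := TmEq.apT_lam h₀.code hX hs (.fst hc' hF' hv)
    rw [Tm.sub_sub] at this
    exact .el this

theorem code (h : CtxEqv K Ψ Ψ') (hΨ : SemCtx K Ψ) : TmEq K.lock (oCode Ψ) (oCode Ψ') .ctx :=
  (h.code_proj hΨ).1
theorem proj (h : CtxEqv K Ψ Ψ') (hΨ : SemCtx K Ψ) :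
    SbEq (K.lock.snoc (.elc (oCode Ψ))) (oProj Ψ) (oProj Ψ') (tel K Ψ) := (h.code_proj hΨ).2

theorem tup (h : CtxEqv K Ψ Ψ') (hΨ : SemCtx K Ψ) :
    TmEq (tel K Ψ) (oTup Ψ) (oTup Ψ') (.elc ((oCode Ψ).sub (wkn Ψ.len))) := by
  have hΨ' := h.sem hΨ
  have t₀ := hΨ.tup
  have ec := (h.code hΨ).sub hΨ.wk
  have t₁ := hΨ'.tup.sub (h.id hΨ)
  simp only [Ty.sub_id, Tm.sub_id, ← h.len] at t₁
  have s := hΨ.wk.scons (A := .elc (oCode Ψ)) t₀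
  have e₁ := hΨ'.tup_proj.sub (.scons (h.len ▸ hΨ.wk)
    (A := .elc (oCode Ψ')) (.conv t₀ (.elc (by rwa [← h.len]))))
  have e₂ := (hΨ'.tup.subEq (Γ' := tel K Ψ) (θ := Tm.var)
    (θ' := fun i => (oProj Ψ' i).sub (scons (oTup Ψ) (wkn Ψ.len))) ?_)
  · rw [Tm.sub_sub, Fitch.elc_wkn_scons] at e₁
    simp only [Ty.sub_id, Tm.sub_id, ← h.len] at e₁ e₂
    exact .symm (.conv (e₂.trans (.conv e₁ (.refl t₁.tyWf))) (.elc ec.symm))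
  · have a := (h.proj hΨ).comp (.refl s)
    have b := (hΨ.proj_tup.symm hΨ.wf).trans a hΨ.wf
    exact (SbEq.refl (h.id hΨ)).comp b

end CtxEqv

end Cocon

namespace Fitch

/-- `(unbox t) u` for `t : □ (Π x : c. X)` declared before `n` variables. -/
def Tm.open (n : ℕ) (c X t u : Tm) : Tm :=
  .app ((Ty.elc c).up n) ((Ty.el X).ren (liftRen (· + n)))
    (.unbox ((Ty.pi (.elc c) (.el X)).up n) (t.up n)) u

theorem ren_liftRen_scons (X u : Tm) (n : ℕ) :
    ((Ty.el X).ren (liftRen (· + n))).inst u = .el (X.sub (scons u (wkn n))) := by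
  refine congrArg Ty.el ((Tm.sub_ren _ _ _).trans (congrArg (X.sub ·) ?_))
  funext i; cases i <;> rfl

theorem HasTm.open {K : Ctx} {Δ : List Ty} {c X t u : Tm} (hw : Wf (K.lock.append Δ))
    (hc : HasTm K.lock c .ctx) (hX : HasTm (K.lock.snoc (.elc c)) X .univ)
    (ht : HasTm K t (.box (.pi (.elc c) (.el X))))
    (hu : HasTm (K.lock.append Δ) u (.elc (c.sub (wkn Δ.length)))) :
    HasTm (K.lock.append Δ) (.open Δ.length c X t u) (.el (X.sub (scons u (wkn Δ.length)))) := by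
  have hp : TyWf K.lock (.pi (.elc c) (.el X)) := .pi (.elc hc) (.el hX)
  have h₁ := hp.weakens Δ hw
  have h₂ := HasTm.unbox hp ht hw
  rw [← ren_liftRen_scons]
  rw [← Tm.up_eq] at hu
  cases h₁ with
  | pi hA hB => exact .app hA hB h₂ hu

theorem TmEq.open {K : Ctx} {Δ : List Ty} {c c' X X' t t' u u' : Tm} (hw : Wf (K.lock.append Δ))
    (ec : TmEq K.lock c c' .ctx) (eX : TmEq (K.lock.snoc (.elc c)) X X' .univ)
    (et : TmEq K t t' (.box (.pi (.elc c) (.el X))))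
    (eu : TmEq (K.lock.append Δ) u u' (.elc (c.sub (wkn Δ.length)))) :
    TmEq (K.lock.append Δ) (.open Δ.length c X t u) (.open Δ.length c' X' t' u')
      (.el (X.sub (scons u (wkn Δ.length)))) := by
  have hp : TyEq K.lock (.pi (.elc c) (.el X)) (.pi (.elc c') (.el X')) :=
    .pi (.elc ec.left) (.elc ec) (.el eX)
  have h₂ := TmEq.unbox hp.left hp et hw
  have h₁ := hp.left.weakens Δ hw
  have e₁ := (TyEq.elc ec).weakens Δ hw
  rw [← ren_liftRen_scons]
  rw [← Tm.up_eq] at eu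
  cases h₁ with
  | pi hA hB =>
    have e₂ : TyEq ((K.lock.append Δ).snoc ((Ty.elc c).up Δ.length))
        ((Ty.el X).ren (liftRen (· + Δ.length))) ((Ty.el X').ren (liftRen (· + Δ.length))) := by
      have := (TyEq.el eX).sub ((SbV.up kitTm hw).lift kitTm (A := .elc c)
        ((Ty.up_eq (.elc c) Δ.length) ▸ hA))
      simp only [Ty.ren_eq_sub, Ty.up] at this ⊢
      convert this using 2 <;> (funext i; cases i <;> rfl)
    exact .app hA e₁ hB e₂ h₂ eu.left eu

theorem Tm.open_sub {n n' : ℕ} {c X t u : Tm} {θ η : ℕ → Tm}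
    (h : ∀ i, η (i + n) = (θ i).up n') :
    (Tm.open n c X t u).sub η =
      .open n' (c.sub θ) (X.sub (liftSub θ)) (t.sub θ) (u.sub η) := by
  have e : ∀ t : Tm, (t.up n).sub η = (t.sub θ).up n' := fun t => by
    rw [Tm.sub_up, Tm.up_sub]; congr 1; funext i; exact h i
  have e' : ∀ t : Ty, (t.up n).sub η = (t.sub θ).up n' := fun t => by
    rw [Ty.sub_up, Ty.up_sub]; congr 1; funext i; exact h i
  have e'' : ∀ t : Ty, (t.ren (liftRen (· + n))).sub (liftSub η) =
      (t.sub (liftSub θ)).ren (liftRen (· + n')) := fun t => by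
    rw [Ty.sub_ren, Ty.ren_sub]; congr 1; funext i
    cases i with
    | zero => rfl
    | succ i =>
      have : liftSub η (i + n + 1) = (θ i).ren (· + (n' + 1)) := by
        rw [liftSub, h, Tm.up_up]; rfl
      simp only [liftRen, liftSub, Tm.up, Tm.ren_ren]
      exact this
  rw [Tm.open, Tm.open, Tm.sub, Tm.sub, e, e', e', e'']
  rfl

end Fitch

namespace Cocon

open Fitch (Tm Ty scons wkn Sb SbEq HasTm TmEq TyEq TyWf Wf Look kitTm)

theorem oTm_unbox (n : ℕ) (Φ : DCtx) (A : DTy) (t : CTm) (σ : DSub) :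
    oTm n (.unbox Φ A t σ) = .open n (oCode Φ) ((oTy Φ.len A).sub (oProj Φ)) (oCTm t)
      ((oTup Φ).sub (oSub n σ)) := rfl

/-- `a` is the code of the type declared for variable `i`. -/
inductive Decl : DCtx → ℕ → Tm → Prop
  | here {Ψ A} : Decl (.snoc Ψ A) 0 ((oTy Ψ.len A).up 1)
  | there {Ψ A i a} : Decl Ψ i a → Decl (.snoc Ψ A) (i + 1) (a.up 1)

mutual
/-- `A` is a type over `Ψ`, as far as its open translation is concerned. -/
def DTy.OK : Fitch.Ctx → DCtx → DTy → Prop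
  | _, _, .ty => True
  | K, Ψ, .trm M => DTm.OK K Ψ M .tyc
  | K, Ψ, .pi A B => DTy.OK K Ψ A ∧ DTy.OK K (.snoc Ψ A) B
termination_by structural _ _ A => A

/-- `M` is a term over `Ψ` of the type with code `a`, as far as its open translation is
concerned. -/
def DTm.OK : Fitch.Ctx → DCtx → DTm → Tm → Prop
  | K, Ψ, .var i, c => ∃ a, Decl Ψ i a ∧ TmEq (tel K Ψ) a c .univ
  | K, Ψ, .lam A B M, c => DTy.OK K Ψ A ∧ DTy.OK K (.snoc Ψ A) B ∧
      DTm.OK K (.snoc Ψ A) M (oTy (Ψ.len + 1) B) ∧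
      TmEq (tel K Ψ) (.pic (oTy Ψ.len A) (oTy (Ψ.len + 1) B)) c .univ
  | K, Ψ, .app A B M N, c => DTy.OK K Ψ A ∧ DTy.OK K (.snoc Ψ A) B ∧
      DTm.OK K Ψ M (.pic (oTy Ψ.len A) (oTy (Ψ.len + 1) B)) ∧ DTm.OK K Ψ N (oTy Ψ.len A) ∧
      TmEq (tel K Ψ) ((oTy (Ψ.len + 1) B).inst (oTm Ψ.len N)) c .univ
  | K, Ψ, .unbox Φ A t σ, c => DCtx.OK K Φ ∧ DTy.OK K Φ A ∧
      CTm.OK K t (.box (.pi (.elc (oCode Φ)) (.el ((oTy Φ.len A).sub (oProj Φ))))) ∧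
      DSub.OK K Ψ σ Φ ∧ TmEq (tel K Ψ) ((oTy Φ.len A).sub (oSub Ψ.len σ)) c .univ
  | K, Ψ, .o, c => TmEq (tel K Ψ) .tyc c .univ
  | K, Ψ, .arr a b, c => DTm.OK K Ψ a .tyc ∧ DTm.OK K Ψ b .tyc ∧ TmEq (tel K Ψ) .tyc c .univ
  | K, Ψ, .lamc a b f, c => DTm.OK K Ψ a .tyc ∧ DTm.OK K Ψ b .tyc ∧
      DTm.OK K Ψ f (.pic (.trmc (oTm Ψ.len a)) (.trmc ((oTm Ψ.len b).up 1))) ∧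
      TmEq (tel K Ψ) (.trmc (.arr (oTm Ψ.len a) (oTm Ψ.len b))) c .univ
  | K, Ψ, .appc a b m n, c => DTm.OK K Ψ a .tyc ∧ DTm.OK K Ψ b .tyc ∧
      DTm.OK K Ψ m (.trmc (.arr (oTm Ψ.len a) (oTm Ψ.len b))) ∧
      DTm.OK K Ψ n (.trmc (oTm Ψ.len a)) ∧ TmEq (tel K Ψ) (.trmc (oTm Ψ.len b)) c .univ
termination_by structural _ _ M _ => M

def DSub.OK : Fitch.Ctx → DCtx → DSub → DCtx → Prop
  | _, _, .nil, Φ => Φ = .nil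
  | K, Ψ, .wk k, Φ => ∃ Φ₀, Drop Ψ k Φ₀ ∧ CtxEqv K Φ₀ Φ
  | K, Ψ, .cons σ M, Φ => ∃ Φ₀ A, Φ = .snoc Φ₀ A ∧ DSub.OK K Ψ σ Φ₀ ∧
      DTm.OK K Ψ M ((oTy Φ₀.len A).sub (oSub Ψ.len σ))
termination_by structural _ _ σ _ => σ

def DCtx.OK : Fitch.Ctx → DCtx → Prop
  | _, .nil => True
  | K, .var y => Look K y (.box .ctx)
  | K, .snoc Ψ A => DCtx.OK K Ψ ∧ DTy.OK K Ψ A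
termination_by structural _ Ψ => Ψ

def CxTy.OK : Fitch.Ctx → CxTy → Prop
  | K, .tm Ψ A => DCtx.OK K Ψ ∧ DTy.OK K Ψ A
  | K, .vr Ψ A => DCtx.OK K Ψ ∧ DTy.OK K Ψ A
termination_by structural _ T => T

def CxObj.OK : Fitch.Ctx → CxObj → Ty → Prop
  | K, .mk Ψ M, T => DCtx.OK K Ψ ∧ ∃ a, DTm.OK K Ψ M a ∧
      TyEq K.lock (.pi (.elc (oCode Ψ)) (.el (a.sub (oProj Ψ)))) T
termination_by structural _ C _ => C

def CTy.OK : Fitch.Ctx → CTy → Prop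
  | K, .box T => CxTy.OK K T
  | K, .pi τ₁ τ₂ => CTy.OK K τ₁ ∧ CTy.OK (K.snoc (oCTy τ₁)) τ₂
  | _, .ctx => True
termination_by structural _ τ => τ

def CTm.OK : Fitch.Ctx → CTm → Ty → Prop
  | K, .var y, T => ∃ A, Look K y A ∧ TyEq K A T
  | K, .box C, T => ∃ A, CxObj.OK K C A ∧ TyEq K (.box A) T
  | K, .fn τ t, T => CTy.OK K τ ∧ ∃ B, CTm.OK (K.snoc (oCTy τ)) t B ∧
      TyEq K (.pi (oCTy τ) B) T
  | K, .app τ₁ τ₂ t s, T => CTy.OK K τ₁ ∧ CTy.OK (K.snoc (oCTy τ₁)) τ₂ ∧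
      CTm.OK K t (.pi (oCTy τ₁) (oCTy τ₂)) ∧ CTm.OK K s (oCTy τ₁) ∧
      TyEq K ((oCTy τ₂).inst (oCTm s)) T
  | K, .ctx Ψ, T => DCtx.OK K Ψ ∧ TyEq K (.box .ctx) T
termination_by structural _ t _ => t
end

theorem Decl.lt {Ψ i a} (h : Decl Ψ i a) : i + 1 < Ψ.len := by
  induction h with
  | @here Ψ _ => have := Ψ.one_le_len; simp only [DCtx.len]; omega
  | there _ ih => simp only [DCtx.len]; omega

theorem Decl.look {K Ψ i a} (h : Decl Ψ i a) : Look (tel K Ψ) i (.el a) := by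
  induction h with
  | here => exact .here
  | there _ ih => exact .there ih

theorem Drop.len {Ψ k Φ} (h : Drop Ψ k Φ) : Ψ.len = Φ.len + k := by
  induction h with
  | zero => rfl
  | succ _ ih => simp only [DCtx.len, ih]; omega

theorem Drop.sem {K Ψ k Φ} (h : Drop Ψ k Φ) (hΨ : SemCtx K Ψ) : SemCtx K Φ := by
  induction h with
  | zero => exact hΨ
  | succ _ ih => exact ih hΨ.tail

theorem Drop.sb {K Ψ k Φ} (h : Drop Ψ k Φ) (hΨ : SemCtx K Ψ) :
    Sb (tel K Ψ) (wkn k) (tel K Φ) := by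
  induction h with
  | zero => exact .id kitTm hΨ.wf
  | succ _ ih => exact (ih hΨ.tail).weaken kitTm (.el hΨ.head)

mutual
theorem DTy.OK.sc : ∀ {A : DTy} {K Ψ}, A.OK K Ψ → A.Sc Ψ.len
  | .ty, _, _, _ => trivial
  | .trm _, _, _, h => DTm.OK.sc h
  | .pi _ _, _, _, h => ⟨DTy.OK.sc h.1, DTy.OK.sc h.2⟩
theorem DTm.OK.sc : ∀ {M : DTm} {K Ψ a}, M.OK K Ψ a → M.Sc Ψ.len
  | .var _, _, _, _, ⟨_, h, _⟩ => h.lt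
  | .lam _ _ _, _, _, _, ⟨h₁, h₂, h₃, _⟩ => ⟨DTy.OK.sc h₁, DTy.OK.sc h₂, DTm.OK.sc h₃⟩
  | .app _ _ _ _, _, _, _, ⟨h₁, h₂, h₃, h₄, _⟩ =>
    ⟨DTy.OK.sc h₁, DTy.OK.sc h₂, DTm.OK.sc h₃, DTm.OK.sc h₄⟩
  | .unbox _ _ _ _, _, _, _, ⟨h₁, h₂, h₃, h₄, _⟩ =>
    ⟨DCtx.OK.sc h₁, DTy.OK.sc h₂, CTm.OK.sc h₃, DSub.OK.sc h₄⟩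
  | .o, _, _, _, _ => trivial
  | .arr _ _, _, _, _, ⟨h₁, h₂, _⟩ => ⟨DTm.OK.sc h₁, DTm.OK.sc h₂⟩
  | .lamc _ _ _, _, _, _, ⟨h₁, h₂, h₃, _⟩ => ⟨DTm.OK.sc h₁, DTm.OK.sc h₂, DTm.OK.sc h₃⟩
  | .appc _ _ _ _, _, _, _, ⟨h₁, h₂, h₃, h₄, _⟩ =>
    ⟨DTm.OK.sc h₁, DTm.OK.sc h₂, DTm.OK.sc h₃, DTm.OK.sc h₄⟩
theorem DSub.OK.sc : ∀ {σ : DSub} {K Ψ Φ}, σ.OK K Ψ Φ → σ.Sc Ψ.len Φ.len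
  | .nil, _, _, _, h => by rw [DSub.OK] at h; subst h; rfl
  | .wk _, _, _, _, ⟨_, d, e⟩ => ⟨by rw [d.len, e.len], DCtx.one_le_len _⟩
  | .cons _ _, _, _, _, ⟨Φ₀, _, e, h₁, h₂⟩ => by
    subst e
    exact ⟨Nat.succ_le_succ Φ₀.one_le_len, DSub.OK.sc h₁, DTm.OK.sc h₂⟩
theorem DCtx.OK.sc : ∀ {Ψ : DCtx} {K}, Ψ.OK K → Ψ.Sc
  | .nil, _, _ => trivial
  | .var _, _, _ => trivial
  | .snoc _ _, _, h => ⟨DCtx.OK.sc h.1, DTy.OK.sc h.2⟩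
theorem CxTy.OK.sc : ∀ {T : CxTy} {K}, T.OK K → T.Sc
  | .tm _ _, _, h => ⟨DCtx.OK.sc h.1, DTy.OK.sc h.2⟩
  | .vr _ _, _, h => ⟨DCtx.OK.sc h.1, DTy.OK.sc h.2⟩
theorem CxObj.OK.sc : ∀ {C : CxObj} {K T}, C.OK K T → C.Sc
  | .mk _ _, _, _, ⟨h₁, _, h₂, _⟩ => ⟨DCtx.OK.sc h₁, DTm.OK.sc h₂⟩
theorem CTy.OK.sc : ∀ {τ : CTy} {K}, τ.OK K → τ.Sc
  | .box _, _, h => CxTy.OK.sc h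
  | .pi _ _, _, h => ⟨CTy.OK.sc h.1, CTy.OK.sc h.2⟩
  | .ctx, _, _ => trivial
theorem CTm.OK.sc : ∀ {t : CTm} {K T}, t.OK K T → t.Sc
  | .var _, _, _, _ => trivial
  | .box _, _, _, ⟨_, h, _⟩ => CxObj.OK.sc h
  | .fn _ _, _, _, ⟨h₁, _, h₂, _⟩ => ⟨CTy.OK.sc h₁, CTm.OK.sc h₂⟩
  | .app _ _ _ _, _, _, ⟨h₁, h₂, h₃, h₄, _⟩ =>
    ⟨CTy.OK.sc h₁, CTy.OK.sc h₂, CTm.OK.sc h₃, CTm.OK.sc h₄⟩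
  | .ctx _, _, _, h => DCtx.OK.sc h.1
end

theorem HasTm.oUnbox {K Ψ Φ A t σ} (hΨ : SemCtx K Ψ) (hΦ : SemCtx K Φ)
    (hA : HasTm (tel K Φ) (oTy Φ.len A) .univ)
    (ht : HasTm K (oCTm t) (.box (.pi (.elc (oCode Φ)) (.el ((oTy Φ.len A).sub (oProj Φ))))))
    (hs : σ.Sc Ψ.len Φ.len) (hσ : Sb (tel K Ψ) (oSub Ψ.len σ) (tel K Φ)) :
    HasTm (tel K Ψ) (oTm Ψ.len (.unbox Φ A t σ)) (.el ((oTy Φ.len A).sub (oSub Ψ.len σ))) := by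
  obtain ⟨Δ, e, l⟩ := tel_eq K Ψ
  have wk : ∀ t : Tm, (t.sub (wkn Φ.len)).sub (oSub Ψ.len σ) = t.sub (wkn Ψ.len) := fun t => by
    rw [Tm.sub_sub]; congr 1; funext i; exact DSub.oSub_tail hs i
  have hu := hΦ.tup.sub hσ
  have hwf := hΨ.wf
  have e₁ := (SbEq.refl hσ)
  have e₂ := hΦ.proj_tup.comp e₁
  rw [oTm_unbox]
  have e₃ := hA.subEq e₂
  rw [Ty.sub, wk] at hu
  refine .conv (A := .el (((oTy Φ.len A).sub (oProj Φ)).sub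
    (scons ((oTup Φ).sub (oSub Ψ.len σ)) (wkn Ψ.len)))) ?_ ?_
  · rw [← l, e] at *
    exact .open hwf hΦ.code (hA.sub hΦ.proj) ht hu
  · refine .el ?_
    rw [Tm.sub_sub]
    have : (fun i => (oProj Φ i).sub (scons ((oTup Φ).sub (oSub Ψ.len σ)) (wkn Ψ.len))) =
        fun i => ((oProj Φ i).sub (scons (oTup Φ) (wkn Φ.len))).sub (oSub Ψ.len σ) := by
      funext i
      rw [Tm.sub_sub]; congr 1; funext j
      cases j with
      | zero => rfl
      | succ j => exact (DSub.oSub_tail hs j).symm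
    rw [this]
    exact e₃

mutual
theorem DTy.OK.typed : ∀ {A : DTy} {K Ψ}, A.OK K Ψ → SemCtx K Ψ →
    HasTm (tel K Ψ) (oTy Ψ.len A) .univ
  | .ty, _, _, _, hΨ => .tyc hΨ.wf
  | .trm _, _, _, h, hΨ => .trmc (DTm.OK.typed h hΨ)
  | .pi _ _, _, _, h, hΨ =>
    have hA := DTy.OK.typed h.1 hΨ
    .pic hA (DTy.OK.typed h.2 (.snoc hΨ hA))
theorem DTm.OK.typed : ∀ {M : DTm} {K Ψ a}, M.OK K Ψ a → SemCtx K Ψ →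
    HasTm (tel K Ψ) (oTm Ψ.len M) (.el a)
  | .var _, _, _, _, ⟨_, h, e⟩, hΨ => .conv (.var hΨ.wf h.look) (.el e)
  | .lam _ _ _, _, _, _, ⟨h₁, h₂, h₃, e⟩, hΨ =>
    have hA := DTy.OK.typed h₁ hΨ
    have hB := DTy.OK.typed h₂ (.snoc hΨ hA)
    .conv (.lam (.el hA) (DTm.OK.typed h₃ (.snoc hΨ hA))) (.trans (.symm (.elPi hA hB)) (.el e))
  | .app _ _ _ _, _, _, _, ⟨h₁, h₂, h₃, h₄, e⟩, hΨ =>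
    have hA := DTy.OK.typed h₁ hΨ
    have hB := DTy.OK.typed h₂ (.snoc hΨ hA)
    .conv (.app (.el hA) (.el hB) (.conv (DTm.OK.typed h₃ hΨ) (.elPi hA hB))
      (DTm.OK.typed h₄ hΨ)) (.el e)
  | .unbox _ _ _ _, _, _, _, ⟨h₁, h₂, h₃, h₄, e⟩, hΨ =>
    have hΦ := DCtx.OK.typed h₁ hΨ.wfBase
    .conv (HasTm.oUnbox hΨ hΦ (DTy.OK.typed h₂ hΦ) (CTm.OK.typed h₃ hΨ.wfBase) h₄.sc
      (DSub.OK.typed h₄ hΨ hΦ)) (.el e)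
  | .o, _, _, _, h, hΨ => .conv (.o hΨ.wf) (.el h)
  | .arr _ _, _, _, _, ⟨h₁, h₂, e⟩, hΨ =>
    .conv (.arr (DTm.OK.typed h₁ hΨ) (DTm.OK.typed h₂ hΨ)) (.el e)
  | .lamc _ _ _, _, _, _, ⟨h₁, h₂, h₃, e⟩, hΨ =>
    have ha := DTm.OK.typed h₁ hΨ
    have hb := DTm.OK.typed h₂ hΨ
    .conv (.lamc ha hb (.conv (DTm.OK.typed h₃ hΨ)
      (.elPi (.trmc ha) (.trmc (hb.weaken (.el (.trmc ha))))))) (.el e)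
  | .appc _ _ _ _, _, _, _, ⟨h₁, h₂, h₃, h₄, e⟩, hΨ =>
    .conv (.appc (DTm.OK.typed h₁ hΨ) (DTm.OK.typed h₂ hΨ) (DTm.OK.typed h₃ hΨ)
      (DTm.OK.typed h₄ hΨ)) (.el e)
theorem DSub.OK.typed : ∀ {σ : DSub} {K Ψ Φ}, σ.OK K Ψ Φ → SemCtx K Ψ → SemCtx K Φ →
    Sb (tel K Ψ) (oSub Ψ.len σ) (tel K Φ)
  | .nil, _, _, _, h, hΨ, _ => by
    rw [DSub.OK] at h; subst h
    exact hΨ.wk.scons (.unit hΨ.wf)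
  | .wk _, _, _, _, ⟨_, d, e⟩, hΨ, _ => (e.id (d.sem hΨ)).comp (d.sb hΨ)
  | .cons _ _, _, _, _, ⟨_, _, e, h₁, h₂⟩, hΨ, hΦ => by
    subst e
    exact (DSub.OK.typed h₁ hΨ hΦ.tail).scons (DTm.OK.typed h₂ hΨ)
theorem DCtx.OK.typed : ∀ {Ψ : DCtx} {K}, Ψ.OK K → Wf K → SemCtx K Ψ
  | .nil, _, _, hK => .nil hK
  | .var _, _, h, hK => .var hK h
  | .snoc _ _, _, h, hK =>
    have hΨ := DCtx.OK.typed h.1 hK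
    .snoc hΨ (DTy.OK.typed h.2 hΨ)
theorem CxTy.OK.typed : ∀ {T : CxTy} {K}, T.OK K → Wf K → TyWf K.lock (oCxTy T)
  | .tm _ _, _, h, hK =>
    have hΨ := DCtx.OK.typed h.1 hK
    .pi (.elc hΨ.code) (.el ((DTy.OK.typed h.2 hΨ).sub hΨ.proj))
  | .vr _ _, _, h, hK =>
    have hΨ := DCtx.OK.typed h.1 hK
    .pi (.elc hΨ.code) (.el ((DTy.OK.typed h.2 hΨ).sub hΨ.proj))
theorem CxObj.OK.typed : ∀ {C : CxObj} {K T}, C.OK K T → Wf K → HasTm K.lock (oCxObj C) T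
  | .mk _ _, _, _, ⟨h₁, _, h₂, e⟩, hK =>
    have hΨ := DCtx.OK.typed h₁ hK
    .conv (.lam (.elc hΨ.code) ((DTm.OK.typed h₂ hΨ).sub hΨ.proj)) e
theorem CTy.OK.typed : ∀ {τ : CTy} {K}, τ.OK K → Wf K → TyWf K (oCTy τ)
  | .box _, _, h, hK => .box (CxTy.OK.typed h hK)
  | .pi _ _, _, h, hK =>
    have h₁ := CTy.OK.typed h.1 hK
    .pi h₁ (CTy.OK.typed h.2 (.snoc hK h₁))
  | .ctx, _, _, hK => .box (.ctx (.lock hK))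
theorem CTm.OK.typed : ∀ {t : CTm} {K T}, t.OK K T → Wf K → HasTm K (oCTm t) T
  | .var _, _, _, ⟨_, l, e⟩, hK => .conv (.var hK l) e
  | .box _, _, _, ⟨_, h, e⟩, hK => .conv (.box (CxObj.OK.typed h hK)) e
  | .fn _ _, _, _, ⟨h₁, _, h₂, e⟩, hK =>
    have h := CTy.OK.typed h₁ hK
    .conv (.lam h (CTm.OK.typed h₂ (.snoc hK h))) e
  | .app _ _ _ _, _, _, ⟨h₁, h₂, h₃, h₄, e⟩, hK =>
    have h := CTy.OK.typed h₁ hK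
    .conv (.app h (CTy.OK.typed h₂ (.snoc hK h)) (CTm.OK.typed h₃ hK) (CTm.OK.typed h₄ hK)) e
  | .ctx _, _, _, ⟨h, e⟩, hK => .conv (.box (DCtx.OK.typed h hK).code) e
end

theorem DTm.OK.conv : ∀ {M : DTm} {K Ψ a a'}, M.OK K Ψ a → TmEq (tel K Ψ) a a' .univ →
    M.OK K Ψ a'
  | .var _, _, _, _, _, ⟨a, h, e⟩, e' => ⟨a, h, e.trans e'⟩
  | .lam _ _ _, _, _, _, _, ⟨h₁, h₂, h₃, e⟩, e' => ⟨h₁, h₂, h₃, e.trans e'⟩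
  | .app _ _ _ _, _, _, _, _, ⟨h₁, h₂, h₃, h₄, e⟩, e' => ⟨h₁, h₂, h₃, h₄, e.trans e'⟩
  | .unbox _ _ _ _, _, _, _, _, ⟨h₁, h₂, h₃, h₄, e⟩, e' => ⟨h₁, h₂, h₃, h₄, e.trans e'⟩
  | .o, _, _, _, _, h, e' => TmEq.trans h e'
  | .arr _ _, _, _, _, _, ⟨h₁, h₂, e⟩, e' => ⟨h₁, h₂, e.trans e'⟩
  | .lamc _ _ _, _, _, _, _, ⟨h₁, h₂, h₃, e⟩, e' => ⟨h₁, h₂, h₃, e.trans e'⟩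
  | .appc _ _ _ _, _, _, _, _, ⟨h₁, h₂, h₃, h₄, e⟩, e' => ⟨h₁, h₂, h₃, h₄, e.trans e'⟩

theorem CTm.OK.conv : ∀ {t : CTm} {K T T'}, t.OK K T → TyEq K T T' → t.OK K T'
  | .var _, _, _, _, ⟨A, h, e⟩, e' => ⟨A, h, e.trans e'⟩
  | .box _, _, _, _, ⟨A, h, e⟩, e' => ⟨A, h, e.trans e'⟩
  | .fn _ _, _, _, _, ⟨h₁, B, h₂, e⟩, e' => ⟨h₁, B, h₂, e.trans e'⟩
  | .app _ _ _ _, _, _, _, ⟨h₁, h₂, h₃, h₄, e⟩, e' => ⟨h₁, h₂, h₃, h₄, e.trans e'⟩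
  | .ctx _, _, _, _, ⟨h, e⟩, e' => ⟨h, e.trans e'⟩

end Cocon

namespace Cocon

open Fitch (Tm Ty scons wkn Sb SbEq HasTm TmEq TyEq TyWf Wf Look kitTm)

/-! ### Conversion of contexts -/

theorem CtxEqv.tmEq {K Ψ Ψ' t t' a} (h : CtxEqv K Ψ Ψ') (hΨ : SemCtx K Ψ)
    (e : TmEq (tel K Ψ) t t' a) : TmEq (tel K Ψ') t t' a := by
  simpa only [Tm.sub_id, Ty.sub_id] using e.sub (h.di hΨ)

theorem Decl.convCtx {K Ψ Ψ' i a} (d : Decl Ψ i a) (h : CtxEqv K Ψ Ψ') (hΨ : SemCtx K Ψ) :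
    ∃ a', Decl Ψ' i a' ∧ TmEq (tel K Ψ) a a' .univ := by
  induction d generalizing Ψ' with
  | here =>
    cases h with
    | snoc h e =>
      refine ⟨_, .here, ?_⟩
      rw [← h.len]
      exact e.weaken (.el hΨ.head)
  | there d ih =>
    cases h with
    | snoc h e =>
      obtain ⟨a', d', e'⟩ := ih h hΨ.tail
      exact ⟨_, .there d', e'.weaken (.el hΨ.head)⟩

theorem Drop.convCtx {K Ψ Ψ' k Φ} (d : Drop Ψ k Φ) (h : CtxEqv K Ψ Ψ') :
    ∃ Φ', Drop Ψ' k Φ' ∧ CtxEqv K Φ Φ' := by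
  induction d generalizing Ψ' with
  | zero => exact ⟨_, .zero, h⟩
  | succ d ih =>
    cases h with
    | snoc h e =>
      obtain ⟨a', d', e'⟩ := ih h
      exact ⟨_, .succ d', e'⟩

mutual
theorem DTy.OK.convCtx : ∀ {A : DTy} {K Ψ Ψ'}, A.OK K Ψ → CtxEqv K Ψ Ψ' → SemCtx K Ψ →
    A.OK K Ψ'
  | .ty, _, _, _, _, _, _ => trivial
  | .trm _, _, _, _, h, e, hΨ => DTm.OK.convCtx h e hΨ
  | .pi _ _, _, _, _, h, e, hΨ =>
    have hA := DTy.OK.typed h.1 hΨ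
    ⟨DTy.OK.convCtx h.1 e hΨ, DTy.OK.convCtx h.2 (.snoc e (.refl hA)) (.snoc hΨ hA)⟩
theorem DTm.OK.convCtx : ∀ {M : DTm} {K Ψ Ψ' a}, M.OK K Ψ a → CtxEqv K Ψ Ψ' → SemCtx K Ψ →
    M.OK K Ψ' a
  | .var _, _, _, _, _, ⟨_, d, h⟩, e, hΨ => by
    obtain ⟨a', d', e'⟩ := d.convCtx e hΨ
    exact ⟨_, d', e.tmEq hΨ (e'.symm.trans h)⟩
  | .lam _ _ _, _, _, _, _, ⟨h₁, h₂, h₃, h₄⟩, e, hΨ => by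
    have hA := DTy.OK.typed h₁ hΨ
    have eA := CtxEqv.snoc e (.refl hA)
    have hΨA := SemCtx.snoc hΨ hA
    have l := e.len
    rw [DTm.OK]
    rw [← l]
    exact ⟨DTy.OK.convCtx h₁ e hΨ, DTy.OK.convCtx h₂ eA hΨA, DTm.OK.convCtx h₃ eA hΨA,
      e.tmEq hΨ h₄⟩
  | .app _ _ _ _, _, _, _, _, ⟨h₁, h₂, h₃, h₄, h₅⟩, e, hΨ => by
    have hA := DTy.OK.typed h₁ hΨ
    have eA := CtxEqv.snoc e (.refl hA)
    have hΨA := SemCtx.snoc hΨ hA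
    have l := e.len
    rw [DTm.OK]
    rw [← l]
    exact ⟨DTy.OK.convCtx h₁ e hΨ, DTy.OK.convCtx h₂ eA hΨA, DTm.OK.convCtx h₃ e hΨ,
      DTm.OK.convCtx h₄ e hΨ, e.tmEq hΨ h₅⟩
  | .unbox _ _ _ _, _, _, _, _, ⟨h₁, h₂, h₃, h₄, h₅⟩, e, hΨ => by
    have l := e.len
    rw [DTm.OK]
    rw [← l]
    exact ⟨h₁, h₂, h₃, DSub.OK.convCtx h₄ e hΨ, e.tmEq hΨ h₅⟩
  | .o, _, _, _, _, h, e, hΨ => e.tmEq hΨ h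
  | .arr _ _, _, _, _, _, ⟨h₁, h₂, h₃⟩, e, hΨ =>
    ⟨DTm.OK.convCtx h₁ e hΨ, DTm.OK.convCtx h₂ e hΨ, e.tmEq hΨ h₃⟩
  | .lamc _ _ _, _, _, _, _, ⟨h₁, h₂, h₃, h₄⟩, e, hΨ => by
    have l := e.len
    rw [DTm.OK]
    rw [← l]
    exact ⟨DTm.OK.convCtx h₁ e hΨ, DTm.OK.convCtx h₂ e hΨ, DTm.OK.convCtx h₃ e hΨ, e.tmEq hΨ h₄⟩
  | .appc _ _ _ _, _, _, _, _, ⟨h₁, h₂, h₃, h₄, h₅⟩, e, hΨ => by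
    have l := e.len
    rw [DTm.OK]
    rw [← l]
    exact ⟨DTm.OK.convCtx h₁ e hΨ, DTm.OK.convCtx h₂ e hΨ, DTm.OK.convCtx h₃ e hΨ,
      DTm.OK.convCtx h₄ e hΨ, e.tmEq hΨ h₅⟩
theorem DSub.OK.convCtx : ∀ {σ : DSub} {K Ψ Ψ' Φ}, σ.OK K Ψ Φ → CtxEqv K Ψ Ψ' → SemCtx K Ψ →
    σ.OK K Ψ' Φ
  | .nil, _, _, _, _, h, _, _ => h
  | .wk _, _, _, _, _, ⟨_, d, h⟩, e, hΨ => by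
    obtain ⟨_, d', e'⟩ := d.convCtx e
    exact ⟨_, d', (e'.symm (d.sem hΨ)).trans h (e'.sem (d.sem hΨ))⟩
  | .cons _ _, _, _, _, _, ⟨Φ, A, h, h₁, h₂⟩, e, hΨ => by
    have l := e.len
    refine ⟨Φ, A, h, DSub.OK.convCtx h₁ e hΨ, ?_⟩
    rw [← l]
    exact DTm.OK.convCtx h₂ e hΨ
end

theorem DSub.OK.convTarget : ∀ {σ : DSub} {K Ψ Φ Φ'}, σ.OK K Ψ Φ → CtxEqv K Φ Φ' →
    SemCtx K Ψ → SemCtx K Φ → σ.OK K Ψ Φ'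
  | .nil, _, _, _, _, h, e, _, _ => by
    rw [DSub.OK] at h ⊢; subst h; cases e; rfl
  | .wk _, _, _, _, _, ⟨_, d, h⟩, e, hΨ, _ => ⟨_, d, h.trans e (d.sem hΨ)⟩
  | .cons _ _, _, _, _, _, ⟨_, _, h, h₁, h₂⟩, e, hΨ, hΦ => by
    subst h
    cases e with
    | @snoc _ Φ' _ A' e eA =>
      refine ⟨Φ', A', rfl, DSub.OK.convTarget h₁ e hΨ hΦ.tail, h₂.conv ?_⟩
      rw [← e.len]
      exact eA.sub (h₁.typed hΨ hΦ.tail)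

/-! ### Weakening -/

/-- `Ψ'` arises from `Ψ` by inserting the declaration of `X` below the innermost `c` ones. -/
inductive Ins (K : Fitch.Ctx) (X : DTy) : ℕ → DCtx → DCtx → Prop
  | zero {Ψ} : HasTm (tel K Ψ) (oTy Ψ.len X) .univ → Ins K X 0 Ψ (.snoc Ψ X)
  | succ {c Ψ Ψ' A} : Ins K X c Ψ Ψ' → A.Sc Ψ.len →
      Ins K X (c + 1) (.snoc Ψ A) (.snoc Ψ' (A.shift c))

namespace Ins

variable {K : Fitch.Ctx} {X : DTy} {c : ℕ} {Ψ Ψ' : DCtx}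

theorem len (h : Ins K X c Ψ Ψ') : Ψ'.len = Ψ.len + 1 := by
  induction h with
  | zero => rfl
  | succ _ _ ih => exact congrArg (· + 1) ih

theorem lt (h : Ins K X c Ψ Ψ') : c < Ψ.len := by
  induction h with
  | zero => exact DCtx.one_le_len _
  | succ _ _ ih => exact Nat.succ_lt_succ ih

theorem oTy (h : Ins K X c Ψ Ψ') {A : DTy} (hA : A.Sc Ψ.len) :
    oTy Ψ'.len (A.shift c) = (oTy Ψ.len A).ren (skip c) := by
  rw [h.len]; exact (DTy.o_shift hA h.lt).1

theorem oTm (h : Ins K X c Ψ Ψ') {A : DTm} (hA : A.Sc Ψ.len) :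
    oTm Ψ'.len (A.shift c) = (oTm Ψ.len A).ren (skip c) := by
  rw [h.len]; exact (DTm.o_shift hA h.lt).1

theorem sb (h : Ins K X c Ψ Ψ') (hΨ : SemCtx K Ψ) :
    Sb (tel K Ψ') (fun i => .var (skip c i)) (tel K Ψ) := by
  induction h with
  | zero hX =>
    rw [skip_zero]
    exact (Fitch.SbV.id kitTm hΨ.wf).weaken kitTm (.el hX)
  | succ h hA ih =>
    have := (ih hΨ.tail).liftEl kitTm (hΨ.head.sub (ih hΨ.tail))
    rwa [Fitch.liftSub_var, liftRen_skip, ← Tm.ren_eq_sub, ← h.oTy hA] at this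

theorem tmEq (h : Ins K X c Ψ Ψ') (hΨ : SemCtx K Ψ) {a a'} (e : TmEq (tel K Ψ) a a' .univ) :
    TmEq (tel K Ψ') (a.ren (skip c)) (a'.ren (skip c)) .univ := by
  simp only [Tm.ren_eq_sub]
  exact e.sub (h.sb hΨ)

theorem decl (h : Ins K X c Ψ Ψ') {i a} (d : Decl Ψ i a) :
    Decl Ψ' (skip c i) (a.ren (skip c)) := by
  induction h generalizing i a with
  | zero => rw [skip_zero]; exact .there d
  | @succ c _ _ _ h hA ih =>
    have e : ∀ a : Tm, (a.up 1).ren (skip (c + 1)) = (a.ren (skip c)).up 1 := fun a => by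
      rw [← liftRen_skip, up_one_ren]
    rw [← liftRen_skip]
    cases d with
    | here => rw [liftRen_skip, e, ← h.oTy hA]; exact .here
    | there d => rw [liftRen_skip, e, ← liftRen_skip]; exact .there (ih d)

theorem drop_of_le (h : Ins K X c Ψ Ψ') {k Φ} (d : Drop Ψ k Φ) (hk : c ≤ k) :
    Drop Ψ' (k + 1) Φ := by
  induction h generalizing k with
  | zero => exact .succ d
  | succ h _ ih =>
    cases d with
    | zero => omega
    | succ d => exact .succ (ih d (by omega))

end Ins

theorem Drop.decl {Ψ k Φ i a} (d : Drop Ψ k Φ) (h : Decl Φ i a) : Decl Ψ (i + k) (a.up k) := by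
  induction d with
  | zero => rwa [Tm.up_zero]
  | @succ _ _ A _ _ ih => have := Decl.there (A := A) (ih h); rwa [Tm.up_up] at this

theorem Ins.snoc_of_drop {K X c Ψ Ψ' k Φ} (h : Ins K X c Ψ Ψ') (d : Drop Ψ k Φ) (hk : k < c) :
    ∃ Φ₁ A, Φ = .snoc Φ₁ A ∧ A.Sc Φ₁.len := by
  induction h generalizing k with
  | zero => omega
  | succ h hA ih =>
    cases d with
    | zero => exact ⟨_, _, rfl, hA⟩
    | succ d => exact ih d (by omega)

theorem Drop.snoc_tail {Ψ k Φ A} (d : Drop Ψ k (.snoc Φ A)) : Drop Ψ (k + 1) Φ := by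
  generalize e : DCtx.snoc Φ A = Φ' at d
  induction d with
  | zero => subst e; exact .succ .zero
  | succ _ ih => exact .succ (ih e)

theorem DSub.OK.chain {K X c Ψ Ψ'} (h : Ins K X c Ψ Ψ') (hΨ : SemCtx K Ψ) :
    ∀ {m j Φ₀ Φ}, Drop Ψ j Φ₀ → CtxEqv K Φ₀ Φ → m = c - j → (DSub.chain j m).OK K Ψ' Φ
  | 0, j, Φ₀, Φ, d, e, hm => ⟨_, h.drop_of_le d (by omega), e⟩
  | m + 1, j, Φ₀, Φ, d, e, hm => by
    obtain ⟨Φ₁, A, rfl, hA⟩ := h.snoc_of_drop d (by omega)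
    cases e with
    | @snoc _ Φ A A' e eA =>
      have d' := d.snoc_tail
      have ih := DSub.OK.chain (m := m) h hΨ d' e (by omega)
      have hj : skip c j = j := if_pos (by omega)
      have d₁ := h.decl (d.decl .here)
      rw [Tm.up_up, Nat.zero_add, hj] at d₁
      refine ⟨Φ, A', rfl, ih, _, d₁, ?_⟩
      have e₁ := h.tmEq hΨ (eA.sub (d'.sb hΨ))
      simp only [← Tm.up_eq] at e₁
      rw [Nat.add_comm j 1] at e₁
      rw [← e.len]
      convert e₁ using 1
      rw [Tm.up, Tm.ren_ren, Tm.ren_eq_sub]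
      congr 1; funext i
      rw [oSub_chain]; simp only [skip]; congr 1; split <;> split <;> omega

mutual
theorem DTy.OK.shift : ∀ {A : DTy} {K X c Ψ Ψ'}, A.OK K Ψ → Ins K X c Ψ Ψ' → SemCtx K Ψ →
    (A.shift c).OK K Ψ'
  | .ty, _, _, _, _, _, _, _, _ => trivial
  | .trm _, _, _, _, _, _, h, i, hΨ => DTm.OK.shift h i hΨ
  | .pi _ _, _, _, _, _, _, h, i, hΨ =>
    ⟨DTy.OK.shift h.1 i hΨ, DTy.OK.shift h.2 (i.succ h.1.sc) (.snoc hΨ (h.1.typed hΨ))⟩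
theorem DTm.OK.shift : ∀ {M : DTm} {K X c Ψ Ψ' a}, M.OK K Ψ a → Ins K X c Ψ Ψ' → SemCtx K Ψ →
    (M.shift c).OK K Ψ' (a.ren (skip c))
  | .var _, _, _, _, _, _, _, ⟨_, d, h⟩, i, hΨ => ⟨_, i.decl d, i.tmEq hΨ h⟩
  | .lam _ _ _, _, _, _, _, _, _, ⟨h₁, h₂, h₃, h₄⟩, i, hΨ => by
    have i' := i.succ h₁.sc
    have hΨ' := hΨ.snoc (h₁.typed hΨ)
    have eB := i'.oTy h₂.sc
    have h₄ := i.tmEq hΨ h₄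
    have h₃ := DTm.OK.shift h₃ i' hΨ'
    simp only [DCtx.len] at eB
    rw [DTm.shift, DTm.OK, eB, i.oTy h₁.sc]
    rw [Tm.ren, liftRen_skip] at h₄
    exact ⟨DTy.OK.shift h₁ i hΨ, DTy.OK.shift h₂ i' hΨ', h₃, h₄⟩
  | .app _ _ _ _, _, _, _, _, _, _, ⟨h₁, h₂, h₃, h₄, h₅⟩, i, hΨ => by
    have i' := i.succ h₁.sc
    have hΨ' := hΨ.snoc (h₁.typed hΨ)
    have eB := i'.oTy h₂.sc
    have h₅ := i.tmEq hΨ h₅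
    have h₃ := DTm.OK.shift h₃ i hΨ
    simp only [DCtx.len] at eB
    rw [DTm.shift, DTm.OK, eB, i.oTy h₁.sc, i.oTm h₄.sc]
    rw [Tm.ren_eq_sub, Tm.inst_sub, Fitch.liftSub_var, ← Tm.ren_eq_sub, ← Tm.ren_eq_sub,
      liftRen_skip] at h₅
    rw [Tm.ren, liftRen_skip] at h₃
    exact ⟨DTy.OK.shift h₁ i hΨ, DTy.OK.shift h₂ i' hΨ', h₃, DTm.OK.shift h₄ i hΨ, h₅⟩
  | .unbox _ _ _ _, _, _, _, _, _, _, ⟨h₁, h₂, h₃, h₄, h₅⟩, i, hΨ => by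
    have h₅ := i.tmEq hΨ h₅
    refine ⟨h₁, h₂, h₃, DSub.OK.shift h₄ i hΨ, ?_⟩
    rw [Tm.ren_sub] at h₅
    rwa [i.len, funext (DSub.o_shift h₄.sc i.lt).1]
  | .o, _, _, _, _, _, _, h, i, hΨ => i.tmEq hΨ h
  | .arr _ _, _, _, _, _, _, _, ⟨h₁, h₂, h₃⟩, i, hΨ =>
    ⟨DTm.OK.shift h₁ i hΨ, DTm.OK.shift h₂ i hΨ, i.tmEq hΨ h₃⟩
  | .lamc _ _ _, _, _, _, _, _, _, ⟨h₁, h₂, h₃, h₄⟩, i, hΨ => by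
    have h₄ := i.tmEq hΨ h₄
    have h₃' := DTm.OK.shift h₃ i hΨ
    simp only [Tm.ren, up_one_ren] at h₃'
    rw [DTm.shift, DTm.OK, i.oTm h₁.sc, i.oTm h₂.sc]
    exact ⟨DTm.OK.shift h₁ i hΨ, DTm.OK.shift h₂ i hΨ, h₃', h₄⟩
  | .appc _ _ _ _, _, _, _, _, _, _, ⟨h₁, h₂, h₃, h₄, h₅⟩, i, hΨ => by
    have h₅ := i.tmEq hΨ h₅
    rw [DTm.shift, DTm.OK, i.oTm h₁.sc, i.oTm h₂.sc]
    exact ⟨DTm.OK.shift h₁ i hΨ, DTm.OK.shift h₂ i hΨ, DTm.OK.shift h₃ i hΨ,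
      DTm.OK.shift h₄ i hΨ, h₅⟩
theorem DSub.OK.shift : ∀ {σ : DSub} {K X c Ψ Ψ' Φ}, σ.OK K Ψ Φ → Ins K X c Ψ Ψ' →
    SemCtx K Ψ → (σ.shift c).OK K Ψ' Φ
  | .nil, _, _, _, _, _, _, h, _, _ => h
  | .wk _, _, _, _, _, _, _, ⟨_, d, h⟩, i, hΨ => DSub.OK.chain i hΨ d h rfl
  | .cons _ _, _, _, _, _, _, _, ⟨Φ, A, h, h₁, h₂⟩, i, hΨ => by
    have h₂ := DTm.OK.shift h₂ i hΨ
    refine ⟨Φ, A, h, DSub.OK.shift h₁ i hΨ, ?_⟩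
    rw [Tm.ren_sub] at h₂
    rwa [i.len, funext (DSub.o_shift h₁.sc i.lt).1]
end

/-! ### Substitution -/

theorem DSub.OK.lift {σ : DSub} {K Ψ Φ A} (h : σ.OK K Ψ Φ) (hΨ : SemCtx K Ψ)
    (hΦ : SemCtx K Φ) (hA : A.OK K Φ) :
    σ.lift.OK K (.snoc Ψ (A.sub σ)) (.snoc Φ A) := by
  have e := (DTy.o_sub hA.sc h.sc Ψ.one_le_len).1
  have hA' := (hA.typed hΦ).sub (h.typed hΨ hΦ)
  have hA'' := hA'
  rw [← e] at hA'
  have i := Ins.zero hA'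
  refine ⟨Φ, A, rfl, h.shift i hΨ, _, .here, ?_⟩
  have e₂ : (oTy Φ.len A).sub (oSub (DCtx.snoc Ψ (A.sub σ)).len (σ.shift 0)) =
      (oTy Ψ.len (A.sub σ)).up 1 := by
    rw [e, Tm.up_sub]; congr 1; funext j
    have := (DSub.o_shift h.sc Ψ.one_le_len).1 j
    rwa [skip_zero] at this
  rw [e₂]
  exact .refl (hA'.weaken (.el hA'))

theorem DSub.OK.lookup : ∀ {σ : DSub} {K Ψ Φ i a}, σ.OK K Ψ Φ → Decl Φ i a → SemCtx K Ψ →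
    SemCtx K Φ → (σ.lookup i).OK K Ψ (a.sub (oSub Ψ.len σ))
  | .nil, _, _, _, _, _, h, d, _, _ => by rw [DSub.OK] at h; subst h; cases d
  | .wk k, K, Ψ, Φ, i, a, ⟨Φ₀, d₀, h⟩, d, hΨ, _ => by
    have hΦ₀ := d₀.sem hΨ
    obtain ⟨a', d', e⟩ := d.convCtx (h.symm hΦ₀) (h.sem hΦ₀)
    have e := (h.symm hΦ₀).tmEq (h.sem hΦ₀) e
    refine ⟨_, d₀.decl d', ?_⟩
    rw [Tm.up_eq]
    exact (e.symm.sub (d₀.sb hΨ))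
  | .cons σ M, _, _, _, 0, _, ⟨_, _, h, h₁, h₂⟩, d, _, _ => by
    subst h
    cases d
    rw [Tm.sub_up]
    exact h₂
  | .cons σ M, _, _, _, i + 1, _, ⟨_, _, h, h₁, h₂⟩, d, hΨ, hΦ => by
    subst h
    cases d with
    | there d =>
      rw [Tm.sub_up]
      exact DSub.OK.lookup h₁ d hΨ hΦ.tail

theorem Drop.trans {Ψ j Φ k Θ} (d : Drop Ψ j Φ) (d' : Drop Φ k Θ) : Drop Ψ (k + j) Θ := by
  induction d with
  | zero => exact d'
  | succ _ ih => exact .succ (ih d')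

theorem DSub.OK.drop : ∀ {σ : DSub} {K Ψ Φ k Θ}, σ.OK K Ψ Φ → Drop Φ k Θ → SemCtx K Ψ →
    SemCtx K Φ → (σ.drop k).OK K Ψ Θ
  | σ, _, _, _, 0, _, h, d, _, _ => by cases d; rwa [DSub.drop]
  | .nil, _, _, _, k + 1, _, h, d, _, _ => by rw [DSub.OK] at h; subst h; cases d
  | .wk j, _, _, _, k + 1, _, ⟨Φ₀, d₀, h⟩, d, hΨ, _ => by
    have hΦ₀ := d₀.sem hΨ
    obtain ⟨Θ', d', e⟩ := d.convCtx (h.symm hΦ₀)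
    refine ⟨Θ', ?_, e.symm (d.sem (h.sem hΦ₀))⟩
    rw [Nat.add_comm]; exact d₀.trans d'
  | .cons σ M, _, _, _, k + 1, _, ⟨_, _, h, h₁, h₂⟩, d, hΨ, hΦ => by
    subst h
    cases d with
    | succ d => exact DSub.OK.drop (σ := σ) h₁ d hΨ hΦ.tail

mutual
theorem DTy.OK.sub : ∀ {A : DTy} {K Ψ Φ σ}, A.OK K Φ → DSub.OK K Ψ σ Φ → SemCtx K Ψ →
    SemCtx K Φ → (A.sub σ).OK K Ψ
  | .ty, _, _, _, _, _, _, _, _ => trivial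
  | .trm _, _, _, _, _, h, s, hΨ, hΦ => DTm.OK.sub h s hΨ hΦ
  | .pi A _, _, _, _, _, h, s, hΨ, hΦ => by
    have h₁ := DTy.OK.sub h.1 s hΨ hΦ
    exact ⟨h₁, DTy.OK.sub h.2 (s.lift hΨ hΦ h.1) (hΨ.snoc (h₁.typed hΨ))
      (hΦ.snoc (DTy.OK.typed (A := A) h.1 hΦ))⟩
theorem DTm.OK.sub : ∀ {M : DTm} {K Ψ Φ σ a}, M.OK K Φ a → DSub.OK K Ψ σ Φ → SemCtx K Ψ →
    SemCtx K Φ → (M.sub σ).OK K Ψ (a.sub (oSub Ψ.len σ))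
  | .var _, _, _, _, _, _, ⟨_, d, e⟩, s, hΨ, hΦ =>
    (s.lookup d hΨ hΦ).conv (e.sub (s.typed hΨ hΦ))
  | .lam _ _ _, _, Ψ, _, _, _, ⟨h₁, h₂, h₃, h₄⟩, s, hΨ, hΦ => by
    have sc := s.sc
    have h₁' := DTy.OK.sub h₁ s hΨ hΦ
    have s' := s.lift hΨ hΦ h₁
    have hΨ' := hΨ.snoc (h₁'.typed hΨ)
    have hΦ' := hΦ.snoc (h₁.typed hΦ)
    have eA := (DTy.o_sub h₁.sc sc Ψ.one_le_len).1
    have eB := (DTy.o_sub h₂.sc s'.sc (Nat.succ_pos _)).1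
    have h₃' := DTm.OK.sub h₃ s' hΨ' hΦ'
    have h₄' := h₄.sub (s.typed hΨ hΦ)
    simp only [DCtx.len, oSub_lift sc Ψ.one_le_len] at eB h₃'
    rw [DTm.sub, DTm.OK, eA, eB]
    exact ⟨h₁', DTy.OK.sub h₂ s' hΨ' hΦ', h₃', h₄'⟩
  | .app _ _ _ _, _, Ψ, _, _, _, ⟨h₁, h₂, h₃, h₄, h₅⟩, s, hΨ, hΦ => by
    have sc := s.sc
    have h₁' := DTy.OK.sub h₁ s hΨ hΦ
    have s' := s.lift hΨ hΦ h₁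
    have hΨ' := hΨ.snoc (h₁'.typed hΨ)
    have hΦ' := hΦ.snoc (h₁.typed hΦ)
    have eA := (DTy.o_sub h₁.sc sc Ψ.one_le_len).1
    have eB := (DTy.o_sub h₂.sc s'.sc (Nat.succ_pos _)).1
    have eN := (DTm.o_sub h₄.sc sc Ψ.one_le_len).1
    have h₃' := DTm.OK.sub h₃ s hΨ hΦ
    have h₅' := h₅.sub (s.typed hΨ hΦ)
    simp only [DCtx.len, oSub_lift sc Ψ.one_le_len] at eB
    rw [DTm.sub, DTm.OK, eA, eB, eN]
    rw [Tm.inst_sub] at h₅'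
    exact ⟨h₁', DTy.OK.sub h₂ s' hΨ' hΦ', h₃', DTm.OK.sub h₄ s hΨ hΦ, h₅'⟩
  | .unbox _ _ _ _, _, Ψ, _, _, _, ⟨h₁, h₂, h₃, h₄, h₅⟩, s, hΨ, hΦ => by
    have h₅ := h₅.sub (s.typed hΨ hΦ)
    have sc := s.sc
    refine ⟨h₁, h₂, h₃, DSub.OK.sub h₄ s hΨ hΦ (h₁.typed hΨ.wfBase), ?_⟩
    rw [Tm.sub_sub] at h₅
    rwa [funext (DSub.o_sub h₄.sc sc Ψ.one_le_len).1]
  | .o, _, _, _, _, _, h, s, hΨ, hΦ => TmEq.sub h (s.typed hΨ hΦ)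
  | .arr _ _, _, _, _, _, _, ⟨h₁, h₂, h₃⟩, s, hΨ, hΦ =>
    ⟨DTm.OK.sub h₁ s hΨ hΦ, DTm.OK.sub h₂ s hΨ hΦ, h₃.sub (s.typed hΨ hΦ)⟩
  | .lamc _ _ _, _, Ψ, _, _, _, ⟨h₁, h₂, h₃, h₄⟩, s, hΨ, hΦ => by
    have sc := s.sc
    have h₄ := h₄.sub (s.typed hΨ hΦ)
    have h₃' := DTm.OK.sub h₃ s hΨ hΦ
    simp only [Tm.sub, Tm.up_one_liftSub] at h₃'
    rw [DTm.sub, DTm.OK, (DTm.o_sub h₁.sc sc Ψ.one_le_len).1,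
      (DTm.o_sub h₂.sc sc Ψ.one_le_len).1]
    exact ⟨DTm.OK.sub h₁ s hΨ hΦ, DTm.OK.sub h₂ s hΨ hΦ, h₃', h₄⟩
  | .appc _ _ _ _, _, Ψ, _, _, _, ⟨h₁, h₂, h₃, h₄, h₅⟩, s, hΨ, hΦ => by
    have sc := s.sc
    have h₅ := h₅.sub (s.typed hΨ hΦ)
    rw [DTm.sub, DTm.OK, (DTm.o_sub h₁.sc sc Ψ.one_le_len).1,
      (DTm.o_sub h₂.sc sc Ψ.one_le_len).1]
    exact ⟨DTm.OK.sub h₁ s hΨ hΦ, DTm.OK.sub h₂ s hΨ hΦ, DTm.OK.sub h₃ s hΨ hΦ,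
      DTm.OK.sub h₄ s hΨ hΦ, h₅⟩
theorem DSub.OK.sub : ∀ {τ : DSub} {K Ψ Φ Θ σ}, τ.OK K Φ Θ → DSub.OK K Ψ σ Φ → SemCtx K Ψ →
    SemCtx K Φ → SemCtx K Θ → (DSub.sub σ τ).OK K Ψ Θ
  | .nil, _, _, _, _, _, h, _, _, _, _ => h
  | .wk _, _, _, _, _, _, ⟨_, d, h⟩, s, hΨ, hΦ, _ =>
    (s.drop d hΨ hΦ).convTarget h hΨ (d.sem hΦ)
  | .cons _ _, _, Ψ, _, _, _, ⟨Θ, A, h, h₁, h₂⟩, s, hΨ, hΦ, hΘ => by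
    subst h
    have h₂ := DTm.OK.sub h₂ s hΨ hΦ
    refine ⟨Θ, A, rfl, DSub.OK.sub h₁ s hΨ hΦ hΘ.tail, ?_⟩
    rw [Tm.sub_sub] at h₂
    have sc := s.sc
    rwa [funext (DSub.o_sub h₁.sc sc Ψ.one_le_len).1]
end

end Cocon

namespace Cocon

open Fitch (Tm Ty scons wkn Sb SbEq HasTm TmEq TyEq TyWf Wf Look kitTm)

/-! ### Computation-level renaming -/

/-- `ρ` renames the variables of `K` to variables of `K'` of equal types, and context variables to
context variables. -/
structure RenOK (K' : Fitch.Ctx) (ρ : ℕ → ℕ) (K : Fitch.Ctx) : Prop where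
  sb : Sb K' (fun i => .var (ρ i)) K
  look : ∀ {y A}, Look K y A → ∃ A', Look K' (ρ y) A' ∧ TyEq K' A' (A.ren ρ)
  ctx : ∀ {y}, Look K y (.box .ctx) → Look K' (ρ y) (.box .ctx)

theorem Ty_up_one_ren (t : Ty) (ρ) : (t.up 1).ren (Fitch.liftRen ρ) = (t.ren ρ).up 1 := by
  rw [← liftN_one]; exact Ty_up_ren_liftN t 1 ρ

theorem up_eq_box_ctx {A : Ty} {k : ℕ} (h : A.up k = .box .ctx) : A = .box .ctx :=
  Fitch.Ty.up_injective (k := k) (by rw [h]; rfl)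

namespace RenOK

variable {K K' : Fitch.Ctx} {ρ : ℕ → ℕ}

theorem wf (r : RenOK K' ρ K) : Wf K' := r.sb.wf

theorem conv {A A' : Ty} (r : RenOK K' ρ K) (hA : TyWf K' A') (e : TyEq K' (A.ren ρ) A')
    (h : A = .box .ctx → A' = .box .ctx) : RenOK (K'.snoc A') (Fitch.liftRen ρ) (K.snoc A) where
  sb := by
    have := r.sb.conv (A := A) hA (by rwa [← Ty.ren_eq_sub])
    rwa [Fitch.liftSub_var] at this
  look l := by
    cases l with
    | here => exact ⟨_, .here, by rw [Ty_up_one_ren]; exact e.symm.weaken hA⟩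
    | there l =>
      obtain ⟨B', l', e'⟩ := r.look l
      exact ⟨_, .there l', by rw [Ty_up_one_ren]; exact e'.weaken hA⟩
  ctx l := by
    generalize e : Ty.box .ctx = B at l
    cases l with
    | here =>
      obtain rfl := up_eq_box_ctx e.symm
      rw [h rfl]; exact .here
    | there l =>
      obtain rfl := up_eq_box_ctx e.symm
      exact .there (r.ctx l)

theorem lift {A : Ty} (r : RenOK K' ρ K) (hA : TyWf K A) :
    RenOK (K'.snoc (A.ren ρ)) (Fitch.liftRen ρ) (K.snoc A) := by
  have : TyWf K' (A.ren ρ) := by rw [Ty.ren_eq_sub]; exact hA.sub r.sb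
  exact r.conv this (.refl this) (by rintro rfl; rfl)

theorem id (h : Wf K) : RenOK K _root_.id K where
  sb := .id kitTm h
  look {_ A} l := ⟨A, l, by rw [Ty.ren_eq_sub]; exact (Ty.sub_id A).symm ▸ .refl (l.tyWf h)⟩
  ctx l := l

theorem succ {A : Ty} (h : TyWf K A) : RenOK (K.snoc A) Nat.succ K where
  sb := (Fitch.SbV.id kitTm h.wf).weaken kitTm h
  look l := ⟨_, .there l, .refl ((l.tyWf h.wf).weaken h)⟩
  ctx l := .there l

theorem tel (r : RenOK K' ρ K) {Ψ : DCtx} (hΨ : SemCtx K Ψ) (sc : Ψ.Sc) :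
    Sb (tel K' (Ψ.cren ρ)) (fun i => .var (liftN Ψ.len ρ i)) (tel K Ψ) := by
  induction hΨ with
  | nil h =>
    have := r.sb.locked.lift kitTm (A := .elc .top) (.elc (.top (.lock r.wf)))
    rw [Fitch.liftSub_var] at this
    rw [DCtx.len, liftN_one]
    exact this
  | @var y h l =>
    have := r.sb.locked.lift kitTm (A := .elc (.unbox .ctx (.var y)))
      (.elc (HasTm.unbox_ctx r.wf (r.ctx l)))
    rw [Fitch.liftSub_var] at this
    rw [DCtx.len, liftN_one]
    exact this
  | snoc h hA ih =>
    have ih := ih sc.1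
    have e := (DTy.o_cren ρ sc.2).1
    have hA := hA.sub ih
    have := ih.liftEl kitTm hA
    rw [Fitch.liftSub_var, liftRen_liftN, ← Tm.ren_eq_sub, ← e] at this
    rw [DCtx.len, DCtx.cren, Cocon.tel, DCtx.len_cren]
    exact this

theorem tmEq (r : RenOK K' ρ K) {Ψ : DCtx} (hΨ : SemCtx K Ψ) (sc : Ψ.Sc) {a b : Tm}
    (e : TmEq (Cocon.tel K Ψ) a b .univ) : TmEq (Cocon.tel K' (Ψ.cren ρ)) (a.ren (liftN Ψ.len ρ))
      (b.ren (liftN Ψ.len ρ)) .univ := by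
  simp only [Tm.ren_eq_sub]
  exact e.sub (r.tel hΨ sc)

theorem tyEq (r : RenOK K' ρ K) {A B : Ty} (e : TyEq K A B) : TyEq K' (A.ren ρ) (B.ren ρ) := by
  simp only [Ty.ren_eq_sub]
  exact e.sub r.sb

theorem tyEq_lock (r : RenOK K' ρ K) {A B : Ty} (e : TyEq K.lock A B) :
    TyEq K'.lock (A.ren ρ) (B.ren ρ) := by
  simp only [Ty.ren_eq_sub]
  exact e.sub r.sb.locked

theorem ctxEqv (r : RenOK K' ρ K) {Ψ Φ : DCtx} (e : CtxEqv K Ψ Φ) (hΨ : SemCtx K Ψ)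
    (s : Ψ.Sc) (s' : Φ.Sc) : CtxEqv K' (Ψ.cren ρ) (Φ.cren ρ) := by
  induction e with
  | nil => exact .nil
  | var => exact .var
  | snoc e eA ih =>
    have := r.tmEq hΨ.tail s.1 eA
    have l := e.len
    refine .snoc (ih hΨ.tail s.1 s'.1) ?_
    rw [DCtx.len_cren, (DTy.o_cren ρ s.2).1, (DTy.o_cren ρ (l ▸ s'.2)).1]
    exact this

end RenOK

theorem Decl.cren {Ψ i a} (d : Decl Ψ i a) (sc : Ψ.Sc) (ρ : ℕ → ℕ) :
    Decl (Ψ.cren ρ) i (a.ren (liftN Ψ.len ρ)) := by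
  induction d with
  | here =>
    rw [DCtx.len, ← liftRen_liftN, up_one_ren, ← (DTy.o_cren ρ sc.2).1, ← DCtx.len_cren ρ]
    exact .here
  | there _ ih =>
    rw [DCtx.len, ← liftRen_liftN, up_one_ren]
    exact .there (ih sc.1)

theorem Drop.cren {Ψ k Φ} (d : Drop Ψ k Φ) (ρ : ℕ → ℕ) : Drop (Ψ.cren ρ) k (Φ.cren ρ) := by
  induction d with
  | zero => exact .zero
  | succ _ ih => exact .succ ih

theorem Drop.sc {Ψ k Φ} (d : Drop Ψ k Φ) (h : Ψ.Sc) : Φ.Sc := by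
  induction d with
  | zero => exact h
  | succ _ ih => exact ih h.1

mutual
theorem DTy.OK.cren : ∀ {A : DTy} {K K' ρ Ψ}, A.OK K Ψ → RenOK K' ρ K → SemCtx K Ψ → Ψ.Sc →
    (A.cren ρ).OK K' (Ψ.cren ρ)
  | .ty, _, _, _, _, _, _, _, _ => trivial
  | .trm _, _, _, _, _, h, r, hΨ, sc => DTm.OK.cren h r hΨ sc
  | .pi A _, _, _, _, _, h, r, hΨ, sc =>
    ⟨DTy.OK.cren h.1 r hΨ sc, DTy.OK.cren h.2 r (hΨ.snoc (DTy.OK.typed (A := A) h.1 hΨ))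
      ⟨sc, h.1.sc⟩⟩
theorem DTm.OK.cren : ∀ {M : DTm} {K K' ρ Ψ a}, M.OK K Ψ a → RenOK K' ρ K → SemCtx K Ψ →
    Ψ.Sc → (M.cren ρ).OK K' (Ψ.cren ρ) (a.ren (liftN Ψ.len ρ))
  | .var _, _, _, ρ, _, _, ⟨_, d, e⟩, r, hΨ, sc => ⟨_, d.cren sc ρ, r.tmEq hΨ sc e⟩
  | .lam A B M, _, _, ρ, Ψ, _, ⟨h₁, h₂, h₃, h₄⟩, r, hΨ, sc => by
    have h₄ := r.tmEq hΨ sc h₄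
    have hΨ' := hΨ.snoc (h₁.typed hΨ)
    have sc' : (Ψ.snoc A).Sc := ⟨sc, h₁.sc⟩
    have h₃ := DTm.OK.cren h₃ r hΨ' sc'
    have eB := (DTy.o_cren ρ h₂.sc).1
    simp only [DCtx.len] at eB
    rw [DTm.cren, DTm.OK, DCtx.len_cren, (DTy.o_cren ρ h₁.sc).1, eB]
    rw [Tm.ren, liftRen_liftN] at h₄
    exact ⟨DTy.OK.cren h₁ r hΨ sc, DTy.OK.cren h₂ r hΨ' sc', h₃, h₄⟩
  | .app A B M N, _, _, ρ, Ψ, _, ⟨h₁, h₂, h₃, h₄, h₅⟩, r, hΨ, sc => by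
    have h₅ := r.tmEq hΨ sc h₅
    have hΨ' := hΨ.snoc (h₁.typed hΨ)
    have sc' : (Ψ.snoc A).Sc := ⟨sc, h₁.sc⟩
    have h₃ := DTm.OK.cren h₃ r hΨ sc
    have eB := (DTy.o_cren ρ h₂.sc).1
    simp only [DCtx.len] at eB
    rw [DTm.cren, DTm.OK, DCtx.len_cren, (DTy.o_cren ρ h₁.sc).1, eB, (DTm.o_cren ρ h₄.sc).1]
    rw [Tm.ren_eq_sub, Tm.inst_sub, Fitch.liftSub_var, ← Tm.ren_eq_sub, ← Tm.ren_eq_sub,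
      liftRen_liftN] at h₅
    rw [Tm.ren, liftRen_liftN] at h₃
    exact ⟨DTy.OK.cren h₁ r hΨ sc, DTy.OK.cren h₂ r hΨ' sc', h₃, DTm.OK.cren h₄ r hΨ sc, h₅⟩
  | .unbox Φ A t σ, _, _, ρ, Ψ, _, ⟨h₁, h₂, h₃, h₄, h₅⟩, r, hΨ, sc => by
    have h₅ := r.tmEq hΨ sc h₅
    have hΦ := h₁.typed hΨ.wfBase
    have scΦ := h₁.sc
    have h₃ := CTm.OK.cren h₃ r hΨ.wfBase
    have e₁ := DCtx.o_cren ρ scΦ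
    have e₂ := (DTy.o_cren ρ h₂.sc).1
    have e₃ := sub_oProj_ren e₂ e₁.2.1
    have e₄ := (DSub.o_cren ρ h₄.sc).1
    rw [DTm.cren, DTm.OK, DCtx.len_cren, DCtx.len_cren, e₁.1, e₃]
    refine ⟨DCtx.OK.cren h₁ r hΨ.wfBase, DTy.OK.cren h₂ r hΦ scΦ, h₃,
      DSub.OK.cren h₄ r hΨ sc hΦ scΦ, ?_⟩
    rw [Tm.ren_sub] at h₅
    rw [e₂, Tm.sub_ren, funext e₄]
    exact h₅
  | .o, _, _, _, _, _, h, r, hΨ, sc => r.tmEq hΨ sc h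
  | .arr _ _, _, _, _, _, _, ⟨h₁, h₂, h₃⟩, r, hΨ, sc =>
    ⟨DTm.OK.cren h₁ r hΨ sc, DTm.OK.cren h₂ r hΨ sc, r.tmEq hΨ sc h₃⟩
  | .lamc _ _ _, _, _, ρ, _, _, ⟨h₁, h₂, h₃, h₄⟩, r, hΨ, sc => by
    have h₄ := r.tmEq hΨ sc h₄
    have h₃ := DTm.OK.cren h₃ r hΨ sc
    simp only [Tm.ren, up_one_ren] at h₃
    rw [DTm.cren, DTm.OK, DCtx.len_cren, (DTm.o_cren ρ h₁.sc).1, (DTm.o_cren ρ h₂.sc).1]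
    exact ⟨DTm.OK.cren h₁ r hΨ sc, DTm.OK.cren h₂ r hΨ sc, h₃, h₄⟩
  | .appc _ _ _ _, _, _, ρ, _, _, ⟨h₁, h₂, h₃, h₄, h₅⟩, r, hΨ, sc => by
    have h₅ := r.tmEq hΨ sc h₅
    rw [DTm.cren, DTm.OK, DCtx.len_cren, (DTm.o_cren ρ h₁.sc).1, (DTm.o_cren ρ h₂.sc).1]
    exact ⟨DTm.OK.cren h₁ r hΨ sc, DTm.OK.cren h₂ r hΨ sc, DTm.OK.cren h₃ r hΨ sc,
      DTm.OK.cren h₄ r hΨ sc, h₅⟩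
theorem DSub.OK.cren : ∀ {σ : DSub} {K K' ρ Ψ Φ}, σ.OK K Ψ Φ → RenOK K' ρ K → SemCtx K Ψ →
    Ψ.Sc → SemCtx K Φ → Φ.Sc → DSub.OK K' (Ψ.cren ρ) (DSub.cren ρ σ) (Φ.cren ρ)
  | .nil, _, _, _, _, _, h, _, _, _, _, _ => by rw [DSub.OK] at h; subst h; rfl
  | .wk _, _, _, ρ, _, _, ⟨_, d, e⟩, r, hΨ, sc, _, sc' =>
    ⟨_, d.cren ρ, r.ctxEqv e (d.sem hΨ) (d.sc sc) sc'⟩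
  | .cons _ _, _, _, ρ, _, _, ⟨Φ, A, h, h₁, h₂⟩, r, hΨ, sc, hΦ, sc' => by
    subst h
    have h₂ := DTm.OK.cren h₂ r hΨ sc
    refine ⟨_, _, rfl, DSub.OK.cren h₁ r hΨ sc hΦ.tail sc'.1, ?_⟩
    rw [Tm.ren_sub] at h₂
    rw [DCtx.len_cren, DCtx.len_cren, (DTy.o_cren ρ sc'.2).1, Tm.sub_ren,
      funext (DSub.o_cren ρ h₁.sc).1]
    exact h₂
theorem DCtx.OK.cren : ∀ {Ψ : DCtx} {K K' ρ}, Ψ.OK K → RenOK K' ρ K → Wf K →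
    (Ψ.cren ρ).OK K'
  | .nil, _, _, _, _, _, _ => trivial
  | .var _, _, _, _, h, r, _ => r.ctx h
  | .snoc Ψ _, _, _, _, h, r, hK =>
    ⟨DCtx.OK.cren h.1 r hK, DTy.OK.cren h.2 r (DCtx.OK.typed (Ψ := Ψ) h.1 hK) h.1.sc⟩
theorem CxTy.OK.cren : ∀ {T : CxTy} {K K' ρ}, T.OK K → RenOK K' ρ K → Wf K → (T.cren ρ).OK K'
  | .tm Ψ _, _, _, _, h, r, hK =>
    ⟨DCtx.OK.cren h.1 r hK, DTy.OK.cren h.2 r (DCtx.OK.typed (Ψ := Ψ) h.1 hK) h.1.sc⟩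
  | .vr Ψ _, _, _, _, h, r, hK =>
    ⟨DCtx.OK.cren h.1 r hK, DTy.OK.cren h.2 r (DCtx.OK.typed (Ψ := Ψ) h.1 hK) h.1.sc⟩
theorem CxObj.OK.cren : ∀ {C : CxObj} {K K' ρ T}, C.OK K T → RenOK K' ρ K → Wf K →
    (C.cren ρ).OK K' (T.ren ρ)
  | .mk Ψ _, _, _, ρ, _, ⟨h₁, a, h₂, e⟩, r, hK => by
    have e := r.tyEq_lock e
    have e₁ := DCtx.o_cren ρ h₁.sc
    refine ⟨DCtx.OK.cren h₁ r hK, _, DTm.OK.cren h₂ r (h₁.typed hK) h₁.sc, ?_⟩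
    rw [sub_oProj_ren rfl e₁.2.1, e₁.1]
    exact e
theorem CTy.OK.cren : ∀ {τ : CTy} {K K' ρ}, τ.OK K → RenOK K' ρ K → Wf K → (τ.cren ρ).OK K'
  | .box T, _, _, _, h, r, hK => CxTy.OK.cren (T := T) h r hK
  | .pi τ₁ _, _, _, ρ, h, r, hK => by
    have w := CTy.OK.typed (τ := τ₁) h.1 hK
    rw [CTy.cren, CTy.OK, (CTy.o_cren ρ h.1.sc).1, liftRen_eq]
    exact ⟨CTy.OK.cren h.1 r hK, CTy.OK.cren h.2 (r.lift w) (.snoc hK w)⟩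
  | .ctx, _, _, _, _, _, _ => trivial
theorem CTm.OK.cren : ∀ {t : CTm} {K K' ρ T}, t.OK K T → RenOK K' ρ K → Wf K →
    (t.cren ρ).OK K' (T.ren ρ)
  | .var _, _, _, ρ, _, ⟨_, l, e⟩, r, hK => by
    obtain ⟨A', l', e'⟩ := r.look l
    exact ⟨A', l', e'.trans (r.tyEq e)⟩
  | .box _, _, _, ρ, _, ⟨_, h, e⟩, r, hK => ⟨_, CxObj.OK.cren h r hK, r.tyEq e⟩
  | .fn τ _, _, _, ρ, _, ⟨h₁, _, h₂, e⟩, r, hK => by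
    have w := CTy.OK.typed h₁ hK
    have h₂ := CTm.OK.cren h₂ (r.lift w) (.snoc hK w)
    rw [CTm.cren, CTm.OK, (CTy.o_cren ρ h₁.sc).1, liftRen_eq]
    exact ⟨CTy.OK.cren h₁ r hK, _, h₂, r.tyEq e⟩
  | .app _ _ _ s, _, _, ρ, _, ⟨h₁, h₂, h₃, h₄, e⟩, r, hK => by
    have w := CTy.OK.typed h₁ hK
    have h₂' := CTy.OK.cren h₂ (r.lift w) (.snoc hK w)
    have h₃ := CTm.OK.cren h₃ r hK
    have h₄' := CTm.OK.cren h₄ r hK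
    have e := r.tyEq e
    have e₂ := (CTy.o_cren (liftRen ρ) h₂.sc).1
    rw [CTm.cren, CTm.OK, e₂, (CTy.o_cren ρ h₁.sc).1, liftRen_eq, (CTm.o_cren ρ h₄.sc).1]
    rw [Ty.ren_eq_sub, Ty.inst_sub, Fitch.liftSub_var, ← Ty.ren_eq_sub, ← Tm.ren_eq_sub] at e
    exact ⟨CTy.OK.cren h₁ r hK, h₂', h₃, h₄', e⟩
  | .ctx _, _, _, _, _, ⟨h, e⟩, r, hK => ⟨DCtx.OK.cren h r hK, r.tyEq e⟩
end

theorem liftRen_id : liftRen id = id := by funext i; cases i <;> rfl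

mutual
theorem DTy.cren_id : ∀ A : DTy, A.cren id = A
  | .ty => rfl
  | .trm M => by simp only [DTy.cren, DTm.cren_id M]
  | .pi A B => by simp only [DTy.cren, DTy.cren_id A, DTy.cren_id B]
theorem DTm.cren_id : ∀ M : DTm, M.cren id = M
  | .var _ => rfl
  | .lam A B M => by simp only [DTm.cren, DTy.cren_id A, DTy.cren_id B, DTm.cren_id M]
  | .app A B M N => by
    simp only [DTm.cren, DTy.cren_id A, DTy.cren_id B, DTm.cren_id M, DTm.cren_id N]
  | .unbox Φ A t σ => by
    simp only [DTm.cren, DCtx.cren_id Φ, DTy.cren_id A, CTm.cren_id t, DSub.cren_id σ]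
  | .o => rfl
  | .arr a b => by simp only [DTm.cren, DTm.cren_id a, DTm.cren_id b]
  | .lamc a b f => by simp only [DTm.cren, DTm.cren_id a, DTm.cren_id b, DTm.cren_id f]
  | .appc a b m n => by
    simp only [DTm.cren, DTm.cren_id a, DTm.cren_id b, DTm.cren_id m, DTm.cren_id n]
theorem DSub.cren_id : ∀ σ : DSub, DSub.cren id σ = σ
  | .nil => rfl
  | .wk _ => rfl
  | .cons σ M => by simp only [DSub.cren, DSub.cren_id σ, DTm.cren_id M]
theorem DCtx.cren_id : ∀ Ψ : DCtx, Ψ.cren id = Ψ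
  | .nil => rfl
  | .var _ => rfl
  | .snoc Ψ A => by simp only [DCtx.cren, DCtx.cren_id Ψ, DTy.cren_id A]
theorem CxTy.cren_id : ∀ T : CxTy, T.cren id = T
  | .tm Ψ A => by simp only [CxTy.cren, DCtx.cren_id Ψ, DTy.cren_id A]
  | .vr Ψ A => by simp only [CxTy.cren, DCtx.cren_id Ψ, DTy.cren_id A]
theorem CxObj.cren_id : ∀ C : CxObj, C.cren id = C
  | .mk Ψ M => by simp only [CxObj.cren, DCtx.cren_id Ψ, DTm.cren_id M]
theorem CTy.cren_id : ∀ τ : CTy, τ.cren id = τ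
  | .box T => by simp only [CTy.cren, CxTy.cren_id T]
  | .pi τ₁ τ₂ => by simp only [CTy.cren, liftRen_id, CTy.cren_id τ₁, CTy.cren_id τ₂]
  | .ctx => rfl
theorem CTm.cren_id : ∀ t : CTm, t.cren id = t
  | .var _ => rfl
  | .box C => by simp only [CTm.cren, CxObj.cren_id C]
  | .fn τ t => by simp only [CTm.cren, liftRen_id, CTy.cren_id τ, CTm.cren_id t]
  | .app τ₁ τ₂ t s => by
    simp only [CTm.cren, liftRen_id, CTy.cren_id τ₁, CTy.cren_id τ₂, CTm.cren_id t, CTm.cren_id s]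
  | .ctx Ψ => by simp only [CTm.cren, DCtx.cren_id Ψ]
end

theorem RenOK.conv_id {K : Fitch.Ctx} {A A' : Ty} (e : TyEq K A A')
    (h : A = .box .ctx → A' = .box .ctx) : RenOK (K.snoc A') _root_.id (K.snoc A) := by
  have := (RenOK.id e.wf).conv (A := A) e.right (by
    rw [Ty.ren_eq_sub]; exact (Ty.sub_id A).symm ▸ e) h
  rwa [← liftRen_eq, liftRen_id] at this

theorem CTy.OK.convCtx {τ : CTy} {K K'} (h : τ.OK K) (r : RenOK K' id K) (hK : Wf K) :
    τ.OK K' := by simpa only [CTy.cren_id] using h.cren r hK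

theorem CTm.OK.convCtx {t : CTm} {K K' T} (h : t.OK K T) (r : RenOK K' id K) (hK : Wf K) :
    t.OK K' T := by
  have := h.cren r hK
  rw [CTm.cren_id, Ty.ren_eq_sub] at this
  exact (Ty.sub_id T) ▸ this

end Cocon

namespace Cocon

open Fitch (Tm Ty scons wkn Sb SbEq HasTm TmEq TyEq TyWf Wf Look kitTm)

/-! ### Computation-level substitution -/

/-- The translation of a computation-level substitution. -/
def oCSub (θ : ℕ → CTm) (i : ℕ) : Tm := oCTm (θ i)

/-- A computation-level substitution, as a substitution between telescopes. -/
def ctel (θ : ℕ → CTm) : DCtx → ℕ → Tm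
  | .nil => Fitch.liftSub (oCSub θ)
  | .var y => scons (oTup (θ y).toDCtx) fun i => (oCSub θ i).up (θ y).toDCtx.len
  | .snoc Ψ _ => Fitch.liftSub (ctel θ Ψ)

theorem ctel_tail (θ : ℕ → CTm) : ∀ (Ψ : DCtx) (i : ℕ),
    ctel θ Ψ (i + Ψ.len) = (oCSub θ i).up (Ψ.csub θ).len
  | .nil, _ => rfl
  | .var _, _ => rfl
  | .snoc Ψ _, i => by
    rw [DCtx.len, ← Nat.add_assoc, ctel, Fitch.liftSub, ctel_tail θ Ψ i, Tm.up_up]; rfl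

theorem ctel_lt (θ : ℕ → CTm) : ∀ (Ψ : DCtx) (i : ℕ), i + 1 < Ψ.len → ctel θ Ψ i = .var i
  | .nil, _, h => by simp [DCtx.len] at h
  | .var _, _, h => by simp [DCtx.len] at h
  | .snoc Ψ _, 0, _ => rfl
  | .snoc Ψ _, i + 1, h => by
    rw [ctel, Fitch.liftSub, ctel_lt θ Ψ i (by simpa [DCtx.len] using h)]; rfl

theorem Drop.ctel {Ψ k Φ} (d : Drop Ψ k Φ) (θ : ℕ → CTm) (i : ℕ) :
    ctel θ Ψ (i + k) = (ctel θ Φ i).up k := by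
  induction d with
  | zero => rw [Tm.up_zero, Nat.add_zero]
  | succ _ ih => rw [← Nat.add_assoc, Cocon.ctel, Fitch.liftSub, ih, Tm.up_up]

theorem CtxEqv.ctel {K Ψ Φ} (e : CtxEqv K Ψ Φ) (θ : ℕ → CTm) : ctel θ Ψ = ctel θ Φ := by
  induction e with
  | nil => rfl
  | var => rfl
  | snoc _ _ ih => rw [Cocon.ctel, ih]; rfl

theorem toDCtx_cren (t : CTm) (ρ : ℕ → ℕ) : (t.cren ρ).toDCtx = t.toDCtx.cren ρ := by
  cases t <;> rfl

/-- `θ` substitutes terms over `K'` for the variables of `K`, and domain-level contexts for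
context variables. -/
structure CSubOK (K' : Fitch.Ctx) (θ : ℕ → CTm) (K : Fitch.Ctx) : Prop where
  sb : Sb K' (oCSub θ) K
  sc : ∀ y, (θ y).Sc
  var : ∀ {y A}, Look K y A → (θ y).OK K' (A.sub (oCSub θ))
  ctx : ∀ {y}, Look K y (.box .ctx) → (θ y).toDCtx.OK K' ∧
    TmEq K'.lock (oCode (θ y).toDCtx) (.unbox .ctx (oCTm (θ y))) .ctx

theorem oCSub_lift {θ : ℕ → CTm} (h : ∀ y, (θ y).Sc) :
    oCSub (liftSub θ) = Fitch.liftSub (oCSub θ) := by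
  funext i
  cases i with
  | zero => rfl
  | succ i => exact (CTm.o_cren Nat.succ (h i)).1

namespace CSubOK

variable {K K' : Fitch.Ctx} {θ : ℕ → CTm}

theorem wf (g : CSubOK K' θ K) : Wf K' := g.sb.wf

theorem lift {A A' : Ty} (g : CSubOK K' θ K) (e : TyEq K' (A.sub (oCSub θ)) A')
    (h : A = .box .ctx → A' = .box .ctx) : CSubOK (K'.snoc A') (liftSub θ) (K.snoc A) where
  sb := by rw [oCSub_lift g.sc]; exact g.sb.conv e.right e
  sc y := by
    cases y with
    | zero => trivial
    | succ y => exact (CTm.o_cren Nat.succ (g.sc y)).2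
  var l := by
    rw [oCSub_lift g.sc]
    cases l with
    | here => exact ⟨_, .here, by rw [Ty.up_one_liftSub]; exact e.symm.weaken e.right⟩
    | there l =>
      rw [Ty.up_one_liftSub]
      exact (g.var l).cren (.succ e.right) g.wf
  ctx l := by
    generalize e' : Ty.box .ctx = B at l
    cases l with
    | here =>
      obtain rfl := up_eq_box_ctx e'.symm
      have hw := Wf.snoc g.wf e.right
      obtain rfl := h rfl
      exact ⟨.here, .refl (HasTm.unbox_ctx hw .here)⟩
    | there l =>
      obtain rfl := up_eq_box_ctx e'.symm
      obtain ⟨h₁, h₂⟩ := g.ctx l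
      have r := RenOK.succ e.right
      have h₂ := h₂.sub r.sb.locked
      simp only [← Tm.ren_eq_sub, ← (DCtx.o_cren Nat.succ h₁.sc).1] at h₂
      rw [liftSub, toDCtx_cren, (CTm.o_cren Nat.succ (g.sc _)).1]
      exact ⟨h₁.cren r g.wf, h₂⟩

theorem single {A : Ty} {s : CTm} (hK : Wf K) (h : s.OK K A) (hc : A = .box .ctx → s.toDCtx.OK K ∧
    TmEq K.lock (oCode s.toDCtx) (.unbox .ctx (oCTm s)) .ctx) : CSubOK K (single s) (K.snoc A) := by
  have e : oCSub (Cocon.single s) = scons (oCTm s) Tm.var := by funext i; cases i <;> rfl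
  refine ⟨?_, ?_, ?_, ?_⟩
  · rw [e, ← Fitch.single_eq]; exact .single (h.typed hK)
  · rintro (_ | y)
    · exact h.sc
    · trivial
  · intro y A l
    rw [e]
    cases l with
    | here => rw [Ty.sub_up]; simp only [scons, Ty.sub_id]; exact h
    | there l =>
      rw [Ty.sub_up]; simp only [scons, Ty.sub_id]
      exact ⟨_, l, .refl (l.tyWf hK)⟩
  · intro y l
    generalize e' : Ty.box .ctx = B at l
    cases l with
    | here => exact hc (up_eq_box_ctx e'.symm)
    | there l =>
      obtain rfl := up_eq_box_ctx e'.symm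
      exact ⟨l, .refl (HasTm.unbox_ctx hK l)⟩

end CSubOK

/-- Domain-level contexts on which computation-level substitution agrees with substitution in the
telescope. -/
inductive CSem (K' : Fitch.Ctx) (θ : ℕ → CTm) (K : Fitch.Ctx) : DCtx → Prop
  | nil : CSem K' θ K .nil
  | var {y} : Look K y (.box .ctx) → CSem K' θ K (.var y)
  | snoc {Ψ A} : CSem K' θ K Ψ → HasTm (tel K Ψ) (oTy Ψ.len A) .univ →
      TmEq (tel K' (Ψ.csub θ)) (oTy (Ψ.csub θ).len (A.csub θ)) ((oTy Ψ.len A).sub (ctel θ Ψ)) .univ →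
      CSem K' θ K (.snoc Ψ A)

namespace CSem

variable {K K' : Fitch.Ctx} {θ : ℕ → CTm} {Ψ : DCtx}

theorem sem (h : CSem K' θ K Ψ) (hK : Wf K) : SemCtx K Ψ := by
  induction h with
  | nil => exact .nil hK
  | var l => exact .var hK l
  | snoc _ hA _ ih => exact .snoc ih hA

theorem sem_sb (h : CSem K' θ K Ψ) (g : CSubOK K' θ K) :
    SemCtx K' (Ψ.csub θ) ∧ Sb (tel K' (Ψ.csub θ)) (ctel θ Ψ) (tel K Ψ) := by
  induction h with
  | nil => exact ⟨.nil g.wf, g.sb.locked.lift kitTm (A := .elc .top) (.elc (.top (.lock g.wf)))⟩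
  | @var y l =>
    obtain ⟨h₁, h₂⟩ := g.ctx l
    have s := h₁.typed g.wf
    refine ⟨s, ?_⟩
    have c := g.sb.locked.comp s.wk
    have e := h₂.sub s.wk
    have t := s.tup
    refine .scons (A := .elc (.unbox .ctx (.var y))) ?_ ?_
    · simp only [Tm.up_eq]; exact c
    · refine .conv t (.elc ?_)
      simp only [Tm.up_eq]; exact e
  | snoc _ hA e ih =>
    exact ⟨.snoc ih.1 e.left, ih.2.conv (.el e.left) (.el e.symm)⟩

theorem sem' (h : CSem K' θ K Ψ) (g : CSubOK K' θ K) : SemCtx K' (Ψ.csub θ) := (h.sem_sb g).1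
theorem sb (h : CSem K' θ K Ψ) (g : CSubOK K' θ K) :
    Sb (tel K' (Ψ.csub θ)) (ctel θ Ψ) (tel K Ψ) := (h.sem_sb g).2

theorem code_proj (h : CSem K' θ K Ψ) (g : CSubOK K' θ K) (hK : Wf K) :
    TmEq K'.lock (oCode (Ψ.csub θ)) ((oCode Ψ).sub (oCSub θ)) .ctx ∧
    SbEq (K'.lock.snoc (.elc (oCode (Ψ.csub θ)))) (fun i => (ctel θ Ψ i).sub (oProj (Ψ.csub θ)))
      (fun i => (oProj Ψ i).sub (Fitch.liftSub (oCSub θ))) (tel K Ψ) := by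
  induction h with
  | nil =>
    have s := SemCtx.nil g.wf
    refine ⟨.refl s.code, ?_⟩
    have e : (fun i => (oProj .nil i).sub (Fitch.liftSub (oCSub θ))) =
        fun i => (ctel θ .nil i).sub (oProj .nil) := funext fun i => (Tm.sub_id _).symm
    rw [e]
    exact .refl (((CSem.nil (θ := θ) (K := K)).sb g).comp s.proj)
  | @var y l =>
    obtain ⟨h₁, h₂⟩ := g.ctx l
    have s := h₁.typed g.wf
    refine ⟨h₂, ?_⟩
    have hs : Sb (K'.lock.snoc (.elc (oCode (θ y).toDCtx))) (wkn 1) K'.lock :=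
      .up (Δ := [_]) kitTm s.wfCode
    have c := g.sb.locked.comp hs
    have e := SbEq.scons (A := .elc (.unbox .ctx (.var y))) (.refl c)
      (.conv s.tup_proj (.elc (h₂.sub hs)))
    have e₁ : (fun i => (ctel θ (.var y) i).sub (oProj (θ y).toDCtx)) =
        scons ((oTup (θ y).toDCtx).sub (oProj (θ y).toDCtx))
          fun n => (oCSub θ n).sub (wkn 1) := by
      funext i
      cases i with
      | zero => rfl
      | succ i => exact (up_sub_oProj _ _).trans (Tm.up_eq _ _)
    have e₂ : (fun i => (oProj (.var y) i).sub (Fitch.liftSub (oCSub θ))) =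
        scons (.var 0) fun n => (oCSub θ n).sub (wkn 1) := by
      funext i
      cases i with
      | zero => rfl
      | succ i => exact Tm.up_eq _ _
    rw [e₂, DCtx.csub, e₁]
    exact e
  | @snoc Ψ A h hA eA ih =>
    obtain ⟨ec, ep⟩ := ih
    have h₀ := h.sem hK
    have h₀' := h.sem' g
    have h₁' := (CSem.snoc h hA eA).sem' g
    have eX : TmEq (K'.lock.snoc (.elc (oCode (Ψ.csub θ))))
        ((oTy (Ψ.csub θ).len (A.csub θ)).sub (oProj (Ψ.csub θ)))
        (((oTy Ψ.len A).sub (oProj Ψ)).sub (Fitch.liftSub (oCSub θ))) .univ := by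
      have e₁ := eA.sub h₀'.proj
      have e₂ := hA.subEq ep
      rw [Tm.sub_sub] at e₁ ⊢
      exact e₁.trans e₂
    have eF : TmEq K'.lock (oFam (Ψ.csub θ) (A.csub θ)) ((oFam Ψ A).sub (oCSub θ))
        (.pi (.elc (oCode (Ψ.csub θ))) .univ) := .lam (.elc h₀'.code) (.elc ec) eX
    have eC : TmEq K'.lock (oCode ((DCtx.snoc Ψ A).csub θ)) ((oCode (.snoc Ψ A)).sub (oCSub θ))
        .ctx := .ext h₀'.code ec eF
    refine ⟨eC, ?_⟩
    have hX := h₁'.head.sub h₀'.proj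
    have hE := h₁'.code
    have hs : Sb (K'.lock.snoc (.elc (oCode ((DCtx.snoc Ψ A).csub θ)))) (wkn 1) K'.lock :=
      .up (Δ := [_]) kitTm h₁'.wfCode
    have hv : HasTm (K'.lock.snoc (.elc (oCode ((DCtx.snoc Ψ A).csub θ)))) (.var 0)
        (.elc ((oCode ((DCtx.snoc Ψ A).csub θ)).sub (wkn 1))) := by
      rw [← Tm.up_eq]; exact .var h₁'.wfCode .here
    have hc' := h₀'.code.sub hs
    have ec' := ec.sub hs
    have hF' := eF.left.sub hs
    have eF' := eF.sub hs
    have e₁ := TmEq.fst hc' ec' hF' eF' (.refl hv)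
    have e₂ := ep.comp (.scons (.refl hs) (A := .elc (oCode (Ψ.csub θ))) e₁)
    have e₃ : TmEq (K'.lock.snoc (.elc (oCode ((DCtx.snoc Ψ A).csub θ))))
        (.snd ((oCode (Ψ.csub θ)).sub (wkn 1)) ((oFam (Ψ.csub θ) (A.csub θ)).sub (wkn 1)) (.var 0))
        (.snd (((oCode Ψ).sub (oCSub θ)).sub (wkn 1)) (((oFam Ψ A).sub (oCSub θ)).sub (wkn 1))
          (.var 0)) (.el ((oTy Ψ.len A).sub fun i => ((ctel θ Ψ i).sub (oProj (Ψ.csub θ))).sub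
            (scons (.fst ((oCode (Ψ.csub θ)).sub (wkn 1))
              ((oFam (Ψ.csub θ) (A.csub θ)).sub (wkn 1)) (.var 0)) (wkn 1)))) := by
      refine .conv (.snd hc' ec' hF' eF' hv (.refl hv)) ?_
      have h₁ := TmEq.apT_lam h₀'.code hX hs (.fst hc' hF' hv)
      have h₂ := (eA.sub h₀'.proj).sub (hs.scons (A := .elc (oCode (Ψ.csub θ))) e₁.left)
      rw [Tm.sub_sub (oTy Ψ.len A), Tm.sub_sub (oTy Ψ.len A)] at h₂
      exact .el (h₁.trans h₂)
    have e₄ := SbEq.scons (A := .el (oTy Ψ.len A)) e₂ e₃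
    have lw : ∀ t : Tm, (t.up 1).sub (Fitch.liftSub (oCSub θ)) = (t.sub (oCSub θ)).sub (wkn 1) :=
      fun t => by rw [Tm.up_one_liftSub, Tm.up_eq]
    convert e₄ using 1
    · funext i
      rw [ctel, DCtx.csub, oProj_snoc, Tm.up_eq, Tm.up_eq]
      cases i with
      | zero => rfl
      | succ i => rw [Fitch.liftSub, Tm.sub_up, scons, Tm.sub_sub]; rfl
    · funext i
      rw [oProj_snoc]
      cases i with
      | zero => rw [scons, Tm.sub, lw, lw]; rfl
      | succ i =>
        rw [scons, Tm.sub_sub, scons, Tm.sub_sub]; congr 1; funext j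
        cases j with
        | zero => rw [scons, Tm.sub, lw, lw]; rfl
        | succ j => exact (Tm.up_eq _ _).trans (Tm.sub_up (oCSub θ j) 1 (scons _ (wkn 1))).symm
    · rfl

theorem code (h : CSem K' θ K Ψ) (g : CSubOK K' θ K) (hK : Wf K) :
    TmEq K'.lock (oCode (Ψ.csub θ)) ((oCode Ψ).sub (oCSub θ)) .ctx := (h.code_proj g hK).1
theorem proj (h : CSem K' θ K Ψ) (g : CSubOK K' θ K) (hK : Wf K) :
    SbEq (K'.lock.snoc (.elc (oCode (Ψ.csub θ)))) (fun i => (ctel θ Ψ i).sub (oProj (Ψ.csub θ)))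
      (fun i => (oProj Ψ i).sub (Fitch.liftSub (oCSub θ))) (tel K Ψ) := (h.code_proj g hK).2

theorem tup (h : CSem K' θ K Ψ) (g : CSubOK K' θ K) (hK : Wf K) :
    TmEq (tel K' (Ψ.csub θ)) ((oTup Ψ).sub (ctel θ Ψ)) (oTup (Ψ.csub θ))
      (.elc ((oCode (Ψ.csub θ)).sub (wkn (Ψ.csub θ).len))) := by
  have s := h.sem hK
  have s' := h.sem' g
  have ec := h.code g hK
  have hb := h.sb g
  have hs := s'.wk.scons (A := .elc (oCode (Ψ.csub θ))) s'.tup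
  have e₁ := (h.proj g hK).comp (.refl hs)
  have e₂ := (SbEq.refl hb).comp s'.proj_tup
  simp only [Tm.sub_sub] at e₁
  have e₃ := ((e₂.symm s.wf).trans e₁ s.wf)
  have e₄ := s.tup.subEq e₃
  have hl := g.sb.locked.conv (A := .elc (oCode Ψ)) (.elc s'.code) (.elc ec.symm)
  have e₅ := (s.tup_proj.sub hl).sub hs
  simp only [Tm.sub_sub] at e₅
  have t₁ : (Ty.elc ((oCode Ψ).sub (wkn Ψ.len))).sub (fun n => (ctel θ Ψ n).sub Tm.var) =
      .elc (((oCode Ψ).sub (oCSub θ)).sub (wkn (Ψ.csub θ).len)) := by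
    simp only [Tm.sub_id, Ty.sub, Tm.sub_sub, ← Tm.up_eq (oCSub θ _), ← ctel_tail]
    rfl
  have t₂ : ((Ty.elc ((oCode Ψ).sub (wkn 1))).sub (Fitch.liftSub (oCSub θ))).sub
      (scons (oTup (Ψ.csub θ)) (wkn (Ψ.csub θ).len)) =
      .elc (((oCode Ψ).sub (oCSub θ)).sub (wkn (Ψ.csub θ).len)) := by
    simp only [Ty.sub, Tm.sub_sub]
    refine congrArg (fun f => Ty.elc ((oCode Ψ).sub f)) (funext fun i => ?_)
    exact Tm.sub_up _ _ _
  rw [t₁] at e₄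
  rw [t₂] at e₅
  simp only [Tm.sub_id] at e₄
  exact .conv (e₄.trans e₅) (.elc (ec.sub s'.wk).symm)

end CSem

theorem CtxEqv.csub {K K' θ Ψ Φ} (e : CtxEqv K Ψ Φ) (g : CSubOK K' θ K) (h : CSem K' θ K Ψ)
    (h' : CSem K' θ K Φ) : CtxEqv K' (Ψ.csub θ) (Φ.csub θ) := by
  induction e with
  | nil => exact .nil
  | var => exact .refl (h.sem' g)
  | snoc e eA ih =>
    cases h with
    | snoc h hA hA' =>
      cases h' with
      | snoc h' hB hB' =>
        have i := ih h h'
        refine .snoc i ?_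
        have e₁ := hB'.sub (i.id (h.sem' g))
        have e₂ := eA.sub (h.sb g)
        simp only [Tm.sub_id] at e₁
        rw [← i.len, ← e.len, ← e.ctel θ] at e₁
        exact hA'.trans (e₂.trans e₁.symm)

theorem Drop.csub {Ψ k Φ} (d : Drop Ψ k Φ) (θ : ℕ → CTm) : Drop (Ψ.csub θ) k (Φ.csub θ) := by
  induction d with
  | zero => exact .zero
  | succ _ ih => exact .succ ih

theorem Drop.csem {K K' θ Ψ k Φ} (d : Drop Ψ k Φ) (h : CSem K' θ K Ψ) : CSem K' θ K Φ := by
  induction d with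
  | zero => exact h
  | succ _ ih => cases h; exact ih ‹_›

theorem Decl.csub {K K' θ Ψ i a} (d : Decl Ψ i a) (h : CSem K' θ K Ψ) :
    ∃ a', Decl (Ψ.csub θ) i a' ∧ TmEq (tel K' (Ψ.csub θ)) a' (a.sub (ctel θ Ψ)) .univ := by
  induction d with
  | here =>
    cases h with
    | snoc h hA hA' =>
      refine ⟨_, .here, ?_⟩
      rw [ctel, Tm.up_one_liftSub]
      exact hA'.weaken (.el hA'.left)
  | there d ih =>
    cases h with
    | snoc h hA hA' =>
      obtain ⟨a', d', e⟩ := ih h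
      refine ⟨_, .there d', ?_⟩
      rw [ctel, Tm.up_one_liftSub]
      exact e.weaken (.el hA'.left)

end Cocon

namespace Fitch

theorem TmEq.inst₂ {Γ A B t t' s s'} (e : TmEq (.snoc Γ A) t t' B) (es : TmEq Γ s s' A) :
    TmEq Γ (t.inst s) (t'.inst s') (B.inst s) :=
  (e.sub (.single es.left)).trans (e.right.subEq (.single es.left es))

theorem TyEq.inst₂ {Γ A B B' s s'} (e : TyEq (.snoc Γ A) B B') (es : TmEq Γ s s' A) :
    TyEq Γ (B.inst s) (B'.inst s') :=
  (e.inst es.left).trans (e.right.subEq (.single es.left es))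

end Fitch

namespace Cocon

open Fitch (Tm Ty scons wkn Sb SbEq HasTm TmEq TyEq TyWf Wf Look kitTm)

theorem TmEq.oUnbox {K Ψ Φ A t σ c' X' t' u'} (hΨ : SemCtx K Ψ) (hΦ : SemCtx K Φ)
    (hA : HasTm (tel K Φ) (oTy Φ.len A) .univ)
    (hs : σ.Sc Ψ.len Φ.len) (hσ : Sb (tel K Ψ) (oSub Ψ.len σ) (tel K Φ))
    (ec : TmEq K.lock (oCode Φ) c' .ctx)
    (eX : TmEq (K.lock.snoc (.elc (oCode Φ))) ((oTy Φ.len A).sub (oProj Φ)) X' .univ)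
    (et : TmEq K (oCTm t) t' (.box (.pi (.elc (oCode Φ)) (.el ((oTy Φ.len A).sub (oProj Φ))))))
    (eu : TmEq (tel K Ψ) ((oTup Φ).sub (oSub Ψ.len σ)) u' (.elc ((oCode Φ).sub (wkn Ψ.len)))) :
    TmEq (tel K Ψ) (oTm Ψ.len (.unbox Φ A t σ)) (.open Ψ.len c' X' t' u')
      (.el ((oTy Φ.len A).sub (oSub Ψ.len σ))) := by
  obtain ⟨Δ, e, l⟩ := tel_eq K Ψ
  have hwf := hΨ.wf
  have e₃ := hA.subEq (hΦ.proj_tup.comp (SbEq.refl hσ))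
  rw [oTm_unbox]
  refine .conv (A := .el (((oTy Φ.len A).sub (oProj Φ)).sub
    (scons ((oTup Φ).sub (oSub Ψ.len σ)) (wkn Ψ.len)))) ?_ ?_
  · rw [← l] at eu ⊢
    rw [e] at hwf eu ⊢
    exact .open hwf ec eX et eu
  · refine .el ?_
    rw [Tm.sub_sub]
    have : (fun i => (oProj Φ i).sub (scons ((oTup Φ).sub (oSub Ψ.len σ)) (wkn Ψ.len))) =
        fun i => ((oProj Φ i).sub (scons (oTup Φ) (wkn Φ.len))).sub (oSub Ψ.len σ) := by
      funext i
      rw [Tm.sub_sub]; congr 1; funext j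
      cases j with
      | zero => rfl
      | succ j => exact (DSub.oSub_tail hs j).symm
    rw [this]
    exact e₃

theorem CSem.pull {K K' θ Ψ a a' T} (h : CSem K' θ K Ψ) (g : CSubOK K' θ K) (hK : Wf K)
    (ha : HasTm (tel K Ψ) a T)
    (e : TmEq (tel K' (Ψ.csub θ)) a' (a.sub (ctel θ Ψ)) (T.sub (ctel θ Ψ))) :
    TmEq (K'.lock.snoc (.elc (oCode (Ψ.csub θ)))) (a'.sub (oProj (Ψ.csub θ)))
      ((a.sub (oProj Ψ)).sub (Fitch.liftSub (oCSub θ)))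
      ((T.sub (ctel θ Ψ)).sub (oProj (Ψ.csub θ))) := by
  have e₁ := e.sub (h.sem' g).proj
  have e₂ := ha.subEq (h.proj g hK)
  rw [Ty.sub_sub, Tm.sub_sub a] at e₁
  rw [Ty.sub_sub, Tm.sub_sub a]
  exact e₁.trans e₂

theorem CSem.natural {K K' θ Ψ Φ σ σ' a a'} (h : CSem K' θ K Φ) (hK : Wf K)
    (ha : HasTm (tel K Φ) a .univ)
    (e : TmEq (tel K' (Φ.csub θ)) a' (a.sub (ctel θ Φ)) .univ)
    (hσ : Sb (tel K' (DCtx.csub θ Ψ)) (oSub (DCtx.csub θ Ψ).len σ') (tel K' (Φ.csub θ)))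
    (n : SbEq (tel K' (DCtx.csub θ Ψ)) (fun i => (oSub Ψ.len σ i).sub (ctel θ Ψ))
      (fun i => (ctel θ Φ i).sub (oSub (DCtx.csub θ Ψ).len σ')) (tel K Φ)) :
    TmEq (tel K' (DCtx.csub θ Ψ)) (a'.sub (oSub (DCtx.csub θ Ψ).len σ'))
      ((a.sub (oSub Ψ.len σ)).sub (ctel θ Ψ)) .univ := by
  have e₁ := e.sub hσ
  have e₂ := ha.subEq (n.symm (h.sem hK).wf)
  rw [Tm.sub_sub] at e₁ ⊢
  exact e₁.trans e₂

theorem oCTy_csub_ctx {τ : CTy} (h : oCTy τ = .box .ctx) (θ : ℕ → CTm) :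
    oCTy (τ.csub θ) = .box .ctx := by
  cases τ with
  | box T => cases T <;> cases h
  | pi => cases h
  | ctx => rfl

mutual
theorem DTy.OK.csub : ∀ {A : DTy} {K K' θ Ψ}, A.OK K Ψ → CSubOK K' θ K → CSem K' θ K Ψ →
    Wf K → (A.csub θ).OK K' (Ψ.csub θ) ∧ TmEq (tel K' (Ψ.csub θ))
      (oTy (Ψ.csub θ).len (A.csub θ)) ((oTy Ψ.len A).sub (ctel θ Ψ)) .univ
  | .ty, _, _, _, _, _, g, h, _ => ⟨trivial, .refl (.tyc (h.sem' g).wf)⟩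
  | .trm M, _, _, _, _, hM, g, h, hK => by
    have ⟨h₁, e₁⟩ := DTm.OK.csub (M := M) hM g h hK
    exact ⟨h₁, .trmc e₁⟩
  | .pi A B, _, _, _, _, ⟨hA, hB⟩, g, h, hK => by
    have ⟨h₁, e₁⟩ := DTy.OK.csub (A := A) hA g h hK
    have ⟨h₂, e₂⟩ := DTy.OK.csub (A := B) hB g (h.snoc (hA.typed (h.sem hK)) e₁) hK
    exact ⟨⟨h₁, h₂⟩, .pic e₁.left e₁ e₂⟩
theorem DTm.OK.csub : ∀ {M : DTm} {K K' θ Ψ a}, M.OK K Ψ a → CSubOK K' θ K → CSem K' θ K Ψ →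
    Wf K → (M.csub θ).OK K' (Ψ.csub θ) (a.sub (ctel θ Ψ)) ∧ TmEq (tel K' (Ψ.csub θ))
      (oTm (Ψ.csub θ).len (M.csub θ)) ((oTm Ψ.len M).sub (ctel θ Ψ)) (.el (a.sub (ctel θ Ψ)))
  | .var i, _, K', θ, Ψ, _, ⟨_, d, e⟩, g, h, hK => by
    obtain ⟨a', d', e'⟩ := d.csub h
    have hM : (DTm.var i).OK K' (Ψ.csub θ) _ := ⟨a', d', e'.trans (e.sub (h.sb g))⟩
    refine ⟨hM, ?_⟩
    have : (oTm Ψ.len (.var i)).sub (ctel θ Ψ) = .var i := ctel_lt θ Ψ i d.lt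
    rw [this]
    exact .refl (hM.typed (h.sem' g))
  | .lam A B M, _, _, _, _, _, ⟨hA, hB, hM, e⟩, g, h, hK => by
    have ⟨h₁, e₁⟩ := DTy.OK.csub hA g h hK
    have h' := h.snoc (hA.typed (h.sem hK)) e₁
    have ⟨h₂, e₂⟩ := DTy.OK.csub hB g h' hK
    have ⟨h₃, e₃⟩ := DTm.OK.csub hM g h' hK
    have e' := (TmEq.pic e₁.left e₁ e₂).trans (e.sub (h.sb g))
    refine ⟨⟨h₁, h₂, h₃.conv e₂.symm, e'⟩, ?_⟩
    exact .conv (.lam (.el e₁.left) (.el e₁) (.conv e₃ (.el e₂.symm)))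
      (.trans (.symm (.elPi e₁.left e₂.left)) (.el e'))
  | .app A B M N, _, _, _, _, _, ⟨hA, hB, hM, hN, e⟩, g, h, hK => by
    have ⟨h₁, e₁⟩ := DTy.OK.csub hA g h hK
    have h' := h.snoc (hA.typed (h.sem hK)) e₁
    have ⟨h₂, e₂⟩ := DTy.OK.csub hB g h' hK
    have ⟨h₃, e₃⟩ := DTm.OK.csub hM g h hK
    have ⟨h₄, e₄⟩ := DTm.OK.csub hN g h hK
    have e₅ := e.sub (h.sb g)
    rw [Tm.inst_sub] at e₅
    have ep := TmEq.pic e₁.left e₁ e₂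
    have e₄ := TmEq.conv e₄ (.el e₁.symm)
    have e' := (e₂.inst₂ e₄).trans e₅
    refine ⟨⟨h₁, h₂, h₃.conv ep.symm, h₄.conv e₁.symm, e'⟩, ?_⟩
    exact .conv (.app (.el e₁.left) (.el e₁) (.el e₂.left) (.el e₂)
      (.conv e₃ (.trans (.el ep.symm) (.elPi e₁.left e₂.left))) e₄.left e₄) (.el e')
  | .unbox Φ A t σ, K, K', θ, Ψ, _, ⟨hΦ, hA, ht, hσ, e⟩, g, h, hK => by
    have ⟨h₁, s⟩ := DCtx.OK.csub hΦ g hK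
    have ⟨h₂, e₂⟩ := DTy.OK.csub hA g s hK
    have ⟨h₃, e₃⟩ := CTm.OK.csub ht g hK
    have ⟨h₄, n⟩ := DSub.OK.csub hσ g h s hK
    have hA := hA.typed (s.sem hK)
    have hσ' := h₄.typed (h.sem' g) (s.sem' g)
    have eX := s.pull g hK hA e₂
    have ec := s.code g hK
    have eT : TyEq K' (.box (.pi (.elc (oCode (Φ.csub θ)))
        (.el ((oTy (Φ.csub θ).len (A.csub θ)).sub (oProj (Φ.csub θ))))))
        ((Ty.box (.pi (.elc (oCode Φ)) (.el ((oTy Φ.len A).sub (oProj Φ))))).sub (oCSub θ)) :=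
      .box (.pi (.elc ec.left) (.elc ec) (.el eX))
    have e₅ := (s.natural hK hA e₂ hσ' n).trans (e.sub (h.sb g))
    refine ⟨⟨h₁, h₂, h₃.conv eT.symm, h₄, e₅⟩, ?_⟩
    have eu : TmEq (tel K' (Ψ.csub θ)) ((oTup (Φ.csub θ)).sub (oSub (Ψ.csub θ).len (σ.csub θ)))
        (((oTup Φ).sub (oSub Ψ.len σ)).sub (ctel θ Ψ))
        (.elc ((oCode (Φ.csub θ)).sub (wkn (Ψ.csub θ).len))) := by
      have u₁ := (s.tup g hK).symm.sub hσ'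
      have u₂ := (s.sem hK).tup.subEq (n.symm (s.sem hK).wf)
      have wk : ∀ t : Tm, (t.sub (wkn (Φ.csub θ).len)).sub (oSub (Ψ.csub θ).len (σ.csub θ)) =
          t.sub (wkn (Ψ.csub θ).len) := fun t => by
        rw [Tm.sub_sub]; congr 1; funext i; exact DSub.oSub_tail h₄.sc i
      have e₆ : (Ty.elc ((oCode Φ).sub (wkn Φ.len))).sub
          (fun i => (ctel θ Φ i).sub (oSub (Ψ.csub θ).len (σ.csub θ))) =
          .elc (((oCode Φ).sub (oCSub θ)).sub (wkn (Ψ.csub θ).len)) := by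
        rw [← wk, Ty.sub, Tm.sub_sub, Tm.sub_sub, Tm.sub_sub]
        refine congrArg (fun f => Ty.elc ((oCode Φ).sub f)) (funext fun i => ?_)
        have : (wkn Φ.len i).sub (fun i => (ctel θ Φ i).sub (oSub (Ψ.csub θ).len (σ.csub θ))) =
          (ctel θ Φ (i + Φ.len)).sub (oSub (Ψ.csub θ).len (σ.csub θ)) := rfl
        rw [this, ctel_tail, Tm.sub_up]
        rfl
      rw [e₆] at u₂
      rw [Ty.sub, wk, Tm.sub_sub] at u₁
      rw [Tm.sub_sub]
      exact u₁.trans (.conv u₂ (.elc (ec.symm.sub (h.sem' g).wk)))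
    have := TmEq.oUnbox (h.sem' g) (s.sem' g) e₂.left h₄.sc hσ' ec eX (.conv e₃ eT.symm) eu
    rw [oTm_unbox, Tm.open_sub (ctel_tail θ Ψ)]
    exact .conv this (.el e₅)
  | .o, _, _, _, _, _, e, g, h, _ =>
    have e' := TmEq.sub (A := .univ) e (h.sb g)
    ⟨e', .conv (.refl (.o (h.sem' g).wf)) (.el e')⟩
  | .arr a b, _, _, _, _, _, ⟨ha, hb, e⟩, g, h, hK => by
    have ⟨h₁, e₁⟩ := DTm.OK.csub ha g h hK
    have ⟨h₂, e₂⟩ := DTm.OK.csub hb g h hK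
    have e' := e.sub (h.sb g)
    exact ⟨⟨h₁, h₂, e'⟩, .conv (.arr e₁ e₂) (.el e')⟩
  | .lamc a b f, _, _, _, _, _, ⟨ha, hb, hf, e⟩, g, h, hK => by
    have ⟨h₁, e₁⟩ := DTm.OK.csub ha g h hK
    have ⟨h₂, e₂⟩ := DTm.OK.csub hb g h hK
    have ⟨h₃, e₃⟩ := DTm.OK.csub hf g h hK
    have et := TmEq.trmc e₁
    have eb := (TmEq.trmc e₂).weaken (.el et.left)
    have ef := TmEq.pic et.left et eb
    simp only [Tm.sub, Tm.up_one_liftSub] at h₃ e₃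
    have e' := (TmEq.trmc (.arr e₁ e₂)).trans (e.sub (h.sb g))
    refine ⟨⟨h₁, h₂, h₃.conv ef.symm, e'⟩, ?_⟩
    exact .conv (.lamc e₁.left e₂.left e₁ e₂
      (.conv e₃ (.trans (.el ef.symm) (.elPi et.left eb.left)))) (.el e')
  | .appc a b m k, _, _, _, _, _, ⟨ha, hb, hm, hk, e⟩, g, h, hK => by
    have ⟨h₁, e₁⟩ := DTm.OK.csub ha g h hK
    have ⟨h₂, e₂⟩ := DTm.OK.csub hb g h hK
    have ⟨h₃, e₃⟩ := DTm.OK.csub hm g h hK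
    have ⟨h₄, e₄⟩ := DTm.OK.csub hk g h hK
    have e₅ := TmEq.trmc (.arr e₁ e₂)
    have e₆ := TmEq.trmc e₁
    have e' := (TmEq.trmc e₂).trans (e.sub (h.sb g))
    exact ⟨⟨h₁, h₂, h₃.conv e₅.symm, h₄.conv e₆.symm, e'⟩, .conv (.appc e₁.left e₂.left e₁ e₂
      (.conv e₃ (.el e₅.symm)) (.conv e₄ (.el e₆.symm))) (.el e')⟩
theorem DSub.OK.csub : ∀ {σ : DSub} {K K' θ Ψ Φ}, σ.OK K Ψ Φ → CSubOK K' θ K →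
    CSem K' θ K Ψ → CSem K' θ K Φ → Wf K →
    DSub.OK K' (Ψ.csub θ) (DSub.csub θ σ) (Φ.csub θ) ∧
    SbEq (tel K' (Ψ.csub θ)) (fun i => (oSub Ψ.len σ i).sub (ctel θ Ψ))
      (fun i => (ctel θ Φ i).sub (oSub (Ψ.csub θ).len (DSub.csub θ σ))) (tel K Φ)
  | .nil, K, _, θ, Ψ, Φ, e, g, h, h', hK => by
    have hσ := DSub.OK.typed (σ := .nil) (K := K) e (h.sem hK) (h'.sem hK)
    rw [DSub.OK] at e; subst e
    refine ⟨rfl, ?_⟩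
    convert SbEq.refl (hσ.comp (h.sb g)) using 1
    funext i
    cases i with
    | zero => rfl
    | succ i =>
      have : (oSub Ψ.len .nil (i + 1)).sub (ctel θ Ψ) = ctel θ Ψ (i + Ψ.len) := rfl
      rw [this, ctel_tail, Tm.up_eq]
      exact Tm.sub_up _ _ _
  | .wk k, K, _, θ, Ψ, Φ, ⟨Φ₀, d, e⟩, g, h, h', hK => by
    have hσ := DSub.OK.typed (σ := .wk k) (K := K) ⟨Φ₀, d, e⟩ (h.sem hK) (h'.sem hK)
    refine ⟨⟨_, d.csub θ, e.csub g (d.csem h) h'⟩, ?_⟩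
    convert SbEq.refl (hσ.comp (h.sb g)) using 1
    funext i
    have : (oSub Ψ.len (.wk k) i).sub (ctel θ Ψ) = ctel θ Ψ (i + k) := rfl
    rw [this, d.ctel, e.ctel, Tm.up_eq]
    rfl
  | .cons σ M, _, _, θ, Ψ, _, ⟨Φ, A, e, hσ, hM⟩, g, h, h', hK => by
    subst e
    cases h' with
    | snoc s hA eA =>
      have ⟨h₁, n⟩ := DSub.OK.csub hσ g h s hK
      have ⟨h₂, e₂⟩ := DTm.OK.csub hM g h hK
      have hσ' := h₁.typed (h.sem' g) (s.sem' g)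
      have e₃ := s.natural hK hA eA hσ' n
      refine ⟨⟨_, _, rfl, h₁, h₂.conv e₃.symm⟩, ?_⟩
      have := n.scons (A := .el (oTy Φ.len A)) (t := (oTm Ψ.len M).sub (ctel θ Ψ))
        (t' := oTm (Ψ.csub θ).len (M.csub θ)) (by rw [← Ty.sub_sub]; exact e₂.symm)
      convert this using 1
      · funext i; cases i <;> rfl
      · funext i
        cases i with
        | zero => rfl
        | succ i => exact Tm.sub_up _ _ _
      · rfl
theorem DCtx.OK.csub : ∀ {Ψ : DCtx} {K K' θ}, Ψ.OK K → CSubOK K' θ K → Wf K →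
    (Ψ.csub θ).OK K' ∧ CSem K' θ K Ψ
  | .nil, _, _, _, _, _, _ => ⟨trivial, .nil⟩
  | .var _, _, _, _, l, g, _ => ⟨(g.ctx l).1, .var l⟩
  | .snoc Ψ A, _, _, _, ⟨hΨ, hA⟩, g, hK => by
    have ⟨h₁, s⟩ := DCtx.OK.csub (Ψ := Ψ) hΨ g hK
    have ⟨h₂, e₂⟩ := DTy.OK.csub (A := A) hA g s hK
    exact ⟨⟨h₁, h₂⟩, s.snoc (hA.typed (s.sem hK)) e₂⟩
theorem CxTy.OK.csub : ∀ {T : CxTy} {K K' θ}, T.OK K → CSubOK K' θ K → Wf K →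
    (T.csub θ).OK K' ∧ TyEq K'.lock (oCxTy (T.csub θ)) ((oCxTy T).sub (oCSub θ))
  | .tm Ψ A, _, _, _, ⟨hΨ, hA⟩, g, hK => by
    have ⟨h₁, s⟩ := DCtx.OK.csub (Ψ := Ψ) hΨ g hK
    have ⟨h₂, e₂⟩ := DTy.OK.csub (A := A) hA g s hK
    have ec := s.code g hK
    exact ⟨⟨h₁, h₂⟩, .pi (.elc ec.left) (.elc ec)
      (.el (s.pull g hK (hA.typed (s.sem hK)) e₂))⟩
  | .vr Ψ A, _, _, _, ⟨hΨ, hA⟩, g, hK => by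
    have ⟨h₁, s⟩ := DCtx.OK.csub (Ψ := Ψ) hΨ g hK
    have ⟨h₂, e₂⟩ := DTy.OK.csub (A := A) hA g s hK
    have ec := s.code g hK
    exact ⟨⟨h₁, h₂⟩, .pi (.elc ec.left) (.elc ec)
      (.el (s.pull g hK (hA.typed (s.sem hK)) e₂))⟩
theorem CxObj.OK.csub : ∀ {C : CxObj} {K K' θ T}, C.OK K T → CSubOK K' θ K → Wf K →
    (C.csub θ).OK K' (T.sub (oCSub θ)) ∧
      TmEq K'.lock (oCxObj (C.csub θ)) ((oCxObj C).sub (oCSub θ)) (T.sub (oCSub θ))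
  | .mk Ψ M, _, K', θ, _, ⟨hΨ, a, hM, e⟩, g, hK => by
    have ⟨h₁, s⟩ := DCtx.OK.csub (Ψ := Ψ) hΨ g hK
    have ⟨h₂, e₂⟩ := DTm.OK.csub (M := M) hM g s hK
    have hM := hM.typed (s.sem hK)
    have ec := s.code g hK
    have ha := (hM.tyWf.of_el)
    have ea := s.pull g hK ha (.refl (ha.sub (s.sb g)))
    have e' : TyEq K'.lock (.pi (.elc (oCode (Ψ.csub θ)))
        (.el ((a.sub (ctel θ Ψ)).sub (oProj (Ψ.csub θ))))) _ :=
      .trans (.pi (.elc ec.left) (.elc ec) (.el ea)) (e.sub g.sb.locked)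
    exact ⟨⟨h₁, _, h₂, e'⟩, .conv (.lam (.elc ec.left) (.elc ec) (s.pull g hK hM e₂)) e'⟩
theorem CTy.OK.csub : ∀ {τ : CTy} {K K' θ}, τ.OK K → CSubOK K' θ K → Wf K →
    (τ.csub θ).OK K' ∧ TyEq K' (oCTy (τ.csub θ)) ((oCTy τ).sub (oCSub θ))
  | .box T, _, _, _, hT, g, hK => by
    have ⟨h₁, e₁⟩ := CxTy.OK.csub (T := T) hT g hK
    exact ⟨h₁, .box e₁⟩
  | .pi τ₁ τ₂, _, _, θ, ⟨h₁, h₂⟩, g, hK => by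
    have w := h₁.typed hK
    have ⟨h₁, e₁⟩ := CTy.OK.csub (τ := τ₁) h₁ g hK
    have ⟨h₂, e₂⟩ := CTy.OK.csub (τ := τ₂) h₂ (g.lift e₁.symm (oCTy_csub_ctx · θ))
      (.snoc hK w)
    rw [oCSub_lift g.sc] at e₂
    exact ⟨⟨h₁, h₂⟩, .pi e₁.left e₁ e₂⟩
  | .ctx, _, _, _, _, g, _ => ⟨trivial, .refl (.box (.ctx (.lock g.wf)))⟩
theorem CTm.OK.csub : ∀ {t : CTm} {K K' θ T}, t.OK K T → CSubOK K' θ K → Wf K →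
    (t.csub θ).OK K' (T.sub (oCSub θ)) ∧
      TmEq K' (oCTm (t.csub θ)) ((oCTm t).sub (oCSub θ)) (T.sub (oCSub θ))
  | .var _, _, _, _, _, ⟨_, l, e⟩, g, _ => by
    have h := (g.var l).conv (e.sub g.sb)
    exact ⟨h, .refl (h.typed g.wf)⟩
  | .box C, _, _, _, _, ⟨_, hC, e⟩, g, hK => by
    have ⟨h₁, e₁⟩ := CxObj.OK.csub hC g hK
    exact ⟨⟨_, h₁, e.sub g.sb⟩, .conv (.box e₁) (e.sub g.sb)⟩
  | .fn τ t, _, _, θ, _, ⟨hτ, B, ht, e⟩, g, hK => by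
    have w := hτ.typed hK
    have ⟨h₁, e₁⟩ := CTy.OK.csub hτ g hK
    have ⟨h₂, e₂⟩ := CTm.OK.csub ht (g.lift e₁.symm (oCTy_csub_ctx · θ)) (.snoc hK w)
    rw [oCSub_lift g.sc] at h₂ e₂
    have e' := TyEq.trans (.pi e₁.left e₁ (.refl e₂.left.tyWf)) (e.sub g.sb)
    exact ⟨⟨h₁, _, h₂, e'⟩, .conv (.lam e₁.left e₁ e₂) e'⟩
  | .app τ₁ τ₂ t s, _, _, θ, _, ⟨h₁, h₂, ht, hs, e⟩, g, hK => by
    have w := h₁.typed hK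
    have ⟨h₁, e₁⟩ := CTy.OK.csub h₁ g hK
    have ⟨h₂, e₂⟩ := CTy.OK.csub h₂ (g.lift e₁.symm (oCTy_csub_ctx · θ)) (.snoc hK w)
    have ⟨h₃, e₃⟩ := CTm.OK.csub ht g hK
    have ⟨h₄, e₄⟩ := CTm.OK.csub hs g hK
    rw [oCSub_lift g.sc] at e₂
    have ep := TyEq.pi e₁.left e₁ e₂
    have e₄ := TmEq.conv e₄ e₁.symm
    have e₅ := e.sub g.sb
    rw [Ty.inst_sub] at e₅
    have e' := (e₂.inst₂ e₄).trans e₅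
    exact ⟨⟨h₁, h₂, h₃.conv ep.symm, h₄.conv e₁.symm, e'⟩,
      .conv (.app e₁.left e₁ e₂.left e₂ (.conv e₃ ep.symm) e₄.left e₄) e'⟩
  | .ctx Ψ, _, _, _, _, ⟨hΨ, e⟩, g, hK => by
    have ⟨h₁, s⟩ := DCtx.OK.csub (Ψ := Ψ) hΨ g hK
    have e' := e.sub g.sb
    exact ⟨⟨h₁, e'⟩, .conv (.box (s.code g hK)) e'⟩
end

end Cocon

namespace Fitch

theorem Ty.ren_liftRen_eq (T : Ty) (n : ℕ) :
    T.ren (liftRen (· + n)) = T.sub (liftSub (wkn n)) := by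
  rw [Ty.ren_eq_sub, ← liftSub_var]; rfl

theorem TmEq.appBeta {D Γ : Ctx} {n : ℕ} {c φ X f u u' : Tm} {T T' : Ty} (hθ : Sb Γ (wkn n) D)
    (eφ : TmEq D c φ .ctx) (hX : HasTm (D.snoc (.elc c)) X T)
    (eT : TyEq (D.snoc (.elc c)) T T') (ef : TmEq D (.lam (.elc c) X) f (.pi (.elc c) T))
    (eu : TmEq Γ u u' (.elc (c.sub (wkn n)))) :
    TmEq Γ (X.sub (scons u (wkn n)))
      (.app (.elc (φ.up n)) (T'.ren (liftRen (· + n))) (f.up n) u')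
      (T.sub (scons u (wkn n))) := by
  have hE : TyWf Γ (.elc (c.sub (wkn n))) := .elc (eφ.left.sub hθ)
  have L := hθ.lift kitTm (A := .elc c) hE
  have e₁ := TmEq.piBeta hE (hX.tyWf.sub L) (hX.sub L) eu.left
  have e₂ := TmEq.app hE (.elc (eφ.sub hθ)) (hX.tyWf.sub L) (eT.sub L) (ef.sub hθ) eu.left eu
  rw [Ty.sub_liftSub_inst] at e₁ e₂
  rw [Tm.sub_liftSub_inst] at e₁
  rw [Ty.ren_liftRen_eq, Tm.up_eq, Tm.up_eq]
  exact e₁.symm.trans e₂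

theorem scons_var_wkn : scons (.var 0) (wkn 1) = Tm.var := by funext i; cases i <;> rfl

theorem TmEq.appBeta_var {D : Ctx} {c φ X f : Tm} {T T' : Ty}
    (eφ : TmEq D c φ .ctx) (hX : HasTm (D.snoc (.elc c)) X T)
    (eT : TyEq (D.snoc (.elc c)) T T') (ef : TmEq D (.lam (.elc c) X) f (.pi (.elc c) T)) :
    TmEq (D.snoc (.elc c)) X
      (.app (.elc (φ.up 1)) (T'.ren (liftRen (· + 1))) (f.up 1) (.var 0)) T := by
  have hv : HasTm (D.snoc (.elc c)) (.var 0) (.elc (c.sub (wkn 1))) := by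
    rw [← Tm.up_eq]; exact .var hX.wf .here
  have hs : Sb (D.snoc (.elc c)) (wkn 1) D := .up (Δ := [_]) kitTm hX.wf
  have := TmEq.appBeta hs eφ hX eT ef (.refl hv)
  rwa [scons_var_wkn, Tm.sub_id, Ty.sub_id] at this

theorem TmEq.openTy {K : Ctx} {Δ : List Ty} {A A' B B' : Ty} {t t' u u' : Tm}
    (hw : Wf (K.lock.append Δ))
    (eA : TyEq K.lock A A') (eB : TyEq (K.lock.snoc A) B B') (et : TmEq K t t' (.box (.pi A B)))
    (eu : TmEq (K.lock.append Δ) u u' (A.up Δ.length)) :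
    TmEq (K.lock.append Δ)
      (.app (A.up Δ.length) (B.ren (liftRen (· + Δ.length)))
        (.unbox ((Ty.pi A B).up Δ.length) (t.up Δ.length)) u)
      (.app (A'.up Δ.length) (B'.ren (liftRen (· + Δ.length)))
        (.unbox ((Ty.pi A' B').up Δ.length) (t'.up Δ.length)) u')
      (B.sub (scons u (wkn Δ.length))) := by
  have hp : TyEq K.lock (.pi A B) (.pi A' B') := .pi eA.left eA eB
  have h₂ := TmEq.unbox hp.left hp et hw
  have hA := eA.left.weakens Δ hw
  have hB := eB.sub ((SbV.up kitTm hw).lift kitTm ((Ty.up_eq A Δ.length) ▸ hA))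
  have e := Ty.ren_liftRen_eq B Δ.length
  have := TmEq.app (B := B.ren (liftRen (· + Δ.length))) (B' := B'.ren (liftRen (· + Δ.length)))
    hA (eA.weakens Δ hw) (by rw [e, Ty.up_eq]; exact hB.left)
    (by rw [e, Ty.ren_liftRen_eq, Ty.up_eq]; exact hB) h₂ eu.left eu
  rwa [e, Ty.sub_liftSub_inst, ← e] at this

end Fitch

namespace Cocon

open Fitch (Tm Ty scons wkn Sb SbEq HasTm TmEq TyEq TyWf Wf Look kitTm apT piT)

section Applications

variable {D : Fitch.Ctx} {c φ X f : Tm}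

theorem up_one_ren_succ (t : Tm) : (t.up 1).ren (Fitch.liftRen (· + 1)) = (t.up 1).up 1 :=
  up_one_ren t _

theorem TmEq.toApT (eφ : TmEq D c φ .ctx) (hX : HasTm (D.snoc (.elc c)) X .univ)
    (ef : TmEq D (.lam (.elc c) X) f (.pi (.elc c) .univ)) :
    TmEq (D.snoc (.elc c)) X (apT (φ.up 1) (f.up 1) (.var 0)) .univ :=
  .appBeta_var (T' := .univ) eφ hX (.refl (.univ hX.wf)) ef

theorem TmEq.toApS {ψ ψ' : Tm} (eφ : TmEq D c φ .ctx) (eψ : TmEq D ψ ψ' .ctx)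
    (hX : HasTm (D.snoc (.elc c)) X (.elc (ψ.up 1)))
    (ef : TmEq D (.lam (.elc c) X) f (.pi (.elc c) (.elc (ψ.up 1)))) :
    TmEq (D.snoc (.elc c)) X (apS (φ.up 1) (ψ'.up 1) (f.up 1) (.var 0)) (.elc (ψ.up 1)) := by
  have := TmEq.appBeta_var (T' := .elc (ψ'.up 1)) eφ hX (.elc (eψ.weaken (.elc eφ.left))) ef
  rw [Ty.ren, up_one_ren_succ] at this
  exact this

theorem TmEq.toApM {a a' : Tm} (eφ : TmEq D c φ .ctx) (hX : HasTm (D.snoc (.elc c)) X (.el a))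
    (ea : TmEq (D.snoc (.elc c)) a (apT (φ.up 1) (a'.up 1) (.var 0)) .univ)
    (ef : TmEq D (.lam (.elc c) X) f (.pi (.elc c) (.el a))) :
    TmEq (D.snoc (.elc c)) X (apM (φ.up 1) (a'.up 1) (f.up 1) (.var 0)) (.el a) := by
  have := TmEq.appBeta_var eφ hX (.el ea) ef
  simp only [apT, Ty.ren, Tm.ren, up_one_ren_succ] at this
  exact this

theorem TmEq.toApTy (eφ : TmEq D c φ .ctx) (hX : HasTm (D.snoc (.elc c)) X (.el .tyc))
    (ef : TmEq D (.lam (.elc c) X) f (.pi (.elc c) (.el .tyc))) :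
    TmEq (D.snoc (.elc c)) X (apTy (φ.up 1) (f.up 1) (.var 0)) (.el .tyc) :=
  .appBeta_var (T' := .el .tyc) eφ hX (.refl hX.tyWf) ef

theorem TmEq.toApTrm {a a' : Tm} (eφ : TmEq D c φ .ctx)
    (hX : HasTm (D.snoc (.elc c)) X (.el (.trmc a)))
    (ea : TmEq (D.snoc (.elc c)) a (apTy (φ.up 1) (a'.up 1) (.var 0)) (.el .tyc))
    (ef : TmEq D (.lam (.elc c) X) f (.pi (.elc c) (.el (.trmc a)))) :
    TmEq (D.snoc (.elc c)) X (apTrm (φ.up 1) (a'.up 1) (f.up 1) (.var 0)) (.el (.trmc a)) := by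
  have := TmEq.appBeta_var eφ hX (.el (.trmc ea)) ef
  simp only [apTy, Ty.ren, Tm.ren, up_one_ren_succ] at this
  exact this

theorem TmEq.toApArr {a a' b b' : Tm} (eφ : TmEq D c φ .ctx)
    (hX : HasTm (D.snoc (.elc c)) X (.el (.trmc (.arr a b))))
    (ea : TmEq (D.snoc (.elc c)) a (apTy (φ.up 1) (a'.up 1) (.var 0)) (.el .tyc))
    (eb : TmEq (D.snoc (.elc c)) b (apTy (φ.up 1) (b'.up 1) (.var 0)) (.el .tyc))
    (ef : TmEq D (.lam (.elc c) X) f (.pi (.elc c) (.el (.trmc (.arr a b))))) :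
    TmEq (D.snoc (.elc c)) X (apArr (φ.up 1) (a'.up 1) (b'.up 1) (f.up 1) (.var 0))
      (.el (.trmc (.arr a b))) := by
  have := TmEq.appBeta_var eφ hX (.el (.trmc (.arr ea eb))) ef
  simp only [apTy, Ty.ren, Tm.ren, up_one_ren_succ] at this
  exact this

theorem TmEq.toApFun {a a' b b' : Tm} (eφ : TmEq D c φ .ctx)
    (hX : HasTm (D.snoc (.elc c)) X (.pi (.el (.trmc a)) (.el (.trmc (b.up 1)))))
    (ea : TmEq (D.snoc (.elc c)) a (apTy (φ.up 1) (a'.up 1) (.var 0)) (.el .tyc))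
    (eb : TmEq (D.snoc (.elc c)) b (apTy (φ.up 1) (b'.up 1) (.var 0)) (.el .tyc))
    (ef : TmEq D (.lam (.elc c) X) f (.pi (.elc c) (.pi (.el (.trmc a)) (.el (.trmc (b.up 1)))))) :
    TmEq (D.snoc (.elc c)) X (apFun (φ.up 1) (a'.up 1) (b'.up 1) (f.up 1) (.var 0))
      (.pi (.el (.trmc a)) (.el (.trmc (b.up 1)))) := by
  have et := TmEq.trmc ea
  have := TmEq.appBeta_var eφ hX
    (.pi (.el et.left) (.el et) (.el ((TmEq.trmc eb).weaken (.el et.left)))) ef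
  have l : ∀ t : Tm, ((t.up 1).ren (· + 1)).ren (Fitch.liftRen (Fitch.liftRen (· + 1))) =
      (t.up 1).up 2 := fun t => by
    simp only [Tm.up, Tm.ren_ren]; rfl
  have e : (Tm.trmc (apTy (φ.up 1) (b'.up 1) (.var 0))).up 1 =
      .trmc (apTy ((φ.up 1).ren (· + 1)) ((b'.up 1).ren (· + 1)) (.var 1)) := rfl
  rw [e] at this
  simp only [apTy, Ty.ren, Tm.ren, up_one_ren_succ, l] at this
  exact this

end Applications

theorem TmEq.abs {D : Fitch.Ctx} {c φ t t' : Tm} {T : Ty} (eφ : TmEq D c φ .ctx)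
    (e : TmEq (D.snoc (.elc c)) t t' T) :
    TmEq D (.lam (.elc c) t) (Cocon.abs φ t') (.pi (.elc c) T) :=
  .lam (.elc eφ.left) (.elc eφ) e

end Cocon

namespace Cocon

open Fitch (Tm Ty scons wkn Sb SbEq HasTm TmEq TyEq TyWf Wf Look kitTm apT piT)

theorem SemCtx.tup_sub {K Γ Φ η n} (hΦ : SemCtx K Φ) (hη : Sb Γ η (tel K Φ))
    (h : ∀ i, η (i + Φ.len) = .var (i + n)) :
    HasTm Γ ((oTup Φ).sub η) (.elc ((oCode Φ).sub (wkn n))) := by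
  have := hΦ.tup.sub hη
  have e : ((oCode Φ).sub (wkn Φ.len)).sub η = (oCode Φ).sub (wkn n) := by
    rw [Tm.sub_sub]; congr 1; funext i; exact h i
  rwa [Ty.sub, e] at this

theorem SemCtx.proj_tup_sub {K Γ Φ η n} (hΦ : SemCtx K Φ) (hη : Sb Γ η (tel K Φ))
    (h : ∀ i, η (i + Φ.len) = .var (i + n)) :
    SbEq Γ (fun i => (oProj Φ i).sub (scons ((oTup Φ).sub η) (wkn n))) η (tel K Φ) := by
  have e := hΦ.proj_tup.comp (SbEq.refl hη)
  have : (fun i => (oProj Φ i).sub (scons ((oTup Φ).sub η) (wkn n))) =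
      fun i => ((oProj Φ i).sub (scons (oTup Φ) (wkn Φ.len))).sub η := by
    funext i
    rw [Tm.sub_sub]; congr 1; funext j
    cases j with
    | zero => rfl
    | succ j => exact (h j).symm
  rw [this]
  exact e

/-- The two translations of every type declared in a domain-level context agree. -/
inductive TrOK (K : Fitch.Ctx) : DCtx → Prop
  | nil : TrOK K .nil
  | var {y} : TrOK K (.var y)
  | snoc {Ψ A} : TrOK K Ψ → TmEq K.lock (oFam Ψ A) (trDTy (trDCtx Ψ) A)
      (.pi (.elc (oCode Ψ)) .univ) → TrOK K (.snoc Ψ A)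

namespace TrOK

variable {K : Fitch.Ctx} {Ψ : DCtx} {A B : DTy}

theorem code (h : TrOK K Ψ) (hΨ : SemCtx K Ψ) :
    TmEq K.lock (oCode Ψ) (trDCtx Ψ).code .ctx := by
  induction h with
  | nil => exact .refl hΨ.code
  | var => exact .refl hΨ.code
  | snoc _ e ih => exact .ext hΨ.tail.code (ih hΨ.tail) e

theorem wk_one (hΨ : SemCtx K Ψ) : Sb (K.lock.snoc (.elc (oCode Ψ))) (wkn 1) K.lock :=
  .up (Δ := [_]) kitTm hΨ.wfCode

theorem sub_proj_succ (t e : Tm) :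
    (t.sub fun j => oProj (.snoc Ψ A) (j + 1)).sub (scons e (wkn 1)) =
      (t.sub (oProj Ψ)).sub (scons (.fst ((oCode Ψ).sub (wkn 1)) ((oFam Ψ A).sub (wkn 1)) e)
        (wkn 1)) := by
  have up : ∀ t s : Tm, (t.up 1).sub (scons s (wkn 1)) = t.sub (wkn 1) :=
    fun t s => Tm.sub_up _ _ _
  rw [Tm.sub_sub, Tm.sub_sub]; congr 1; funext j
  rw [oProj_snoc]; simp only [scons, Tm.sub_sub]; congr 1; funext k
  cases k with
  | zero => simp only [scons, Tm.sub, up]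
  | succ k => rfl

theorem pick (h : TrOK K Ψ) (hΨ : SemCtx K Ψ) {i a} (d : Decl Ψ i a) {Γ e e'}
    (hs : Sb Γ (wkn 1) K.lock) (ee : TmEq Γ e e' (.elc ((oCode Ψ).sub (wkn 1)))) :
    TmEq Γ ((oProj Ψ i).sub (scons e (wkn 1))) ((trDCtx Ψ).pick i e')
      (.el ((a.sub (oProj Ψ)).sub (scons e (wkn 1)))) := by
  have up : ∀ t s : Tm, (t.up 1).sub (scons s (wkn 1)) = t.sub (wkn 1) :=
    fun t s => Tm.sub_up _ _ _
  induction d generalizing e e' with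
  | @here Ψ A =>
    cases h with
    | snoc h eA =>
      have h₀ := hΨ.tail
      have hX := hΨ.head.sub h₀.proj
      have ec := (h.code h₀).sub hs
      have ef := eA.sub hs
      have e₁ := TmEq.snd ec.left ec ef.left ef ee.left ee
      have e₂ := TmEq.apT_lam h₀.code hX hs (.fst ec.left ef.left ee.left)
      have e₃ := TmEq.conv e₁ (.el e₂)
      rw [Tm.sub_up, sub_proj_succ, oProj_snoc]
      simp only [scons, Tm.sub, up]
      simp only [trDCtx, TCtx.pick, Tm.up_eq _ 1]
      exact e₃
  | @there Ψ A i a d ih =>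
    cases h with
    | snoc h eA =>
      have h₀ := hΨ.tail
      have ec := (h.code h₀).sub hs
      have ef := eA.sub hs
      have e₁ := TmEq.fst ec.left ec ef.left ef ee
      have e₂ := ih h h₀ e₁
      have e₃ := sub_proj_succ (Ψ := Ψ) (A := A) (.var i) e
      simp only [Tm.sub] at e₃
      rw [e₃, Tm.sub_up, sub_proj_succ]
      simp only [trDCtx, TCtx.pick, Tm.up_eq _ 1]
      exact e₂

theorem proj (h : TrOK K Ψ) (hΨ : SemCtx K Ψ) {k Φ} (d : Drop Ψ k Φ) {Γ e e'}
    (hs : Sb Γ (wkn 1) K.lock) (ee : TmEq Γ e e' (.elc ((oCode Ψ).sub (wkn 1)))) :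
    TmEq Γ (((oTup Φ).sub fun i => oProj Ψ (i + k)).sub (scons e (wkn 1))) ((trDCtx Ψ).proj k e')
      (.elc ((oCode Φ).sub (wkn 1))) := by
  induction d generalizing e e' with
  | zero =>
    have e₁ := hΨ.tup_proj.sub (hs.scons (A := .elc _) ee.left)
    rw [Fitch.elc_wkn_scons] at e₁
    rw [TCtx.proj]
    exact e₁.trans ee
  | @succ Ψ Φ A k d ih =>
    cases h with
    | snoc h eA =>
      have h₀ := hΨ.tail
      have ec := (h.code h₀).sub hs
      have ef := eA.sub hs
      have e₁ := TmEq.fst ec.left ec ef.left ef ee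
      have e₂ := ih h h₀ e₁
      have eP : ((oTup Φ).sub fun i => oProj (.snoc Ψ A) (i + (k + 1))) =
          ((oTup Φ).sub (wkn k)).sub fun j => oProj (.snoc Ψ A) (j + 1) := by
        rw [Tm.sub_sub]; rfl
      rw [eP, sub_proj_succ, Tm.sub_sub _ (wkn k)]
      simp only [trDCtx, TCtx.proj, Tm.up_eq _ 1]
      exact e₂

theorem lift_proj_tail (Ψ : DCtx) (A : DTy) (i : ℕ) :
    Fitch.liftSub (oProj Ψ) (i + (DCtx.snoc Ψ A).len) = .var (i + 2) := by
  rw [DCtx.len, ← Nat.add_assoc, Fitch.liftSub, oProj_tail]; rfl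

section Pair

variable (hΨ : SemCtx K (.snoc Ψ A))
include hΨ

theorem lift_proj : Sb ((K.lock.snoc (.elc (oCode Ψ))).snoc (.el ((oTy Ψ.len A).sub (oProj Ψ))))
    (Fitch.liftSub (oProj Ψ)) (tel K (.snoc Ψ A)) :=
  hΨ.tail.proj.lift kitTm (A := .el _) (.el (hΨ.head.sub hΨ.tail.proj))

theorem tup_pairUX (h : TrOK K (.snoc Ψ A)) :
    TmEq ((K.lock.snoc (.elc (oCode Ψ))).snoc (.el ((oTy Ψ.len A).sub (oProj Ψ))))
      ((oTup (.snoc Ψ A)).sub (Fitch.liftSub (oProj Ψ)))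
      (pairUX (trDCtx Ψ).code (trDTy (trDCtx Ψ) A)) (.elc ((oCode (.snoc Ψ A)).sub (wkn 2))) := by
  have hL := lift_proj hΨ
  cases h with
  | snoc h eA =>
    have h₀ := hΨ.tail
    have hX := hΨ.head.sub h₀.proj
    have hs : Sb ((K.lock.snoc (.elc (oCode Ψ))).snoc (.el ((oTy Ψ.len A).sub (oProj Ψ))))
      (wkn 2) K.lock := .up (Δ := [_, _]) kitTm hL.wf
    have up : ∀ t : Tm, (t.up (Ψ.len + 1)).sub (Fitch.liftSub (oProj Ψ)) = t.sub (wkn 2) :=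
      fun t => by
        rw [Tm.sub_up]; congr 1; funext i; exact lift_proj_tail Ψ A i
    have ec := (h.code h₀).sub hs
    have ef := eA.sub hs
    have e₁ := h₀.tup_proj.weaken (.el hX)
    have e₂ : ((oCode Ψ).sub (wkn 1)).up 1 = (oCode Ψ).sub (wkn 2) := Tm.up_sub _ _ _
    rw [Ty.up, Ty.ren, ← Tm.up, e₂] at e₁
    have hv : HasTm ((K.lock.snoc (.elc (oCode Ψ))).snoc (.el ((oTy Ψ.len A).sub (oProj Ψ))))
      (.var 0) (.el (((oTy Ψ.len A).sub (oProj Ψ)).sub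
        (scons (((oTup Ψ).sub (oProj Ψ)).up 1) (wkn 2)))) := by
      have e₂ := hX.subEq (SbEq.scons (A := .elc (oCode Ψ)) (.refl hs) e₁)
      refine .conv (.var hL.wf .here) (.symm (.el ?_))
      have e₃ : scons ((Tm.var 0).up 1) (wkn 2) = wkn 1 := by funext i; cases i <;> rfl
      rw [e₃, ← Tm.up_eq] at e₂
      exact e₂
    have := TmEq.pair ec.left ec ef.left ef e₁.left e₁
      (.refl (.el_apT h₀.code hX hs e₁.left hv))
    rw [oTup_snoc, Tm.sub, up, up, Fitch.Tm.up_one_liftSub]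
    simp only [pairUX, Tm.up_eq _ 2]
    exact this

/-- The body of a function over an extended context, applied to the pair of the two innermost
variables. -/
theorem appPairUX (h : TrOK K (.snoc Ψ A)) {t f : Tm} {T T' : Ty}
    (ht : HasTm (tel K (.snoc Ψ A)) t T)
    (eT : TyEq (K.lock.snoc (.elc (oCode (.snoc Ψ A)))) (T.sub (oProj (.snoc Ψ A))) T')
    (ef : TmEq K.lock (.lam (.elc (oCode (.snoc Ψ A))) (t.sub (oProj (.snoc Ψ A)))) f
      (.pi (.elc (oCode (.snoc Ψ A))) (T.sub (oProj (.snoc Ψ A))))) :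
    TmEq ((K.lock.snoc (.elc (oCode Ψ))).snoc (.el ((oTy Ψ.len A).sub (oProj Ψ))))
      (t.sub (Fitch.liftSub (oProj Ψ)))
      (.app (.elc ((Tm.ext (trDCtx Ψ).code (trDTy (trDCtx Ψ) A)).up 2))
        (T'.ren (Fitch.liftRen (· + 2))) (f.up 2) (pairUX (trDCtx Ψ).code (trDTy (trDCtx Ψ) A)))
      (T.sub (Fitch.liftSub (oProj Ψ))) := by
  have hL := lift_proj hΨ
  have hs : Sb ((K.lock.snoc (.elc (oCode Ψ))).snoc (.el ((oTy Ψ.len A).sub (oProj Ψ))))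
      (wkn 2) K.lock := .up (Δ := [_, _]) kitTm hL.wf
  have e₁ := TmEq.appBeta hs (h.code hΨ) (ht.sub hΨ.proj) eT ef (tup_pairUX hΨ h)
  have e₂ := hΨ.proj_tup_sub hL (lift_proj_tail Ψ A)
  rw [Tm.sub_sub, Ty.sub_sub] at e₁
  exact .conv ((ht.subEq e₂).symm.trans e₁) (ht.tyWf.subEq e₂)

end Pair

theorem dPi (hΨ : SemCtx K Ψ) (h : TrOK K Ψ) (hA : HasTm (tel K Ψ) (oTy Ψ.len A) .univ)
    (hB : HasTm (tel K (.snoc Ψ A)) (oTy (Ψ.len + 1) B) .univ)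
    (eA : TmEq K.lock (oFam Ψ A) (trDTy (trDCtx Ψ) A) (.pi (.elc (oCode Ψ)) .univ))
    (eB : TmEq K.lock (oFam (.snoc Ψ A) B) (trDTy (trDCtx (.snoc Ψ A)) B)
      (.pi (.elc (oCode (.snoc Ψ A))) .univ)) :
    TmEq K.lock (oFam Ψ (.pi A B)) (trDTy (trDCtx Ψ) (.pi A B)) (.pi (.elc (oCode Ψ)) .univ) := by
  have hΨ' := SemCtx.snoc hΨ hA
  have h' := h.snoc eA
  have e₁ := TmEq.toApT (h.code hΨ) (hA.sub hΨ.proj) eA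
  have e₂ := appPairUX hΨ' h' hB (T' := .univ) (.refl (.univ hΨ'.wfCode)) eB
  exact TmEq.abs (h.code hΨ) (.pic (hA.sub hΨ.proj) e₁ e₂)

end TrOK

end Cocon

namespace Cocon

open Fitch (Tm Ty scons wkn Sb SbEq HasTm TmEq TyEq TyWf Wf Look kitTm apT piT)

theorem el_apT_ren (n : ℕ) (φ a t : Tm) : (Ty.el (apT (φ.up 1) (a.up 1) t)).ren (Fitch.liftRen (· + n)) =
    .el (apT ((φ.up n).up 1) ((a.up n).up 1) (t.ren (Fitch.liftRen (· + n)))) := by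
  simp only [apT, Ty.ren, Tm.ren, up_one_ren]; rfl

theorem apS_ren (φ ψ s : Tm) :
    (apS (φ.up 1) (ψ.up 1) (s.up 1) (.var 0)).ren (Fitch.liftRen (· + 1)) =
      apS (φ.up 2) (ψ.up 2) (s.up 2) (.var 0) := by
  have l : ((ψ.up 1).up 1).ren (Fitch.liftRen (Fitch.liftRen (· + 1))) = (ψ.up 2).up 1 := by
    simp only [Tm.up, Tm.ren_ren]; rfl
  simp only [apS, Ty.ren, Tm.ren, up_one_ren_succ, l]
  simp only [Tm.up_up]; rfl

mutual
theorem DTy.OK.tr : ∀ {A : DTy} {K Ψ}, A.OK K Ψ → SemCtx K Ψ → TrOK K Ψ →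
    TmEq K.lock (oFam Ψ A) (trDTy (trDCtx Ψ) A) (.pi (.elc (oCode Ψ)) .univ)
  | .ty, _, _, _, hΨ, h => TmEq.abs (h.code hΨ) (.refl (.tyc hΨ.wfCode))
  | .trm _, _, _, hM, hΨ, h =>
    TmEq.abs (h.code hΨ) (.trmc (TmEq.toApTy (h.code hΨ) ((DTm.OK.typed hM hΨ).sub hΨ.proj)
      (DTm.OK.tr hM hΨ h)))
  | .pi _ _, _, _, hA, hΨ, h =>
    have h₁ := DTy.OK.typed hA.1 hΨ
    have e₁ := DTy.OK.tr hA.1 hΨ h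
    have hΨ' := SemCtx.snoc hΨ h₁
    TrOK.dPi hΨ h h₁ (DTy.OK.typed hA.2 hΨ') e₁ (DTy.OK.tr hA.2 hΨ' (h.snoc e₁))
theorem DTm.OK.tr : ∀ {M : DTm} {K Ψ a}, M.OK K Ψ a → SemCtx K Ψ → TrOK K Ψ →
    TmEq K.lock (.lam (.elc (oCode Ψ)) ((oTm Ψ.len M).sub (oProj Ψ))) (trDTm (trDCtx Ψ) M)
      (.pi (.elc (oCode Ψ)) (.el (a.sub (oProj Ψ))))
  | .var i, K, Ψ, a, ⟨_, d, e⟩, hΨ, h => by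
    have hv : HasTm (K.lock.snoc (.elc (oCode Ψ))) (.var 0) (.elc ((oCode Ψ).sub (wkn 1))) := by
      rw [← Tm.up_eq]; exact .var hΨ.wfCode .here
    have := h.pick hΨ d (TrOK.wk_one hΨ) (.refl hv)
    rw [Fitch.scons_var_wkn, Tm.sub_id, Tm.sub_id] at this
    exact TmEq.abs (h.code hΨ) (.conv this (.el (TmEq.sub (A := .univ) e hΨ.proj)))
  | .lam A B M, K, Ψ, a, ⟨h₁, h₂, h₃, e⟩, hΨ, h => by
    have hA := DTy.OK.typed h₁ hΨ
    have eA := DTy.OK.tr h₁ hΨ h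
    have hΨ' := SemCtx.snoc hΨ hA
    have h' := h.snoc eA
    have hB := DTy.OK.typed h₂ hΨ'
    have eB := DTy.OK.tr h₂ hΨ' h'
    have hM := DTm.OK.typed h₃ hΨ'
    have eM := DTm.OK.tr h₃ hΨ' h'
    have e₁ := TmEq.toApT (h.code hΨ) (hA.sub hΨ.proj) eA
    have e₂ := TmEq.toApT (h'.code hΨ') (hB.sub hΨ'.proj) eB
    have e₃ := TrOK.appPairUX hΨ' h' hM (.el e₂) eM
    rw [el_apT_ren] at e₃
    have hL := TrOK.lift_proj hΨ'
    have e₄ := TmEq.lam (.el e₁.left) (.el e₁) e₃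
    have e₅ := TyEq.elPi e₁.left (hB.sub hL)
    exact TmEq.abs (h.code hΨ) (.conv e₄ (.trans e₅.symm (.el (TmEq.sub (A := .univ) e hΨ.proj))))
  | .app A B M N, K, Ψ, a, ⟨h₁, h₂, h₃, h₄, e⟩, hΨ, h => by
    have hA := DTy.OK.typed h₁ hΨ
    have eA := DTy.OK.tr h₁ hΨ h
    have hΨ' := SemCtx.snoc hΨ hA
    have h' := h.snoc eA
    have hB := DTy.OK.typed h₂ hΨ'
    have eB := DTy.OK.tr h₂ hΨ' h'
    have hM := DTm.OK.typed h₃ hΨ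
    have eM := DTm.OK.tr h₃ hΨ h
    have hN := DTm.OK.typed h₄ hΨ
    have eN := DTm.OK.tr h₄ hΨ h
    have hL := TrOK.lift_proj hΨ'
    have ec := h.code hΨ
    have e₁ := TmEq.toApT ec (hA.sub hΨ.proj) eA
    have e₂ := TrOK.appPairUX hΨ' h' hB (T' := .univ) (.refl (.univ hΨ'.wfCode)) eB
    have hP := (HasTm.pic hA hB).sub hΨ.proj
    have e₃ := TmEq.toApT ec hP (TrOK.dPi hΨ h hA hB eA eB)
    have e₄ := TmEq.toApM ec (hM.sub hΨ.proj) e₃ eM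
    have e₅ := TmEq.toApM ec (hN.sub hΨ.proj) e₁ eN
    have e₆ := TmEq.app (.el e₁.left) (.el e₁) (.el (hB.sub hL)) (.el e₂)
      (.conv e₄ (.elPi e₁.left (hB.sub hL))) e₅.left e₅
    refine TmEq.abs ec (.conv e₆ ?_)
    have := TmEq.sub (A := .univ) e hΨ.proj
    rw [Tm.inst_sub] at this
    exact .el this
  | .unbox Φ A t σ, K, Ψ, a, ⟨h₁, h₂, h₃, h₄, e⟩, hΨ, h => by
    have hK := hΨ.wfBase
    have hΦ := DCtx.OK.typed h₁ hK
    have tΦ := DCtx.OK.tr h₁ hK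
    have hA := DTy.OK.typed h₂ hΦ
    have eA := DTy.OK.tr h₂ hΦ tΦ
    have et := CTm.OK.tr h₃ hK
    have hs := h₄.sc
    have hσ := DSub.OK.typed h₄ hΨ hΦ
    have eσ := DSub.OK.tr h₄ hΨ hΦ h tΦ
    have ec := h.code hΨ
    have tail : ∀ i, (oSub Ψ.len σ (i + Φ.len)).sub (oProj Ψ) = .var (i + 1) := fun i => by
      rw [DSub.oSub_tail hs, Tm.sub, oProj_tail]
    have hp := hσ.comp hΨ.proj
    have hu := hΦ.tup_sub hp tail
    rw [← Tm.sub_sub] at hu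
    have e₁ := TmEq.toApS ec (tΦ.code hΦ) (by rw [Tm.up_eq]; exact hu) eσ
    have e₂ := TmEq.toApT (tΦ.code hΦ) (hA.sub hΦ.proj) eA
    have e₃ := TmEq.openTy (Δ := [.elc (oCode Ψ)]) hΨ.wfCode (.elc (tΦ.code hΦ)) (.el e₂) et e₁
    refine TmEq.abs ec (t := (oTm Ψ.len (.unbox Φ A t σ)).sub (oProj Ψ)) ?_
    have e₄ : (oTm Ψ.len (.unbox Φ A t σ)).sub (oProj Ψ) = .open 1 (oCode Φ)
        ((oTy Φ.len A).sub (oProj Φ)) (oCTm t) (((oTup Φ).sub (oSub Ψ.len σ)).sub (oProj Ψ)) := by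
      rw [oTm_unbox, Fitch.Tm.open_sub (θ := Tm.var) (n' := 1) (fun i => oProj_tail Ψ i),
        Tm.sub_id, Fitch.liftSub_id, Tm.sub_id, Tm.sub_id]
    rw [e₄]
    have e₅ := hA.subEq (hΦ.proj_tup_sub hp tail)
    have e₆ := TmEq.sub (A := .univ) e hΨ.proj
    rw [Tm.sub_sub] at e₆
    simp only [List.length_singleton] at e₃
    rw [Ty.sub, Tm.sub_sub, el_apT_ren, Tm.sub_sub] at e₃
    rw [Tm.sub_sub]
    exact .conv e₃ (.trans (.el e₅) (.el e₆))
  | .o, _, Ψ, _, e, hΨ, h =>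
    TmEq.abs (h.code hΨ) (.conv (.refl (.o hΨ.wfCode)) (.el (TmEq.sub (A := .univ) e hΨ.proj)))
  | .arr _ _, _, _, _, ⟨h₁, h₂, e⟩, hΨ, h =>
    have ec := h.code hΨ
    TmEq.abs ec (.conv (.arr
      (TmEq.toApTy ec ((DTm.OK.typed h₁ hΨ).sub hΨ.proj) (DTm.OK.tr h₁ hΨ h))
      (TmEq.toApTy ec ((DTm.OK.typed h₂ hΨ).sub hΨ.proj) (DTm.OK.tr h₂ hΨ h)))
      (.el (TmEq.sub (A := .univ) e hΨ.proj)))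
  | .lamc a b f, K, Ψ, _, ⟨h₁, h₂, h₃, e⟩, hΨ, h => by
    have ec := h.code hΨ
    have ha := DTm.OK.typed h₁ hΨ
    have hb := DTm.OK.typed h₂ hΨ
    have ea := TmEq.toApTy ec (ha.sub hΨ.proj) (DTm.OK.tr h₁ hΨ h)
    have eb := TmEq.toApTy ec (hb.sub hΨ.proj) (DTm.OK.tr h₂ hΨ h)
    have hf := (DTm.OK.typed h₃ hΨ).sub hΨ.proj
    have ef := DTm.OK.tr h₃ hΨ h
    have ta := HasTm.trmc ea.left
    have eP := TyEq.elPi ta (.trmc (eb.left.weaken (.el ta)))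
    simp only [Ty.sub, Tm.sub, Fitch.Tm.up_one_liftSub] at hf ef
    have e₁ := TmEq.toApFun ec (.conv hf eP) ea eb (.conv ef (.pi (.elc ec.left) (.refl (.elc ec.left)) eP))
    exact TmEq.abs ec (.conv (.lamc ea.left eb.left ea eb e₁)
      (.el (TmEq.sub (A := .univ) e hΨ.proj)))
  | .appc a b m n, K, Ψ, _, ⟨h₁, h₂, h₃, h₄, e⟩, hΨ, h => by
    have ec := h.code hΨ
    have ha := DTm.OK.typed h₁ hΨ
    have hb := DTm.OK.typed h₂ hΨ
    have ea := TmEq.toApTy ec (ha.sub hΨ.proj) (DTm.OK.tr h₁ hΨ h)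
    have eb := TmEq.toApTy ec (hb.sub hΨ.proj) (DTm.OK.tr h₂ hΨ h)
    have em := TmEq.toApArr ec ((DTm.OK.typed h₃ hΨ).sub hΨ.proj) ea eb (DTm.OK.tr h₃ hΨ h)
    have en := TmEq.toApTrm ec ((DTm.OK.typed h₄ hΨ).sub hΨ.proj) ea (DTm.OK.tr h₄ hΨ h)
    exact TmEq.abs ec (.conv (.appc ea.left eb.left ea eb em en)
      (.el (TmEq.sub (A := .univ) e hΨ.proj)))
theorem DSub.OK.tr : ∀ {σ : DSub} {K Ψ Φ}, σ.OK K Ψ Φ → SemCtx K Ψ → SemCtx K Φ → TrOK K Ψ →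
    TrOK K Φ →
    TmEq K.lock (.lam (.elc (oCode Ψ)) (((oTup Φ).sub (oSub Ψ.len σ)).sub (oProj Ψ)))
      (trDSub (trDCtx Ψ) (trDCtx Φ) σ) (.pi (.elc (oCode Ψ)) (.elc ((oCode Φ).up 1)))
  | .nil, _, _, _, e, hΨ, _, h, _ => by
    rw [DSub.OK] at e; subst e
    exact TmEq.abs (h.code hΨ) (.refl (.unit hΨ.wfCode))
  | .wk k, K, Ψ, Φ, ⟨Φ₀, d, e⟩, hΨ, hΦ, h, _ => by
    have h₀ := d.sem hΨ
    have hv : HasTm (K.lock.snoc (.elc (oCode Ψ))) (.var 0) (.elc ((oCode Ψ).sub (wkn 1))) := by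
      rw [← Tm.up_eq]; exact .var hΨ.wfCode .here
    have e₁ := h.proj hΨ d (TrOK.wk_one hΨ) (.refl hv)
    rw [Fitch.scons_var_wkn, Tm.sub_id] at e₁
    have e₂ := (e.tup h₀).sub ((d.sb hΨ).comp hΨ.proj)
    have e₃ : ((oCode Φ₀).sub (wkn Φ₀.len)).sub (fun i => (wkn k i).sub (oProj Ψ)) =
        (oCode Φ₀).sub (wkn 1) := by
      rw [Tm.sub_sub]; congr 1; funext i
      simp only [wkn, Tm.sub]
      rw [Nat.add_assoc, ← d.len, oProj_tail]
    rw [Ty.sub, e₃] at e₂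
    have e₄ := (e.code h₀).sub (TrOK.wk_one hΨ)
    refine TmEq.abs (h.code hΨ) (.conv ?_ (.elc (by rw [Tm.up_eq]; exact e₄)))
    rw [Tm.sub_sub]
    exact e₂.symm.trans e₁
  | .cons σ M, K, Ψ, _, ⟨Φ, A, e, h₁, h₂⟩, hΨ, hΦ, h, hT => by
    subst e
    cases hT with
    | snoc tΦ eA =>
    have h₀ := hΦ.tail
    have ec := h.code hΨ
    have hs := h₁.sc
    have hσ := DSub.OK.typed h₁ hΨ h₀
    have eσ := DSub.OK.tr h₁ hΨ h₀ h tΦ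
    have tail : ∀ i, (oSub Ψ.len σ (i + Φ.len)).sub (oProj Ψ) = .var (i + 1) := fun i => by
      rw [DSub.oSub_tail hs, Tm.sub, oProj_tail]
    have hp := hσ.comp hΨ.proj
    have hu := h₀.tup_sub hp tail
    rw [← Tm.sub_sub] at hu
    have e₁ := TmEq.toApS ec (tΦ.code h₀) (by rw [Tm.up_eq]; exact hu) eσ
    have wk := TrOK.wk_one hΨ
    have hX := hΦ.head.sub h₀.proj
    have e₂ := TmEq.apT_lam h₀.code hX wk hu
    have e₃ := hΦ.head.subEq (h₀.proj_tup_sub hp tail)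
    have c₁ := (tΦ.code h₀).sub wk
    have a₁ := eA.sub wk
    have u₁ := Tm.up_eq (oCode Φ) 1
    rw [u₁] at e₁
    have e₄ := TmEq.apT c₁.left c₁ a₁ e₁.left e₁
    have hM := (DTm.OK.typed h₂ hΨ).sub hΨ.proj
    have eM := DTm.OK.tr h₂ hΨ h
    have e₅ : TmEq (K.lock.snoc (.elc (oCode Ψ))) (((oTy Φ.len A).sub (oSub Ψ.len σ)).sub (oProj Ψ))
      (apT ((oCode Φ).sub (wkn 1)) ((oFam Φ A).sub (wkn 1))
        (((oTup Φ).sub (oSub Ψ.len σ)).sub (oProj Ψ))) .univ := by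
      rw [← Tm.sub_sub (oTup Φ)] at e₃
      rw [Tm.sub_sub (oTy Φ.len A) (oProj Φ)] at e₂
      rw [Tm.sub_sub (oTy Φ.len A)]
      exact .symm (e₂.trans e₃)
    have e₆ := TmEq.appBeta_var ec hM (.el (e₅.trans e₄)) eM
    have e₇ := TmEq.pair c₁.left c₁ a₁.left a₁ e₁.left e₁ (.conv e₆ (.el e₅))
    refine TmEq.abs ec (t := ((oTup (.snoc Φ A)).sub (oSub Ψ.len (.cons σ M))).sub (oProj Ψ)) ?_
    have up : ∀ t : Tm, ((t.up (Φ.len + 1)).sub (oSub Ψ.len (.cons σ M))).sub (oProj Ψ) =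
        t.sub (wkn 1) := fun t => by
      rw [Tm.sub_up, Tm.sub_sub]; congr 1; funext i; exact tail i
    have ep : ((oTup (.snoc Φ A)).sub (oSub Ψ.len (.cons σ M))).sub (oProj Ψ) =
        .pair ((oCode Φ).sub (wkn 1)) ((oFam Φ A).sub (wkn 1))
          (((oTup Φ).sub (oSub Ψ.len σ)).sub (oProj Ψ)) ((oTm Ψ.len M).sub (oProj Ψ)) := by
      simp only [oTup_snoc, Tm.sub, up]
      rw [Tm.sub_up]; rfl
    rw [ep, Tm.up_eq]
    simp only [← Tm.up_eq] at e₇ ⊢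
    rw [el_apT_ren] at e₇
    rw [apS_ren, Tm.up_up, Tm.up_up] at e₇
    exact e₇
theorem DCtx.OK.tr : ∀ {Ψ : DCtx} {K}, Ψ.OK K → Wf K → TrOK K Ψ
  | .nil, _, _, _ => .nil
  | .var _, _, _, _ => .var
  | .snoc _ _, _, h, hK =>
    have t := DCtx.OK.tr h.1 hK
    .snoc t (DTy.OK.tr h.2 (DCtx.OK.typed h.1 hK) t)
theorem CxTy.OK.tr : ∀ {T : CxTy} {K}, T.OK K → Wf K → TyEq K.lock (oCxTy T) (trCxTy T)
  | .tm _ _, _, h, hK =>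
    have hΨ := DCtx.OK.typed h.1 hK
    have t := DCtx.OK.tr h.1 hK
    .pi (.elc hΨ.code) (.elc (t.code hΨ)) (.el (TmEq.toApT (t.code hΨ)
      ((DTy.OK.typed h.2 hΨ).sub hΨ.proj) (DTy.OK.tr h.2 hΨ t)))
  | .vr _ _, _, h, hK =>
    have hΨ := DCtx.OK.typed h.1 hK
    have t := DCtx.OK.tr h.1 hK
    .pi (.elc hΨ.code) (.elc (t.code hΨ)) (.el (TmEq.toApT (t.code hΨ)
      ((DTy.OK.typed h.2 hΨ).sub hΨ.proj) (DTy.OK.tr h.2 hΨ t)))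
theorem CxObj.OK.tr : ∀ {C : CxObj} {K T}, C.OK K T → Wf K →
    TmEq K.lock (oCxObj C) (trCxObj C) T
  | .mk _ _, _, _, ⟨h₁, _, h₂, e⟩, hK =>
    have hΨ := DCtx.OK.typed h₁ hK
    .conv (DTm.OK.tr h₂ hΨ (DCtx.OK.tr h₁ hK)) e
theorem CTy.OK.tr : ∀ {τ : CTy} {K}, τ.OK K → Wf K → TyEq K (oCTy τ) (trCTy τ)
  | .box _, _, h, hK => .box (CxTy.OK.tr h hK)
  | .pi _ _, _, h, hK =>
    have h₁ := CTy.OK.typed h.1 hK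
    .pi h₁ (CTy.OK.tr h.1 hK) (CTy.OK.tr h.2 (.snoc hK h₁))
  | .ctx, _, _, hK => .refl (.box (.ctx (.lock hK)))
theorem CTm.OK.tr : ∀ {t : CTm} {K T}, t.OK K T → Wf K → TmEq K (oCTm t) (trCTm t) T
  | .var _, _, _, ⟨_, l, e⟩, hK => .conv (.refl (.var hK l)) e
  | .box _, _, _, ⟨_, h, e⟩, hK => .conv (.box (CxObj.OK.tr h hK)) e
  | .fn _ _, _, _, ⟨h₁, _, h₂, e⟩, hK =>
    have h := CTy.OK.typed h₁ hK
    .conv (.lam h (CTy.OK.tr h₁ hK) (CTm.OK.tr h₂ (.snoc hK h))) e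
  | .app _ _ _ _, _, _, ⟨h₁, h₂, h₃, h₄, e⟩, hK =>
    have h := CTy.OK.typed h₁ hK
    have hK' := Wf.snoc hK h
    .conv (.app h (CTy.OK.tr h₁ hK) (CTy.OK.typed h₂ hK') (CTy.OK.tr h₂ hK')
      (CTm.OK.tr h₃ hK) (CTm.OK.typed h₄ hK) (CTm.OK.tr h₄ hK)) e
  | .ctx _, _, _, ⟨h, e⟩, hK => .conv (.box ((DCtx.OK.tr h hK).code (DCtx.OK.typed h hK))) e
end

end Cocon

namespace Cocon

open Fitch (Tm Ty scons wkn Sb SbEq HasTm TmEq TyEq TyWf Wf Look kitTm apT piT)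

/-! ### Soundness of the open translation -/

def oCtx : Ctx → Fitch.Ctx
  | [] => .nil
  | τ :: Γ => .snoc (oCtx Γ) (oCTy τ)

structure SCtx (Γ : Ctx) : Prop where
  wf : Wf (oCtx Γ)
  look : ∀ {y τ}, CLook Γ y τ → τ.OK (oCtx Γ) ∧ Look (oCtx Γ) y (oCTy τ)

structure SDCtx (Γ : Ctx) (Ψ : DCtx) : Prop where
  base : SCtx Γ
  ok : Ψ.OK (oCtx Γ)

structure SDCtxEq (Γ : Ctx) (Ψ Ψ' : DCtx) : Prop where
  left : SDCtx Γ Ψ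
  right : SDCtx Γ Ψ'
  eqv : CtxEqv (oCtx Γ) Ψ Ψ'

structure SDTy (Γ : Ctx) (Ψ : DCtx) (A : DTy) : Prop where
  ctx : SDCtx Γ Ψ
  ok : A.OK (oCtx Γ) Ψ

structure SDTyEq (Γ : Ctx) (Ψ : DCtx) (A A' : DTy) : Prop where
  left : SDTy Γ Ψ A
  right : SDTy Γ Ψ A'
  eq : TmEq (tel (oCtx Γ) Ψ) (oTy Ψ.len A) (oTy Ψ.len A') .univ

structure SDTm (Γ : Ctx) (Ψ : DCtx) (M : DTm) (A : DTy) : Prop where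
  ty : SDTy Γ Ψ A
  ok : M.OK (oCtx Γ) Ψ (oTy Ψ.len A)

structure SDTmEq (Γ : Ctx) (Ψ : DCtx) (M M' : DTm) (A : DTy) : Prop where
  left : SDTm Γ Ψ M A
  right : SDTm Γ Ψ M' A
  eq : TmEq (tel (oCtx Γ) Ψ) (oTm Ψ.len M) (oTm Ψ.len M') (.el (oTy Ψ.len A))

structure SDSub (Γ : Ctx) (Ψ : DCtx) (σ : DSub) (Φ : DCtx) : Prop where
  src : SDCtx Γ Ψ
  tgt : SDCtx Γ Φ
  ok : σ.OK (oCtx Γ) Ψ Φ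

structure SDSubEq (Γ : Ctx) (Ψ : DCtx) (σ σ' : DSub) (Φ : DCtx) : Prop where
  left : SDSub Γ Ψ σ Φ
  right : SDSub Γ Ψ σ' Φ
  eq : SbEq (tel (oCtx Γ) Ψ) (oSub Ψ.len σ) (oSub Ψ.len σ') (tel (oCtx Γ) Φ)

structure SObj (Γ : Ctx) (C : CxObj) (T : CxTy) : Prop where
  base : SCtx Γ
  ty : T.OK (oCtx Γ)
  ok : C.OK (oCtx Γ) (oCxTy T)

structure SObjEq (Γ : Ctx) (C C' : CxObj) (T : CxTy) : Prop where
  left : SObj Γ C T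
  right : SObj Γ C' T
  eq : TmEq (oCtx Γ).lock (oCxObj C) (oCxObj C') (oCxTy T)

structure SCTy (Γ : Ctx) (τ : CTy) : Prop where
  base : SCtx Γ
  ok : τ.OK (oCtx Γ)

structure SCTyEq (Γ : Ctx) (τ τ' : CTy) : Prop where
  left : SCTy Γ τ
  right : SCTy Γ τ'
  eq : TyEq (oCtx Γ) (oCTy τ) (oCTy τ')
  ctx_iff : oCTy τ = .box .ctx ↔ oCTy τ' = .box .ctx

structure SCTm (Γ : Ctx) (t : CTm) (τ : CTy) : Prop where
  ty : SCTy Γ τ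
  ok : t.OK (oCtx Γ) (oCTy τ)
  ctx : oCTy τ = .box .ctx → t.toDCtx.OK (oCtx Γ) ∧
    TmEq (oCtx Γ).lock (oCode t.toDCtx) (.unbox .ctx (oCTm t)) .ctx

structure SCTmEq (Γ : Ctx) (t t' : CTm) (τ : CTy) : Prop where
  left : SCTm Γ t τ
  right : SCTm Γ t' τ
  eq : TmEq (oCtx Γ) (oCTm t) (oCTm t') (oCTy τ)

variable {Γ : Ctx} {Ψ Ψ' Ψ'' Φ Φ' : DCtx}

theorem SDCtx.sem (h : SDCtx Γ Ψ) : SemCtx (oCtx Γ) Ψ := h.ok.typed h.base.wf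

theorem SDTy.typed {A} (h : SDTy Γ Ψ A) : HasTm (tel (oCtx Γ) Ψ) (oTy Ψ.len A) .univ :=
  h.ok.typed h.ctx.sem

theorem SDTy.snoc {A} (h : SDTy Γ Ψ A) : SDCtx Γ (.snoc Ψ A) := ⟨h.ctx.base, h.ctx.ok, h.ok⟩

theorem SDTm.typed {A M} (h : SDTm Γ Ψ M A) :
    HasTm (tel (oCtx Γ) Ψ) (oTm Ψ.len M) (.el (oTy Ψ.len A)) :=
  h.ok.typed h.ty.ctx.sem

theorem SDSub.typed {σ} (h : SDSub Γ Ψ σ Φ) :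
    Sb (tel (oCtx Γ) Ψ) (oSub Ψ.len σ) (tel (oCtx Γ) Φ) := h.ok.typed h.src.sem h.tgt.sem

theorem SCTy.typed {τ} (h : SCTy Γ τ) : TyWf (oCtx Γ) (oCTy τ) := h.ok.typed h.base.wf

theorem SCTm.typed {τ t} (h : SCTm Γ t τ) : HasTm (oCtx Γ) (oCTm t) (oCTy τ) :=
  h.ok.typed h.ty.base.wf

/-! #### Contexts -/

theorem SCtx.nil : SCtx [] := ⟨.nil, nofun⟩

theorem SCtx.cons {τ} (h : SCTy Γ τ) : SCtx (τ :: Γ) where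
  wf := .snoc h.base.wf h.typed
  look l := by
    cases l with
    | here =>
      refine ⟨h.ok.cren (.succ h.typed) h.base.wf, ?_⟩
      rw [(CTy.o_cren _ h.ok.sc).1]
      exact .here
    | there l =>
      have ⟨h₁, h₂⟩ := h.base.look l
      refine ⟨h₁.cren (.succ h.typed) h.base.wf, ?_⟩
      rw [(CTy.o_cren _ h₁.sc).1]
      exact .there h₂

theorem SDCtxEq.refl (h : SDCtx Γ Ψ) : SDCtxEq Γ Ψ Ψ := ⟨h, h, .refl h.sem⟩

theorem SDCtxEq.symm (h : SDCtxEq Γ Ψ Ψ') : SDCtxEq Γ Ψ' Ψ :=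
  ⟨h.right, h.left, h.eqv.symm h.left.sem⟩

theorem SDCtxEq.trans (h : SDCtxEq Γ Ψ Ψ') (h' : SDCtxEq Γ Ψ' Ψ'') : SDCtxEq Γ Ψ Ψ'' :=
  ⟨h.left, h'.right, h.eqv.trans h'.eqv h.left.sem⟩

theorem SDCtxEq.snoc {A A'} (h : SDCtxEq Γ Ψ Ψ') (hA' : SDTy Γ Ψ' A') (e : SDTyEq Γ Ψ A A') :
    SDCtxEq Γ (.snoc Ψ A) (.snoc Ψ' A') := ⟨e.left.snoc, hA'.snoc, .snoc h.eqv e.eq⟩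

theorem SDTyEq.snoc {A A'} (e : SDTyEq Γ Ψ A A') :
    CtxEqv (oCtx Γ) (.snoc Ψ A) (.snoc Ψ A') := .snoc (.refl e.left.ctx.sem) e.eq

/-! #### Domain types -/

theorem SDTyEq.refl {A} (h : SDTy Γ Ψ A) : SDTyEq Γ Ψ A A := ⟨h, h, .refl h.typed⟩

theorem SDTyEq.symm {A A'} (h : SDTyEq Γ Ψ A A') : SDTyEq Γ Ψ A' A :=
  ⟨h.right, h.left, h.eq.symm⟩

theorem SDTyEq.trans {A A' A''} (h : SDTyEq Γ Ψ A A') (h' : SDTyEq Γ Ψ A' A'') :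
    SDTyEq Γ Ψ A A'' := ⟨h.left, h'.right, h.eq.trans h'.eq⟩

theorem SDTy.pi {A B} (hA : SDTy Γ Ψ A) (hB : SDTy Γ (.snoc Ψ A) B) : SDTy Γ Ψ (.pi A B) :=
  ⟨hA.ctx, hA.ok, hB.ok⟩

theorem SDTyEq.trm {M M'} (h : SDTmEq Γ Ψ M M' .ty) : SDTyEq Γ Ψ (.trm M) (.trm M') :=
  ⟨⟨h.left.ty.ctx, h.left.ok⟩, ⟨h.left.ty.ctx, h.right.ok⟩, .trmc h.eq⟩

theorem SDTy.convCtx {A A' B} (h : SDTy Γ (.snoc Ψ A) B) (e : SDTyEq Γ Ψ A A') :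
    SDTy Γ (.snoc Ψ A') B := ⟨e.right.snoc, h.ok.convCtx e.snoc e.left.snoc.sem⟩

theorem SDTyEq.pi {A A' B B'} (eA : SDTyEq Γ Ψ A A') (eB : SDTyEq Γ (.snoc Ψ A) B B') :
    SDTyEq Γ Ψ (.pi A B) (.pi A' B') :=
  ⟨eA.left.pi eB.left, eA.right.pi (eB.right.convCtx eA), .pic eA.left.typed eA.eq eB.eq⟩

/-! #### Domain terms -/

theorem DLook.decl {K Ψ n A} (d : DLook Ψ n A) (h : Ψ.OK K) (hK : Wf K) :
    A.OK K Ψ ∧ Decl Ψ n (oTy Ψ.len A) := by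
  induction d with
  | @here Ψ A =>
    have hs := h.1.typed hK
    refine ⟨h.2.shift (.zero (h.2.typed hs)) hs, ?_⟩
    rw [DCtx.len, DTy.o_shift_zero h.2.sc Ψ.one_le_len]
    exact .here
  | @there Ψ A B n _ ih =>
    have hs := h.1.typed hK
    have ⟨h₁, h₂⟩ := ih h.1
    refine ⟨h₁.shift (.zero (h.2.typed hs)) hs, ?_⟩
    rw [DCtx.len, DTy.o_shift_zero h₁.sc Ψ.one_le_len]
    exact .there h₂

theorem SDTmEq.refl {A M} (h : SDTm Γ Ψ M A) : SDTmEq Γ Ψ M M A := ⟨h, h, .refl h.typed⟩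

theorem SDTmEq.symm {A M M'} (h : SDTmEq Γ Ψ M M' A) : SDTmEq Γ Ψ M' M A :=
  ⟨h.right, h.left, h.eq.symm⟩

theorem SDTmEq.trans {A M M' M''} (h : SDTmEq Γ Ψ M M' A) (h' : SDTmEq Γ Ψ M' M'' A) :
    SDTmEq Γ Ψ M M'' A := ⟨h.left, h'.right, h.eq.trans h'.eq⟩

theorem SDTm.conv {A B M} (h : SDTm Γ Ψ M A) (e : SDTyEq Γ Ψ A B) : SDTm Γ Ψ M B :=
  ⟨e.right, h.ok.conv e.eq⟩

theorem SDTmEq.conv {A B M M'} (h : SDTmEq Γ Ψ M M' A) (e : SDTyEq Γ Ψ A B) :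
    SDTmEq Γ Ψ M M' B := ⟨h.left.conv e, h.right.conv e, h.eq.conv (.el e.eq)⟩

theorem SDTm.var {n A} (c : SDCtx Γ Ψ) (d : DLook Ψ n A) : SDTm Γ Ψ (.var n) A :=
  have h := d.decl c.ok c.base.wf
  have h' : SDTy Γ Ψ A := ⟨c, h.1⟩
  ⟨h', _, h.2, .refl h'.typed⟩

theorem SDTm.lam {A B M} (hA : SDTy Γ Ψ A) (hM : SDTm Γ (.snoc Ψ A) M B) :
    SDTm Γ Ψ (.lam A B M) (.pi A B) :=
  ⟨hA.pi hM.ty, hA.ok, hM.ty.ok, hM.ok, .refl (hA.pi hM.ty).typed⟩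

theorem oSub_wk_zero (n : ℕ) : oSub n (.wk 0) = Tm.var := rfl

theorem single_eq (t : Tm) : Fitch.single t = scons t Tm.var := by
  funext i; cases i <;> rfl

theorem oSub_inst (n : ℕ) (N : DTm) : oSub n (.cons (.wk 0) N) = Fitch.single (oTm n N) :=
  (single_eq _).symm

theorem SDCtx.wk (c : SDCtx Γ Ψ) {k} (d : Drop Ψ k Φ) (c' : SDCtx Γ Φ) : SDSub Γ Ψ (.wk k) Φ :=
  ⟨c, c', _, d, .refl c'.sem⟩

theorem SDSub.cons {σ A M} (h : SDSub Γ Ψ σ Φ) (hA : SDTy Γ Φ A) (hM : SDTm Γ Ψ M (A.sub σ)) :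
    SDSub Γ Ψ (.cons σ M) (.snoc Φ A) := by
  refine ⟨h.src, hA.snoc, _, _, rfl, h.ok, ?_⟩
  rw [← (DTy.o_sub hA.ok.sc h.ok.sc Ψ.one_le_len).1]
  exact hM.ok

theorem SDTm.inst {A N} (hN : SDTm Γ Ψ N A) : SDSub Γ Ψ (.cons (.wk 0) N) (.snoc Ψ A) := by
  refine ⟨hN.ty.ctx, hN.ty.snoc, _, _, rfl, ⟨_, .zero, .refl hN.ty.ctx.sem⟩, ?_⟩
  rw [oSub_wk_zero, Tm.sub_id]
  exact hN.ok

theorem SDTy.sub {A σ} (h : SDTy Γ Φ A) (s : SDSub Γ Ψ σ Φ) : SDTy Γ Ψ (A.sub σ) :=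
  ⟨s.src, h.ok.sub s.ok s.src.sem s.tgt.sem⟩

theorem SDTy.o_sub {A σ} (h : SDTy Γ Φ A) (s : SDSub Γ Ψ σ Φ) :
    oTy Ψ.len (A.sub σ) = (oTy Φ.len A).sub (oSub Ψ.len σ) :=
  (DTy.o_sub h.ok.sc s.ok.sc Ψ.one_le_len).1

theorem SDTm.o_sub {A M σ} (h : SDTm Γ Φ M A) (s : SDSub Γ Ψ σ Φ) :
    oTm Ψ.len (M.sub σ) = (oTm Φ.len M).sub (oSub Ψ.len σ) :=
  (DTm.o_sub h.ok.sc s.ok.sc Ψ.one_le_len).1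

theorem SDTm.sub {A M σ} (h : SDTm Γ Φ M A) (s : SDSub Γ Ψ σ Φ) :
    SDTm Γ Ψ (M.sub σ) (A.sub σ) :=
  ⟨h.ty.sub s, by rw [h.ty.o_sub s]; exact h.ok.sub s.ok s.src.sem s.tgt.sem⟩

theorem SDTy.o_inst {A B N} (hB : SDTy Γ (.snoc Ψ A) B) (hN : SDTm Γ Ψ N A) :
    oTy Ψ.len (B.inst N) = (oTy (Ψ.len + 1) B).inst (oTm Ψ.len N) := by
  rw [DTy.inst, hB.o_sub hN.inst, oSub_inst]; rfl

theorem SDTm.o_inst {A B M N} (hM : SDTm Γ (.snoc Ψ A) M B) (hN : SDTm Γ Ψ N A) :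
    oTm Ψ.len (M.inst N) = (oTm (Ψ.len + 1) M).inst (oTm Ψ.len N) := by
  rw [DTm.inst, hM.o_sub hN.inst, oSub_inst]; rfl

theorem SDTm.app {A B M N} (hB : SDTy Γ (.snoc Ψ A) B)
    (hM : SDTm Γ Ψ M (.pi A B)) (hN : SDTm Γ Ψ N A) : SDTm Γ Ψ (.app A B M N) (B.inst N) :=
  have h := hB.sub hN.inst
  ⟨h, hN.ty.ok, hB.ok, hM.ok, hN.ok, by rw [← hB.o_inst hN]; exact .refl h.typed⟩

theorem SDTm.unbox {A t σ} (hA : SDTy Γ Φ A)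
    (ht : t.OK (oCtx Γ) (.box (.pi (.elc (oCode Φ)) (.el ((oTy Φ.len A).sub (oProj Φ))))))
    (hσ : SDSub Γ Ψ σ Φ) : SDTm Γ Ψ (.unbox Φ A t σ) (A.sub σ) :=
  have h := hA.sub hσ
  ⟨h, hA.ctx.ok, hA.ok, ht, hσ.ok, by rw [← hA.o_sub hσ]; exact .refl h.typed⟩

theorem SDTm.o (c : SDCtx Γ Ψ) : SDTm Γ Ψ .o .ty := ⟨⟨c, trivial⟩, .refl (.tyc c.sem.wf)⟩

theorem SDTm.arr {a b} (ha : SDTm Γ Ψ a .ty) (hb : SDTm Γ Ψ b .ty) : SDTm Γ Ψ (.arr a b) .ty :=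
  ⟨ha.ty, ha.ok, hb.ok, .refl (.tyc ha.ty.ctx.sem.wf)⟩

theorem SDTm.trm {a} (h : SDTm Γ Ψ a .ty) : SDTy Γ Ψ (.trm a) := ⟨h.ty.ctx, h.ok⟩

theorem SDTm.o_fun {a b} (hb : SDTm Γ Ψ b .ty) : oTy Ψ.len (.pi (.trm a) (.trm (b.shift 0))) =
    .pic (.trmc (oTm Ψ.len a)) (.trmc ((oTm Ψ.len b).up 1)) := by
  rw [← DTm.o_shift_zero hb.ok.sc Ψ.one_le_len]; rfl

theorem SDTm.lamc {a b f} (ha : SDTm Γ Ψ a .ty) (hb : SDTm Γ Ψ b .ty)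
    (hf : SDTm Γ Ψ f (.pi (.trm a) (.trm (b.shift 0)))) :
    SDTm Γ Ψ (.lamc a b f) (.trm (.arr a b)) :=
  ⟨(ha.arr hb).trm, ha.ok, hb.ok, hb.o_fun ▸ hf.ok, .refl (ha.arr hb).trm.typed⟩

theorem SDTm.appc {a b m n} (ha : SDTm Γ Ψ a .ty) (hb : SDTm Γ Ψ b .ty)
    (hm : SDTm Γ Ψ m (.trm (.arr a b))) (hn : SDTm Γ Ψ n (.trm a)) :
    SDTm Γ Ψ (.appc a b m n) (.trm b) :=
  ⟨hb.trm, ha.ok, hb.ok, hm.ok, hn.ok, .refl hb.trm.typed⟩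

theorem SDTm.convCtx {A A' B M} (h : SDTm Γ (.snoc Ψ A) M B) (e : SDTyEq Γ Ψ A A') :
    SDTm Γ (.snoc Ψ A') M B := ⟨h.ty.convCtx e, h.ok.convCtx e.snoc e.left.snoc.sem⟩

theorem SDTmEq.lam {A A' B B' M M'} (eA : SDTyEq Γ Ψ A A') (eB : SDTyEq Γ (.snoc Ψ A) B B')
    (eM : SDTmEq Γ (.snoc Ψ A) M M' B) : SDTmEq Γ Ψ (.lam A B M) (.lam A' B' M') (.pi A B) :=
  ⟨.lam eA.left eM.left, .conv (.lam eA.right ((eM.right.conv eB).convCtx eA)) (eA.pi eB).symm,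
    .conv (.lam (.el eA.left.typed) (.el eA.eq) eM.eq)
      (.symm (.elPi eA.left.typed eB.left.typed))⟩

theorem SDTyEq.inst {A B B' N N'} (eB : SDTyEq Γ (.snoc Ψ A) B B') (eN : SDTmEq Γ Ψ N N' A) :
    SDTyEq Γ Ψ (B.inst N) (B'.inst N') :=
  ⟨eB.left.sub eN.left.inst, eB.right.sub eN.right.inst, by
    rw [eB.left.o_inst eN.left, eB.right.o_inst eN.right]
    exact eB.eq.inst₂ eN.eq⟩

theorem SDTmEq.app {A A' B B' M M' N N'} (eA : SDTyEq Γ Ψ A A')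
    (eB : SDTyEq Γ (.snoc Ψ A) B B') (eM : SDTmEq Γ Ψ M M' (.pi A B)) (eN : SDTmEq Γ Ψ N N' A) :
    SDTmEq Γ Ψ (.app A B M N) (.app A' B' M' N') (B.inst N) := by
  refine ⟨.app eB.left eM.left eN.left, .conv (.app (eB.right.convCtx eA)
    (eM.right.conv (eA.pi eB)) (eN.right.conv eA)) (eB.inst eN).symm, ?_⟩
  rw [eB.left.o_inst eN.left]
  exact .app (.el eA.left.typed) (.el eA.eq) (.el eB.left.typed) (.el eB.eq)
    (eM.eq.conv (.elPi eA.left.typed eB.left.typed)) eN.left.typed eN.eq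

theorem SDTmEq.arr {a a' b b'} (ea : SDTmEq Γ Ψ a a' .ty) (eb : SDTmEq Γ Ψ b b' .ty) :
    SDTmEq Γ Ψ (.arr a b) (.arr a' b') .ty :=
  ⟨ea.left.arr eb.left, ea.right.arr eb.right, .arr ea.eq eb.eq⟩

theorem SDTm.shift {A X M} (h : SDTm Γ Ψ M A) (hX : SDTy Γ Ψ X) :
    SDTm Γ (.snoc Ψ X) (M.shift 0) (A.shift 0) := by
  have i : Ins (oCtx Γ) X 0 Ψ (.snoc Ψ X) := .zero hX.typed
  refine ⟨⟨hX.snoc, h.ty.ok.shift i hX.ctx.sem⟩, ?_⟩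
  rw [i.oTy h.ty.ok.sc]
  exact h.ok.shift i hX.ctx.sem

theorem SDTmEq.shift {A X M M'} (h : SDTmEq Γ Ψ M M' A) (hX : SDTy Γ Ψ X) :
    SDTmEq Γ (.snoc Ψ X) (M.shift 0) (M'.shift 0) (A.shift 0) := by
  refine ⟨h.left.shift hX, h.right.shift hX, ?_⟩
  rw [DCtx.len, DTm.o_shift_zero h.left.ok.sc Ψ.one_le_len,
    DTm.o_shift_zero h.right.ok.sc Ψ.one_le_len, DTy.o_shift_zero h.left.ty.ok.sc Ψ.one_le_len]
  exact h.eq.weaken (.el hX.typed)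

theorem SDTmEq.lamc {a a' b b' f f'} (ea : SDTmEq Γ Ψ a a' .ty) (eb : SDTmEq Γ Ψ b b' .ty)
    (ef : SDTmEq Γ Ψ f f' (.pi (.trm a) (.trm (b.shift 0)))) :
    SDTmEq Γ Ψ (.lamc a b f) (.lamc a' b' f') (.trm (.arr a b)) := by
  refine ⟨.lamc ea.left eb.left ef.left, .conv (.lamc ea.right eb.right (ef.right.conv
    ((SDTyEq.trm ea).pi (.trm (eb.shift ea.left.trm))))) (.symm (.trm (ea.arr eb))), ?_⟩
  have e := ef.eq
  rw [eb.left.o_fun] at e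
  have hb := eb.left.typed.weaken (.el (.trmc ea.left.typed))
  exact .lamc ea.left.typed eb.left.typed ea.eq eb.eq
    (.conv e (.elPi (.trmc ea.left.typed) (.trmc hb)))

theorem SDTmEq.appc {a a' b b' m m' n n'} (ea : SDTmEq Γ Ψ a a' .ty) (eb : SDTmEq Γ Ψ b b' .ty)
    (em : SDTmEq Γ Ψ m m' (.trm (.arr a b))) (en : SDTmEq Γ Ψ n n' (.trm a)) :
    SDTmEq Γ Ψ (.appc a b m n) (.appc a' b' m' n') (.trm b) :=
  ⟨.appc ea.left eb.left em.left en.left, .conv (.appc ea.right eb.right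
    (em.right.conv (.trm (ea.arr eb))) (en.right.conv (.trm ea))) (.symm (.trm eb)),
    .appc ea.left.typed eb.left.typed ea.eq eb.eq em.eq en.eq⟩

theorem SDTmEq.beta {A B M N} (hM : SDTm Γ (.snoc Ψ A) M B) (hN : SDTm Γ Ψ N A) :
    SDTmEq Γ Ψ (.app A B (.lam A B M) N) (M.inst N) (B.inst N) := by
  refine ⟨.app hM.ty (.lam hN.ty hM) hN, hM.sub hN.inst, ?_⟩
  rw [hM.ty.o_inst hN, hM.o_inst hN]
  exact .piBeta (.el hN.ty.typed) (.el hM.ty.typed) hM.typed hN.typed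

theorem skip_one : skip 1 = Fitch.liftRen (· + 1) := by rw [← liftRen_skip, skip_zero]

theorem ren_lift_inst_var (t : Tm) : (t.ren (Fitch.liftRen (· + 1))).inst (.var 0) = t := by
  refine (Tm.sub_ren _ _ _).trans (Eq.trans (congrArg (fun θ => Tm.sub θ t) ?_) t.sub_id)
  funext i; cases i <;> rfl

theorem SDTmEq.eta {A B M} (hA : SDTy Γ Ψ A) (hB : SDTy Γ (.snoc Ψ A) B)
    (hM : SDTm Γ Ψ M (.pi A B)) :
    SDTmEq Γ Ψ M (.lam A B (.app (A.shift 0) (B.shift 1) (M.shift 0) (.var 0))) (.pi A B) := by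
  have i : Ins (oCtx Γ) A 0 Ψ (.snoc Ψ A) := .zero hA.typed
  have i' : Ins (oCtx Γ) A 1 (.snoc Ψ A) (.snoc (.snoc Ψ A) (A.shift 0)) := .succ i hA.ok.sc
  have hA' : SDTy Γ (.snoc Ψ A) (A.shift 0) := ⟨hA.snoc, hA.ok.shift i hA.ctx.sem⟩
  have hB' : SDTy Γ (.snoc (.snoc Ψ A) (A.shift 0)) (B.shift 1) :=
    ⟨hA'.snoc, hB.ok.shift i' hA.snoc.sem⟩
  have hv : SDTm Γ (.snoc Ψ A) (.var 0) (A.shift 0) := .var hA.snoc .here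
  have h : SDTm Γ (.snoc Ψ A) (.app (A.shift 0) (B.shift 1) (M.shift 0) (.var 0)) _ :=
    .app hB' (hM.shift hA) hv
  have e₁ : oTy (Ψ.len + 1 + 1) (B.shift 1) = (oTy (Ψ.len + 1) B).ren (Fitch.liftRen (· + 1)) := by
    rw [← skip_one]; exact i'.oTy hB.ok.sc
  have e : oTy (Ψ.len + 1) ((B.shift 1).inst (.var 0)) = oTy (Ψ.len + 1) B :=
    (hB'.o_inst hv).trans ((congrArg (·.inst (.var 0)) e₁).trans (ren_lift_inst_var _))
  have h' : SDTm Γ (.snoc Ψ A) (.app (A.shift 0) (B.shift 1) (M.shift 0) (.var 0)) B :=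
    ⟨hB, e ▸ h.ok⟩
  refine ⟨hM, .lam hA h', ?_⟩
  have := TmEq.piEta (.el hA.typed) (.el hB.typed)
    (hM.typed.conv (.elPi hA.typed hB.typed))
  rw [oTm, oTm, e₁, DTm.o_shift_zero hM.ok.sc Ψ.one_le_len,
    DTy.o_shift_zero hA.ok.sc Ψ.one_le_len]
  exact .conv this (.symm (.elPi hA.typed hB.typed))

end Cocon

namespace Fitch

theorem TmEq.open_beta {K : Ctx} {Δ : List Ty} {c X m u : Tm} (hw : Wf (K.lock.append Δ))
    (hc : HasTm K.lock c .ctx) (hX : HasTm (K.lock.snoc (.elc c)) X .univ)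
    (hm : HasTm (K.lock.snoc (.elc c)) m (.el X))
    (hu : HasTm (K.lock.append Δ) u (.elc (c.sub (wkn Δ.length)))) :
    TmEq (K.lock.append Δ) (.open Δ.length c X (.box (.lam (.elc c) m)) u)
      (m.sub (scons u (wkn Δ.length))) (.el (X.sub (scons u (wkn Δ.length)))) := by
  have hp : TyWf K.lock (.pi (.elc c) (.el X)) := .pi (.elc hc) (.el hX)
  have hl := HasTm.lam (.elc hc) hm
  have h₁ := hp.weakens Δ hw
  have h₂ := TmEq.boxBeta hp hl hw
  have h₃ := TmEq.appBeta (SbV.up kitTm hw) (.refl hc) hm (.refl (.el hX)) (.refl hl)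
    (.refl hu)
  rw [← ren_liftRen_scons]
  rw [← Tm.up_eq] at hu
  cases h₁ with
  | pi hA hB =>
    refine .trans (.app hA (.refl hA) hB (.refl hB) h₂ hu (.refl hu)) (.symm ?_)
    rw [ren_liftRen_scons]
    exact h₃

end Fitch

namespace Cocon

open Fitch (Tm Ty scons wkn Sb SbEq HasTm TmEq TyEq TyWf Wf Look kitTm apT piT)

variable {Γ : Ctx} {Ψ Ψ' Ψ'' Φ Φ' : DCtx}

theorem SDTyEq.sub {A A' σ σ'} (e : SDTyEq Γ Φ A A') (s : SDSubEq Γ Ψ σ σ' Φ) :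
    SDTyEq Γ Ψ (A.sub σ) (A'.sub σ') :=
  ⟨e.left.sub s.left, e.right.sub s.right, by
    rw [e.left.o_sub s.left, e.right.o_sub s.right]
    exact (TmEq.sub (A := .univ) e.eq s.left.typed).trans (e.right.typed.subEq s.eq)⟩

theorem SDTy.code_proj {A} (h : SDTy Γ Ψ A) :
    HasTm ((oCtx Γ).lock.snoc (.elc (oCode Ψ))) ((oTy Ψ.len A).sub (oProj Ψ)) .univ :=
  h.typed.sub h.ctx.sem.proj

theorem SDTyEq.code_proj {A A'} (e : SDTyEq Γ Ψ A A') (eΨ : SDCtxEq Γ Ψ Ψ') :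
    TmEq ((oCtx Γ).lock.snoc (.elc (oCode Ψ))) ((oTy Ψ.len A).sub (oProj Ψ))
      ((oTy Ψ'.len A').sub (oProj Ψ')) .univ := by
  rw [← eΨ.eqv.len]
  exact (TmEq.sub (A := .univ) e.eq eΨ.left.sem.proj).trans
    (e.right.typed.subEq (eΨ.eqv.proj eΨ.left.sem))

theorem SDTyEq.o_pi {A A'} (e : SDTyEq Γ Ψ A A') (eΨ : SDCtxEq Γ Ψ Ψ') :
    TyEq (oCtx Γ).lock (.pi (.elc (oCode Ψ)) (.el ((oTy Ψ.len A).sub (oProj Ψ))))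
      (.pi (.elc (oCode Ψ')) (.el ((oTy Ψ'.len A').sub (oProj Ψ')))) :=
  .pi (.elc eΨ.left.sem.code) (.elc (eΨ.eqv.code eΨ.left.sem)) (.el (e.code_proj eΨ))

theorem SDTmEq.unbox {A A' t t' σ σ'} (eΦ : SDCtxEq Γ Φ Φ') (eA : SDTyEq Γ Φ A A')
    (ht : t.OK (oCtx Γ) (.box (.pi (.elc (oCode Φ)) (.el ((oTy Φ.len A).sub (oProj Φ))))))
    (ht' : t'.OK (oCtx Γ) (.box (.pi (.elc (oCode Φ)) (.el ((oTy Φ.len A).sub (oProj Φ))))))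
    (et : TmEq (oCtx Γ) (oCTm t) (oCTm t')
      (.box (.pi (.elc (oCode Φ)) (.el ((oTy Φ.len A).sub (oProj Φ))))))
    (eσ : SDSubEq Γ Ψ σ σ' Φ) :
    SDTmEq Γ Ψ (.unbox Φ A t σ) (.unbox Φ' A' t' σ') (A.sub σ) := by
  have hΦ := eΦ.left.sem
  have hA' : SDTy Γ Φ' A' := ⟨eΦ.right, eA.right.ok.convCtx eΦ.eqv hΦ⟩
  have hσ' : SDSub Γ Ψ σ' Φ' :=
    ⟨eσ.left.src, eΦ.right, eσ.right.ok.convTarget eΦ.eqv eσ.left.src.sem hΦ⟩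
  refine ⟨.unbox eA.left ht eσ.left, .conv (.unbox hA' (ht'.conv (.box (eA.o_pi eΦ))) hσ')
    (eA.sub eσ).symm, ?_⟩
  rw [eA.left.o_sub eσ.left, oTm_unbox Ψ.len Φ']
  refine TmEq.oUnbox eσ.left.src.sem hΦ eA.left.typed eσ.left.ok.sc eσ.left.typed
    (eΦ.eqv.code hΦ) (eA.code_proj eΦ) et ?_
  have e := eΦ.eqv.tup hΦ
  have e' := (e.sub eσ.left.typed).trans (e.right.subEq eσ.eq)
  have : ((oCode Φ).sub (wkn Φ.len)).sub (oSub Ψ.len σ) = (oCode Φ).sub (wkn Ψ.len) := by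
    rw [Tm.sub_sub]; congr 1; funext i; exact DSub.oSub_tail eσ.left.ok.sc i
  rwa [Ty.sub, this] at e'

theorem SDTm.box {A M} (h : SDTm Γ Ψ M A) : (CTm.box (.mk Ψ M)).OK (oCtx Γ)
    (.box (.pi (.elc (oCode Ψ)) (.el ((oTy Ψ.len A).sub (oProj Ψ))))) :=
  have e := TyEq.refl (.pi (.elc h.ty.ctx.sem.code) (.el h.ty.code_proj))
  ⟨_, ⟨h.ty.ctx.ok, _, h.ok, e⟩, .box e⟩

theorem SDTmEq.unboxBeta {A M σ} (hM : SDTm Γ Φ M A) (hσ : SDSub Γ Ψ σ Φ) :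
    SDTmEq Γ Ψ (.unbox Φ A (.box (.mk Φ M)) σ) (M.sub σ) (A.sub σ) := by
  refine ⟨.unbox hM.ty hM.box hσ, hM.sub hσ, ?_⟩
  have hΦ := hM.ty.ctx.sem
  have ht := DSub.oSub_tail hσ.ok.sc
  have hu := hΦ.tup_sub hσ.typed ht
  have hp := hΦ.proj_tup_sub hσ.typed ht
  rw [hM.o_sub hσ, hM.ty.o_sub hσ, oTm_unbox]
  have hM' := hM.typed
  have hwf := hσ.src.sem.wf
  have e₁ := hM'.subEq hp
  have e₂ := hM.ty.typed.subEq hp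
  have hm := hM'.sub hΦ.proj
  rw [← Tm.sub_sub, Ty.sub, ← Tm.sub_sub] at e₁
  rw [← Tm.sub_sub] at e₂
  obtain ⟨Δ, e, l⟩ := tel_eq (oCtx Γ) Ψ
  refine .conv (.trans (t' := ((oTm Φ.len M).sub (oProj Φ)).sub
    (scons ((oTup Φ).sub (oSub Ψ.len σ)) (wkn Ψ.len))) ?_ e₁) (.el e₂)
  rw [e] at hwf hu ⊢
  rw [← l] at hu ⊢
  exact .open_beta hwf hΦ.code hM.ty.code_proj hm hu

/-! #### Domain substitutions -/

theorem SDSub.nil (c : SDCtx Γ Ψ) : SDSub Γ Ψ .nil .nil := ⟨c, ⟨c.base, trivial⟩, rfl⟩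

theorem SDSubEq.refl {σ} (h : SDSub Γ Ψ σ Φ) : SDSubEq Γ Ψ σ σ Φ := ⟨h, h, .refl h.typed⟩

theorem SDSubEq.symm {σ σ'} (h : SDSubEq Γ Ψ σ σ' Φ) : SDSubEq Γ Ψ σ' σ Φ :=
  ⟨h.right, h.left, h.eq.symm h.left.tgt.sem.wf⟩

theorem SDSubEq.trans {σ σ' σ''} (h : SDSubEq Γ Ψ σ σ' Φ) (h' : SDSubEq Γ Ψ σ' σ'' Φ) :
    SDSubEq Γ Ψ σ σ'' Φ := ⟨h.left, h'.right, h.eq.trans h'.eq h.left.tgt.sem.wf⟩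

theorem SDSubEq.cons {σ σ' A M M'} (hA : SDTy Γ Φ A) (h : SDSubEq Γ Ψ σ σ' Φ)
    (e : SDTmEq Γ Ψ M M' (A.sub σ)) : SDSubEq Γ Ψ (.cons σ M) (.cons σ' M') (.snoc Φ A) := by
  refine ⟨h.left.cons hA e.left, h.right.cons hA (e.right.conv ((SDTyEq.refl hA).sub h)), ?_⟩
  refine SbEq.scons (A := .el _) h.eq ?_
  rw [Ty.sub, ← hA.o_sub h.left]
  exact e.eq

theorem SDSubEq.nilEta {σ} (h : SDSub Γ Ψ σ .nil) : SDSubEq Γ Ψ σ .nil .nil := by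
  refine ⟨h, .nil h.src, ?_⟩
  have hs := h.typed
  have e : oSub Ψ.len σ = scons (oSub Ψ.len σ 0) (wkn Ψ.len) := by
    funext i
    cases i with
    | zero => rfl
    | succ i => exact DSub.oSub_tail h.ok.sc i
  have h₀ : HasTm (tel (oCtx Γ) Ψ) (oSub Ψ.len σ 0) (.elc .top) :=
    hs.look kitTm (n := 0) .here
  rw [e]
  exact SbEq.scons (A := .elc _) (.refl h.src.sem.wk) (.topEta h₀)

theorem CtxEqv.snoc_right {K A} (h : CtxEqv K Φ' (.snoc Φ A)) :
    ∃ Φ₁ A₁, Φ' = .snoc Φ₁ A₁ ∧ CtxEqv K Φ₁ Φ := by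
  cases h with
  | snoc h _ => exact ⟨_, _, rfl, h⟩

theorem SDSubEq.wkEta {A k} (h : SDSub Γ Ψ (.wk k) (.snoc Φ A)) :
    SDSubEq Γ Ψ (.wk k) (.cons (.wk (k + 1)) (.var k)) (.snoc Φ A) := by
  obtain ⟨Φ₀, d, e⟩ := h.ok
  obtain ⟨Φ₁, A₁, rfl, e'⟩ := e.snoc_right
  have eq : oSub Ψ.len (.cons (.wk (k + 1)) (.var k)) = oSub Ψ.len (.wk k) := by
    funext i
    cases i with
    | zero => simp [oSub, scons, oTm]
    | succ i => simp only [oSub, scons]; congr 1; omega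
  refine ⟨h, ⟨h.src, h.tgt, _, _, rfl, ⟨_, d.snoc_tail, e'⟩, ?_⟩, by rw [eq]; exact .refl h.typed⟩
  have hl := h.ok.lookup .here h.src.sem h.tgt.sem
  have : (DSub.wk k).lookup 0 = .var k := by simp [DSub.lookup]
  rw [this, Tm.sub_up] at hl
  have eq' : (fun j => oSub Ψ.len (.wk k) (j + 1)) = oSub Ψ.len (.wk (k + 1)) := by
    funext i; simp only [oSub]; congr 1; omega
  exact eq' ▸ hl

/-! #### Contextual objects -/

theorem SDTm.obj {A M} (h : SDTm Γ Ψ M A) : SObj Γ (.mk Ψ M) (.tm Ψ A) :=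
  ⟨h.ty.ctx.base, ⟨h.ty.ctx.ok, h.ty.ok⟩, h.ty.ctx.ok, _, h.ok,
    .refl (.pi (.elc h.ty.ctx.sem.code) (.el h.ty.code_proj))⟩

theorem SDTm.objv {A M} (h : SDTm Γ Ψ M A) : SObj Γ (.mk Ψ M) (.vr Ψ A) :=
  ⟨h.ty.ctx.base, ⟨h.ty.ctx.ok, h.ty.ok⟩, h.obj.ok⟩

theorem SDTmEq.obj {A M M'} (eΨ : SDCtxEq Γ Ψ Ψ') (e : SDTmEq Γ Ψ M M' A) :
    SObjEq Γ (.mk Ψ M) (.mk Ψ' M') (.tm Ψ A) := by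
  have hΨ := eΨ.left.sem
  have h' : SDTm Γ Ψ' M' A := ⟨⟨eΨ.right, e.left.ty.ok.convCtx eΨ.eqv hΨ⟩,
    eΨ.eqv.len ▸ e.right.ok.convCtx eΨ.eqv hΨ⟩
  refine ⟨e.left.obj, ⟨h'.obj.base, e.left.obj.ty, h'.ty.ctx.ok, _, h'.ok,
    ((SDTyEq.refl e.left.ty).o_pi eΨ).symm⟩, ?_⟩
  refine .lam (.elc hΨ.code) (.elc (eΨ.eqv.code hΨ)) ?_
  rw [← eΨ.eqv.len]
  exact (e.eq.sub hΨ.proj).trans (e.right.typed.subEq (eΨ.eqv.proj hΨ))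

theorem SDTmEq.objv {A M M'} (eΨ : SDCtxEq Γ Ψ Ψ') (e : SDTmEq Γ Ψ M M' A) :
    SObjEq Γ (.mk Ψ M) (.mk Ψ' M') (.vr Ψ A) :=
  have h := e.obj eΨ
  ⟨⟨h.left.base, h.left.ty, h.left.ok⟩, ⟨h.left.base, h.left.ty, h.right.ok⟩, h.eq⟩

/-! #### Computation types -/

theorem SCTy.pi {τ₁ τ₂} (h : SCTy Γ τ₁) (h' : SCTy (τ₁ :: Γ) τ₂) : SCTy Γ (.pi τ₁ τ₂) :=
  ⟨h.base, h.ok, h'.ok⟩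

theorem SDTy.tm {A} (h : SDTy Γ Ψ A) : SCTy Γ (.box (.tm Ψ A)) :=
  ⟨h.ctx.base, h.ctx.ok, h.ok⟩

theorem SDTy.vr {A} (h : SDTy Γ Ψ A) : SCTy Γ (.box (.vr Ψ A)) :=
  ⟨h.ctx.base, h.ctx.ok, h.ok⟩

theorem SCTyEq.refl {τ} (h : SCTy Γ τ) : SCTyEq Γ τ τ := ⟨h, h, .refl h.typed, .rfl⟩

theorem SCTyEq.symm {τ τ'} (h : SCTyEq Γ τ τ') : SCTyEq Γ τ' τ :=
  ⟨h.right, h.left, h.eq.symm, h.ctx_iff.symm⟩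

theorem SCTyEq.trans {τ τ' τ''} (h : SCTyEq Γ τ τ') (h' : SCTyEq Γ τ' τ'') : SCTyEq Γ τ τ'' :=
  ⟨h.left, h'.right, h.eq.trans h'.eq, h.ctx_iff.trans h'.ctx_iff⟩

theorem oCTy_eq_ctx : ∀ {τ : CTy}, oCTy τ = .box .ctx → τ = .ctx
  | .box (.tm _ _), h => by simp [oCTy, oCxTy] at h
  | .box (.vr _ _), h => by simp [oCTy, oCxTy] at h
  | .pi _ _, h => by simp [oCTy] at h
  | .ctx, _ => rfl

theorem SCTyEq.renOK {τ₁ τ₁'} (e : SCTyEq Γ τ₁ τ₁') :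
    RenOK (oCtx (τ₁' :: Γ)) _root_.id (oCtx (τ₁ :: Γ)) := RenOK.conv_id e.eq e.ctx_iff.1

theorem SCTy.convCtx {τ₁ τ₁' τ} (h : SCTy (τ₁ :: Γ) τ) (e : SCTyEq Γ τ₁ τ₁') :
    SCTy (τ₁' :: Γ) τ := ⟨.cons e.right, h.ok.convCtx e.renOK h.base.wf⟩

theorem SCTyEq.pi {τ₁ τ₁' τ₂ τ₂'} (e : SCTyEq Γ τ₁ τ₁') (e' : SCTyEq (τ₁ :: Γ) τ₂ τ₂') :
    SCTyEq Γ (.pi τ₁ τ₂) (.pi τ₁' τ₂') :=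
  ⟨e.left.pi e'.left, e.right.pi (e'.right.convCtx e), .pi e.left.typed e.eq e'.eq,
    ⟨nofun, nofun⟩⟩

theorem SDTyEq.tm {A A'} (eΨ : SDCtxEq Γ Ψ Ψ') (hA : SDTy Γ Ψ' A') (e : SDTyEq Γ Ψ A A') :
    SCTyEq Γ (.box (.tm Ψ A)) (.box (.tm Ψ' A')) :=
  ⟨e.left.tm, hA.tm, .box (e.o_pi eΨ), ⟨nofun, nofun⟩⟩

theorem SDTyEq.vr {A A'} (eΨ : SDCtxEq Γ Ψ Ψ') (hA : SDTy Γ Ψ' A') (e : SDTyEq Γ Ψ A A') :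
    SCTyEq Γ (.box (.vr Ψ A)) (.box (.vr Ψ' A')) :=
  ⟨e.left.vr, hA.vr, .box (e.o_pi eΨ), ⟨nofun, nofun⟩⟩

/-! #### Computation terms -/

theorem SCTm.of_ne {t τ} (h : SCTy Γ τ) (h' : t.OK (oCtx Γ) (oCTy τ)) (hn : τ ≠ .ctx) :
    SCTm Γ t τ := ⟨h, h', fun e => (hn (oCTy_eq_ctx e)).elim⟩

theorem SCTm.var {y τ} (g : SCtx Γ) (l : CLook Γ y τ) : SCTm Γ (.var y) τ :=
  have h := g.look l
  have h' : SCTy Γ τ := ⟨g, h.1⟩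
  ⟨h', ⟨_, h.2, .refl h'.typed⟩, fun e =>
    have l' : Look (oCtx Γ) y (.box .ctx) := e ▸ h.2
    ⟨l', .refl (HasTm.unbox_ctx g.wf l')⟩⟩

theorem SCTm.dctx (c : SDCtx Γ Ψ) : SCTm Γ (.ctx Ψ) .ctx :=
  have hl := Wf.lock c.base.wf
  ⟨⟨c.base, trivial⟩, ⟨c.ok, .refl (.box (.ctx hl))⟩, fun _ => ⟨c.ok,
    .symm (by
      have := TmEq.boxBeta (Δ := []) (.ctx hl) c.sem.code hl
      simp only [Tm.up_eq, Ty.up_eq] at this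
      have e : wkn ([] : List Ty).length = Tm.var := rfl
      rw [e] at this
      simp only [Tm.sub_id, Ty.sub_id] at this
      exact this)⟩⟩

theorem SObj.box {C T} (h : SObj Γ C T) : SCTm Γ (.box C) (.box T) :=
  .of_ne ⟨h.base, h.ty⟩ ⟨_, h.ok, .refl (.box (h.ty.typed h.base.wf))⟩ nofun

theorem SCTm.fn {τ₁ τ₂ t} (h : SCTy Γ τ₁) (ht : SCTm (τ₁ :: Γ) t τ₂) :
    SCTm Γ (.fn τ₁ t) (.pi τ₁ τ₂) :=
  .of_ne (h.pi ht.ty) ⟨h.ok, _, ht.ok, .refl (h.pi ht.ty).typed⟩ nofun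

theorem SCTm.single {τ₁ s} (h : SCTm Γ s τ₁) :
    CSubOK (oCtx Γ) (single s) (oCtx (τ₁ :: Γ)) := CSubOK.single h.ty.base.wf h.ok h.ctx

theorem inst_ne_ctx {τ : CTy} {s : CTm} (h : τ ≠ .ctx) : τ.inst s ≠ .ctx := by
  cases τ with
  | ctx => exact (h rfl).elim
  | _ => simp [CTy.inst, CTy.csub]

theorem oCSub_single (s : CTm) : oCSub (single s) = Fitch.single (oCTm s) := by
  funext i; cases i <;> rfl

theorem SCTy.inst {τ₁ τ₂ s} (h : SCTy (τ₁ :: Γ) τ₂) (hs : SCTm Γ s τ₁) :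
    SCTy Γ (τ₂.inst s) ∧ TyEq (oCtx Γ) (oCTy (τ₂.inst s)) ((oCTy τ₂).inst (oCTm s)) := by
  have ⟨h₁, h₂⟩ := h.ok.csub hs.single h.base.wf
  rw [oCSub_single] at h₂
  exact ⟨⟨hs.ty.base, h₁⟩, h₂⟩

theorem SCTm.app {τ₁ τ₂ t s} (h : SCTy (τ₁ :: Γ) τ₂) (hn : τ₂ ≠ .ctx)
    (ht : SCTm Γ t (.pi τ₁ τ₂)) (hs : SCTm Γ s τ₁) : SCTm Γ (.app τ₁ τ₂ t s) (τ₂.inst s) :=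
  .of_ne (h.inst hs).1 ⟨hs.ty.ok, h.ok, ht.ok, hs.ok, (h.inst hs).2.symm⟩ (inst_ne_ctx hn)

theorem SCTm.conv {τ τ' t} (h : SCTm Γ t τ) (e : SCTyEq Γ τ τ') : SCTm Γ t τ' :=
  ⟨e.right, h.ok.conv e.eq, fun h' => h.ctx (e.ctx_iff.2 h')⟩

theorem SCTmEq.refl {τ t} (h : SCTm Γ t τ) : SCTmEq Γ t t τ := ⟨h, h, .refl h.typed⟩

theorem SCTmEq.symm {τ t t'} (h : SCTmEq Γ t t' τ) : SCTmEq Γ t' t τ :=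
  ⟨h.right, h.left, h.eq.symm⟩

theorem SCTmEq.trans {τ t t' t''} (h : SCTmEq Γ t t' τ) (h' : SCTmEq Γ t' t'' τ) :
    SCTmEq Γ t t'' τ := ⟨h.left, h'.right, h.eq.trans h'.eq⟩

theorem SCTmEq.conv {τ τ' t t'} (h : SCTmEq Γ t t' τ) (e : SCTyEq Γ τ τ') : SCTmEq Γ t t' τ' :=
  ⟨h.left.conv e, h.right.conv e, h.eq.conv e.eq⟩

theorem SDCtxEq.tm (h : SDCtxEq Γ Ψ Ψ') : SCTmEq Γ (.ctx Ψ) (.ctx Ψ') .ctx :=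
  ⟨.dctx h.left, .dctx h.right, .box (h.eqv.code h.left.sem)⟩

theorem SCTmEq.ctxVar {y} (g : SCtx Γ) (l : CLook Γ y .ctx) :
    SCTmEq Γ (.ctx (.var y)) (.var y) .ctx :=
  have l' := (g.look l).2
  ⟨.dctx ⟨g, l'⟩, .var g l, .symm (.boxEta (.ctx (.lock g.wf)) (.var g.wf l'))⟩

theorem SObjEq.box {C C' T} (h : SObjEq Γ C C' T) : SCTmEq Γ (.box C) (.box C') (.box T) :=
  ⟨h.left.box, h.right.box, .box h.eq⟩

theorem SCTm.convCtx {τ₁ τ₁' τ t} (h : SCTm (τ₁ :: Γ) t τ) (hn : τ ≠ .ctx)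
    (e : SCTyEq Γ τ₁ τ₁') : SCTm (τ₁' :: Γ) t τ :=
  .of_ne (h.ty.convCtx e) (h.ok.convCtx e.renOK h.ty.base.wf) hn

theorem SCTmEq.fn {τ₁ τ₁' τ₂ t t'} (e : SCTyEq Γ τ₁ τ₁') (hn : τ₂ ≠ .ctx)
    (et : SCTmEq (τ₁ :: Γ) t t' τ₂) : SCTmEq Γ (.fn τ₁ t) (.fn τ₁' t') (.pi τ₁ τ₂) :=
  ⟨.fn e.left et.left, .conv (.fn e.right (et.right.convCtx hn e))
    (.symm (e.pi (.refl et.left.ty))), .lam e.left.typed e.eq et.eq⟩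

theorem SCTyEq.inst {τ₁ τ₂ τ₂' s s'} (e : SCTyEq (τ₁ :: Γ) τ₂ τ₂') (hn : τ₂ ≠ .ctx)
    (es : SCTmEq Γ s s' τ₁) : SCTyEq Γ (τ₂.inst s) (τ₂'.inst s') :=
  have hn' : τ₂' ≠ .ctx := fun h => hn (oCTy_eq_ctx (e.ctx_iff.2 (by rw [h]; rfl)))
  have h := e.left.inst es.left
  have h' := e.right.inst es.right
  ⟨h.1, h'.1, (h.2.trans (TyEq.inst₂ e.eq es.eq)).trans h'.2.symm,
    ⟨fun h => (inst_ne_ctx hn (oCTy_eq_ctx h)).elim,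
      fun h => (inst_ne_ctx hn' (oCTy_eq_ctx h)).elim⟩⟩

theorem SCTmEq.app {τ₁ τ₁' τ₂ τ₂' t t' s s'} (e₁ : SCTyEq Γ τ₁ τ₁')
    (e₂ : SCTyEq (τ₁ :: Γ) τ₂ τ₂') (hn : τ₂ ≠ .ctx) (et : SCTmEq Γ t t' (.pi τ₁ τ₂))
    (es : SCTmEq Γ s s' τ₁) :
    SCTmEq Γ (.app τ₁ τ₂ t s) (.app τ₁' τ₂' t' s') (τ₂.inst s) :=
  have hn' : τ₂' ≠ .ctx := fun h => hn (oCTy_eq_ctx (e₂.ctx_iff.2 (by rw [h]; rfl)))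
  ⟨.app e₂.left hn et.left es.left, .conv (.app (e₂.right.convCtx e₁) hn'
    (et.right.conv (e₁.pi e₂)) (es.right.conv e₁)) (e₂.inst hn es).symm,
    .conv (.app e₁.left.typed e₁.eq e₂.left.typed e₂.eq et.eq es.left.typed es.eq)
      (e₂.left.inst es.left).2.symm⟩

theorem SCTmEq.beta {τ₁ τ₂ t s} (hn : τ₂ ≠ .ctx) (ht : SCTm (τ₁ :: Γ) t τ₂)
    (hs : SCTm Γ s τ₁) : SCTmEq Γ (.app τ₁ τ₂ (.fn τ₁ t) s) (t.inst s) (τ₂.inst s) := by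
  have ⟨h₁, h₂⟩ := ht.ty.inst hs
  have ⟨h₃, h₄⟩ := ht.ok.csub hs.single ht.ty.base.wf
  rw [oCSub_single] at h₃ h₄
  refine ⟨.app ht.ty hn (.fn hs.ty ht) hs, .of_ne h₁ (h₃.conv h₂.symm) (inst_ne_ctx hn), ?_⟩
  exact .conv (.trans (.piBeta hs.ty.typed ht.ty.typed ht.typed hs.typed) (.symm h₄)) h₂.symm

theorem SCTmEq.eta {τ₁ τ₂ t} (h₁ : SCTy Γ τ₁) (h₂ : SCTy (τ₁ :: Γ) τ₂) (hn : τ₂ ≠ .ctx)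
    (ht : SCTm Γ t (.pi τ₁ τ₂)) :
    SCTmEq Γ t (.fn τ₁ (.app (τ₁.cren Nat.succ) (τ₂.cren (liftRen Nat.succ))
        (t.cren Nat.succ) (.var 0))) (.pi τ₁ τ₂) := by
  have g := SCtx.cons h₁
  have r : RenOK (oCtx (τ₁ :: Γ)) Nat.succ (oCtx Γ) := .succ h₁.typed
  have e₁ := (CTy.o_cren Nat.succ h₁.ok.sc).1
  have e₂ := (CTy.o_cren (liftRen Nat.succ) h₂.ok.sc).1
  have e₃ := (CTm.o_cren Nat.succ ht.ok.sc).1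
  have hp := ht.ty.ok.cren r h₁.base.wf
  have hv := SCTm.var g .here
  have ht' := ht.ok.cren r h₁.base.wf
  have hi : (oCTy (τ₂.cren (liftRen Nat.succ))).inst (.var 0) = oCTy τ₂ := by
    rw [e₂, liftRen_eq]; exact Ty.ren_lift_inst_var _
  have h : (CTm.app (τ₁.cren Nat.succ) (τ₂.cren (liftRen Nat.succ)) (t.cren Nat.succ)
      (.var 0)).OK (oCtx (τ₁ :: Γ)) (oCTy τ₂) := by
    refine ⟨hp.1, hp.2, ?_, hv.ok, ?_⟩
    · rw [e₁, e₂, liftRen_eq]; exact ht'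
    · show TyEq _ ((oCTy (τ₂.cren (liftRen Nat.succ))).inst (.var 0)) _
      rw [hi]; exact .refl h₂.typed
  refine ⟨ht, .fn h₁ (.of_ne h₂ h hn), ?_⟩
  have := TmEq.piEta h₁.typed h₂.typed ht.typed
  rw [oCTm, oCTm, e₁, e₂, e₃, liftRen_eq]
  exact this

theorem SCTmEq.boxEta {A t} (hA : SDTy Γ Ψ A) (ht : SCTm Γ t (.box (.tm Ψ A))) :
    SCTmEq Γ t (.box (.mk Ψ (.unbox Ψ A t (.wk 0)))) (.box (.tm Ψ A)) := by
  have hσ := hA.ctx.wk .zero hA.ctx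
  have hΨ := hA.ctx.sem
  have e : oTy Ψ.len (A.sub (.wk 0)) = oTy Ψ.len A := by
    rw [hA.o_sub hσ, oSub_wk_zero, Tm.sub_id]
  have hu : SDTm Γ Ψ (.unbox Ψ A t (.wk 0)) A := ⟨hA, e ▸ (SDTm.unbox hA ht.ok hσ).ok⟩
  refine ⟨ht, hu.obj.box, ?_⟩
  have hp := hu.obj.ty.typed hA.ctx.base.wf
  have hT := TmEq.boxEta hp ht.typed
  refine hT.trans (.box ?_)
  have hX := hA.code_proj
  have h₁ := HasTm.unbox (Δ := []) hp ht.typed (.lock hA.ctx.base.wf)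
  simp only [Tm.up_eq, Ty.up_eq] at h₁
  rw [show wkn ([] : List Ty).length = Tm.var from rfl] at h₁
  simp only [Tm.sub_id, Ty.sub_id] at h₁
  refine (TmEq.piEta (.elc hΨ.code) (.el hX) h₁).trans
    (.lam (.elc hΨ.code) (.refl (.elc hΨ.code)) ?_)
  have hv : Fitch.liftSub Tm.var = Tm.var := by funext i; cases i <;> rfl
  rw [oTm_unbox, Tm.open_sub (θ := Tm.var) (n' := 1) (oProj_tail Ψ), hv, oSub_wk_zero]
  simp only [Tm.sub_id]
  have ho := TmEq.open (Δ := [.elc (oCode Ψ)]) hΨ.wfCode (.refl hΨ.code) (.refl hX)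
    (.refl ht.typed) hΨ.tup_proj.symm
  simp only [List.length_singleton, Fitch.scons_var_wkn, Tm.sub_id] at ho
  exact ho

end Cocon

namespace Cocon

mutual
theorem WfCtx.sound : ∀ {Γ}, WfCtx Γ → SCtx Γ
  | _, .nil => .nil
  | _, .cons _ h => .cons (CTyWf.sound h)
theorem DCtxWf.sound : ∀ {Γ Ψ}, DCtxWf Γ Ψ → SDCtx Γ Ψ
  | _, _, .nil h => ⟨WfCtx.sound h, trivial⟩
  | _, _, .var h l => ⟨WfCtx.sound h, ((WfCtx.sound h).look l).2⟩
  | _, _, .snoc _ h => (DTyWf.sound h).snoc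
theorem DCtxEq.sound : ∀ {Γ Ψ Ψ'}, DCtxEq Γ Ψ Ψ' → SDCtxEq Γ Ψ Ψ'
  | _, _, _, .refl h => .refl (DCtxWf.sound h)
  | _, _, _, .symm h => (DCtxEq.sound h).symm
  | _, _, _, .trans h h' => (DCtxEq.sound h).trans (DCtxEq.sound h')
  | _, _, _, .snoc h _ _ hA e => .snoc (DCtxEq.sound h) (DTyWf.sound hA) (DTyEq.sound e)
theorem DTyWf.sound : ∀ {Γ Ψ A}, DTyWf Γ Ψ A → SDTy Γ Ψ A
  | _, _, _, .ty h => ⟨DCtxWf.sound h, trivial⟩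
  | _, _, _, .trm _ h => (HasDTm.sound h).trm
  | _, _, _, .pi _ hA hB => .pi (DTyWf.sound hA) (DTyWf.sound hB)
theorem DTyEq.sound : ∀ {Γ Ψ A A'}, DTyEq Γ Ψ A A' → SDTyEq Γ Ψ A A'
  | _, _, _, _, .refl h => .refl (DTyWf.sound h)
  | _, _, _, _, .symm h => (DTyEq.sound h).symm
  | _, _, _, _, .trans h h' => (DTyEq.sound h).trans (DTyEq.sound h')
  | _, _, _, _, .trm _ h => .trm (DTmEq.sound h)
  | _, _, _, _, .pi _ _ _ eA _ _ eB => .pi (DTyEq.sound eA) (DTyEq.sound eB)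
theorem HasDTm.sound : ∀ {Γ Ψ M A}, HasDTm Γ Ψ M A → SDTm Γ Ψ M A
  | _, _, _, _, .var c d => .var (DCtxWf.sound c) d
  | _, _, _, _, .lam _ hA _ hM => .lam (DTyWf.sound hA) (HasDTm.sound hM)
  | _, _, _, _, .app _ _ hB hM hN => .app (DTyWf.sound hB) (HasDTm.sound hM) (HasDTm.sound hN)
  | _, _, _, _, .unbox _ _ hA ht hσ =>
    .unbox (DTyWf.sound hA) (HasCTm.sound ht).ok (HasDSub.sound hσ)
  | _, _, _, _, .unboxv _ _ hA ht hσ =>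
    .unbox (DTyWf.sound hA) (HasCTm.sound ht).ok (HasDSub.sound hσ)
  | _, _, _, _, .conv h e => .conv (HasDTm.sound h) (DTyEq.sound e)
  | _, _, _, _, .o c => .o (DCtxWf.sound c)
  | _, _, _, _, .arr _ ha hb => .arr (HasDTm.sound ha) (HasDTm.sound hb)
  | _, _, _, _, .lamc _ ha hb hf => .lamc (HasDTm.sound ha) (HasDTm.sound hb) (HasDTm.sound hf)
  | _, _, _, _, .appc _ ha hb hm hn =>
    .appc (HasDTm.sound ha) (HasDTm.sound hb) (HasDTm.sound hm) (HasDTm.sound hn)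
theorem DTmEq.sound : ∀ {Γ Ψ M M' A}, DTmEq Γ Ψ M M' A → SDTmEq Γ Ψ M M' A
  | _, _, _, _, _, .refl h => .refl (HasDTm.sound h)
  | _, _, _, _, _, .symm h => (DTmEq.sound h).symm
  | _, _, _, _, _, .trans h h' => (DTmEq.sound h).trans (DTmEq.sound h')
  | _, _, _, _, _, .conv h e => (DTmEq.sound h).conv (DTyEq.sound e)
  | _, _, _, _, _, .lam _ _ _ eA _ _ eB _ eM =>
    .lam (DTyEq.sound eA) (DTyEq.sound eB) (DTmEq.sound eM)
  | _, _, _, _, _, .app _ _ _ eA _ _ eB eM _ eN =>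
    .app (DTyEq.sound eA) (DTyEq.sound eB) (DTmEq.sound eM) (DTmEq.sound eN)
  | _, _, _, _, _, .unbox _ _ _ eΦ _ _ eA et _ _ eσ =>
    have h := CTmEq.sound et
    .unbox (DCtxEq.sound eΦ) (DTyEq.sound eA) h.left.ok h.right.ok h.eq (DSubEq.sound eσ)
  | _, _, _, _, _, .unboxv _ _ _ eΦ _ _ eA et _ _ eσ =>
    have h := CTmEq.sound et
    .unbox (DCtxEq.sound eΦ) (DTyEq.sound eA) h.left.ok h.right.ok h.eq (DSubEq.sound eσ)
  | _, _, _, _, _, .arr _ ea eb => .arr (DTmEq.sound ea) (DTmEq.sound eb)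
  | _, _, _, _, _, .lamc _ _ _ ea eb ef =>
    .lamc (DTmEq.sound ea) (DTmEq.sound eb) (DTmEq.sound ef)
  | _, _, _, _, _, .appc _ _ _ ea eb em en =>
    .appc (DTmEq.sound ea) (DTmEq.sound eb) (DTmEq.sound em) (DTmEq.sound en)
  | _, _, _, _, _, .beta _ _ _ hM hN => .beta (HasDTm.sound hM) (HasDTm.sound hN)
  | _, _, _, _, _, .eta _ hA hB hM => .eta (DTyWf.sound hA) (DTyWf.sound hB) (HasDTm.sound hM)
  | _, _, _, _, _, .unboxBeta _ _ _ hM hσ => .unboxBeta (HasDTm.sound hM) (HasDSub.sound hσ)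
theorem HasDSub.sound : ∀ {Γ Ψ σ Φ}, HasDSub Γ Ψ σ Φ → SDSub Γ Ψ σ Φ
  | _, _, _, _, .nil c => .nil (DCtxWf.sound c)
  | _, _, _, _, .cons _ _ hA hσ hM => .cons (HasDSub.sound hσ) (DTyWf.sound hA) (HasDTm.sound hM)
  | _, _, _, _, .wk c c' d => (DCtxWf.sound c).wk d (DCtxWf.sound c')
theorem DSubEq.sound : ∀ {Γ Ψ σ σ' Φ}, DSubEq Γ Ψ σ σ' Φ → SDSubEq Γ Ψ σ σ' Φ
  | _, _, _, _, _, .refl h => .refl (HasDSub.sound h)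
  | _, _, _, _, _, .symm h => (DSubEq.sound h).symm
  | _, _, _, _, _, .trans h h' => (DSubEq.sound h).trans (DSubEq.sound h')
  | _, _, _, _, _, .cons _ _ hA _ eσ eM => .cons (DTyWf.sound hA) (DSubEq.sound eσ) (DTmEq.sound eM)
  | _, _, _, _, _, .nilEta h => .nilEta (HasDSub.sound h)
  | _, _, _, _, _, .wkEta h => .wkEta (HasDSub.sound h)
theorem HasObj.sound : ∀ {Γ C T}, HasObj Γ C T → SObj Γ C T
  | _, _, _, .tm _ _ hM => (HasDTm.sound hM).obj
  | _, _, _, .var c d => (SDTm.var (DCtxWf.sound c) d).objv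
  | _, _, _, .unboxv c _ hA l hσ =>
    (SDTm.unbox (DTyWf.sound hA) (SCTm.var (DCtxWf.sound c).base l).ok (HasDSub.sound hσ)).objv
theorem ObjEq.sound : ∀ {Γ C C' T}, ObjEq Γ C C' T → SObjEq Γ C C' T
  | _, _, _, _, .tm _ _ eΨ _ _ e => (DTmEq.sound e).obj (DCtxEq.sound eΨ)
  | _, _, _, _, .vr _ _ eΨ _ _ _ _ e => (DTmEq.sound e).objv (DCtxEq.sound eΨ)
theorem CTyWf.sound : ∀ {Γ τ}, CTyWf Γ τ → SCTy Γ τ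
  | _, _, .ctx h => ⟨WfCtx.sound h, trivial⟩
  | _, _, .pi _ h h' _ => (CTyWf.sound h).pi (CTyWf.sound h')
  | _, _, .tm _ _ h => (DTyWf.sound h).tm
  | _, _, .vr _ _ h => (DTyWf.sound h).vr
theorem CTyEq.sound : ∀ {Γ τ τ'}, CTyEq Γ τ τ' → SCTyEq Γ τ τ'
  | _, _, _, .refl h => .refl (CTyWf.sound h)
  | _, _, _, .symm h => (CTyEq.sound h).symm
  | _, _, _, .trans h h' => (CTyEq.sound h).trans (CTyEq.sound h')
  | _, _, _, .pi _ _ e _ e' _ => (CTyEq.sound e).pi (CTyEq.sound e')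
  | _, _, _, .tm _ _ _ eΨ _ _ hA e => SDTyEq.tm (DCtxEq.sound eΨ) (DTyWf.sound hA) (DTyEq.sound e)
  | _, _, _, .vr _ _ _ eΨ _ _ hA e => SDTyEq.vr (DCtxEq.sound eΨ) (DTyWf.sound hA) (DTyEq.sound e)
theorem HasCTm.sound : ∀ {Γ t τ}, HasCTm Γ t τ → SCTm Γ t τ
  | _, _, _, .var h l => .var (WfCtx.sound h) l
  | _, _, _, .ctx _ h => .dctx (DCtxWf.sound h)
  | _, _, _, .box _ h => (HasObj.sound h).box
  | _, _, _, .fn _ h _ _ ht => .fn (CTyWf.sound h) (HasCTm.sound ht)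
  | _, _, _, .app _ _ h hn ht hs => .app (CTyWf.sound h) hn (HasCTm.sound ht) (HasCTm.sound hs)
  | _, _, _, .conv h e => (HasCTm.sound h).conv (CTyEq.sound e)
theorem CTmEq.sound : ∀ {Γ t t' τ}, CTmEq Γ t t' τ → SCTmEq Γ t t' τ
  | _, _, _, _, .refl h => .refl (HasCTm.sound h)
  | _, _, _, _, .symm h => (CTmEq.sound h).symm
  | _, _, _, _, .trans h h' => (CTmEq.sound h).trans (CTmEq.sound h')
  | _, _, _, _, .conv h e => (CTmEq.sound h).conv (CTyEq.sound e)
  | _, _, _, _, .ctx _ h => (DCtxEq.sound h).tm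
  | _, _, _, _, .ctxVar h l => .ctxVar (WfCtx.sound h) l
  | _, _, _, _, .box _ h => (ObjEq.sound h).box
  | _, _, _, _, .fn _ _ e _ hn et => .fn (CTyEq.sound e) hn (CTmEq.sound et)
  | _, _, _, _, .app _ _ e₁ _ e₂ hn et _ es =>
    .app (CTyEq.sound e₁) (CTyEq.sound e₂) hn (CTmEq.sound et) (CTmEq.sound es)
  | _, _, _, _, .beta _ _ _ hn ht hs => .beta hn (HasCTm.sound ht) (HasCTm.sound hs)
  | _, _, _, _, .eta _ h₁ h₂ hn ht => .eta (CTyWf.sound h₁) (CTyWf.sound h₂) hn (HasCTm.sound ht)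
  | _, _, _, _, .boxEta _ _ hA ht => .boxEta (DTyWf.sound hA) (HasCTm.sound ht)
end

end Cocon

namespace Cocon

open Fitch (Tm Ty scons wkn Sb SbEq HasTm TmEq TyEq TyWf Wf Look kitTm apT piT)

/-! ### Soundness of the translation -/

theorem WfCtx.tr : ∀ {Γ}, WfCtx Γ → Wf (trCtx Γ) ∧ Sb (trCtx Γ) Tm.var (oCtx Γ)
  | _, .nil => ⟨.nil, .id kitTm .nil⟩
  | _, .cons h h' => by
    have ⟨h₁, s⟩ := WfCtx.tr h
    have h' := h'.sound
    have e := (h'.ok.tr h'.base.wf).sub s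
    simp only [Ty.sub_id] at e
    exact ⟨.snoc h₁ e.right, s.id_snoc e.right e⟩

variable {Γ : Ctx} {Ψ Φ : DCtx}

theorem tmEq_base {t t' A} (h : WfCtx Γ) (e : TmEq (oCtx Γ) t t' A) :
    TmEq (trCtx Γ) t t' A := by
  have := e.sub h.tr.2
  simpa only [Tm.sub_id, Ty.sub_id] using this

theorem tyEq_base {A A'} (h : WfCtx Γ) (e : TyEq (oCtx Γ) A A') : TyEq (trCtx Γ) A A' := by
  have := e.sub h.tr.2
  simpa only [Ty.sub_id] using this

theorem tmEq_lock {t t' A} (h : WfCtx Γ) (e : TmEq (oCtx Γ).lock t t' A) :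
    TmEq (trCtx Γ).lock t t' A := by
  have := e.sub h.tr.2.locked
  simpa only [Tm.sub_id, Ty.sub_id] using this

theorem SDCtx.trOK (h : SDCtx Γ Ψ) : TrOK (oCtx Γ) Ψ := h.ok.tr h.base.wf

theorem SDCtx.code (h : SDCtx Γ Ψ) :
    TmEq (oCtx Γ).lock (oCode Ψ) (trDCtx Ψ).code .ctx := h.trOK.code h.sem

theorem SDTy.tr {A} (h : SDTy Γ Ψ A) : TmEq (oCtx Γ).lock (oFam Ψ A) (trDTy (trDCtx Ψ) A)
    (.pi (.elc (oCode Ψ)) .univ) := h.ok.tr h.ctx.sem h.ctx.trOK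

theorem SDTyEq.tr {A A'} (h : WfCtx Γ) (e : SDTyEq Γ Ψ A A') :
    TmEq (trCtx Γ).lock (trDTy (trDCtx Ψ) A) (trDTy (trDCtx Ψ) A')
      (.pi (.elc (trDCtx Ψ).code) .univ) := by
  have c := e.left.ctx
  have e₁ : TmEq (oCtx Γ).lock (oFam Ψ A) (oFam Ψ A') (.pi (.elc (oCode Ψ)) .univ) :=
    .lam (.elc c.sem.code) (.refl (.elc c.sem.code)) (e.code_proj (.refl c))
  exact tmEq_lock h (.conv (.trans (.symm e.left.tr) (.trans e₁ e.right.tr))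
    (.piElcUniv c.sem.code c.code))

theorem SDTy.tr_pi {A} (h : SDTy Γ Ψ A) :
    TyEq (oCtx Γ).lock (.pi (.elc (oCode Ψ)) (.el ((oTy Ψ.len A).sub (oProj Ψ))))
      (piT (trDCtx Ψ).code (trDTy (trDCtx Ψ) A)) :=
  .pi (.elc h.ctx.sem.code) (.elc h.ctx.code) (.el (TmEq.toApT h.ctx.code h.code_proj h.tr))

theorem SDTmEq.tr {M M' A} (h : WfCtx Γ) (e : SDTmEq Γ Ψ M M' A) :
    TmEq (trCtx Γ).lock (trDTm (trDCtx Ψ) M) (trDTm (trDCtx Ψ) M')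
      (piT (trDCtx Ψ).code (trDTy (trDCtx Ψ) A)) := by
  have c := e.left.ty.ctx
  have e₁ := TmEq.lam (.elc c.sem.code) (.refl (.elc c.sem.code)) (e.eq.sub c.sem.proj)
  exact tmEq_lock h (.conv (.trans (.symm (e.left.ok.tr c.sem c.trOK))
    (.trans e₁ (e.right.ok.tr c.sem c.trOK))) e.left.ty.tr_pi)

theorem SDSubEq.tr {σ σ'} (h : WfCtx Γ) (e : SDSubEq Γ Ψ σ σ' Φ) :
    TmEq (trCtx Γ).lock (trDSub (trDCtx Ψ) (trDCtx Φ) σ) (trDSub (trDCtx Ψ) (trDCtx Φ) σ')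
      (.pi (.elc (trDCtx Ψ).code) (.elc ((trDCtx Φ).code.up 1))) := by
  have c := e.left.src
  have c' := e.left.tgt
  have e₀ := (c'.sem.tup.subEq e.eq).sub c.sem.proj
  have eq : ((Ty.elc ((oCode Φ).sub (wkn Φ.len))).sub (oSub Ψ.len σ)).sub (oProj Ψ) =
      .elc ((oCode Φ).up 1) := by
    rw [← Tm.up_eq]
    exact congrArg Ty.elc ((congrArg _ (up_sub_oSub _ e.left.ok.sc)).trans (up_sub_oProj _ _))
  rw [eq] at e₀
  have e₁ := TmEq.lam (.elc c.sem.code) (.refl (.elc c.sem.code)) e₀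
  refine tmEq_lock h (.conv (.trans (.symm (e.left.ok.tr c.sem c'.sem c.trOK c'.trOK))
    (.trans e₁ (e.right.ok.tr c.sem c'.sem c.trOK c'.trOK))) ?_)
  exact .pi (.elc c.sem.code) (.elc c.code) (.elc (c'.code.weaken (.elc c.sem.code)))

theorem SObj.tr {C T} (h : WfCtx Γ) (e : SObj Γ C T) :
    HasTm (trCtx Γ).lock (trCxObj C) (trCxTy T) :=
  (tmEq_lock h ((e.ok.tr e.base.wf).conv (e.ty.tr e.base.wf))).right

theorem SCTyEq.tr {τ τ'} (h : WfCtx Γ) (e : SCTyEq Γ τ τ') :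
    TyEq (trCtx Γ) (trCTy τ) (trCTy τ') :=
  tyEq_base h (.trans (.symm (e.left.ok.tr e.left.base.wf))
    (.trans e.eq (e.right.ok.tr e.right.base.wf)))

theorem SCTmEq.tr {t t' τ} (h : WfCtx Γ) (e : SCTmEq Γ t t' τ) :
    TmEq (trCtx Γ) (trCTm t) (trCTm t') (trCTy τ) :=
  have w := e.left.ty.base.wf
  tmEq_base h (.conv (.trans (.symm (e.left.ok.tr w)) (.trans e.eq (e.right.ok.tr w)))
    (e.left.ty.ok.tr w))

mutual
theorem DCtxWf.base : ∀ {Γ Ψ}, DCtxWf Γ Ψ → WfCtx Γ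
  | _, _, .nil h => h
  | _, _, .var h _ => h
  | _, _, .snoc h _ => DCtxWf.base h
theorem DCtxEq.base : ∀ {Γ Ψ Ψ'}, DCtxEq Γ Ψ Ψ' → WfCtx Γ
  | _, _, _, .refl h => DCtxWf.base h
  | _, _, _, .symm h => DCtxEq.base h
  | _, _, _, .trans h _ => DCtxEq.base h
  | _, _, _, .snoc h _ _ _ _ => DCtxEq.base h
end

theorem DTyWf.base {Γ Ψ A} (h : DTyWf Γ Ψ A) : WfCtx Γ := by
  cases h with
  | ty h => exact h.base
  | trm h _ => exact h.base
  | pi h _ _ => exact h.base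

theorem HasDTm.base : ∀ {Γ Ψ M A}, HasDTm Γ Ψ M A → WfCtx Γ
  | _, _, _, _, .var c _ => c.base
  | _, _, _, _, .lam c _ _ _ => c.base
  | _, _, _, _, .app c _ _ _ _ => c.base
  | _, _, _, _, .unbox c _ _ _ _ => c.base
  | _, _, _, _, .unboxv c _ _ _ _ => c.base
  | _, _, _, _, .conv h _ => HasDTm.base h
  | _, _, _, _, .o c => c.base
  | _, _, _, _, .arr c _ _ => c.base
  | _, _, _, _, .lamc c _ _ _ => c.base
  | _, _, _, _, .appc c _ _ _ _ => c.base

theorem HasDSub.base {Γ Ψ σ Φ} (h : HasDSub Γ Ψ σ Φ) : WfCtx Γ := by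
  cases h with
  | nil c => exact c.base
  | cons c _ _ _ _ => exact c.base
  | wk c _ _ => exact c.base

theorem HasObj.base {Γ C T} (h : HasObj Γ C T) : WfCtx Γ := by
  cases h with
  | tm c _ _ => exact c.base
  | var c _ => exact c.base
  | unboxv c _ _ _ _ => exact c.base

theorem CTyWf.base {Γ τ} (h : CTyWf Γ τ) : WfCtx Γ := by cases h <;> assumption

theorem HasCTm.base : ∀ {Γ t τ}, HasCTm Γ t τ → WfCtx Γ
  | _, _, _, .var h _ => h
  | _, _, _, .ctx h _ => h
  | _, _, _, .box h _ => h
  | _, _, _, .fn h _ _ _ _ => h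
  | _, _, _, .app h _ _ _ _ _ => h
  | _, _, _, .conv h _ => HasCTm.base h

end Cocon

/-! ### Categories with families -/

namespace CwF

variable {C : Type u} [Category.{v} C] (M : CwF.{u, v, w} C)

theorem cast_heq {Γ : C} {A B : M.Ty Γ} (h : A = B) (t : M.Tm Γ A) : HEq (M.cast h t) t := by
  subst h; rfl

/-- Semantic terms with their types. -/
abbrev Val (Γ : C) := Σ A : M.Ty Γ, M.Tm Γ A

def vsub {Δ Γ : C} (σ : Δ ⟶ Γ) (x : M.Val Γ) : M.Val Δ := ⟨M.tySub σ x.1, M.tmSub σ x.2⟩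

theorem val_ext {Γ : C} {A B : M.Ty Γ} {t : M.Tm Γ A} {s : M.Tm Γ B} (h : A = B) (h' : HEq t s) :
    (⟨A, t⟩ : M.Val Γ) = ⟨B, s⟩ := by
  subst h; cases h'; rfl

theorem val_heq {Γ : C} {A B : M.Ty Γ} {t : M.Tm Γ A} {s : M.Tm Γ B}
    (h : (⟨A, t⟩ : M.Val Γ) = ⟨B, s⟩) : HEq t s := by
  cases h; rfl

theorem val_cast {Γ : C} {A B : M.Ty Γ} (h : A = B) (t : M.Tm Γ A) :
    (⟨B, M.cast h t⟩ : M.Val Γ) = ⟨A, t⟩ := M.val_ext h.symm (M.cast_heq h t)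

theorem vsub_id {Γ : C} (x : M.Val Γ) : M.vsub (𝟙 Γ) x = x :=
  M.val_ext (M.tySub_id _) (M.tmSub_id _)

theorem vsub_comp {Θ Δ Γ : C} (δ : Θ ⟶ Δ) (σ : Δ ⟶ Γ) (x : M.Val Γ) :
    M.vsub (δ ≫ σ) x = M.vsub δ (M.vsub σ x) := M.val_ext (M.tySub_comp _ _ _) (M.tmSub_comp _ _ _)

/-- The last variable. -/
def qv {Γ : C} (A : M.Ty Γ) : M.Val (M.ext Γ A) := ⟨_, M.q A⟩

theorem pair_congr {Δ Γ : C} {A : M.Ty Γ} {σ σ' : Δ ⟶ Γ} (h : σ = σ')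
    {t : M.Tm Δ (M.tySub σ A)} {t' : M.Tm Δ (M.tySub σ' A)} (h' : HEq t t') :
    M.pair σ t = M.pair σ' t' := by
  subst h; cases h'; rfl

theorem hom_ext {Δ Γ : C} {A : M.Ty Γ} {g h : Δ ⟶ M.ext Γ A} (e : g ≫ M.p A = h ≫ M.p A)
    (e' : M.vsub g (M.qv A) = M.vsub h (M.qv A)) : g = h := by
  have k : ∀ g : Δ ⟶ M.ext Γ A, ∃ t : M.Tm Δ (M.tySub (g ≫ M.p A) A),
      HEq t (M.tmSub g (M.q A)) ∧ M.pair (g ≫ M.p A) t = g := fun g =>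
    ⟨M.cast (M.tySub_comp _ _ _).symm (M.tmSub g (M.q A)), M.cast_heq _ _,
      M.pair_eta g _ (M.cast_heq _ _)⟩
  obtain ⟨t, ht, hg⟩ := k g
  obtain ⟨t', ht', hh⟩ := k h
  rw [← hg, ← hh]
  exact M.pair_congr e (ht.trans ((M.val_heq e').trans ht'.symm))

theorem vsub_pair {Δ Γ : C} (σ : Δ ⟶ Γ) {A : M.Ty Γ} (t : M.Tm Δ (M.tySub σ A)) :
    M.vsub (M.pair σ t) (M.qv A) = ⟨_, t⟩ :=
  M.val_ext (by rw [qv, ← M.tySub_comp, M.pair_p]) (M.pair_q σ t)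

theorem inst_p {Γ : C} {A : M.Ty Γ} (t : M.Tm Γ A) : M.inst t ≫ M.p A = 𝟙 Γ := M.pair_p _ _

theorem vsub_inst {Γ : C} {A : M.Ty Γ} (t : M.Tm Γ A) : M.vsub (M.inst t) (M.qv A) = ⟨A, t⟩ :=
  (M.vsub_pair _ _).trans (M.val_cast _ _)

theorem lift_p {Δ Γ : C} (σ : Δ ⟶ Γ) (A : M.Ty Γ) :
    M.lift σ A ≫ M.p A = M.p (M.tySub σ A) ≫ σ := M.pair_p _ _

theorem vsub_lift {Δ Γ : C} (σ : Δ ⟶ Γ) (A : M.Ty Γ) :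
    M.vsub (M.lift σ A) (M.qv A) = M.qv (M.tySub σ A) :=
  (M.vsub_pair _ _).trans (M.val_cast _ _)

theorem comp_inst {Δ Γ : C} (σ : Δ ⟶ Γ) {A : M.Ty Γ} (t : M.Tm Γ A) :
    σ ≫ M.inst t = M.inst (M.tmSub σ t) ≫ M.lift σ A := by
  refine M.hom_ext ?_ ?_
  · rw [Category.assoc, Category.assoc, M.inst_p, M.lift_p, ← Category.assoc, M.inst_p]; simp
  · rw [M.vsub_comp, M.vsub_comp, M.vsub_inst, M.vsub_lift, M.vsub_inst]; rfl

theorem inst_q_lift {Γ : C} (A : M.Ty Γ) : M.inst (M.q A) ≫ M.lift (M.p A) A = 𝟙 _ := by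
  refine M.hom_ext ?_ ?_
  · rw [Category.assoc, M.lift_p, ← Category.assoc, M.inst_p]
  · rw [M.vsub_comp, M.vsub_lift, M.vsub_inst, M.vsub_id]; rfl

end CwF

namespace FitchModel

variable {C : Type u} [Category.{v} C] {M : FitchModel.{u, v, w} C}

/-! ### Equations in a model of K -/

theorem transpose_symm_sub {Δ Γ : C} (σ : Δ ⟶ Γ) {A : M.Ty (M.L.obj Γ)} (t : M.Tm Γ (M.R A))
    (t' : M.Tm Δ (M.R (M.tySub (M.L.map σ) A))) (h : HEq t' (M.tmSub σ t)) :
    HEq (M.tmSub (M.L.map σ) (M.transpose.symm t)) (M.transpose.symm t') := by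
  obtain ⟨s, rfl⟩ := M.transpose.surjective t
  have : t' = M.transpose (M.tmSub (M.L.map σ) s) := eq_of_heq (h.trans (M.transpose_sub σ s))
  subst this
  simp

theorem app_congr {Γ : C} {A A' : M.Ty Γ} {B : M.Ty (M.ext Γ A)} {B' : M.Ty (M.ext Γ A')}
    {t : M.Tm Γ (M.Pi A B)} {t' : M.Tm Γ (M.Pi A' B')} {s : M.Tm Γ A} {s' : M.Tm Γ A'}
    (hA : A = A') (hB : HEq B B') (ht : HEq t t') (hs : HEq s s') :
    HEq (M.app t s) (M.app t' s') := by
  subst hA; cases hB; cases ht; cases hs; rfl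

theorem PiU_sub {Δ Γ : C} (σ : Δ ⟶ Γ) {φ : M.Tm Γ (M.Ctx Γ)} {φ' : M.Tm Δ (M.Ctx Δ)}
    (h : HEq φ' (M.tmSub σ φ)) :
    M.tySub σ (M.Pi (M.Elc φ) (M.U _)) = M.Pi (M.Elc φ') (M.U _) := by
  rw [M.Pi_sub, M.U_sub]
  have e := M.Elc_sub σ φ φ' h
  generalize M.tySub σ (M.Elc φ) = X at e
  subst e; rfl

theorem appU_sub {Δ Γ : C} (σ : Δ ⟶ Γ) {φ : M.Tm Γ (M.Ctx Γ)} {φ' : M.Tm Δ (M.Ctx Δ)}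
    {a : M.Tm Γ (M.Pi (M.Elc φ) (M.U _))} {a' : M.Tm Δ (M.Pi (M.Elc φ') (M.U _))}
    {t : M.Tm Γ (M.Elc φ)} {t' : M.Tm Δ (M.Elc φ')}
    (h : HEq φ' (M.tmSub σ φ)) (ha : HEq a' (M.tmSub σ a)) (ht : HEq t' (M.tmSub σ t)) :
    M.tySub σ (M.El (M.cast (M.U_sub (M.inst t)) (M.app a t))) =
      M.El (M.cast (M.U_sub (M.inst t')) (M.app a' t')) := by
  refine M.El_sub σ _ _ ?_
  have e := M.Elc_sub σ φ φ' h
  refine (M.cast_heq _ _).trans (HEq.trans ?_ (?_ : HEq (M.tmSub σ (M.app a t)) _))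
  · refine HEq.trans (app_congr e.symm (B' := M.tySub (M.lift σ (M.Elc φ)) (M.U _)) ?_ ?_ ht)
      (M.app_sub σ a t (M.cast (M.Pi_sub _ _ _) (M.tmSub σ a)) (M.cast_heq _ _)).symm
    · rw [M.U_sub, e]
    · exact ha.trans (M.cast_heq _ _).symm
  · have : ∀ {A B : M.Ty Γ} (h : A = B) (t : M.Tm Γ A),
        HEq (M.tmSub σ t) (M.tmSub σ (M.cast h t)) := by
      intro A B h t; subst h; rfl
    exact this _ _

theorem cfst_csnd_sub {Δ Γ : C} (σ : Δ ⟶ Γ) {φ : M.Tm Γ (M.Ctx Γ)} {φ' : M.Tm Δ (M.Ctx Δ)}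
    {a : M.Tm Γ (M.Pi (M.Elc φ) (M.U _))} {a' : M.Tm Δ (M.Pi (M.Elc φ') (M.U _))}
    {t : M.Tm Γ (M.Elc (M.cext φ a))} {t' : M.Tm Δ (M.Elc (M.cext φ' a'))}
    (h : HEq φ' (M.tmSub σ φ)) (ha : HEq a' (M.tmSub σ a)) (ht : HEq t' (M.tmSub σ t)) :
    HEq (M.cfst φ' a' t') (M.tmSub σ (M.cfst φ a t)) ∧
      HEq (M.csnd φ' a' t') (M.tmSub σ (M.csnd φ a t)) := by
  let x : M.Tm Δ (M.Elc φ') := M.cast (M.Elc_sub σ φ φ' h) (M.tmSub σ (M.cfst φ a t))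
  have hx : HEq x (M.tmSub σ (M.cfst φ a t)) := M.cast_heq _ _
  let y : M.Tm Δ (M.El (M.cast (M.U_sub (M.inst x)) (M.app a' x))) :=
    M.cast (appU_sub σ h ha hx) (M.tmSub σ (M.csnd φ a t))
  have hy : HEq y (M.tmSub σ (M.csnd φ a t)) := M.cast_heq _ _
  have e := M.cpair_sub σ φ a _ _ φ' a' x y h ha hx hy
  rw [M.cpair_eta] at e
  obtain rfl : t' = M.cpair φ' a' x y := eq_of_heq (ht.trans e)
  exact ⟨(heq_of_eq (M.cfst_pair _ _ _ _)).trans hx, (M.csnd_pair _ _ _ _).trans hy⟩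

end FitchModel

namespace FitchModel

open Fitch (Tm Ty wkn)

variable {C : Type u} [Category.{v} C] {M : FitchModel.{u, v, w} C}

/-! ### Denotations and substitution -/

/-- `DenTm` for a semantic term packed with its type. -/
def Den (S : Env M) (t : Tm) (x : M.Val S.obj) : Prop := DenTm S t x.1 x.2

theorem DenTy.congr {S : Env M} {A : Ty} {a b : M.Ty S.obj} (h : DenTy S A a) (e : a = b) :
    DenTy S A b := e ▸ h

theorem DenTm.congr {S : Env M} {t : Tm} {a b : M.Ty S.obj} {m : M.Tm S.obj a}
    {n : M.Tm S.obj b} (h : DenTm S t a m) (e : a = b) (e' : HEq m n) : DenTm S t b n := by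
  subst e; cases e'; exact h

theorem DenTm.cast {S : Env M} {t : Tm} {a b : M.Ty S.obj} {m : M.Tm S.obj a}
    (h : DenTm S t a m) (e : a = b) : DenTm S t b (M.cast e m) :=
  h.congr e (M.cast_heq e m).symm

theorem DenTm.push_univ {S : Env M} {a b : M.Ty S.obj} (e : a = b) {t : Tm}
    {m : M.Tm (M.ext S.obj a) (M.U _)} (h : DenTm (S.push a) t (M.U _) m) :
    ∃ m' : M.Tm (M.ext S.obj b) (M.U _), DenTm (S.push b) t (M.U _) m' ∧ HEq m' m := by
  subst e; exact ⟨m, h, .rfl⟩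

/-- Environments all of whose declarations live over the preceding environment. -/
inductive Env.OK : Env M → Prop
  | nil : OK .nil
  | push {S : Env M} (a : M.Ty S.obj) : OK S → OK (S.push a)
  | lock {S : Env M} : OK S → OK S.lock

theorem Wk.ok {S S' : Env M} {k π} (h : Wk S k S' π) (h' : S'.OK) : S.OK := by
  induction h with
  | zero => exact h'
  | succ a _ ih => exact .push a (ih h')

/-- A class of terms with denotations closed under weakening that contains the innermost
variable. -/
structure SemKit (V : (S : Env M) → Tm → M.Val S.obj → Prop) : Prop where
  den : ∀ {S t x}, V S t x → Den S t x
  weaken : ∀ {S : Env M} {t x} (b : M.Ty S.obj), V S t x → V (S.push b) (t.up 1) (M.vsub (M.p b) x)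
  var : ∀ {S : Env M} (b : M.Ty S.obj), S.OK → V (S.push b) (.var 0) (M.qv b)

/-- The morphism denoted by a substitution by terms of the class `V`. -/
inductive DenSub (V : (S : Env M) → Tm → M.Val S.obj → Prop) :
    (S' : Env M) → (ℕ → Tm) → (S : Env M) → (S'.obj ⟶ S.obj) → Prop
  | nil {S' : Env M} {θ} (f : S'.obj ⟶ (Env.nil : Env M).obj) : S'.OK → DenSub V S' θ .nil f
  | snoc {S' S : Env M} {θ} {a : M.Ty S.obj} {f : S'.obj ⟶ S.obj} (m : M.Tm S'.obj (M.tySub f a)) :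
      DenSub V S' (fun n => θ (n + 1)) S f → V S' (θ 0) ⟨M.tySub f a, m⟩ →
      DenSub V S' θ (S.push a) (M.pair f m)
  | lock {S' T S : Env M} {k : ℕ} {π : S'.obj ⟶ T.lock.obj} {θ θ'} {f : T.obj ⟶ S.obj} :
      DenSub V T θ S f → Wk S' k T.lock π → (∀ n, θ' n = (θ n).up k) →
      DenSub V S' θ' S.lock (π ≫ M.L.map f)

namespace DenSub

variable {V : (S : Env M) → Tm → M.Val S.obj → Prop}

theorem congr {S' θ} {S : Env M} {f g : S'.obj ⟶ S.obj} (h : DenSub V S' θ S f) (e : f = g) :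
    DenSub V S' θ S g := e ▸ h

theorem ok {S' θ S f} (h : DenSub V S' θ S f) : S'.OK := by
  induction h with
  | nil _ h => exact h
  | snoc _ _ _ ih => exact ih
  | lock _ w _ ih => exact w.ok (.lock ih)

theorem push {S' S : Env M} {θ : ℕ → Tm} {a : M.Ty S.obj} {f : S'.obj ⟶ S.obj}
    (g : S'.obj ⟶ M.ext S.obj a) (h : DenSub V S' (fun n => θ (n + 1)) S f)
    (h' : V S' (θ 0) (M.vsub g (M.qv a))) (e : g ≫ M.p a = f) :
    DenSub V S' θ (S.push a) g := by
  subst e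
  have e : M.vsub g (M.qv a) = ⟨_, M.cast (M.tySub_comp _ _ _).symm (M.tmSub g (M.q a))⟩ :=
    M.val_ext (M.tySub_comp _ _ _).symm (M.cast_heq _ _).symm
  exact (DenSub.snoc _ h (e ▸ h')).congr (M.pair_eta g _ (M.cast_heq _ _))

theorem weaken (K : SemKit V) {S' θ S f} (h : DenSub V S' θ S f) (b : M.Ty S'.obj) :
    DenSub V (S'.push b) (fun n => (θ n).up 1) S (M.p b ≫ f) := by
  induction h with
  | nil f h => exact .nil _ (.push b h)
  | @snoc S' S θ a f m _ h ih =>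
    refine DenSub.push (θ := fun n => (θ n).up 1) (M.p b ≫ M.pair f m) (ih b) ?_
      ((Category.assoc _ _ _).trans (congrArg (M.p b ≫ ·) (M.pair_p f m)))
    have e : M.vsub (M.p b ≫ M.pair f m) (M.qv a) = M.vsub (M.p b) ⟨_, m⟩ := by
      rw [M.vsub_comp, M.vsub_pair]
    exact e ▸ K.weaken b h
  | lock h w e _ =>
    exact (DenSub.lock h (.succ b w) fun _ => by rw [e, Tm.up_up]).congr (Category.assoc _ _ _)

theorem lift (K : SemKit V) {S' θ S f} (h : DenSub V S' θ S f) (a : M.Ty S.obj) :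
    DenSub V (S'.push (M.tySub f a)) (Fitch.liftSub θ) (S.push a) (M.lift f a) :=
  DenSub.push (θ := Fitch.liftSub θ) (M.lift f a) (h.weaken K _)
    ((M.vsub_lift f a) ▸ K.var (M.tySub f a) h.ok) (M.lift_p _ _)

theorem locked {S' θ S f} (h : DenSub V S' θ S f) :
    DenSub V S'.lock θ S.lock (M.L.map f) :=
  (DenSub.lock h .zero fun _ => (Tm.up_zero _).symm).congr (Category.id_comp _)

theorem push_inv {S' θ} {S : Env M} {a g} (h : DenSub V S' θ (S.push a) g) :
    ∃ f m, DenSub V S' (fun n => θ (n + 1)) S f ∧ V S' (θ 0) ⟨M.tySub f a, m⟩ ∧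
      g = M.pair f m := by
  cases h with
  | snoc m h h' => exact ⟨_, m, h, h', rfl⟩

theorem lock_inv {S' θ} {S : Env M} {g} (h : DenSub V S' θ S.lock g) :
    ∃ (T : Env M) (k : ℕ) (π : S'.obj ⟶ M.L.obj T.obj) (θ₀ : ℕ → Tm) (f : T.obj ⟶ S.obj),
      DenSub V T θ₀ S f ∧ Wk S' k T.lock π ∧ (∀ n, θ n = (θ₀ n).up k) ∧ g = π ≫ M.L.map f := by
  cases h with
  | lock h w e => exact ⟨_, _, _, _, _, h, w, e, rfl⟩

theorem drop {S S₁ : Env M} {k π} (w : Wk S k S₁ π) :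
    ∀ {S' θ f}, DenSub V S' θ S f → DenSub V S' (fun n => θ (n + k)) S₁ (f ≫ π) := by
  induction w with
  | zero => intro _ _ _ h; exact h.congr (Category.comp_id _).symm
  | @succ _ _ _ π a _ ih =>
    intro _ _ _ h
    obtain ⟨f, m, hf, _, rfl⟩ := h.push_inv
    exact (ih hf).congr ((congrArg (· ≫ π) (M.pair_p f m)).symm.trans (Category.assoc _ _ _))

theorem look (K : SemKit V) {S S₀ : Env M} {k : ℕ} {a : M.Ty S₀.obj}
    {π : S.obj ⟶ M.ext S₀.obj a}
    (w : Wk S k (S₀.push a) π) {S' θ f} (h : DenSub V S' θ S f) :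
    Den S' (θ k) (M.vsub f (M.vsub π (M.qv a))) := by
  obtain ⟨g, m, _, h, e⟩ := (h.drop w).push_inv
  have e : M.vsub f (M.vsub π (M.qv a)) = ⟨_, m⟩ :=
    (M.vsub_comp _ _ _).symm.trans ((congrArg (fun g => M.vsub g (M.qv a)) e).trans
      (M.vsub_pair g m))
  rw [Nat.zero_add] at h
  exact e ▸ K.den h

theorem id (K : SemKit V) {S : Env M} (h : S.OK) : DenSub V S Tm.var S (𝟙 _) := by
  induction h with
  | nil => exact .nil _ .nil
  | push a h ih =>
    exact DenSub.push (θ := Tm.var) (𝟙 (M.ext _ a)) (ih.weaken K a)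
      ((M.vsub_id _).symm ▸ K.var a h) ((Category.id_comp _).trans (Category.comp_id _).symm)
  | lock _ ih => exact ih.locked.congr (M.L.map_id _)

theorem up (K : SemKit V) {S S' : Env M} {k π} (w : Wk S k S' π) (h : S'.OK) :
    DenSub V S (wkn k) S' π := by
  induction w with
  | zero => exact .id K h
  | succ a _ ih => exact (ih h).weaken K a

end DenSub

theorem arrC_sub {Δ Γ : C} (σ : Δ ⟶ Γ) {a b : M.Tm Γ (M.El (M.tyC Γ))}
    {a' b' : M.Tm Δ (M.El (M.tyC Δ))} (ha : HEq a' (M.tmSub σ a)) (hb : HEq b' (M.tmSub σ b)) :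
    M.tySub σ (M.Pi (M.El (M.trmC a)) (M.tySub (M.p _) (M.El (M.trmC b)))) =
      M.Pi (M.El (M.trmC a')) (M.tySub (M.p _) (M.El (M.trmC b'))) := by
  rw [M.Pi_sub, ← M.tySub_comp, M.lift_p, M.tySub_comp,
    M.El_sub σ _ _ (M.trmC_sub σ b b' hb).symm]
  have e := M.El_sub σ _ _ (M.trmC_sub σ a a' ha).symm
  generalize M.tySub σ (M.El (M.trmC a)) = X at e
  subst e; rfl

mutual
theorem DenTy.subV {V : (S : Env M) → Tm → M.Val S.obj → Prop} (K : SemKit V) :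
    ∀ {S A a}, DenTy S A a → ∀ {S' θ f}, DenSub V S' θ S f → DenTy S' (A.sub θ) (M.tySub f a)
  | _, _, _, .pi hA hB, _, _, _, h =>
    (DenTy.pi (DenTy.subV K hA h) (DenTy.subV K hB (h.lift K _))).congr (M.Pi_sub _ _ _).symm
  | _, _, _, .box hA, _, _, _, h =>
    (DenTy.box (DenTy.subV K hA h.locked)).congr (M.R_sub _ _).symm
  | _, _, _, .univ, _, _, _, _ => DenTy.univ.congr (M.U_sub _).symm
  | _, _, _, .ctx, _, _, _, _ => DenTy.ctx.congr (M.Ctx_sub _).symm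
  | _, _, _, .el ht, _, _, _, h =>
    (DenTy.el ((DenTm.subV K ht h).cast (M.U_sub _))).congr
      (M.El_sub _ _ _ (M.cast_heq (M.U_sub _) _)).symm
  | _, _, _, .elc ht, _, _, _, h =>
    (DenTy.elc ((DenTm.subV K ht h).cast (M.Ctx_sub _))).congr
      (M.Elc_sub _ _ _ (M.cast_heq (M.Ctx_sub _) _)).symm
theorem DenTm.subV {V : (S : Env M) → Tm → M.Val S.obj → Prop} (K : SemKit V) :
    ∀ {S t a m}, DenTm S t a m → ∀ {S' θ f}, DenSub V S' θ S f →
      DenTm S' (t.sub θ) (M.tySub f a) (M.tmSub f m)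
  | _, _, _, _, .var w, _, _, _, h => h.look K w
  | _, _, _, _, .lam hA ht, _, _, f, h =>
    (DenTm.lam (DenTy.subV K hA h) (DenTm.subV K ht (h.lift K _))).congr (M.Pi_sub _ _ _).symm
      (M.lam_sub f _).symm
  | S, _, _, _, .app (a := a) (b := b) (n := n) hA hB ht hs, S', θ, f, h =>
    (DenTm.app (DenTy.subV K hA h) (DenTy.subV K hB (h.lift K _))
      ((DenTm.subV K ht h).cast (M.Pi_sub _ _ _)) (DenTm.subV K hs h)).congr
      ((M.tySub_comp _ _ _).symm.trans ((congrArg (fun g => M.tySub g b) (M.comp_inst f n).symm).trans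
        (M.tySub_comp _ _ _)))
      (M.app_sub f _ _ _ (M.cast_heq _ _)).symm
  | _, _, _, _, .box ht, _, _, f, h =>
    (DenTm.box (DenTm.subV K ht h.locked)).congr (M.R_sub _ _).symm (M.transpose_sub f _).symm
  | _, _, _, _, .unbox (k := k) (A := A) (t := t) (a := a) (m := m) (π := π) w hA ht,
      S', θ, f, h => by
    obtain ⟨T, k', π', θ₀, f₀, h₀, w', e, e'⟩ := (h.drop w).lock_inv
    have e₁ : (A.up k).sub θ = (A.sub θ₀).up k' := by
      rw [Ty.sub_up, Ty.up_sub]; congr 1; funext i; exact e i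
    have e₂ : (t.up k).sub θ = (t.sub θ₀).up k' := by
      rw [Tm.sub_up, Tm.up_sub]; congr 1; funext i; exact e i
    have d := DenTm.unbox w' (DenTy.subV K hA h₀.locked)
      ((DenTm.subV K ht h₀).cast (M.R_sub _ _))
    rw [← e₁, ← e₂] at d
    have e₃ := transpose_symm_sub f₀ m (M.cast (M.R_sub _ _) (M.tmSub f₀ m)) (M.cast_heq _ _)
    have e₄ : M.vsub π' ⟨_, M.transpose.symm (M.cast (M.R_sub _ _) (M.tmSub f₀ m))⟩ =
        M.vsub f (M.vsub π ⟨_, M.transpose.symm m⟩) :=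
      (congrArg (M.vsub π') (M.val_ext rfl e₃).symm).trans
        ((M.vsub_comp π' (M.L.map f₀) ⟨a, M.transpose.symm m⟩).symm.trans
        ((congrArg (fun g => M.vsub g ⟨a, M.transpose.symm m⟩) e'.symm).trans (M.vsub_comp _ _ _)))
    exact d.congr (congrArg Sigma.fst e₄) (M.val_heq e₄)
  | _, _, _, _, .pic (a := a) (b := b) ha hb, S', _, f, h => by
    have ha' := (DenTm.subV K ha h).cast (M.U_sub _)
    have e := M.El_sub f _ _ (M.cast_heq (M.U_sub _) (M.tmSub f a))
    have hb' := DenTm.subV K hb (h.lift K _)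
    obtain ⟨b', hb', eb⟩ := DenTm.push_univ e (hb'.cast (M.U_sub _))
    exact (DenTm.pic ha' hb').congr (M.U_sub f).symm
      (M.piC_sub f _ _ _ _ (M.cast_heq _ _) (eb.trans (M.cast_heq _ _))).symm
  | _, _, _, _, .tyc, _, _, f, h => DenTm.tyc.congr (M.U_sub _).symm (M.tyC_sub f).symm
  | _, _, _, _, .trmc hm, _, _, f, h =>
    have e := M.El_sub f _ _ (M.tyC_sub f).symm
    (DenTm.trmc ((DenTm.subV K hm h).cast e)).congr (M.U_sub f).symm
      (M.trmC_sub f _ _ (M.cast_heq _ _)).symm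
  | _, _, _, _, .top, _, _, f, h => DenTm.top.congr (M.Ctx_sub _).symm (M.top_sub f).symm
  | _, _, _, _, .ext hφ ha, _, _, f, h =>
    have eφ := M.cast_heq (M.Ctx_sub f) _
    (DenTm.ext ((DenTm.subV K hφ h).cast (M.Ctx_sub _))
      ((DenTm.subV K ha h).cast (PiU_sub f eφ))).congr (M.Ctx_sub _).symm
      (M.cext_sub f _ _ _ _ eφ (M.cast_heq _ _)).symm
  | _, _, _, _, .unit, _, _, f, h =>
    have e := M.Elc_sub f _ _ (M.top_sub f).symm
    DenTm.unit.congr e.symm ((heq_of_eq (M.unit_eta (M.cast e _)).symm).trans (M.cast_heq _ _))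
  | _, _, _, _, .pair (φ := φ) (a := a) (m := m) hφ ha ht hs, _, _, f, h => by
    have eφ := M.cast_heq (M.Ctx_sub f) (M.tmSub f φ)
    have ea := M.cast_heq (PiU_sub f eφ) (M.tmSub f a)
    have em := M.cast_heq (M.Elc_sub f _ _ eφ) (M.tmSub f m)
    exact (DenTm.pair ((DenTm.subV K hφ h).cast _) ((DenTm.subV K ha h).cast _)
      ((DenTm.subV K ht h).cast _) ((DenTm.subV K hs h).cast (appU_sub f eφ ea em))).congr
      (M.Elc_sub f _ _ (M.cext_sub f _ _ _ _ eφ ea).symm).symm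
      (M.cpair_sub f _ _ _ _ _ _ _ _ eφ ea em (M.cast_heq _ _)).symm
  | _, _, _, _, .fst (φ := φ) (a := a) (m := m) hφ ha ht, _, _, f, h => by
    have eφ := M.cast_heq (M.Ctx_sub f) (M.tmSub f φ)
    have ea := M.cast_heq (PiU_sub f eφ) (M.tmSub f a)
    have em := M.cast_heq (M.Elc_sub f _ _ (M.cext_sub f _ _ _ _ eφ ea).symm) (M.tmSub f m)
    exact (DenTm.fst ((DenTm.subV K hφ h).cast _) ((DenTm.subV K ha h).cast _)
      ((DenTm.subV K ht h).cast _)).congr (M.Elc_sub f _ _ eφ).symm (cfst_csnd_sub f eφ ea em).1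
  | _, _, _, _, .snd (φ := φ) (a := a) (m := m) hφ ha ht, _, _, f, h => by
    have eφ := M.cast_heq (M.Ctx_sub f) (M.tmSub f φ)
    have ea := M.cast_heq (PiU_sub f eφ) (M.tmSub f a)
    have em := M.cast_heq (M.Elc_sub f _ _ (M.cext_sub f _ _ _ _ eφ ea).symm) (M.tmSub f m)
    have e := cfst_csnd_sub f eφ ea em
    exact (DenTm.snd ((DenTm.subV K hφ h).cast _) ((DenTm.subV K ha h).cast _)
      ((DenTm.subV K ht h).cast _)).congr (appU_sub f eφ ea e.1).symm e.2
  | _, _, _, _, .o, _, _, f, h =>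
    DenTm.o.congr (M.El_sub f _ _ (M.tyC_sub f).symm).symm (M.o_sub f).symm
  | _, _, _, _, .arr ha hb, _, _, f, h =>
    have e := M.El_sub f _ _ (M.tyC_sub f).symm
    (DenTm.arr ((DenTm.subV K ha h).cast e) ((DenTm.subV K hb h).cast e)).congr e.symm
      (M.arr_sub f _ _ _ _ (M.cast_heq _ _) (M.cast_heq _ _)).symm
  | _, _, _, _, .lamc (a := a) (b := b) ha hb hf, _, _, f, h => by
    have e := M.El_sub f _ _ (M.tyC_sub f).symm
    have ea := M.cast_heq e (M.tmSub f a)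
    have eb := M.cast_heq e (M.tmSub f b)
    exact (DenTm.lamc ((DenTm.subV K ha h).cast e) ((DenTm.subV K hb h).cast e)
      ((DenTm.subV K hf h).cast (arrC_sub f ea eb))).congr
      (M.El_sub f _ _ (M.trmC_sub f _ _ (M.arr_sub f _ _ _ _ ea eb).symm).symm).symm
      (M.lamC_sub f _ _ _ _ _ _ ea eb (M.cast_heq _ _)).symm
  | _, _, _, _, .appc (a := a) (b := b) ha hb hm hn, _, _, f, h => by
    have e := M.El_sub f _ _ (M.tyC_sub f).symm
    have ea := M.cast_heq e (M.tmSub f a)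
    have eb := M.cast_heq e (M.tmSub f b)
    exact (DenTm.appc ((DenTm.subV K ha h).cast e) ((DenTm.subV K hb h).cast e)
      ((DenTm.subV K hm h).cast
        (M.El_sub f _ _ (M.trmC_sub f _ _ (M.arr_sub f _ _ _ _ ea eb).symm).symm))
      ((DenTm.subV K hn h).cast (M.El_sub f _ _ (M.trmC_sub f _ _ ea).symm))).congr
      (M.El_sub f _ _ (M.trmC_sub f _ _ eb).symm).symm
      (M.appC_sub f _ _ _ _ _ _ _ _ ea eb (M.cast_heq _ _) (M.cast_heq _ _)).symm
end

end FitchModel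

namespace FitchModel

open Fitch (Tm Ty wkn)

variable {C : Type u} [Category.{v} C] {M : FitchModel.{u, v, w} C}

/-- The kit of variables. -/
def VarDen (S : Env M) (t : Tm) (x : M.Val S.obj) : Prop := S.OK ∧ (∃ n, t = .var n) ∧ Den S t x

/-- The kit of terms. -/
def TmDen (S : Env M) (t : Tm) (x : M.Val S.obj) : Prop := S.OK ∧ Den S t x

theorem Wk.den {S S' : Env M} {k : ℕ} {a : M.Ty S'.obj} {π : S.obj ⟶ M.ext S'.obj a}
    (w : Wk S k (S'.push a) π) : Den S (.var k) (M.vsub π (M.qv a)) := DenTm.var w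

theorem DenTm.var_inv {S : Env M} {k : ℕ} {a m} (h : DenTm S (.var k) a m) :
    ∃ (S' : Env M) (b : M.Ty S'.obj) (π : S.obj ⟶ M.ext S'.obj b), Wk S k (S'.push b) π ∧
      (⟨a, m⟩ : M.Val S.obj) = M.vsub π (M.qv b) := by
  cases h with
  | var w => exact ⟨_, _, _, w, rfl⟩

theorem den_var_zero {S : Env M} (b : M.Ty S.obj) : Den (S.push b) (.var 0) (M.qv b) := by
  have := Wk.den (Wk.zero (S := S.push b))
  have e : M.vsub (𝟙 (M.ext S.obj b)) (M.qv b) = M.qv b := M.vsub_id _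
  exact e ▸ this

theorem semKit_var : SemKit (M := M) VarDen where
  den h := h.2.2
  weaken := by
    rintro S t ⟨a, m⟩ b ⟨h, ⟨n, rfl⟩, ht⟩
    obtain ⟨S', c, π, w, e⟩ := DenTm.var_inv ht
    refine ⟨.push b h, ⟨n + 1, rfl⟩, ?_⟩
    rw [e]
    exact (M.vsub_comp (M.p b) π (M.qv c)) ▸ Wk.den (Wk.succ b w)
  var b h := ⟨.push b h, ⟨0, rfl⟩, den_var_zero b⟩

theorem DenTy.weaken {S S' : Env M} {k π A a} (h : DenTy S' A a) (w : Wk S k S' π) (hS : S'.OK) :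
    DenTy S (A.up k) (M.tySub π a) := by
  rw [Ty.up, Ty.ren_eq_sub]
  exact h.subV semKit_var (.up semKit_var w hS)

theorem DenTm.weaken {S S' : Env M} {k π t a m} (h : DenTm S' t a m) (w : Wk S k S' π)
    (hS : S'.OK) : DenTm S (t.up k) (M.tySub π a) (M.tmSub π m) := by
  rw [Tm.up, Tm.ren_eq_sub]
  exact h.subV semKit_var (.up semKit_var w hS)

theorem Wk.one {S : Env M} (b : M.Ty S.obj) : Wk (S.push b) 1 S (M.p b) :=
  have e : M.p b ≫ 𝟙 S.obj = M.p b := Category.comp_id _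
  e ▸ Wk.succ b (Wk.zero (S := S))

theorem semKit_tm : SemKit (M := M) TmDen where
  den h := h.2
  weaken b h := ⟨.push b h.1, DenTm.weaken h.2 (.one b) h.1⟩
  var b h := ⟨.push b h, den_var_zero b⟩

theorem DenSub.single {S : Env M} (h : S.OK) {s : Tm} {a : M.Ty S.obj} {n : M.Tm S.obj a}
    (hs : DenTm S s a n) : DenSub TmDen S (Fitch.single s) (S.push a) (M.inst n) :=
  DenSub.push (θ := Fitch.single s) (M.inst n) (.id semKit_tm h)
    ((M.vsub_inst n).symm ▸ ⟨h, hs⟩) (M.inst_p n)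

theorem DenTy.inst {S : Env M} (h : S.OK) {B : Ty} {s : Tm} {a : M.Ty S.obj} {n : M.Tm S.obj a}
    {b : M.Ty (M.ext S.obj a)} (hB : DenTy (S.push a) B b) (hs : DenTm S s a n) :
    DenTy S (B.inst s) (M.tySub (M.inst n) b) := hB.subV semKit_tm (.single h hs)

theorem DenTm.inst {S : Env M} (h : S.OK) {t s : Tm} {a : M.Ty S.obj} {n : M.Tm S.obj a}
    {b : M.Ty (M.ext S.obj a)} {m : M.Tm (M.ext S.obj a) b} (ht : DenTm (S.push a) t b m)
    (hs : DenTm S s a n) : DenTm S (t.inst s) (M.tySub (M.inst n) b) (M.tmSub (M.inst n) m) :=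
  ht.subV semKit_tm (.single h hs)

theorem DenTy.lift_up {S : Env M} (h : S.OK) {B : Ty} {a : M.Ty S.obj}
    {b : M.Ty (M.ext S.obj a)} (hB : DenTy (S.push a) B b) :
    DenTy ((S.push a).push (M.tySub (M.p a) a)) (B.ren (Fitch.liftRen (· + 1)))
      (M.tySub (M.lift (M.p a) a) b) := by
  have e : B.ren (Fitch.liftRen (· + 1)) = B.sub (Fitch.liftSub (wkn 1)) := by
    rw [Ty.ren_eq_sub]; congr 1; funext n; cases n <;> rfl
  rw [e]
  exact hB.subV semKit_tm ((DenSub.up semKit_tm (.one a) h).lift semKit_tm a)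

/-! ### Uniqueness of denotations -/

theorem Wk.unique {S S₁ S₂ : Env M} {k π₁ π₂} (h₁ : Wk S k S₁ π₁) (h₂ : Wk S k S₂ π₂) :
    (⟨S₁, π₁⟩ : Σ T : Env M, S.obj ⟶ T.obj) = ⟨S₂, π₂⟩ := by
  induction h₁ with
  | zero => cases h₂; rfl
  | succ a _ ih =>
    cases h₂ with
    | succ _ h₂ => cases ih h₂; rfl

theorem Wk.lock_length {S T₁ T₂ : Env M} {k₁ k₂ π₁ π₂} (h₁ : Wk S k₁ T₁ π₁) (h₂ : Wk S k₂ T₂ π₂)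
    {S₁ S₂ : Env M} (e₁ : T₁ = S₁.lock) (e₂ : T₂ = S₂.lock) : k₁ = k₂ := by
  induction h₁ generalizing k₂ with
  | zero =>
    subst e₁
    cases h₂; rfl
  | succ a _ ih =>
    cases h₂ with
    | zero => cases e₂
    | succ _ h₂ => rw [ih h₂ e₁]

theorem DenTm.unbox_inv {S : Env M} {A t a m} (h : DenTm S (.unbox A t) a m) :
    ∃ (S' : Env M) (k : ℕ) (π : S.obj ⟶ M.L.obj S'.obj) (A' : Ty) (t' : Tm)
      (b : M.Ty (M.L.obj S'.obj)) (n : M.Tm S'.obj (M.R b)),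
      Wk S k S'.lock π ∧ DenTy S'.lock A' b ∧ DenTm S' t' (M.R b) n ∧ A = A'.up k ∧ t = t'.up k ∧
      (⟨a, m⟩ : M.Val S.obj) = M.vsub π ⟨b, M.transpose.symm n⟩ := by
  cases h with
  | unbox w hA ht => exact ⟨_, _, _, _, _, _, _, w, hA, ht, rfl, rfl, rfl⟩

theorem val_inj {Γ : C} {A : M.Ty Γ} {t s : M.Tm Γ A} (e : (⟨A, t⟩ : M.Val Γ) = ⟨A, s⟩) : t = s :=
  eq_of_heq (M.val_heq e)

mutual
theorem DenTy.unique : ∀ {S : Env M} {A a a'}, DenTy S A a → DenTy S A a' → a = a'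
  | _, _, _, _, .pi hA hB, h => by
    cases h with
    | pi hA' hB' =>
      obtain rfl := DenTy.unique hA hA'
      obtain rfl := DenTy.unique hB hB'
      rfl
  | _, _, _, _, .box hA, h => by
    cases h with
    | box hA' => rw [DenTy.unique hA hA']
  | _, _, _, _, .univ, h => by cases h; rfl
  | _, _, _, _, .ctx, h => by cases h; rfl
  | _, _, _, _, .el ht, h => by
    cases h with
    | el ht' => rw [val_inj (DenTm.unique ht ht')]
  | _, _, _, _, .elc ht, h => by
    cases h with
    | elc ht' => rw [val_inj (DenTm.unique ht ht')]
theorem DenTm.unique : ∀ {S : Env M} {t a m a' m'}, DenTm S t a m → DenTm S t a' m' →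
    (⟨a, m⟩ : M.Val S.obj) = ⟨a', m'⟩
  | _, _, _, _, _, _, .var w, h => by
    obtain ⟨S', b, π, w', e⟩ := h.var_inv
    cases w.unique w'
    exact e.symm
  | _, _, _, _, _, _, .lam hA ht, h => by
    cases h with
    | lam hA' ht' =>
      obtain rfl := DenTy.unique hA hA'
      cases DenTm.unique ht ht'
      rfl
  | _, _, _, _, _, _, .app hA hB ht hs, h => by
    cases h with
    | app hA' hB' ht' hs' =>
      obtain rfl := DenTy.unique hA hA'
      obtain rfl := DenTy.unique hB hB'
      obtain rfl := val_inj (DenTm.unique ht ht')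
      obtain rfl := val_inj (DenTm.unique hs hs')
      rfl
  | _, _, _, _, _, _, .box ht, h => by
    cases h with
    | box ht' =>
      cases DenTm.unique ht ht'
      rfl
  | _, _, _, _, _, _, .unbox w hA ht, h => by
    obtain ⟨S', k, π, A', t', b, n, w', hA', ht', eA, et, e⟩ := h.unbox_inv
    rw [e]
    obtain rfl := w.lock_length w' rfl rfl
    cases w.unique w'
    obtain rfl := Ty.up_injective eA
    obtain rfl := Tm.up_injective et
    obtain rfl := DenTy.unique hA hA'
    obtain rfl := val_inj (DenTm.unique ht ht')
    rfl
  | _, _, _, _, _, _, .pic ha hb, h => by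
    cases h with
    | pic ha' hb' =>
      obtain rfl := val_inj (DenTm.unique ha ha')
      obtain rfl := val_inj (DenTm.unique hb hb')
      rfl
  | _, _, _, _, _, _, .tyc, h => by cases h; rfl
  | _, _, _, _, _, _, .trmc hm, h => by
    cases h with
    | trmc hm' => rw [val_inj (DenTm.unique hm hm')]
  | _, _, _, _, _, _, .top, h => by cases h; rfl
  | _, _, _, _, _, _, .ext hφ ha, h => by
    cases h with
    | ext hφ' ha' =>
      obtain rfl := val_inj (DenTm.unique hφ hφ')
      obtain rfl := val_inj (DenTm.unique ha ha')
      rfl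
  | _, _, _, _, _, _, .unit, h => by cases h; rfl
  | _, _, _, _, _, _, .pair hφ ha ht hs, h => by
    cases h with
    | pair hφ' ha' ht' hs' =>
      obtain rfl := val_inj (DenTm.unique hφ hφ')
      obtain rfl := val_inj (DenTm.unique ha ha')
      obtain rfl := val_inj (DenTm.unique ht ht')
      obtain rfl := val_inj (DenTm.unique hs hs')
      rfl
  | _, _, _, _, _, _, .fst hφ ha ht, h => by
    cases h with
    | fst hφ' ha' ht' =>
      obtain rfl := val_inj (DenTm.unique hφ hφ')
      obtain rfl := val_inj (DenTm.unique ha ha')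
      obtain rfl := val_inj (DenTm.unique ht ht')
      rfl
  | _, _, _, _, _, _, .snd hφ ha ht, h => by
    cases h with
    | snd hφ' ha' ht' =>
      obtain rfl := val_inj (DenTm.unique hφ hφ')
      obtain rfl := val_inj (DenTm.unique ha ha')
      obtain rfl := val_inj (DenTm.unique ht ht')
      rfl
  | _, _, _, _, _, _, .o, h => by cases h; rfl
  | _, _, _, _, _, _, .arr ha hb, h => by
    cases h with
    | arr ha' hb' => rw [val_inj (DenTm.unique ha ha'), val_inj (DenTm.unique hb hb')]
  | _, _, _, _, _, _, .lamc ha hb hf, h => by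
    cases h with
    | lamc ha' hb' hf' =>
      obtain rfl := val_inj (DenTm.unique ha ha')
      obtain rfl := val_inj (DenTm.unique hb hb')
      obtain rfl := val_inj (DenTm.unique hf hf')
      rfl
  | _, _, _, _, _, _, .appc ha hb hm hn, h => by
    cases h with
    | appc ha' hb' hm' hn' =>
      obtain rfl := val_inj (DenTm.unique ha ha')
      obtain rfl := val_inj (DenTm.unique hb hb')
      obtain rfl := val_inj (DenTm.unique hm hm')
      obtain rfl := val_inj (DenTm.unique hn hn')
      rfl
end

theorem DenCtx.unique {Γ : Fitch.Ctx} {S S' : Env M} (h : DenCtx Γ S) (h' : DenCtx Γ S') :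
    S = S' := by
  induction h generalizing S' with
  | nil => cases h'; rfl
  | snoc _ hA ih =>
    cases h' with
    | snoc h' hA' =>
      obtain rfl := ih h'
      rw [hA.unique hA']
  | lock _ ih =>
    cases h' with
    | lock h' => rw [ih h']

theorem DenCtx.ok {Γ : Fitch.Ctx} {S : Env M} (h : DenCtx Γ S) : S.OK := by
  induction h with
  | nil => exact .nil
  | snoc _ _ ih => exact .push _ ih
  | lock _ ih => exact .lock ih

end FitchModel

namespace FitchModel

open Fitch (Tm Ty wkn TyWf TyEq HasTm TmEq Wf Look apT)

variable {C : Type u} [Category.{v} C] {M : FitchModel.{u, v, w} C}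

/-! ### Soundness of the interpretation of K -/

/-- The term `t` denotes an element of the denotation of `A`. -/
def TermDen (S : Env M) (t : Tm) (A : Ty) : Prop :=
  ∃ a : M.Ty S.obj, DenTy S A a ∧ ∃ m : M.Tm S.obj a, DenTm S t a m

theorem TermDen.at {S : Env M} {t A a} (h : TermDen S t A) (hA : DenTy S A a) :
    ∃ m, DenTm S t a m := by
  obtain ⟨a', hA', h⟩ := h
  obtain rfl := hA.unique hA'
  exact h

theorem TermEqual.at {S : Env M} {t t' A a} (h : TermEqual S t t' A) (hA : DenTy S A a) :
    ∃ m, DenTm S t a m ∧ DenTm S t' a m := by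
  obtain ⟨a', hA', h⟩ := h
  obtain rfl := hA.unique hA'
  exact h

theorem TermEqual.of {S : Env M} {t t' A a m} (h : TermEqual S t t' A) (hA : DenTy S A a)
    (ht : DenTm S t a m) : DenTm S t' a m := by
  obtain ⟨m', h, h'⟩ := h.at hA
  obtain rfl := val_inj (ht.unique h)
  exact h'

theorem TypeEqual.of {S : Env M} {A A' a} (h : TypeEqual S A A') (hA : DenTy S A a) :
    DenTy S A' a := by
  obtain ⟨a', h, h'⟩ := h
  obtain rfl := hA.unique h
  exact h'

theorem TermDen.defined {S : Env M} {t A} (h : TermDen S t A) : TermDefined S t A := by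
  obtain ⟨a, hA, m, ht⟩ := h
  refine ⟨a, hA, m, ht, fun a' m' h => ?_⟩
  have e := h.unique ht
  exact ⟨congrArg Sigma.fst e, M.val_heq e⟩

theorem look_den {Γ : Fitch.Ctx} {n A} (h : Look Γ n A) :
    ∀ {S : Env M}, DenCtx Γ S → TermDen S (.var n) A := by
  induction h with
  | here =>
    rintro _ (_ | ⟨hS, hA⟩)
    exact ⟨_, hA.weaken (.one _) hS.ok, _, den_var_zero _⟩
  | there _ ih =>
    rintro _ (_ | ⟨hS, hA⟩)
    obtain ⟨a, hA, m, ht⟩ := ih hS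
    exact ⟨_, hA.weaken (.one _) hS.ok, _, ht.weaken (.one _) hS.ok⟩

theorem DenCtx.append_inv : ∀ {Γ : Fitch.Ctx} {Δ : List Ty} {S : Env M},
    DenCtx (Γ.append Δ) S → ∃ (S' : Env M) (π : S.obj ⟶ S'.obj), DenCtx Γ S' ∧ Wk S Δ.length S' π
  | _, [], S, h => ⟨S, 𝟙 _, h, .zero⟩
  | _, A :: Δ, _, h => by
    cases h with
    | snoc h _ =>
      obtain ⟨S', π, h, w⟩ := DenCtx.append_inv h
      exact ⟨S', _, h, .succ _ w⟩

theorem DenCtx.lock_append_inv {Γ : Fitch.Ctx} {Δ : List Ty} {S : Env M}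
    (h : DenCtx (Γ.lock.append Δ) S) :
    ∃ (S' : Env M) (π : S.obj ⟶ M.L.obj S'.obj), DenCtx Γ S' ∧ Wk S Δ.length S'.lock π := by
  obtain ⟨T, π, h, w⟩ := h.append_inv
  cases h with
  | lock h => exact ⟨_, π, h, w⟩

theorem DenTm.apT {S : Env M} {f a t : Tm} {φ : M.Tm S.obj (M.Ctx S.obj)}
    {c : M.Tm S.obj (M.Pi (M.Elc φ) (M.U _))} {m : M.Tm S.obj (M.Elc φ)}
    (hφ : DenTm S f (M.Ctx S.obj) φ) (ha : DenTm S a (M.Pi (M.Elc φ) (M.U _)) c)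
    (ht : DenTm S t (M.Elc φ) m) :
    DenTm S (apT f a t) (M.U S.obj) (M.cast (M.U_sub (M.inst m)) (M.app c m)) :=
  (DenTm.app (.elc hφ) .univ ha ht).cast _

theorem DenTy.fam {S : Env M} {f : Tm} {φ : M.Tm S.obj (M.Ctx S.obj)}
    (hφ : DenTm S f (M.Ctx S.obj) φ) : DenTy S (.pi (.elc f) .univ) (M.Pi (M.Elc φ) (M.U _)) :=
  .pi (.elc hφ) .univ

theorem DenTy.objFun {S : Env M} {t s : Tm} {a b : M.Tm S.obj (M.El (M.tyC S.obj))} (h : S.OK)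
    (ha : DenTm S t (M.El (M.tyC S.obj)) a) (hb : DenTm S s (M.El (M.tyC S.obj)) b) :
    DenTy S (.pi (.el (.trmc t)) (.el (.trmc (s.up 1))))
      (M.Pi (M.El (M.trmC a)) (M.tySub (M.p (M.El (M.trmC a))) (M.El (M.trmC b)))) :=
  .pi (.el (.trmc ha)) ((DenTy.el (.trmc hb)).weaken (.one _) h)

theorem DenTm.unbox_zero {S : Env M} {A : Ty} {t : Tm} {a : M.Ty (M.L.obj S.obj)}
    {m : M.Tm S.obj (M.R a)} (hA : DenTy S.lock A a) (ht : DenTm S t (M.R a) m) :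
    DenTm S.lock (.unbox A t) a (M.transpose.symm m) := by
  have h := DenTm.unbox .zero hA ht
  rw [Ty.up_zero, Tm.up_zero] at h
  exact h.congr (M.tySub_id a) (M.tmSub_id (M.transpose.symm m))

theorem DenTm.eta {S : Env M} (h : S.OK) {A B : Ty} {t : Tm} {a : M.Ty S.obj}
    {b : M.Ty (M.ext S.obj a)} {m : M.Tm S.obj (M.Pi a b)} (hA : DenTy S A a)
    (hB : DenTy (S.push a) B b) (ht : DenTm S t (M.Pi a b) m) :
    DenTm S (.lam A (.app (A.up 1) (B.ren (Fitch.liftRen (· + 1))) (t.up 1) (.var 0)))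
      (M.Pi a b) m := by
  have d := DenTm.lam hA (DenTm.app (hA.weaken (.one a) h) (hB.lift_up h)
    ((ht.weaken (.one a) h).cast (M.Pi_sub _ _ _)) (den_var_zero a))
  refine d.congr ?_ (M.Pi_eta m _ (M.cast_heq _ _))
  exact congrArg (M.Pi a) ((M.tySub_comp _ _ _).symm.trans
    ((congrArg (fun g => M.tySub g b) (M.inst_q_lift a)).trans (M.tySub_id b)))

mutual
theorem sound_tyWf : ∀ {Γ : Fitch.Ctx} {A : Ty}, TyWf Γ A → ∀ {S : Env M}, DenCtx Γ S →
    ∃ a, DenTy S A a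
  | _, _, .pi hA hB, S, hS => by
    obtain ⟨a, hA⟩ := sound_tyWf hA hS
    obtain ⟨b, hB⟩ := sound_tyWf hB (hS.snoc hA)
    exact ⟨_, .pi hA hB⟩
  | _, _, .box hA, S, hS => by
    obtain ⟨a, hA⟩ := sound_tyWf hA hS.lock
    exact ⟨_, .box hA⟩
  | _, _, .univ _, S, hS => ⟨_, .univ⟩
  | _, _, .ctx _, S, hS => ⟨_, .ctx⟩
  | _, _, .el h, S, hS => by
    obtain ⟨m, h⟩ := (sound_hasTm h hS).at .univ
    exact ⟨_, .el h⟩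
  | _, _, .elc h, S, hS => by
    obtain ⟨m, h⟩ := (sound_hasTm h hS).at .ctx
    exact ⟨_, .elc h⟩
theorem sound_tyEq : ∀ {Γ : Fitch.Ctx} {A A' : Ty}, TyEq Γ A A' → ∀ {S : Env M}, DenCtx Γ S →
    TypeEqual S A A'
  | _, _, _, .refl h, S, hS => by
    obtain ⟨a, h⟩ := sound_tyWf h hS
    exact ⟨a, h, h⟩
  | _, _, _, .symm h, S, hS => by
    obtain ⟨a, h, h'⟩ := sound_tyEq h hS
    exact ⟨a, h', h⟩
  | _, _, _, .trans h₁ h₂, S, hS => by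
    obtain ⟨a, h, h'⟩ := sound_tyEq h₁ hS
    exact ⟨a, h, (sound_tyEq h₂ hS).of h'⟩
  | _, _, _, .pi _ hA hB, S, hS => by
    obtain ⟨a, hA, hA'⟩ := sound_tyEq hA hS
    obtain ⟨b, hB, hB'⟩ := sound_tyEq hB (hS.snoc hA)
    exact ⟨_, .pi hA hB, .pi hA' hB'⟩
  | _, _, _, .box hA, S, hS => by
    obtain ⟨a, hA, hA'⟩ := sound_tyEq hA hS.lock
    exact ⟨_, .box hA, .box hA'⟩
  | _, _, _, .el h, S, hS => by
    obtain ⟨m, h, h'⟩ := (sound_tmEq h hS).at .univ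
    exact ⟨_, .el h, .el h'⟩
  | _, _, _, .elc h, S, hS => by
    obtain ⟨m, h, h'⟩ := (sound_tmEq h hS).at .ctx
    exact ⟨_, .elc h, .elc h'⟩
  | _, _, _, .elPi ha hb, S, hS => by
    obtain ⟨a, ha⟩ := (sound_hasTm ha hS).at .univ
    obtain ⟨b, hb⟩ := (sound_hasTm hb (hS.snoc (.el ha))).at .univ
    exact ⟨_, .el (.pic ha hb), (DenTy.pi (.el ha) (.el hb)).congr (M.El_piC a b).symm⟩
theorem sound_hasTm : ∀ {Γ : Fitch.Ctx} {t : Tm} {A : Ty}, HasTm Γ t A → ∀ {S : Env M},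
    DenCtx Γ S → TermDen S t A
  | _, _, _, .var _ h, S, hS => look_den h hS
  | _, _, _, .conv h e, S, hS => by
    obtain ⟨a, hA, h⟩ := sound_hasTm h hS
    exact ⟨a, (sound_tyEq e hS).of hA, h⟩
  | _, _, _, .lam hA ht, S, hS => by
    obtain ⟨a, hA⟩ := sound_tyWf hA hS
    obtain ⟨b, hB, m, ht⟩ := sound_hasTm ht (hS.snoc hA)
    exact ⟨_, .pi hA hB, _, .lam hA ht⟩
  | _, _, _, .app hA hB ht hs, S, hS => by
    obtain ⟨a, hA⟩ := sound_tyWf hA hS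
    obtain ⟨b, hB⟩ := sound_tyWf hB (hS.snoc hA)
    obtain ⟨m, ht⟩ := (sound_hasTm ht hS).at (.pi hA hB)
    obtain ⟨n, hs⟩ := (sound_hasTm hs hS).at hA
    exact ⟨_, hB.inst hS.ok hs, _, .app hA hB ht hs⟩
  | _, _, _, .box ht, S, hS => by
    obtain ⟨a, hA, m, ht⟩ := sound_hasTm ht hS.lock
    exact ⟨_, .box hA, _, .box ht⟩
  | _, _, _, .unbox hA ht _, S, hS => by
    obtain ⟨S', π, hS', w⟩ := hS.lock_append_inv
    obtain ⟨a, hA⟩ := sound_tyWf hA hS'.lock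
    obtain ⟨m, ht⟩ := (sound_hasTm ht hS').at (.box hA)
    exact ⟨_, hA.weaken w (.lock hS'.ok), _, .unbox w hA ht⟩
  | _, _, _, .pic ha hb, S, hS => by
    obtain ⟨a, ha⟩ := (sound_hasTm ha hS).at .univ
    obtain ⟨b, hb⟩ := (sound_hasTm hb (hS.snoc (.el ha))).at .univ
    exact ⟨_, .univ, _, .pic ha hb⟩
  | _, _, _, .tyc _, S, hS => ⟨_, .univ, _, .tyc⟩
  | _, _, _, .trmc hm, S, hS => by
    obtain ⟨m, hm⟩ := (sound_hasTm hm hS).at (.el .tyc)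
    exact ⟨_, .univ, _, .trmc hm⟩
  | _, _, _, .top _, S, hS => ⟨_, .ctx, _, .top⟩
  | _, _, _, .ext hφ ha, S, hS => by
    obtain ⟨φ, hφ⟩ := (sound_hasTm hφ hS).at .ctx
    obtain ⟨a, ha⟩ := (sound_hasTm ha hS).at (.fam hφ)
    exact ⟨_, .ctx, _, .ext hφ ha⟩
  | _, _, _, .unit _, S, hS => ⟨_, .elc .top, _, .unit⟩
  | _, _, _, .pair hφ ha ht hs, S, hS => by
    obtain ⟨φ, hφ⟩ := (sound_hasTm hφ hS).at .ctx
    obtain ⟨a, ha⟩ := (sound_hasTm ha hS).at (.fam hφ)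
    obtain ⟨m, ht⟩ := (sound_hasTm ht hS).at (.elc hφ)
    obtain ⟨n, hs⟩ := (sound_hasTm hs hS).at (.el (.apT hφ ha ht))
    exact ⟨_, .elc (.ext hφ ha), _, .pair hφ ha ht hs⟩
  | _, _, _, .fst hφ ha ht, S, hS => by
    obtain ⟨φ, hφ⟩ := (sound_hasTm hφ hS).at .ctx
    obtain ⟨a, ha⟩ := (sound_hasTm ha hS).at (.fam hφ)
    obtain ⟨m, ht⟩ := (sound_hasTm ht hS).at (.elc (.ext hφ ha))
    exact ⟨_, .elc hφ, _, .fst hφ ha ht⟩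
  | _, _, _, .snd hφ ha ht, S, hS => by
    obtain ⟨φ, hφ⟩ := (sound_hasTm hφ hS).at .ctx
    obtain ⟨a, ha⟩ := (sound_hasTm ha hS).at (.fam hφ)
    obtain ⟨m, ht⟩ := (sound_hasTm ht hS).at (.elc (.ext hφ ha))
    exact ⟨_, .el (.apT hφ ha (.fst hφ ha ht)), _, .snd hφ ha ht⟩
  | _, _, _, .o _, S, hS => ⟨_, .el .tyc, _, .o⟩
  | _, _, _, .arr ha hb, S, hS => by
    obtain ⟨a, ha⟩ := (sound_hasTm ha hS).at (.el .tyc)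
    obtain ⟨b, hb⟩ := (sound_hasTm hb hS).at (.el .tyc)
    exact ⟨_, .el .tyc, _, .arr ha hb⟩
  | _, _, _, .lamc ha hb hf, S, hS => by
    obtain ⟨a, ha⟩ := (sound_hasTm ha hS).at (.el .tyc)
    obtain ⟨b, hb⟩ := (sound_hasTm hb hS).at (.el .tyc)
    obtain ⟨f, hf⟩ := (sound_hasTm hf hS).at (.objFun hS.ok ha hb)
    exact ⟨_, .el (.trmc (.arr ha hb)), _, .lamc ha hb hf⟩
  | _, _, _, .appc ha hb hm hn, S, hS => by
    obtain ⟨a, ha⟩ := (sound_hasTm ha hS).at (.el .tyc)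
    obtain ⟨b, hb⟩ := (sound_hasTm hb hS).at (.el .tyc)
    obtain ⟨m, hm⟩ := (sound_hasTm hm hS).at (.el (.trmc (.arr ha hb)))
    obtain ⟨n, hn⟩ := (sound_hasTm hn hS).at (.el (.trmc ha))
    exact ⟨_, .el (.trmc hb), _, .appc ha hb hm hn⟩
theorem sound_tmEq : ∀ {Γ : Fitch.Ctx} {t t' : Tm} {A : Ty}, TmEq Γ t t' A → ∀ {S : Env M},
    DenCtx Γ S → TermEqual S t t' A
  | _, _, _, _, .refl h, S, hS => by
    obtain ⟨a, hA, m, h⟩ := sound_hasTm h hS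
    exact ⟨a, hA, m, h, h⟩
  | _, _, _, _, .symm h, S, hS => by
    obtain ⟨a, hA, m, h, h'⟩ := sound_tmEq h hS
    exact ⟨a, hA, m, h', h⟩
  | _, _, _, _, .trans h₁ h₂, S, hS => by
    obtain ⟨a, hA, m, h, h'⟩ := sound_tmEq h₁ hS
    exact ⟨a, hA, m, h, (sound_tmEq h₂ hS).of hA h'⟩
  | _, _, _, _, .conv h e, S, hS => by
    obtain ⟨a, hA, h⟩ := sound_tmEq h hS
    exact ⟨a, (sound_tyEq e hS).of hA, h⟩
  | _, _, _, _, .lam _ hA ht, S, hS => by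
    obtain ⟨a, hA, hA'⟩ := sound_tyEq hA hS
    obtain ⟨b, hB, m, ht, ht'⟩ := sound_tmEq ht (hS.snoc hA)
    exact ⟨_, .pi hA hB, _, .lam hA ht, .lam hA' ht'⟩
  | _, _, _, _, .app _ hA _ hB ht _ hs, S, hS => by
    obtain ⟨a, hA, hA'⟩ := sound_tyEq hA hS
    obtain ⟨b, hB, hB'⟩ := sound_tyEq hB (hS.snoc hA)
    obtain ⟨m, ht, ht'⟩ := (sound_tmEq ht hS).at (.pi hA hB)
    obtain ⟨n, hs, hs'⟩ := (sound_tmEq hs hS).at hA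
    exact ⟨_, hB.inst hS.ok hs, _, .app hA hB ht hs, .app hA' hB' ht' hs'⟩
  | _, _, _, _, .box ht, S, hS => by
    obtain ⟨a, hA, m, ht, ht'⟩ := sound_tmEq ht hS.lock
    exact ⟨_, .box hA, _, .box ht, .box ht'⟩
  | _, _, _, _, .unbox _ hA ht _, S, hS => by
    obtain ⟨S', π, hS', w⟩ := hS.lock_append_inv
    obtain ⟨a, hA, hA'⟩ := sound_tyEq hA hS'.lock
    obtain ⟨m, ht, ht'⟩ := (sound_tmEq ht hS').at (.box hA)
    exact ⟨_, hA.weaken w (.lock hS'.ok), _, .unbox w hA ht, .unbox w hA' ht'⟩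
  | _, _, _, _, .pic _ ha hb, S, hS => by
    obtain ⟨a, ha, ha'⟩ := (sound_tmEq ha hS).at .univ
    obtain ⟨b, hb, hb'⟩ := (sound_tmEq hb (hS.snoc (.el ha))).at .univ
    exact ⟨_, .univ, _, .pic ha hb, .pic ha' hb'⟩
  | _, _, _, _, .trmc hm, S, hS => by
    obtain ⟨m, hm, hm'⟩ := (sound_tmEq hm hS).at (.el .tyc)
    exact ⟨_, .univ, _, .trmc hm, .trmc hm'⟩
  | _, _, _, _, .ext _ hφ ha, S, hS => by
    obtain ⟨φ, hφ, hφ'⟩ := (sound_tmEq hφ hS).at .ctx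
    obtain ⟨a, ha, ha'⟩ := (sound_tmEq ha hS).at (.fam hφ)
    exact ⟨_, .ctx, _, .ext hφ ha, .ext hφ' ha'⟩
  | _, _, _, _, .pair _ hφ _ ha _ ht hs, S, hS => by
    obtain ⟨φ, hφ, hφ'⟩ := (sound_tmEq hφ hS).at .ctx
    obtain ⟨a, ha, ha'⟩ := (sound_tmEq ha hS).at (.fam hφ)
    obtain ⟨m, ht, ht'⟩ := (sound_tmEq ht hS).at (.elc hφ)
    obtain ⟨n, hs, hs'⟩ := (sound_tmEq hs hS).at (.el (.apT hφ ha ht))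
    exact ⟨_, .elc (.ext hφ ha), _, .pair hφ ha ht hs, .pair hφ' ha' ht' hs'⟩
  | _, _, _, _, .fst _ hφ _ ha ht, S, hS => by
    obtain ⟨φ, hφ, hφ'⟩ := (sound_tmEq hφ hS).at .ctx
    obtain ⟨a, ha, ha'⟩ := (sound_tmEq ha hS).at (.fam hφ)
    obtain ⟨m, ht, ht'⟩ := (sound_tmEq ht hS).at (.elc (.ext hφ ha))
    exact ⟨_, .elc hφ, _, .fst hφ ha ht, .fst hφ' ha' ht'⟩
  | _, _, _, _, .snd _ hφ _ ha _ ht, S, hS => by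
    obtain ⟨φ, hφ, hφ'⟩ := (sound_tmEq hφ hS).at .ctx
    obtain ⟨a, ha, ha'⟩ := (sound_tmEq ha hS).at (.fam hφ)
    obtain ⟨m, ht, ht'⟩ := (sound_tmEq ht hS).at (.elc (.ext hφ ha))
    exact ⟨_, .el (.apT hφ ha (.fst hφ ha ht)), _, .snd hφ ha ht, .snd hφ' ha' ht'⟩
  | _, _, _, _, .arr ha hb, S, hS => by
    obtain ⟨a, ha, ha'⟩ := (sound_tmEq ha hS).at (.el .tyc)
    obtain ⟨b, hb, hb'⟩ := (sound_tmEq hb hS).at (.el .tyc)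
    exact ⟨_, .el .tyc, _, .arr ha hb, .arr ha' hb'⟩
  | _, _, _, _, .lamc _ _ ha hb hf, S, hS => by
    obtain ⟨a, ha, ha'⟩ := (sound_tmEq ha hS).at (.el .tyc)
    obtain ⟨b, hb, hb'⟩ := (sound_tmEq hb hS).at (.el .tyc)
    obtain ⟨f, hf, hf'⟩ := (sound_tmEq hf hS).at (.objFun hS.ok ha hb)
    exact ⟨_, .el (.trmc (.arr ha hb)), _, .lamc ha hb hf, .lamc ha' hb' hf'⟩
  | _, _, _, _, .appc _ _ ha hb hm hn, S, hS => by
    obtain ⟨a, ha, ha'⟩ := (sound_tmEq ha hS).at (.el .tyc)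
    obtain ⟨b, hb, hb'⟩ := (sound_tmEq hb hS).at (.el .tyc)
    obtain ⟨m, hm, hm'⟩ := (sound_tmEq hm hS).at (.el (.trmc (.arr ha hb)))
    obtain ⟨n, hn, hn'⟩ := (sound_tmEq hn hS).at (.el (.trmc ha))
    exact ⟨_, .el (.trmc hb), _, .appc ha hb hm hn, .appc ha' hb' hm' hn'⟩
  | _, _, _, _, .piBeta hA hB ht hs, S, hS => by
    obtain ⟨a, hA⟩ := sound_tyWf hA hS
    obtain ⟨b, hB⟩ := sound_tyWf hB (hS.snoc hA)
    obtain ⟨m, ht⟩ := (sound_hasTm ht (hS.snoc hA)).at hB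
    obtain ⟨n, hs⟩ := (sound_hasTm hs hS).at hA
    exact ⟨_, hB.inst hS.ok hs, _, .app hA hB (.lam hA ht) hs,
      (DenTm.inst hS.ok ht hs).congr rfl (heq_of_eq (M.Pi_beta m n).symm)⟩
  | _, _, _, _, .piEta hA hB ht, S, hS => by
    obtain ⟨a, hA⟩ := sound_tyWf hA hS
    obtain ⟨b, hB⟩ := sound_tyWf hB (hS.snoc hA)
    obtain ⟨m, ht⟩ := (sound_hasTm ht hS).at (.pi hA hB)
    exact ⟨_, .pi hA hB, m, ht, .eta hS.ok hA hB ht⟩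
  | _, _, _, _, .boxBeta hA ht _, S, hS => by
    obtain ⟨S', π, hS', w⟩ := hS.lock_append_inv
    obtain ⟨a, hA⟩ := sound_tyWf hA hS'.lock
    obtain ⟨m, ht⟩ := (sound_hasTm ht hS'.lock).at hA
    exact ⟨_, hA.weaken w (.lock hS'.ok), _,
      (DenTm.unbox w hA (.box ht)).congr rfl
        (heq_of_eq (congrArg (M.tmSub π) (M.transpose.symm_apply_apply m))),
      ht.weaken w (.lock hS'.ok)⟩
  | _, _, _, _, .boxEta hA ht, S, hS => by
    obtain ⟨a, hA⟩ := sound_tyWf hA hS.lock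
    obtain ⟨m, ht⟩ := (sound_hasTm ht hS).at (.box hA)
    exact ⟨_, .box hA, m, ht, (DenTm.box (.unbox_zero hA ht)).congr rfl
      (heq_of_eq (M.transpose.apply_symm_apply m))⟩
  | _, _, _, _, .topEta ht, S, hS => by
    obtain ⟨m, ht⟩ := (sound_hasTm ht hS).at (.elc .top)
    exact ⟨_, .elc .top, m, ht, DenTm.unit.congr rfl (heq_of_eq (M.unit_eta m).symm)⟩
  | _, _, _, _, .fstBeta hφ ha ht hs, S, hS => by
    obtain ⟨φ, hφ⟩ := (sound_hasTm hφ hS).at .ctx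
    obtain ⟨a, ha⟩ := (sound_hasTm ha hS).at (.fam hφ)
    obtain ⟨m, ht⟩ := (sound_hasTm ht hS).at (.elc hφ)
    obtain ⟨n, hs⟩ := (sound_hasTm hs hS).at (.el (.apT hφ ha ht))
    exact ⟨_, .elc hφ, m, (DenTm.fst hφ ha (.pair hφ ha ht hs)).congr rfl
      (heq_of_eq (M.cfst_pair φ a m n)), ht⟩
  | _, _, _, _, .sndBeta hφ ha ht hs, S, hS => by
    obtain ⟨φ, hφ⟩ := (sound_hasTm hφ hS).at .ctx
    obtain ⟨a, ha⟩ := (sound_hasTm ha hS).at (.fam hφ)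
    obtain ⟨m, ht⟩ := (sound_hasTm ht hS).at (.elc hφ)
    obtain ⟨n, hs⟩ := (sound_hasTm hs hS).at (.el (.apT hφ ha ht))
    exact ⟨_, .el (.apT hφ ha ht), n, (DenTm.snd hφ ha (.pair hφ ha ht hs)).congr
      (by rw [M.cfst_pair]) (M.csnd_pair φ a m n), hs⟩
  | _, _, _, _, .pairEta hφ ha ht, S, hS => by
    obtain ⟨φ, hφ⟩ := (sound_hasTm hφ hS).at .ctx
    obtain ⟨a, ha⟩ := (sound_hasTm ha hS).at (.fam hφ)
    obtain ⟨m, ht⟩ := (sound_hasTm ht hS).at (.elc (.ext hφ ha))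
    exact ⟨_, .elc (.ext hφ ha), m, ht,
      (DenTm.pair hφ ha (.fst hφ ha ht) (.snd hφ ha ht)).congr rfl
        (heq_of_eq (M.cpair_eta φ a m))⟩
end

theorem sound_wf : ∀ {Γ : Fitch.Ctx}, Wf Γ → ∃ S : Env M, DenCtx Γ S
  | _, .nil => ⟨_, .nil⟩
  | _, .snoc h hA => by
    obtain ⟨S, hS⟩ := sound_wf h
    obtain ⟨a, hA⟩ := sound_tyWf hA hS
    exact ⟨_, .snoc hS hA⟩
  | _, .lock h => by
    obtain ⟨S, hS⟩ := sound_wf h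
    exact ⟨_, .lock hS⟩

end FitchModel

namespace Cocon

/-! ### Soundness of the interpretation of Cocon -/

theorem DCtxWf.tr_code {Γ Φ} (h : DCtxWf Γ Φ) :
    Fitch.HasTm (trCtx Γ).lock (trDCtx Φ).code .ctx := (tmEq_lock h.base h.sound.code).right

theorem DTyWf.tr_fam {Γ Ψ A} (h : DTyWf Γ Ψ A) :
    Fitch.HasTm (trCtx Γ).lock (trDTy (trDCtx Ψ) A) (.pi (.elc (trDCtx Ψ).code) .univ) :=
  ((SDTyEq.refl h.sound).tr h.base).left

theorem HasDTm.tr_tm {Γ Ψ M A} (h : HasDTm Γ Ψ M A) :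
    Fitch.HasTm (trCtx Γ).lock (trDTm (trDCtx Ψ) M)
      (Fitch.piT (trDCtx Ψ).code (trDTy (trDCtx Ψ) A)) := ((SDTmEq.refl h.sound).tr h.base).left

theorem HasDSub.tr_sub {Γ Ψ σ Φ} (h : HasDSub Γ Ψ σ Φ) :
    Fitch.HasTm (trCtx Γ).lock (trDSub (trDCtx Ψ) (trDCtx Φ) σ)
      (.pi (.elc (trDCtx Ψ).code) (.elc ((trDCtx Φ).code.up 1))) :=
  ((SDSubEq.refl h.sound).tr h.base).left

theorem CTyWf.tr_ty {Γ τ} (h : CTyWf Γ τ) : Fitch.TyWf (trCtx Γ) (trCTy τ) :=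
  ((SCTyEq.refl h.sound).tr h.base).left

theorem HasCTm.tr_ctm {Γ t τ} (h : HasCTm Γ t τ) :
    Fitch.HasTm (trCtx Γ) (trCTm t) (trCTy τ) := ((SCTmEq.refl h.sound).tr h.base).left

end Cocon

theorem mainTheorem3 :
    -- The interpretation in dependent intuitionistic K is well typed.
    (∀ Γ : Cocon.Ctx, Cocon.WfCtx Γ → Fitch.Wf (Cocon.trCtx Γ)) ∧
    (∀ (Γ : Cocon.Ctx) (Φ : Cocon.DCtx), Cocon.DCtxWf Γ Φ →
      Fitch.HasTm (Cocon.trCtx Γ).lock (Cocon.trDCtx Φ).code .ctx) ∧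
    (∀ (Γ : Cocon.Ctx) (Ψ : Cocon.DCtx) (A : Cocon.DTy), Cocon.DTyWf Γ Ψ A →
      Fitch.HasTm (Cocon.trCtx Γ).lock (Cocon.trDTy (Cocon.trDCtx Ψ) A)
        (.pi (.elc (Cocon.trDCtx Ψ).code) .univ)) ∧
    (∀ (Γ : Cocon.Ctx) (Ψ : Cocon.DCtx) (M : Cocon.DTm) (A : Cocon.DTy),
      Cocon.HasDTm Γ Ψ M A →
      Fitch.HasTm (Cocon.trCtx Γ).lock (Cocon.trDTm (Cocon.trDCtx Ψ) M)
        (Fitch.piT (Cocon.trDCtx Ψ).code (Cocon.trDTy (Cocon.trDCtx Ψ) A))) ∧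
    (∀ (Γ : Cocon.Ctx) (Ψ Φ : Cocon.DCtx) (σ : Cocon.DSub), Cocon.HasDSub Γ Ψ σ Φ →
      Fitch.HasTm (Cocon.trCtx Γ).lock (Cocon.trDSub (Cocon.trDCtx Ψ) (Cocon.trDCtx Φ) σ)
        (.pi (.elc (Cocon.trDCtx Ψ).code) (.elc ((Cocon.trDCtx Φ).code.up 1)))) ∧
    (∀ (Γ : Cocon.Ctx) (O : Cocon.CxObj) (T : Cocon.CxTy), Cocon.HasObj Γ O T →
      Fitch.HasTm (Cocon.trCtx Γ).lock (Cocon.trCxObj O) (Cocon.trCxTy T)) ∧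
    (∀ (Γ : Cocon.Ctx) (τ : Cocon.CTy), Cocon.CTyWf Γ τ →
      Fitch.TyWf (Cocon.trCtx Γ) (Cocon.trCTy τ)) ∧
    (∀ (Γ : Cocon.Ctx) (t : Cocon.CTm) (τ : Cocon.CTy), Cocon.HasCTm Γ t τ →
      Fitch.HasTm (Cocon.trCtx Γ) (Cocon.trCTm t) (Cocon.trCTy τ)) ∧
    -- Hence Cocon is interpreted in every CwF with a dependent right adjoint.
    (∀ (C : Type u) [Category.{v} C] (M : FitchModel.{u, v, w} C) (Γ : Cocon.Ctx),
      Cocon.WfCtx Γ →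
      ∃ S : FitchModel.Env M, FitchModel.DenCtx (Cocon.trCtx Γ) S ∧
        (∀ S' : FitchModel.Env M, FitchModel.DenCtx (Cocon.trCtx Γ) S' → S' = S) ∧
        (∀ Φ : Cocon.DCtx, Cocon.DCtxWf Γ Φ →
          FitchModel.TermDefined S.lock (Cocon.trDCtx Φ).code .ctx) ∧
        (∀ (Ψ : Cocon.DCtx) (A : Cocon.DTy), Cocon.DTyWf Γ Ψ A →
          FitchModel.TermDefined S.lock (Cocon.trDTy (Cocon.trDCtx Ψ) A)
            (.pi (.elc (Cocon.trDCtx Ψ).code) .univ)) ∧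
        (∀ (Ψ : Cocon.DCtx) (N : Cocon.DTm) (A : Cocon.DTy), Cocon.HasDTm Γ Ψ N A →
          FitchModel.TermDefined S.lock (Cocon.trDTm (Cocon.trDCtx Ψ) N)
            (Fitch.piT (Cocon.trDCtx Ψ).code (Cocon.trDTy (Cocon.trDCtx Ψ) A))) ∧
        (∀ (Ψ Φ : Cocon.DCtx) (σ : Cocon.DSub), Cocon.HasDSub Γ Ψ σ Φ →
          FitchModel.TermDefined S.lock (Cocon.trDSub (Cocon.trDCtx Ψ) (Cocon.trDCtx Φ) σ)
            (.pi (.elc (Cocon.trDCtx Ψ).code) (.elc ((Cocon.trDCtx Φ).code.up 1)))) ∧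
        (∀ (O : Cocon.CxObj) (T : Cocon.CxTy), Cocon.HasObj Γ O T →
          FitchModel.TermDefined S.lock (Cocon.trCxObj O) (Cocon.trCxTy T)) ∧
        (∀ τ : Cocon.CTy, Cocon.CTyWf Γ τ → FitchModel.TypeDefined S (Cocon.trCTy τ)) ∧
        (∀ (t : Cocon.CTm) (τ : Cocon.CTy), Cocon.HasCTm Γ t τ →
          FitchModel.TermDefined S (Cocon.trCTm t) (Cocon.trCTy τ)) ∧
        (∀ (Ψ : Cocon.DCtx) (A A' : Cocon.DTy), Cocon.DTyEq Γ Ψ A A' →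
          FitchModel.TermEqual S.lock (Cocon.trDTy (Cocon.trDCtx Ψ) A)
            (Cocon.trDTy (Cocon.trDCtx Ψ) A')
            (.pi (.elc (Cocon.trDCtx Ψ).code) .univ)) ∧
        (∀ (Ψ : Cocon.DCtx) (N N' : Cocon.DTm) (A : Cocon.DTy), Cocon.DTmEq Γ Ψ N N' A →
          FitchModel.TermEqual S.lock (Cocon.trDTm (Cocon.trDCtx Ψ) N)
            (Cocon.trDTm (Cocon.trDCtx Ψ) N')
            (Fitch.piT (Cocon.trDCtx Ψ).code (Cocon.trDTy (Cocon.trDCtx Ψ) A))) ∧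
        (∀ (Ψ Φ : Cocon.DCtx) (σ σ' : Cocon.DSub), Cocon.DSubEq Γ Ψ σ σ' Φ →
          FitchModel.TermEqual S.lock (Cocon.trDSub (Cocon.trDCtx Ψ) (Cocon.trDCtx Φ) σ)
            (Cocon.trDSub (Cocon.trDCtx Ψ) (Cocon.trDCtx Φ) σ')
            (.pi (.elc (Cocon.trDCtx Ψ).code) (.elc ((Cocon.trDCtx Φ).code.up 1)))) ∧
        (∀ τ τ' : Cocon.CTy, Cocon.CTyEq Γ τ τ' →
          FitchModel.TypeEqual S (Cocon.trCTy τ) (Cocon.trCTy τ')) ∧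
        (∀ (t t' : Cocon.CTm) (τ : Cocon.CTy), Cocon.CTmEq Γ t t' τ →
          FitchModel.TermEqual S (Cocon.trCTm t) (Cocon.trCTm t') (Cocon.trCTy τ))) := by
  refine ⟨fun Γ h => h.tr.1, fun Γ Φ h => h.tr_code, fun Γ Ψ A h => h.tr_fam, fun Γ Ψ N A h => h.tr_tm,
    fun Γ Ψ Φ σ h => h.tr_sub, fun Γ O T h => h.sound.tr h.base, fun Γ τ h => h.tr_ty,
    fun Γ t τ h => h.tr_ctm, fun C _ M Γ h => ?_⟩
  obtain ⟨S, hS⟩ := FitchModel.sound_wf (M := M) h.tr.1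
  exact ⟨S, hS, fun S' h' => h'.unique hS,
    fun Φ h => (FitchModel.sound_hasTm h.tr_code hS.lock).defined,
    fun Ψ A h => (FitchModel.sound_hasTm h.tr_fam hS.lock).defined,
    fun Ψ N A h => (FitchModel.sound_hasTm h.tr_tm hS.lock).defined,
    fun Ψ Φ σ h => (FitchModel.sound_hasTm h.tr_sub hS.lock).defined,
    fun O T h => (FitchModel.sound_hasTm (h.sound.tr h.base) hS.lock).defined,
    fun τ h => by
      obtain ⟨a, ha⟩ := FitchModel.sound_tyWf h.tr_ty hS
      exact ⟨a, ha, fun _ h' => h'.unique ha⟩,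
    fun t τ h => (FitchModel.sound_hasTm h.tr_ctm hS).defined,
    fun Ψ A A' e => FitchModel.sound_tmEq (e.sound.tr h) hS.lock,
    fun Ψ N N' A e => FitchModel.sound_tmEq (e.sound.tr h) hS.lock,
    fun Ψ Φ σ σ' e => FitchModel.sound_tmEq (e.sound.tr h) hS.lock,
    fun τ τ' e => FitchModel.sound_tyEq (e.sound.tr h) hS,
    fun t t' τ e => FitchModel.sound_tmEq (e.sound.tr h) hS⟩
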